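/- Let $\mathrm{M}$ be the Möbius strip (without punctures) and, for a positive integer $n$, let $\mathrm{M}_n$ be $\mathrm{M}$ equipped with $n$ marked points on its boundary. An arc of $\mathrm{M}_n$ is a simple curve in $\mathrm{M}$ whose extremities are marked points (and may coincide), whose interior contains no marked point, and which is not contractible relatively to its extremities; arcs are considered up to isotopy and up to reversal. A triangulation of $\mathrm{M}_n$ is an inclusion-wise maximal set of pairwise non-crossing and pairwise non-homotopic arcs of $\mathrm{M}_n$, considered up to isotopy (in particular, it contains the boundary arcs joining consecutive marked points along the boundary). The flip-graph $\mathcal{F}(\mathrm{M}_n)$ is the graph whose vertices are the triangulations of $\mathrm{M}_n$, where two triangulations are adjacent when one is obtained from the other by a flip, that is, by replacing a single arc with a different arc (the other diagonal of the quadrilateral formed by the two triangles incident to the removed arc). A triangulation of $\mathrm{M}_n$ is simplicial when it contains neither a loop arc nor two distinct arcs with the same pair of extremities. Let $\mathcal{F}_\star(\mathrm{M}_n)$ be the subgraph of $\mathcal{F}(\mathrm{M}_n)$ induced by the simplicial triangulations, and let its diameter be measured with its own graph distance. There exists a constant $K$ such that, for every integer $n\geq 5$, the diameter of $\mathcal{F}_\star(\mathrm{M}_n)$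 is finite and $$ \left\lfloor\frac{5}{2}n\right\rfloor-16\;\leq\;\mathrm{diam}\bigl(\mathcal{F}_\star(\mathrm{M}_n)\bigr)\;\leq\;4n+K. $$ -/

import Mathlib

open scoped unitInterval

namespace MobiusFlip

/-- The infinite strip `ℝ × [0, 1]`. -/
abbrev Strip : Type := ℝ × I

/-- The glide reflection `(x, t) ↦ (x + 1, 1 - t)` of the strip. -/
noncomputable def glide : Strip ≃ₜ Strip :=
  (Homeomorph.addRight (1 : ℝ)).prodCongr unitInterval.symmHomeomorph

/-- Two points of the strip are identified when an iterate of the glide reflection maps one to the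
other. -/
def glideSetoid : Setoid Strip where
  r p q := ∃ k : ℤ, (glide ^ k) p = q
  iseqv :=
    { refl := fun _ => ⟨0, rfl⟩
      symm := by
        rintro p q ⟨k, rfl⟩
        exact ⟨-k, by rw [← Homeomorph.mul_apply, ← zpow_add]; simp⟩
      trans := by
        rintro p q r ⟨k, rfl⟩ ⟨l, rfl⟩
        exact ⟨l + k, by rw [zpow_add, Homeomorph.mul_apply]⟩ }

/-- The (unpunctured) Möbius strip, with the quotient topology. -/
abbrev Mobius : Type := Quotient glideSetoid

/-- The marked points of `M_n`: the `n` points `[(2 i / n, 0)]`, in cyclic order along the boundary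
circle of the Möbius strip (parametrized by `x ↦ [(x, 0)]`, which has period `2`). -/
noncomputable def marked (n : ℕ) (i : Fin n) : Mobius :=
  Quotient.mk glideSetoid (2 * (i : ℝ) / (n : ℝ), 0)

/-- A simple (essential) arc in `M_n` between marked points. -/
structure Arc (n : ℕ) where
  /-- the underlying curve -/
  curve : C(I, Mobius)
  start_mem : curve 0 ∈ Set.range (marked n)
  end_mem : curve 1 ∈ Set.range (marked n)
  /-- the arc has no self-intersection, except that its two extremities may coincide -/
  simple : ∀ s t : I, curve s = curve t → s = t ∨ (s = 0 ∧ t = 1) ∨ (s = 1 ∧ t = 0)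
  /-- the arc does not go through marked points except at its extremities -/
  interior_not_mem : ∀ t ∈ Set.Ioo (0 : I) 1, curve t ∉ Set.range (marked n)
  /-- the arc is not contractible (relatively to its extremities) to a marked point -/
  essential : ¬ curve.HomotopicRel (ContinuousMap.const I (curve 0)) {0, 1}

namespace Arc

variable {n : ℕ}

/-- The arc without its extremities. -/
def interior (a : Arc n) : Set Mobius := a.curve '' Set.Ioo (0 : I) 1

/-- A curve travelled backwards. -/
def rev (f : C(I, Mobius)) : C(I, Mobius) := f.comp ⟨unitInterval.symm, unitInterval.continuous_symm⟩

theorem rev_rev (f : C(I, Mobius)) : rev (rev f) = f := by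
  ext t; simp [rev]

theorem rev_homotopicRel {f g : C(I, Mobius)} (h : f.HomotopicRel g {0, 1}) :
    (rev f).HomotopicRel (rev g) {0, 1} := by
  obtain ⟨H⟩ := h
  refine ⟨⟨⟨⟨fun p => H (p.1, unitInterval.symm p.2), by fun_prop⟩, ?_, ?_⟩, ?_⟩⟩
  · intro x; simp [rev]
  · intro x; simp [rev]
  · intro t x hx
    have hx' : unitInterval.symm x ∈ ({0, 1} : Set I) := by
      rcases hx with rfl | rfl <;> simp
    exact H.eq_fst t hx'

/-- Two arcs are homotopic when, up to reversing one of them, the corresponding curves are homotopic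
relatively to their extremities. For simple arcs on a surface this is the same as being isotopic. -/
def Homotopic (a b : Arc n) : Prop :=
  a.curve.HomotopicRel b.curve {0, 1} ∨ a.curve.HomotopicRel (rev b.curve) {0, 1}

theorem homotopic_equivalence : Equivalence (Homotopic (n := n)) where
  refl a := Or.inl (.refl _)
  symm := by
    rintro a b (h | h)
    · exact Or.inl h.symm
    · exact Or.inr (by simpa [rev_rev] using rev_homotopicRel h.symm)
  trans := by
    rintro a b c (h | h) (h' | h')
    · exact Or.inl (h.trans h')
    · exact Or.inr (h.trans h')
    · exact Or.inr (h.trans (rev_homotopicRel h'))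
    · exact Or.inl (h.trans (by simpa [rev_rev] using rev_homotopicRel h'))

/-- Homotopy of arcs, as an equivalence relation. -/
def setoid (n : ℕ) : Setoid (Arc n) := ⟨Homotopic, homotopic_equivalence⟩

/-- The unordered pair of extremities of an arc. -/
def ends (a : Arc n) : Sym2 Mobius := s(a.curve 0, a.curve 1)

theorem ends_eq_of_homotopic {a b : Arc n} (h : Homotopic a b) : a.ends = b.ends := by
  rcases h with h | h
  · have h0 := h.fst_eq_snd (x := 0) (by simp)
    have h1 := h.fst_eq_snd (x := 1) (by simp)
    simp [ends, h0, h1]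
  · have h0 := h.fst_eq_snd (x := 0) (by simp)
    have h1 := h.fst_eq_snd (x := 1) (by simp)
    simp [ends, h0, h1, rev, Sym2.eq_swap]

end Arc

/-- The arcs of `M_n` up to isotopy. -/
abbrev ArcClass (n : ℕ) : Type := Quotient (Arc.setoid n)

/-- The unordered pair of extremities of an arc considered up to isotopy. -/
def ArcClass.ends {n : ℕ} : ArcClass n → Sym2 Mobius :=
  Quotient.lift Arc.ends fun _ _ => Arc.ends_eq_of_homotopic

/-- A set of pairwise non-crossing and pairwise non-homotopic simple arcs in `M_n`. -/
def IsArcSystem {n : ℕ} (S : Set (Arc n)) : Prop :=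
  S.Pairwise fun a b => Disjoint a.interior b.interior ∧ ¬ a.Homotopic b

/-- A set of arcs up to isotopy that can be realized simultaneously by pairwise non-crossing simple
arcs. -/
def IsRealizable {n : ℕ} (A : Set (ArcClass n)) : Prop :=
  ∃ S : Set (Arc n), IsArcSystem S ∧ (Quotient.mk (Arc.setoid n)) '' S = A

/-- A triangulation of `M_n`: an inclusion-wise maximal set of pairwise non-crossing and pairwise
non-homotopic simple arcs, considered up to isotopy. Boundary arcs belong to it. -/
def IsTriangulation {n : ℕ} (A : Set (ArcClass n)) : Prop := Maximal IsRealizable A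

/-- The type of the triangulations of `M_n`. -/
abbrev Triangulation (n : ℕ) : Type := {A : Set (ArcClass n) // IsTriangulation A}

/-- The flip-graph `F(M_n)`. Two triangulations are related by a flip when the second is obtained
from the first by replacing one of its arcs `α` with a different arc `β`. (Since both sets are
triangulations, `α` is then incident to two distinct triangles of the first, and `α` and `β` are
the two diagonals of the quadrilateral formed by these triangles.) -/
def flipGraph (n : ℕ) : SimpleGraph (Triangulation n) where
  Adj T U := ∃ α ∈ T.1, ∃ β ∉ T.1, U.1 = insert β (T.1 \ {α})
  symm := ⟨by
    rintro T U ⟨α, hα, β, hβ, h⟩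
    have hne : α ≠ β := fun e => hβ (e ▸ hα)
    refine ⟨β, by simp [h], α, by simp [h, hne], ?_⟩
    ext c
    simp only [h, Set.mem_insert_iff, Set.mem_sdiff, Set.mem_singleton_iff]
    grind⟩
  loopless := ⟨by
    rintro T ⟨α, hα, β, hβ, h⟩
    exact hβ (by rw [h]; simp)⟩

/-- A triangulation of `M_n` is simplicial when it does not contain any loop arc or any two distinct
arcs with the same pair of vertices. -/
def IsSimplicial {n : ℕ} (T : Triangulation n) : Prop :=
  (∀ α ∈ T.1, ¬ α.ends.IsDiag) ∧ Set.InjOn ArcClass.ends T.1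

/-- The subgraph of `F(M_n)` induced by the simplicial triangulations. -/
def simplicialFlipGraph (n : ℕ) : SimpleGraph {T : Triangulation n | IsSimplicial T} :=
  (flipGraph n).induce {T : Triangulation n | IsSimplicial T}

end MobiusFlip

/-!
The strip is the universal cover of the Möbius strip, and an arc of `M_n` is determined up to
isotopy by the extremities of its lifts. This encodes the arcs by pairs of integers (`IsCode`): a
planar arc has a lift between two lower points of the strip and a crossing arc has a lift from a
lower point to an upper point. Two arcs can be realized without crossing if and only if the
extremities of their lifts are not interleaved (`Compat`): if they are, the lifts meet, by a
winding argument on the difference of two curves (`halfArg_square`), and if they are not, the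
standard representatives (parabolas and segments) are disjoint. The flip-graph thus becomes a graph
on finite sets of pairs of integers (`diam_simplicialFlipGraph`).

*Lower bound.* Contracting boundary arcs sends `M_n` to some `M_m`, and sets of pairwise
non-crossing arcs of maximal size to such sets. A flip becomes trivial when the images of the two exchanged arcs do not cross, so
that a path of flips is sent to a path that is shorter by the number of its trivial flips. The
zigzag triangulations `IsZig` and `IsZag` of `M_m` are at distance at least `5 m / 2 - 4`
(`le_of_path`). Indeed, contract either two or three well-chosen consecutive boundary arcs: the
images are zigzag triangulations of `M_(m - 2)` and `M_(m - 3)`. On any path at least twelve flips,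
counted with multiplicity, become trivial, hence at least five in the first contraction or at least
eight in the second one, and the bound follows by induction. That these flips are at least twelve
is seen on the image of the path in `M_6`, where only six boundary arcs are kept: a flip whose
exchanged arcs cross both in `M_6` and in the contraction also crosses in the common contraction
(`IsContraction.crosses_of_separated`), and an exhaustive search by increasing weight in `M_6`,
evaluated by the kernel, concludes. The zigzag triangulations contain loops. Simplicial
triangulations are obtained from them by replacing the vertex of each one-sided loop by five
vertices, joined by the five crossing arcs of a pentagram. Contracting the pentagrams gives back the
zigzag triangulations and makes eight flips trivial (`Path.fiberCard_le`). For `n < 10`, it is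
enough to count the arcs that two triangulations do not share.

*Upper bound.* As long as a simplicial triangulation has a planar arc that is not a boundary arc,
some flip within the simplicial triangulations replaces such an arc by a crossing arc
(`IsTri.exists_isPure`); at most `n` flips remove them all. The crossing arcs `(p, q)` that remain
form a lattice path with unit steps, periodic up to the glide reflection, and two such paths share
a point (`IsPureTri.exists_common`). A rotation places this common arc at `(v, 0)`. All the flips
that follow, but for a bounded number of them, insert an arc incident to the vertex `v + 2`: they
lead in about `n` steps from each triangulation to one of two triangulations in which `v + 2` is
joined to all the vertices (`IsPureTri.exists_chain`), and these two are five flips apart. The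
bounded number of other flips keeps the vertex `v + 2` from being joined twice to `v` or to `0`.
-/

namespace MobiusFlip

/-! ### The strip as a covering of the Möbius strip -/

theorem glide_apply (p : Strip) : glide p = (p.1 + 1, unitInterval.symm p.2) := rfl

theorem glide_zpow_fst (k : ℤ) (p : Strip) : ((glide ^ k) p).1 = p.1 + k := by
  induction k using Int.induction_on generalizing p with
  | zero => simp
  | succ k ih =>
    rw [zpow_add, zpow_one, Homeomorph.mul_apply, ih, glide_apply]
    push_cast; ring
  | pred k ih =>
    have h := ih ((glide ^ (-1 : ℤ)) p)
    have h2 : ((glide ^ (-1 : ℤ)) p).1 + 1 = p.1 := by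
      have : glide ((glide ^ (-1 : ℤ)) p) = p := by
        rw [zpow_neg_one, ← Homeomorph.mul_apply]; simp
      rw [glide_apply] at this
      exact congrArg Prod.fst this
    rw [sub_eq_add_neg, zpow_add, Homeomorph.mul_apply, h]
    push_cast; linarith

theorem glide_zpow_two_mul (k : ℤ) (p : Strip) : (glide ^ (2 * k)) p = (p.1 + 2 * k, p.2) := by
  have h : ∀ q : Strip, (glide ^ (2 : ℤ)) q = (q.1 + 2, q.2) := by
    intro q
    have : (2 : ℤ) = 1 + 1 := rfl
    rw [this, zpow_add, zpow_one, Homeomorph.mul_apply, glide_apply, glide_apply]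
    ext <;> simp; ring
  have h2 : ((glide ^ (2 * k)) p).2 = p.2 := by
    rw [zpow_mul]
    induction k using Int.induction_on generalizing p with
    | zero => simp
    | succ k ih => rw [zpow_add, zpow_one, Homeomorph.mul_apply, ih, h]
    | pred k ih =>
      have h3 : (((glide ^ (2 : ℤ)) ^ (-1 : ℤ)) p).2 = p.2 := by
        have : (glide ^ (2 : ℤ)) (((glide ^ (2 : ℤ)) ^ (-1 : ℤ)) p) = p := by
          rw [zpow_neg_one, ← Homeomorph.mul_apply]; simp
        rw [h] at this
        exact (Prod.ext_iff.1 this).2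
      rw [sub_eq_add_neg, zpow_add, Homeomorph.mul_apply, ih, h3]
  ext
  · rw [glide_zpow_fst]; push_cast; rfl
  · simp [h2]

theorem glide_zpow_two_mul_add_one (k : ℤ) (p : Strip) :
    (glide ^ (2 * k + 1)) p = (p.1 + 2 * k + 1, unitInterval.symm p.2) := by
  rw [add_comm, zpow_add, Homeomorph.mul_apply, glide_zpow_two_mul, zpow_one, glide_apply]

/-- The projection of the strip onto the Möbius strip. -/
def proj : Strip → Mobius := Quotient.mk glideSetoid

theorem proj_eq_iff {p q : Strip} : proj p = proj q ↔ ∃ k : ℤ, (glide ^ k) p = q :=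
  Quotient.eq (r := glideSetoid)

theorem proj_glide_zpow (k : ℤ) (p : Strip) : proj ((glide ^ k) p) = proj p :=
  (proj_eq_iff.2 ⟨k, rfl⟩).symm

/-- The action of `ℤ` on the strip by iterates of the glide reflection. -/
@[reducible] noncomputable def glideAction : AddAction ℤ Strip where
  vadd k p := (glide ^ k) p
  zero_vadd p := by
    change (glide ^ (0 : ℤ)) p = p
    simp
  add_vadd k l p := by
    change (glide ^ (k + l)) p = (glide ^ k) ((glide ^ l) p)
    rw [zpow_add, Homeomorph.mul_apply]

theorem isCoveringMap_proj : IsCoveringMap proj := by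
  let := glideAction
  have h : IsAddQuotientCoveringMap proj ℤ := by
    refine ⟨isQuotientMap_quotient_mk', ⟨fun k => (glide ^ k).continuous⟩, ?_, ?_⟩
    · intro p q
      rw [eq_comm, proj_eq_iff]
      rfl
    · intro p
      refine ⟨{q | |q.1 - p.1| < 1 / 2}, ?_, ?_⟩
      · refine IsOpen.mem_nhds ?_ (by simp)
        exact isOpen_lt (by fun_prop) continuous_const
      · rintro k ⟨_, ⟨q, hq, rfl⟩, hq'⟩
        have hq' : |((glide ^ k) q).1 - p.1| < 1 / 2 := hq'
        rw [glide_zpow_fst] at hq'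
        have hq : |q.1 - p.1| < 1 / 2 := hq
        rw [abs_lt] at hq hq'
        have h1 : (k : ℝ) < 1 := by linarith
        have h2 : (-1 : ℝ) < k := by linarith
        have h1 : k < 1 := by exact_mod_cast h1
        have h2 : -1 < k := by exact_mod_cast h2
        omega
  exact h.isCoveringMap

theorem continuous_proj : Continuous proj := isCoveringMap_proj.continuous

/-- Two paths in the strip with the same extremities have homotopic projections: the strip is
convex. -/
theorem homotopicRel_of_lifts {f g : C(I, Mobius)} {γ δ : C(I, Strip)}
    (hγ : ∀ t, proj (γ t) = f t) (hδ : ∀ t, proj (δ t) = g t) (h0 : γ 0 = δ 0) (h1 : γ 1 = δ 1) :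
    f.HomotopicRel g {0, 1} := by
  have hI : ∀ a b s : I, (1 - (s : ℝ)) * a + s * b ∈ Set.Icc (0 : ℝ) 1 := by
    intro a b s
    have := a.2.1; have := a.2.2; have := b.2.1; have := b.2.2; have := s.2.1; have := s.2.2
    constructor
    · have := mul_nonneg (sub_nonneg.2 s.2.2) a.2.1
      have := mul_nonneg s.2.1 b.2.1
      linarith
    · nlinarith
  have hrel : γ.HomotopicRel δ {0, 1} := by
    refine ⟨⟨⟨⟨fun p => ((1 - (p.1 : ℝ)) * (γ p.2).1 + p.1 * (δ p.2).1,
      ⟨(1 - (p.1 : ℝ)) * (γ p.2).2 + p.1 * (δ p.2).2, hI _ _ _⟩), by fun_prop⟩, ?_, ?_⟩, ?_⟩⟩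
    · intro x; ext <;> simp
    · intro x; ext <;> simp
    · intro s x hx
      have : γ x = δ x := by rcases hx with rfl | rfl <;> assumption
      ext
      · simp [this]; ring
      · simp [this]; ring
  have := hrel.comp_continuousMap ⟨proj, continuous_proj⟩
  have e1 : (⟨proj, continuous_proj⟩ : C(Strip, Mobius)).comp γ = f := by ext t; exact hγ t
  have e2 : (⟨proj, continuous_proj⟩ : C(Strip, Mobius)).comp δ = g := by ext t; exact hδ t
  rwa [e1, e2] at this

theorem exists_lift (f : C(I, Mobius)) (p : Strip) (hp : proj p = f 0) :
    ∃ γ : C(I, Strip), (∀ t, proj (γ t) = f t) ∧ γ 0 = p := by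
  obtain ⟨γ, h, h0⟩ := isCoveringMap_proj.exists_path_lifts f p hp.symm
  exact ⟨γ, fun t => congrFun h t, h0⟩

theorem lift_one_eq {f g : C(I, Mobius)} {γ δ : C(I, Strip)} (h : f.HomotopicRel g {0, 1})
    (hγ : ∀ t, proj (γ t) = f t) (hδ : ∀ t, proj (δ t) = g t) (h0 : γ 0 = δ 0) : γ 1 = δ 1 := by
  have e1 : γ = isCoveringMap_proj.liftPath f (γ 0) (hγ 0).symm :=
    (isCoveringMap_proj.eq_liftPath_iff' _).2 ⟨funext hγ, rfl⟩
  have e2 : δ = isCoveringMap_proj.liftPath g (γ 0) (by rw [h0, hδ 0]) :=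
    (isCoveringMap_proj.eq_liftPath_iff' _).2 ⟨funext hδ, h0.symm⟩
  rw [e1, e2]
  exact isCoveringMap_proj.liftPath_apply_one_eq_of_homotopicRel h _ _ _

/-- Two lifts of the same curve differ by an iterate of the glide reflection. -/
theorem lift_unique {f : C(I, Mobius)} {γ δ : C(I, Strip)}
    (hγ : ∀ t, proj (γ t) = f t) (hδ : ∀ t, proj (δ t) = f t) :
    ∃ k : ℤ, ∀ t, δ t = (glide ^ k) (γ t) := by
  obtain ⟨k, hk⟩ := proj_eq_iff.1 ((hγ 0).trans (hδ 0).symm)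
  refine ⟨k, ?_⟩
  set γ' : C(I, Strip) := ⟨fun t => (glide ^ k) (γ t), by fun_prop⟩ with hγ'
  have h' : ∀ t, proj (γ' t) = f t := fun t => (proj_glide_zpow k _).trans (hγ t)
  have e1 : δ = isCoveringMap_proj.liftPath f (δ 0) (hδ 0).symm :=
    (isCoveringMap_proj.eq_liftPath_iff' _).2 ⟨funext hδ, rfl⟩
  have e2 : γ' = isCoveringMap_proj.liftPath f (δ 0) (hδ 0).symm :=
    (isCoveringMap_proj.eq_liftPath_iff' _).2 ⟨funext h', hk⟩
  intro t
  rw [e1, ← e2]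
  rfl

/-! ### Lifts of the marked points -/

/-- The lift of index `i` of a marked point on the lower side of the strip. -/
noncomputable def bot (n : ℕ) (i : ℤ) : Strip := (2 * i / n, 0)

/-- The lift of index `j` of a marked point on the upper side of the strip, the image by the glide
reflection of the lift of the same index on the lower side. -/
noncomputable def top (n : ℕ) (j : ℤ) : Strip := (2 * j / n + 1, 1)

theorem glide_bot (n : ℕ) (i : ℤ) : glide (bot n i) = top n i := by
  ext <;> simp [glide_apply, bot, top]

theorem glide_zpow_bot_even {n : ℕ} (hn : 0 < n) (i k : ℤ) :
    (glide ^ (2 * k)) (bot n i) = bot n (i + k * n) := by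
  have : (n : ℝ) ≠ 0 := by positivity
  rw [glide_zpow_two_mul]
  ext
  · simp only [bot]; push_cast; field_simp
  · simp [bot]

theorem glide_zpow_top_even {n : ℕ} (hn : 0 < n) (i k : ℤ) :
    (glide ^ (2 * k)) (top n i) = top n (i + k * n) := by
  have : (n : ℝ) ≠ 0 := by positivity
  rw [glide_zpow_two_mul]
  ext
  · simp only [top]; push_cast; field_simp; ring
  · simp [top]

theorem glide_zpow_bot_odd {n : ℕ} (hn : 0 < n) (i k : ℤ) :
    (glide ^ (2 * k + 1)) (bot n i) = top n (i + k * n) := by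
  rw [add_comm, zpow_add, Homeomorph.mul_apply, glide_zpow_bot_even hn, zpow_one, glide_bot]

theorem glide_zpow_top_odd {n : ℕ} (hn : 0 < n) (i k : ℤ) :
    (glide ^ (2 * k + 1)) (top n i) = bot n (i + (k + 1) * n) := by
  rw [← glide_bot, ← Homeomorph.mul_apply, ← zpow_add_one, ← glide_zpow_bot_even hn]
  congr 2; ring

theorem bot_injective {n : ℕ} (hn : 0 < n) {i j : ℤ} (h : bot n i = bot n j) : i = j := by
  have h0 : (n : ℝ) ≠ 0 := by positivity
  have : 2 * (i : ℝ) / n = 2 * j / n := congrArg Prod.fst h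
  field_simp at this
  exact_mod_cast this

theorem top_injective {n : ℕ} (hn : 0 < n) {i j : ℤ} (h : top n i = top n j) : i = j := by
  rw [← glide_bot, ← glide_bot] at h
  exact bot_injective hn (glide.injective h)

theorem bot_ne_top (n : ℕ) (i j : ℤ) : bot n i ≠ top n j := by
  intro h
  have : (0 : I) = 1 := congrArg Prod.snd h
  exact zero_ne_one this

theorem proj_bot_mem {n : ℕ} (hn : 0 < n) (i : ℤ) : proj (bot n i) ∈ Set.range (marked n) := by
  have hn' : (0 : ℤ) < n := by exact_mod_cast hn
  have h1 := Int.emod_nonneg i hn'.ne'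
  have h2 := Int.emod_lt_of_pos i hn'
  refine ⟨⟨(i % n).toNat, by omega⟩, ?_⟩
  change proj _ = _
  refine proj_eq_iff.2 ⟨2 * (i / n), ?_⟩
  have e : ((2 * (((i % n).toNat : ℕ) : ℝ) / (n : ℝ), 0) : Strip) = bot n (i % n) := by
    ext
    · have : (((i % n).toNat : ℕ) : ℝ) = ((i % n : ℤ) : ℝ) := by
        have : (((i % n).toNat : ℕ) : ℤ) = i % n := Int.toNat_of_nonneg h1
        exact_mod_cast congrArg (Int.cast (R := ℝ)) this
      simp [bot, this]
    · simp [bot]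
  simp only
  rw [e, glide_zpow_bot_even hn]
  congr 1
  exact Int.emod_add_ediv_mul i n

theorem proj_top (n : ℕ) (j : ℤ) : proj (top n j) = proj (bot n j) := by
  have := proj_glide_zpow 1 (bot n j)
  rwa [zpow_one, glide_bot] at this

theorem proj_mem_marked {n : ℕ} (hn : 0 < n) {p : Strip} :
    proj p ∈ Set.range (marked n) ↔ (∃ i, p = bot n i) ∨ ∃ j, p = top n j := by
  constructor
  · rintro ⟨i, hi⟩
    have hi : proj (bot n (i : ℕ)) = proj p := by
      rw [← hi]; simp [marked, bot, proj]
    obtain ⟨k, rfl⟩ := proj_eq_iff.1 hi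
    rcases Int.even_or_odd' k with ⟨l, rfl | rfl⟩
    · exact Or.inl ⟨_, glide_zpow_bot_even hn _ _⟩
    · exact Or.inr ⟨_, glide_zpow_bot_odd hn _ _⟩
  · rintro (⟨i, rfl⟩ | ⟨j, rfl⟩)
    · exact proj_bot_mem hn i
    · rw [proj_top]; exact proj_bot_mem hn j

theorem proj_bot_eq_iff {n : ℕ} (hn : 0 < n) {i j : ℤ} :
    proj (bot n i) = proj (bot n j) ↔ ∃ k : ℤ, j = i + k * n := by
  constructor
  · intro h
    obtain ⟨k, hk⟩ := proj_eq_iff.1 h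
    rcases Int.even_or_odd' k with ⟨l, rfl | rfl⟩
    · rw [glide_zpow_bot_even hn] at hk
      exact ⟨l, (bot_injective hn hk).symm⟩
    · rw [glide_zpow_bot_odd hn] at hk
      exact absurd hk.symm (bot_ne_top _ _ _)
  · rintro ⟨k, rfl⟩
    exact proj_eq_iff.2 ⟨2 * k, glide_zpow_bot_even hn _ _⟩

/-! ### Curves of the strip whose extremities are interleaved meet -/

/-- The argument of a point of the closed upper half-plane (`ε = 1`, in `[0, π]`) or of the closed
lower half-plane (`ε = -1`, in `[-π, 0]`). -/
noncomputable def halfArg (ε : ℝ) (z : ℂ) : ℝ :=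
  (Complex.log (-(ε * Complex.I) * z)).im + ε * (Real.pi / 2)

theorem halfArg_neg {x : ℝ} {ε : ℝ} (hε : ε = 1 ∨ ε = -1) {z : ℂ} (hz : z = x) (hx : x < 0) :
    halfArg ε z = ε * Real.pi := by
  subst hz
  rw [halfArg, Complex.log_im]
  have hx' : 0 < -x := by linarith
  rcases hε with rfl | rfl
  · have : (-(((1 : ℝ) : ℂ) * Complex.I) * (x : ℂ)) = ((-x : ℝ) : ℂ) * Complex.I := by
      push_cast; ring
    rw [this, Complex.arg_real_mul _ hx', Complex.arg_I]; ring
  · have : (-(((-1 : ℝ) : ℂ) * Complex.I) * (x : ℂ)) = ((-x : ℝ) : ℂ) * -Complex.I := by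
      push_cast; ring
    rw [this, Complex.arg_real_mul _ hx', Complex.arg_neg_I]; ring

theorem halfArg_pos {x : ℝ} {ε : ℝ} (hε : ε = 1 ∨ ε = -1) {z : ℂ} (hz : z = x) (hx : 0 < x) :
    halfArg ε z = 0 := by
  subst hz
  rw [halfArg, Complex.log_im]
  rcases hε with rfl | rfl
  · have : (-(((1 : ℝ) : ℂ) * Complex.I) * (x : ℂ)) = (x : ℂ) * -Complex.I := by
      push_cast; ring
    rw [this, Complex.arg_real_mul _ hx, Complex.arg_neg_I]; ring
  · have : (-(((-1 : ℝ) : ℂ) * Complex.I) * (x : ℂ)) = (x : ℂ) * Complex.I := by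
      push_cast; ring
    rw [this, Complex.arg_real_mul _ hx, Complex.arg_I]; ring

/-- Along a path that stays in a closed half-plane, the variation of the imaginary part of a
continuous logarithm is determined by the extremities. -/
theorem im_sub_im_eq_halfArg {f L : I → ℂ} (hL : Continuous L) (hf : Continuous f)
    (h : ∀ s, Complex.exp (L s) = f s) {ε : ℝ} (hε : ε = 1 ∨ ε = -1)
    (him : ∀ s, 0 ≤ ε * (f s).im) :
    (L 1).im - (L 0).im = halfArg ε (f 1) - halfArg ε (f 0) := by
  have h0 : ∀ s, f s ≠ 0 := fun s => by rw [← h s]; exact Complex.exp_ne_zero _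
  have hε2 : ε * ε = 1 := by rcases hε with rfl | rfl <;> norm_num
  have hslit : ∀ s, -(ε * Complex.I) * f s ∈ Complex.slitPlane := by
    intro s
    rw [Complex.mem_slitPlane_iff]
    have h1 : (-(ε * Complex.I) * f s).re = ε * (f s).im := by simp
    have h2 : (-(ε * Complex.I) * f s).im = -ε * (f s).re := by simp
    rw [h1, h2]
    by_cases hs : (f s).im = 0
    · right
      have : (f s).re ≠ 0 := fun hr => h0 s (Complex.ext hr hs)
      have : ε ≠ 0 := by rcases hε with rfl | rfl <;> norm_num
      exact mul_ne_zero (neg_ne_zero.2 this) ‹_›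
    · left
      refine lt_of_le_of_ne (him s) fun h => ?_
      have : ε ≠ 0 := by rcases hε with rfl | rfl <;> norm_num
      exact (mul_ne_zero this hs) h.symm
  set g : I → ℂ := fun s => L s - Complex.log (-(ε * Complex.I) * f s)
    - ε * (Real.pi / 2) * Complex.I with hg
  have hgc : Continuous g := by
    refine (hL.sub ?_).sub continuous_const
    exact (continuous_const.mul hf).clog hslit
  have hexp : ∀ s, Complex.exp (g s) = 1 := by
    intro s
    have hI : Complex.exp (ε * (Real.pi / 2) * Complex.I) = ε * Complex.I := by
      rcases hε with rfl | rfl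
      · have : (((1 : ℝ) : ℂ) * (Real.pi / 2) * Complex.I) = Real.pi / 2 * Complex.I := by
          push_cast; ring
        rw [this, Complex.exp_pi_div_two_mul_I]; simp
      · have : (((-1 : ℝ) : ℂ) * (Real.pi / 2) * Complex.I) = -(Real.pi / 2 * Complex.I) := by
          push_cast; ring
        rw [this, Complex.exp_neg, Complex.exp_pi_div_two_mul_I]; simp
    have hz : -(ε * Complex.I) * f s ≠ 0 := Complex.slitPlane_ne_zero (hslit s)
    rw [hg]
    simp only
    rw [Complex.exp_sub, Complex.exp_sub, hI, h, Complex.exp_log hz]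
    have hε0 : (ε : ℂ) ≠ 0 := by rcases hε with rfl | rfl <;> norm_num
    have hε3 : (ε : ℂ) * ε = 1 := by exact_mod_cast hε2
    have := h0 s
    have hI0 := Complex.I_ne_zero
    field_simp
    rw [Complex.I_sq, sq, hε3]; ring
  have hint : ∀ s, ∃ k : ℤ, (g s).im / (2 * Real.pi) = k := by
    intro s
    obtain ⟨k, hk⟩ := Complex.exp_eq_one_iff.1 (hexp s)
    refine ⟨k, ?_⟩
    rw [hk]
    have := Real.pi_pos.ne'
    simp
  have hconst : (g 1).im / (2 * Real.pi) = (g 0).im / (2 * Real.pi) := by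
    have hc : Continuous fun s => (g s).im / (2 * Real.pi) :=
      (Complex.continuous_im.comp hgc).div_const _
    have hpre : IsPreconnected (Set.range fun s => (g s).im / (2 * Real.pi)) :=
      isPreconnected_range hc
    have hsub : (Set.range fun s => (g s).im / (2 * Real.pi)).Subsingleton := by
      have hcount : (Set.range fun s => (g s).im / (2 * Real.pi)).Countable := by
        refine (Set.countable_range (fun k : ℤ => (k : ℝ))).mono ?_
        rintro _ ⟨s, rfl⟩
        obtain ⟨k, hk⟩ := hint s
        exact ⟨k, hk.symm⟩
      exact hcount.isTotallyDisconnected _ subset_rfl hpre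
    exact hsub ⟨1, rfl⟩ ⟨0, rfl⟩
  have hpi := Real.pi_pos.ne'
  have hconst : (g 1).im = (g 0).im := by field_simp at hconst; exact hconst
  have himg : ∀ s, (g s).im = (L s).im - halfArg ε (f s) := by
    intro s
    simp [hg, halfArg]
    ring
  rw [himg, himg] at hconst
  linarith

theorem exists_continuous_log {F : I × I → ℂ} (hF : Continuous F) (h0 : ∀ p, F p ≠ 0) :
    ∃ L : I × I → ℂ, Continuous L ∧ ∀ p, Complex.exp (L p) = F p := by
  set G : C(I × I, {z : ℂ // z ≠ 0}) := ⟨fun p => ⟨F p, h0 p⟩, by fun_prop⟩ with hG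
  set f : C(I, ℂ) := ⟨(Complex.isCoveringMap_exp.liftPath
    (G.comp ⟨fun t => (0, t), by fun_prop⟩) (Complex.log (F (0, 0)))
    (by ext; simp [hG, Complex.exp_log (h0 _)])), by fun_prop⟩ with hf
  have hfl : ∀ t, (⟨Complex.exp (f t), Complex.exp_ne_zero _⟩ : {z : ℂ // z ≠ 0}) = G (0, t) := by
    intro t
    exact congrFun (Complex.isCoveringMap_exp.liftPath_lifts
      (G.comp ⟨fun t => (0, t), by fun_prop⟩) (Complex.log (F (0, 0)))
      (by ext; simp [hG, Complex.exp_log (h0 _)])) t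
  refine ⟨Complex.isCoveringMap_exp.liftHomotopy G f (fun t => (hfl t).symm), by fun_prop, ?_⟩
  intro p
  have := congrFun (Complex.isCoveringMap_exp.liftHomotopy_lifts G f (fun t => (hfl t).symm)) p
  exact congrArg Subtype.val this

/-- If the difference of two paths stays on each side of the square of parameters in a closed
half-plane, the variations of its argument along the two ways around the square agree. -/
theorem halfArg_square {F : I × I → ℂ} (hF : Continuous F) (h0 : ∀ p, F p ≠ 0)
    {ε₁ ε₂ ε₃ ε₄ : ℝ} (hε₁ : ε₁ = 1 ∨ ε₁ = -1) (hε₂ : ε₂ = 1 ∨ ε₂ = -1) (hε₃ : ε₃ = 1 ∨ ε₃ = -1)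
    (hε₄ : ε₄ = 1 ∨ ε₄ = -1)
    (h₁ : ∀ s, 0 ≤ ε₁ * (F (s, 0)).im) (h₂ : ∀ t, 0 ≤ ε₂ * (F (1, t)).im)
    (h₃ : ∀ t, 0 ≤ ε₃ * (F (0, t)).im) (h₄ : ∀ s, 0 ≤ ε₄ * (F (s, 1)).im) :
    halfArg ε₁ (F (1, 0)) - halfArg ε₁ (F (0, 0)) + (halfArg ε₂ (F (1, 1)) - halfArg ε₂ (F (1, 0)))
      = halfArg ε₃ (F (0, 1)) - halfArg ε₃ (F (0, 0))
        + (halfArg ε₄ (F (1, 1)) - halfArg ε₄ (F (0, 1))) := by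
  obtain ⟨L, hL, hexp⟩ := exists_continuous_log hF h0
  have e₁ := im_sub_im_eq_halfArg (L := fun s => L (s, 0)) (by fun_prop) (f := fun s => F (s, 0))
    (by fun_prop) (fun s => hexp _) hε₁ h₁
  have e₂ := im_sub_im_eq_halfArg (L := fun t => L (1, t)) (by fun_prop) (f := fun t => F (1, t))
    (by fun_prop) (fun s => hexp _) hε₂ h₂
  have e₃ := im_sub_im_eq_halfArg (L := fun t => L (0, t)) (by fun_prop) (f := fun t => F (0, t))
    (by fun_prop) (fun s => hexp _) hε₃ h₃
  have e₄ := im_sub_im_eq_halfArg (L := fun s => L (s, 1)) (by fun_prop) (f := fun s => F (s, 1))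
    (by fun_prop) (fun s => hexp _) hε₄ h₄
  linarith

/-- The difference of two points of the strip, as a complex number. -/
noncomputable def stripSub (p q : Strip) : ℂ := ⟨p.1 - q.1, (p.2 : ℝ) - q.2⟩

theorem continuous_stripSub (γ δ : C(I, Strip)) :
    Continuous fun p : I × I => stripSub (γ p.1) (δ p.2) := by
  have : (fun p : I × I => stripSub (γ p.1) (δ p.2)) = fun p => (((γ p.1).1 - (δ p.2).1 : ℝ) : ℂ)
      + ((((γ p.1).2 : ℝ) - ((δ p.2).2 : ℝ) : ℝ) : ℂ) * Complex.I := by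
    funext p
    apply Complex.ext <;> simp [stripSub]
  rw [this]
  fun_prop

theorem stripSub_eq_zero {p q : Strip} (h : stripSub p q = 0) : p = q := by
  have h1 := congrArg Complex.re h
  have h2 := congrArg Complex.im h
  simp only [stripSub, Complex.zero_re, Complex.zero_im] at h1 h2
  ext <;> linarith

theorem stripSub_of_snd_eq {p q : Strip} (h : p.2 = q.2) : stripSub p q = ((p.1 - q.1 : ℝ) : ℂ) := by
  apply Complex.ext <;> simp [stripSub, h]

/-- Two curves of the strip meet when they both join two points of the lower side, and these four
points are interleaved. -/
theorem meet_of_bot_bot {γ δ : C(I, Strip)} (hγ0 : (γ 0).2 = 0) (hγ1 : (γ 1).2 = 0)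
    (hδ0 : (δ 0).2 = 0) (hδ1 : (δ 1).2 = 0) (h1 : (γ 0).1 < (δ 0).1) (h2 : (δ 0).1 < (γ 1).1)
    (h3 : (γ 1).1 < (δ 1).1) : ∃ s t, γ s = δ t := by
  by_contra! hne
  have key := halfArg_square (continuous_stripSub γ δ)
    (fun p h => hne _ _ (stripSub_eq_zero h)) (ε₁ := 1) (ε₂ := -1) (ε₃ := -1) (ε₄ := 1)
    (by simp) (by simp) (by simp) (by simp)
    (fun s => by simpa [stripSub, hδ0] using (γ s).2.2.1)
    (fun s => by simpa [stripSub, hγ1] using (δ s).2.2.1)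
    (fun s => by simpa [stripSub, hγ0] using (δ s).2.2.1)
    (fun s => by simpa [stripSub, hδ1] using (γ s).2.2.1)
  have a00 := stripSub_of_snd_eq (hγ0.trans hδ0.symm)
  have a10 := stripSub_of_snd_eq (hγ1.trans hδ0.symm)
  have a01 := stripSub_of_snd_eq (hγ0.trans hδ1.symm)
  have a11 := stripSub_of_snd_eq (hγ1.trans hδ1.symm)
  simp only at key
  rw [halfArg_pos (by simp) a10 (by linarith), halfArg_neg (by simp) a00 (by linarith),
    halfArg_neg (by simp) a11 (by linarith), halfArg_pos (by simp) a10 (by linarith),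
    halfArg_neg (by simp) a01 (by linarith), halfArg_neg (by simp) a00 (by linarith),
    halfArg_neg (by simp) a11 (by linarith), halfArg_neg (by simp) a01 (by linarith)] at key
  linarith [Real.pi_pos]

/-- A curve that joins two points of the lower side of the strip meets any curve that joins a point
between them to the upper side. -/
theorem meet_of_bot_bot_bot_top {γ δ : C(I, Strip)} (hγ0 : (γ 0).2 = 0) (hγ1 : (γ 1).2 = 0)
    (hδ0 : (δ 0).2 = 0) (hδ1 : (δ 1).2 = 1) (h1 : (γ 0).1 < (δ 0).1) (h2 : (δ 0).1 < (γ 1).1) :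
    ∃ s t, γ s = δ t := by
  by_contra! hne
  have key := halfArg_square (continuous_stripSub γ δ)
    (fun p h => hne _ _ (stripSub_eq_zero h)) (ε₁ := 1) (ε₂ := -1) (ε₃ := -1) (ε₄ := -1)
    (by simp) (by simp) (by simp) (by simp)
    (fun s => by simpa [stripSub, hδ0] using (γ s).2.2.1)
    (fun s => by simpa [stripSub, hγ1] using (δ s).2.2.1)
    (fun s => by simpa [stripSub, hγ0] using (δ s).2.2.1)
    (fun s => by simpa [stripSub, hδ1] using (γ s).2.2.2)
  have a00 := stripSub_of_snd_eq (hγ0.trans hδ0.symm)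
  have a10 := stripSub_of_snd_eq (hγ1.trans hδ0.symm)
  simp only at key
  rw [halfArg_pos (by simp) a10 (by linarith), halfArg_neg (by simp) a00 (by linarith),
    halfArg_pos (by simp) a10 (by linarith), halfArg_neg (by simp) a00 (by linarith)] at key
  linarith [Real.pi_pos]

/-- Two curves that join the lower side of the strip to its upper side meet when their extremities
come in opposite orders. -/
theorem meet_of_bot_top {γ δ : C(I, Strip)} (hγ0 : (γ 0).2 = 0) (hγ1 : (γ 1).2 = 1)
    (hδ0 : (δ 0).2 = 0) (hδ1 : (δ 1).2 = 1) (h1 : (γ 0).1 < (δ 0).1) (h2 : (δ 1).1 < (γ 1).1) :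
    ∃ s t, γ s = δ t := by
  by_contra! hne
  have key := halfArg_square (continuous_stripSub γ δ)
    (fun p h => hne _ _ (stripSub_eq_zero h)) (ε₁ := 1) (ε₂ := 1) (ε₃ := -1) (ε₄ := -1)
    (by simp) (by simp) (by simp) (by simp)
    (fun s => by simpa [stripSub, hδ0] using (γ s).2.2.1)
    (fun s => by simpa [stripSub, hγ1] using (δ s).2.2.2)
    (fun s => by simpa [stripSub, hγ0] using (δ s).2.2.1)
    (fun s => by simpa [stripSub, hδ1] using (γ s).2.2.2)
  have a00 := stripSub_of_snd_eq (hγ0.trans hδ0.symm)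
  have a11 := stripSub_of_snd_eq (hγ1.trans hδ1.symm)
  simp only at key
  rw [halfArg_neg (by simp) a00 (by linarith), halfArg_pos (by simp) a11 (by linarith),
    halfArg_neg (by simp) a00 (by linarith), halfArg_pos (by simp) a11 (by linarith)] at key
  linarith [Real.pi_pos]

/-! ### Lifts of arcs -/

theorem bot_fst_lt {n : ℕ} (hn : 0 < n) {i j : ℤ} (h : i < j) : (bot n i).1 < (bot n j).1 := by
  have : (0 : ℝ) < n := by positivity
  have : (i : ℝ) < j := by exact_mod_cast h
  simp only [bot]
  gcongr

theorem top_fst_lt {n : ℕ} (hn : 0 < n) {i j : ℤ} (h : i < j) : (top n i).1 < (top n j).1 := by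
  have : (0 : ℝ) < n := by positivity
  have : (i : ℝ) < j := by exact_mod_cast h
  simp only [top]
  gcongr

namespace Arc

variable {n : ℕ}

/-- `γ` is a lift to the strip of the arc `a` or of the reversed arc. -/
def IsLift (a : Arc n) (γ : C(I, Strip)) : Prop :=
  (∀ t, proj (γ t) = a.curve t) ∨ ∀ t, proj (γ t) = rev a.curve t

/-- The path `γ` travelled backwards. -/
def revLift (γ : C(I, Strip)) : C(I, Strip) := γ.comp ⟨unitInterval.symm, unitInterval.continuous_symm⟩

theorem IsLift.rev {a : Arc n} {γ : C(I, Strip)} (h : a.IsLift γ) : a.IsLift (revLift γ) := by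
  rcases h with h | h
  · exact Or.inr fun t => h _
  · refine Or.inl fun t => (h _).trans ?_
    simp [Arc.rev]

/-- The image of the path `γ` by an iterate of the glide reflection. -/
noncomputable def glideLift (k : ℤ) (γ : C(I, Strip)) : C(I, Strip) :=
  ⟨fun t => (glide ^ k) (γ t), by fun_prop⟩

theorem IsLift.glide {a : Arc n} {γ : C(I, Strip)} (h : a.IsLift γ) (k : ℤ) :
    a.IsLift (glideLift k γ) := by
  rcases h with h | h
  · exact Or.inl fun t => (proj_glide_zpow k _).trans (h t)
  · exact Or.inr fun t => (proj_glide_zpow k _).trans (h t)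

theorem curve_mem_marked_iff (a : Arc n) (t : I) :
    a.curve t ∈ Set.range (marked n) ↔ t = 0 ∨ t = 1 := by
  constructor
  · intro h
    by_contra! hc
    exact a.interior_not_mem t ⟨unitInterval.pos_iff_ne_zero.2 hc.1,
      unitInterval.lt_one_iff_ne_one.2 hc.2⟩ h
  · rintro (rfl | rfl)
    exacts [a.start_mem, a.end_mem]

theorem IsLift.exists_param {a : Arc n} {γ : C(I, Strip)} (h : a.IsLift γ) (t : I) :
    ∃ u, proj (γ t) = a.curve u ∧ ((u = 0 ∨ u = 1) ↔ (t = 0 ∨ t = 1)) := by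
  rcases h with h | h
  · exact ⟨t, h t, Iff.rfl⟩
  · refine ⟨unitInterval.symm t, h t, ?_⟩
    rw [or_comm]
    simp

/-- Lifts of two arcs with disjoint interiors only meet at extremities. -/
theorem IsLift.eq_of_disjoint {a b : Arc n} (hab : Disjoint a.interior b.interior)
    {γ δ : C(I, Strip)} (hγ : a.IsLift γ) (hδ : b.IsLift δ) {s t : I} (h : γ s = δ t) :
    (s = 0 ∨ s = 1) ∧ (t = 0 ∨ t = 1) := by
  obtain ⟨u, hu, hus⟩ := hγ.exists_param s
  obtain ⟨v, hv, hvt⟩ := hδ.exists_param t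
  rw [← hus, ← hvt]
  have huv : a.curve u = b.curve v := (hu.symm.trans (congrArg proj h)).trans hv
  have h1 : (u = 0 ∨ u = 1) ↔ (v = 0 ∨ v = 1) := by
    refine (a.curve_mem_marked_iff u).symm.trans (Iff.trans ?_ (b.curve_mem_marked_iff v))
    exact iff_of_eq (congrArg (· ∈ Set.range (marked n)) huv)
  by_contra hc
  have hu' : ¬ (u = 0 ∨ u = 1) := fun h => hc ⟨h, h1.1 h⟩
  have hv' : ¬ (v = 0 ∨ v = 1) := fun h => hc ⟨h1.2 h, h⟩
  push Not at hu' hv'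
  have hu1 : a.curve u ∈ a.interior := ⟨u, ⟨unitInterval.pos_iff_ne_zero.2 hu'.1,
    unitInterval.lt_one_iff_ne_one.2 hu'.2⟩, rfl⟩
  have hv1 : a.curve u ∈ b.interior := ⟨v, ⟨unitInterval.pos_iff_ne_zero.2 hv'.1,
    unitInterval.lt_one_iff_ne_one.2 hv'.2⟩, huv.symm⟩
  exact Set.disjoint_left.1 hab hu1 hv1

/-- A lift of an arc only meets its translates at extremities. -/
theorem IsLift.eq_of_glide {a : Arc n} {γ : C(I, Strip)} (hγ : a.IsLift γ) {k : ℤ} (hk : k ≠ 0)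
    {s t : I} (h : γ s = (MobiusFlip.glide ^ k) (γ t)) : (s = 0 ∨ s = 1) ∧ (t = 0 ∨ t = 1) := by
  have hst : s ≠ t := by
    rintro rfl
    have := congrArg Prod.fst h
    rw [glide_zpow_fst] at this
    have : (k : ℝ) = 0 := by linarith
    exact hk (by exact_mod_cast this)
  have hp : proj (γ s) = proj (γ t) := by rw [h, proj_glide_zpow]
  rcases hγ with hγ | hγ
  · rw [hγ, hγ] at hp
    rcases a.simple _ _ hp with e | ⟨e1, e2⟩ | ⟨e1, e2⟩
    · exact absurd e hst
    · exact ⟨Or.inl e1, Or.inr e2⟩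
    · exact ⟨Or.inr e1, Or.inl e2⟩
  · rw [hγ, hγ] at hp
    rcases a.simple _ _ hp with e | ⟨e1, e2⟩ | ⟨e1, e2⟩
    · exact absurd (unitInterval.symm_bijective.injective e) hst
    · simp only [ContinuousMap.coe_mk, unitInterval.symm_eq_zero, unitInterval.symm_eq_one] at e1 e2
      exact ⟨Or.inr e1, Or.inl e2⟩
    · simp only [ContinuousMap.coe_mk, unitInterval.symm_eq_zero, unitInterval.symm_eq_one] at e1 e2
      exact ⟨Or.inl e1, Or.inr e2⟩

/-- Some lift of the arc `a`, or of its reverse, joins the lower points of indices `i` and `j`. -/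
def Planar (a : Arc n) (i j : ℤ) : Prop := ∃ γ, a.IsLift γ ∧ γ 0 = bot n i ∧ γ 1 = bot n j

/-- Some lift of the arc `a`, or of its reverse, joins the lower point of index `p` to the upper
point of index `q`. -/
def Crossing (a : Arc n) (p q : ℤ) : Prop := ∃ γ, a.IsLift γ ∧ γ 0 = bot n p ∧ γ 1 = top n q

theorem Planar.symm {a : Arc n} {i j : ℤ} (h : a.Planar i j) : a.Planar j i := by
  obtain ⟨γ, hγ, h0, h1⟩ := h
  exact ⟨_, hγ.rev, by simp [revLift, h1], by simp [revLift, h0]⟩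

theorem Planar.shift (hn : 0 < n) {a : Arc n} {i j : ℤ} (h : a.Planar i j) (k : ℤ) :
    a.Planar (i + k * n) (j + k * n) := by
  obtain ⟨γ, hγ, h0, h1⟩ := h
  refine ⟨_, hγ.glide (2 * k), ?_, ?_⟩
  · simp only [glideLift, ContinuousMap.coe_mk, h0, glide_zpow_bot_even hn]
  · simp only [glideLift, ContinuousMap.coe_mk, h1, glide_zpow_bot_even hn]

theorem Crossing.shift (hn : 0 < n) {a : Arc n} {i j : ℤ} (h : a.Crossing i j) (k : ℤ) :
    a.Crossing (i + k * n) (j + k * n) := by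
  obtain ⟨γ, hγ, h0, h1⟩ := h
  refine ⟨_, hγ.glide (2 * k), ?_, ?_⟩
  · simp only [glideLift, ContinuousMap.coe_mk, h0, glide_zpow_bot_even hn]
  · simp only [glideLift, ContinuousMap.coe_mk, h1, glide_zpow_top_even hn]

theorem Crossing.glide (hn : 0 < n) {a : Arc n} {p q : ℤ} (h : a.Crossing p q) :
    a.Crossing (q + n) p := by
  obtain ⟨γ, hγ, h0, h1⟩ := h
  refine ⟨_, (hγ.glide (2 * 0 + 1)).rev, ?_, ?_⟩
  · simp only [revLift, glideLift, ContinuousMap.comp_apply, ContinuousMap.coe_mk,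
      unitInterval.symm_zero, h1, glide_zpow_top_odd hn]
    simp
  · simp only [revLift, glideLift, ContinuousMap.comp_apply, ContinuousMap.coe_mk,
      unitInterval.symm_one, h0, glide_zpow_bot_odd hn]
    simp

theorem Planar.le_add (hn : 0 < n) {a : Arc n} {i j : ℤ} (h : a.Planar i j) :
    j ≤ i + n := by
  by_contra! hc
  obtain ⟨γ, hγ, h0, h1⟩ := h
  have e0 : glideLift 2 γ 0 = bot n (i + n) := by
    have := glide_zpow_bot_even hn i 1
    simpa [glideLift, h0] using this
  have e1 : glideLift 2 γ 1 = bot n (j + n) := by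
    have := glide_zpow_bot_even hn j 1
    simpa [glideLift, h1] using this
  obtain ⟨s, t, hst⟩ := meet_of_bot_bot (γ := γ) (δ := glideLift 2 γ) (by rw [h0]; rfl)
    (by rw [h1]; rfl) (by rw [e0]; rfl) (by rw [e1]; rfl)
    (by rw [h0, e0]; exact bot_fst_lt hn (by omega)) (by rw [h1, e0]; exact bot_fst_lt hn (by omega))
    (by rw [h1, e1]; exact bot_fst_lt hn (by omega))
  obtain ⟨hs, ht⟩ := hγ.eq_of_glide (k := 2) (by norm_num) hst
  rcases hs with rfl | rfl <;> rcases ht with rfl | rfl <;>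
    simp only [h0, h1, e0, e1] at hst <;> have := bot_injective hn hst <;> omega

theorem Crossing.bounds (hn : 0 < n) {a : Arc n} {p q : ℤ} (h : a.Crossing p q) :
    q ≤ p ∧ p ≤ q + n := by
  obtain ⟨γ, hγ, h0, h1⟩ := h
  set δ := revLift (glideLift 1 γ) with hδ
  have e0 : δ 0 = bot n (q + n) := by
    have := glide_zpow_top_odd hn q 0
    simpa [hδ, revLift, glideLift, h1] using this
  have e1 : δ 1 = top n p := by
    have := glide_zpow_bot_odd hn p 0
    simpa [hδ, revLift, glideLift, h0] using this
  have main : p ≠ q → p ≠ q + n → ∀ s t, γ s ≠ δ t := by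
    intro h2 h3 s t hst
    obtain ⟨hs, ht⟩ := hγ.eq_of_glide (k := 1) (by norm_num) (t := unitInterval.symm t) hst
    have ht : t = 0 ∨ t = 1 := by rw [or_comm]; simpa using ht
    rcases hs with rfl | rfl <;> rcases ht with rfl | rfl <;>
      simp only [h0, h1, e0, e1] at hst
    · exact h3 (bot_injective hn hst)
    · exact bot_ne_top _ _ _ hst
    · exact bot_ne_top _ _ _ hst.symm
    · exact h2 (top_injective hn hst).symm
  by_contra! hc
  rcases lt_or_ge p q with hpq | hpq
  · obtain ⟨s, t, hst⟩ := meet_of_bot_top (γ := γ) (δ := δ) (by rw [h0]; rfl) (by rw [h1]; rfl)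
      (by rw [e0]; rfl) (by rw [e1]; rfl) (by rw [h0, e0]; exact bot_fst_lt hn (by omega))
      (by rw [h1, e1]; exact top_fst_lt hn hpq)
    exact main (by omega) (by omega) _ _ hst
  · have hc := hc hpq
    obtain ⟨s, t, hst⟩ := meet_of_bot_top (γ := δ) (δ := γ) (by rw [e0]; rfl) (by rw [e1]; rfl)
      (by rw [h0]; rfl) (by rw [h1]; rfl) (by rw [h0, e0]; exact bot_fst_lt hn (by omega))
      (by rw [h1, e1]; exact top_fst_lt hn (by omega))
    exact main (by omega) (by omega) _ _ hst.symm

/-- The lifts of disjoint planar arcs are not interleaved: they would meet. -/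
theorem Planar.not_interleaved (hn : 0 < n) {a b : Arc n} (hab : Disjoint a.interior b.interior)
    {i j i' j' : ℤ} (ha : a.Planar i j) (hb : b.Planar i' j') :
    ¬ (i < i' ∧ i' < j ∧ j < j') := by
  rintro ⟨h1, h2, h3⟩
  obtain ⟨γ, hγ, g0, g1⟩ := ha
  obtain ⟨δ, hδ, d0, d1⟩ := hb
  obtain ⟨s, t, hst⟩ := meet_of_bot_bot (γ := γ) (δ := δ) (by rw [g0]; rfl)
    (by rw [g1]; rfl) (by rw [d0]; rfl) (by rw [d1]; rfl)
    (by rw [g0, d0]; exact bot_fst_lt hn h1) (by rw [g1, d0]; exact bot_fst_lt hn h2)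
    (by rw [g1, d1]; exact bot_fst_lt hn h3)
  obtain ⟨hs, ht⟩ := hγ.eq_of_disjoint hab hδ hst
  rcases hs with rfl | rfl <;> rcases ht with rfl | rfl <;>
    simp only [g0, g1, d0, d1] at hst <;> have := bot_injective hn hst <;> omega

/-- No crossing arc starts below a planar arc that is disjoint from it. -/
theorem Planar.not_mem_Ioo (hn : 0 < n) {a b : Arc n} (hab : Disjoint a.interior b.interior)
    {i j p q : ℤ} (ha : a.Planar i j) (hb : b.Crossing p q) : ¬ (i < p ∧ p < j) := by
  rintro ⟨h1, h2⟩
  obtain ⟨γ, hγ, g0, g1⟩ := ha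
  obtain ⟨δ, hδ, d0, d1⟩ := hb
  obtain ⟨s, t, hst⟩ := meet_of_bot_bot_bot_top (γ := γ) (δ := δ) (by rw [g0]; rfl)
    (by rw [g1]; rfl) (by rw [d0]; rfl) (by rw [d1]; rfl)
    (by rw [g0, d0]; exact bot_fst_lt hn h1) (by rw [g1, d0]; exact bot_fst_lt hn h2)
  obtain ⟨hs, ht⟩ := hγ.eq_of_disjoint hab hδ hst
  rcases hs with rfl | rfl <;> rcases ht with rfl | rfl <;>
    simp only [g0, g1, d0, d1] at hst
  · have := bot_injective hn hst; omega
  · exact bot_ne_top _ _ _ hst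
  · have := bot_injective hn hst; omega
  · exact bot_ne_top _ _ _ hst

/-- The lifts of two disjoint crossing arcs are in the same order at the bottom and at the top. -/
theorem Crossing.not_opposite (hn : 0 < n) {a b : Arc n} (hab : Disjoint a.interior b.interior)
    {p q p' q' : ℤ} (ha : a.Crossing p q) (hb : b.Crossing p' q') : ¬ (p < p' ∧ q' < q) := by
  rintro ⟨h1, h2⟩
  obtain ⟨γ, hγ, g0, g1⟩ := ha
  obtain ⟨δ, hδ, d0, d1⟩ := hb
  obtain ⟨s, t, hst⟩ := meet_of_bot_top (γ := γ) (δ := δ) (by rw [g0]; rfl)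
    (by rw [g1]; rfl) (by rw [d0]; rfl) (by rw [d1]; rfl)
    (by rw [g0, d0]; exact bot_fst_lt hn h1) (by rw [g1, d1]; exact top_fst_lt hn h2)
  obtain ⟨hs, ht⟩ := hγ.eq_of_disjoint hab hδ hst
  rcases hs with rfl | rfl <;> rcases ht with rfl | rfl <;>
    simp only [g0, g1, d0, d1] at hst
  · have := bot_injective hn hst; omega
  · exact bot_ne_top _ _ _ hst
  · exact bot_ne_top _ _ _ hst.symm
  · have := top_injective hn hst; omega

/-- Two lifts of an arc or of its reverse differ by an iterate of the glide reflection, and possibly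
by the direction. -/
theorem IsLift.eq_glideLift {a : Arc n} {γ δ : C(I, Strip)} (hγ : a.IsLift γ) (hδ : a.IsLift δ) :
    ∃ k : ℤ, δ = glideLift k γ ∨ δ = glideLift k (revLift γ) := by
  have key : ∀ {f : C(I, Mobius)} {γ δ : C(I, Strip)}, (∀ t, proj (γ t) = f t) →
      (∀ t, proj (δ t) = f t) → ∃ k, δ = glideLift k γ := by
    intro f γ δ h1 h2
    obtain ⟨k, hk⟩ := lift_unique h1 h2
    exact ⟨k, ContinuousMap.ext hk⟩
  have flip : ∀ {f : C(I, Mobius)} {γ : C(I, Strip)}, (∀ t, proj (γ t) = f t) →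
      ∀ t, proj (revLift γ t) = Arc.rev f t := fun h t => h _
  rcases hγ with hγ | hγ <;> rcases hδ with hδ | hδ
  · obtain ⟨k, hk⟩ := key hγ hδ; exact ⟨k, Or.inl hk⟩
  · obtain ⟨k, hk⟩ := key (flip hγ) hδ; exact ⟨k, Or.inr hk⟩
  · have := flip hγ
    rw [rev_rev] at this
    obtain ⟨k, hk⟩ := key this hδ; exact ⟨k, Or.inr hk⟩
  · obtain ⟨k, hk⟩ := key hγ hδ; exact ⟨k, Or.inl hk⟩

/-- The lift of a planar arc is unique up to translations and direction. -/
theorem Planar.eq_shift (hn : 0 < n) {a : Arc n} {i j i' j' : ℤ} (h : a.Planar i j)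
    (h' : a.Planar i' j') :
    ∃ k : ℤ, (i' = i + k * n ∧ j' = j + k * n) ∨ (i' = j + k * n ∧ j' = i + k * n) := by
  obtain ⟨γ, hγ, g0, g1⟩ := h
  obtain ⟨δ, hδ, d0, d1⟩ := h'
  obtain ⟨k, hk⟩ := hγ.eq_glideLift hδ
  rcases Int.even_or_odd' k with ⟨l, rfl | rfl⟩
  · refine ⟨l, ?_⟩
    rcases hk with rfl | rfl
    · left
      simp only [glideLift, ContinuousMap.coe_mk, g0, g1, glide_zpow_bot_even hn] at d0 d1
      exact ⟨(bot_injective hn d0).symm, (bot_injective hn d1).symm⟩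
    · right
      simp only [glideLift, revLift, ContinuousMap.coe_mk, ContinuousMap.comp_apply,
        unitInterval.symm_zero, unitInterval.symm_one, g0, g1, glide_zpow_bot_even hn] at d0 d1
      exact ⟨(bot_injective hn d0).symm, (bot_injective hn d1).symm⟩
  · exfalso
    rcases hk with rfl | rfl
    · simp only [glideLift, ContinuousMap.coe_mk, g0, glide_zpow_bot_odd hn] at d0
      exact bot_ne_top _ _ _ d0.symm
    · simp only [glideLift, revLift, ContinuousMap.coe_mk, ContinuousMap.comp_apply,
        unitInterval.symm_zero, g1, glide_zpow_bot_odd hn] at d0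
      exact bot_ne_top _ _ _ d0.symm

/-- The lift of a crossing arc is unique up to translations and to the glide reflection, which
exchanges the two extremities. -/
theorem Crossing.eq_shift (hn : 0 < n) {a : Arc n} {p q p' q' : ℤ} (h : a.Crossing p q)
    (h' : a.Crossing p' q') :
    ∃ k : ℤ, (p' = p + k * n ∧ q' = q + k * n) ∨ (p' = q + (k + 1) * n ∧ q' = p + k * n) := by
  obtain ⟨γ, hγ, g0, g1⟩ := h
  obtain ⟨δ, hδ, d0, d1⟩ := h'
  obtain ⟨k, hk⟩ := hγ.eq_glideLift hδ
  rcases Int.even_or_odd' k with ⟨l, rfl | rfl⟩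
  · refine ⟨l, ?_⟩
    rcases hk with rfl | rfl
    · left
      simp only [glideLift, ContinuousMap.coe_mk, g0, g1, glide_zpow_bot_even hn,
        glide_zpow_top_even hn] at d0 d1
      exact ⟨(bot_injective hn d0).symm, (top_injective hn d1).symm⟩
    · simp only [glideLift, revLift, ContinuousMap.coe_mk, ContinuousMap.comp_apply,
        unitInterval.symm_zero, g1, glide_zpow_top_even hn] at d0
      exact absurd d0.symm (bot_ne_top _ _ _)
  · refine ⟨l, ?_⟩
    rcases hk with rfl | rfl
    · simp only [glideLift, ContinuousMap.coe_mk, g0, glide_zpow_bot_odd hn] at d0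
      exact absurd d0.symm (bot_ne_top _ _ _)
    · right
      simp only [glideLift, revLift, ContinuousMap.coe_mk, ContinuousMap.comp_apply,
        unitInterval.symm_zero, unitInterval.symm_one, g0, g1, glide_zpow_bot_odd hn,
        glide_zpow_top_odd hn] at d0 d1
      exact ⟨(bot_injective hn d0).symm, (top_injective hn d1).symm⟩

theorem not_planar_and_crossing (hn : 0 < n) {a : Arc n} {i j p q : ℤ} (h : a.Planar i j)
    (h' : a.Crossing p q) : False := by
  obtain ⟨γ, hγ, g0, g1⟩ := h
  obtain ⟨δ, hδ, d0, d1⟩ := h'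
  obtain ⟨k, hk⟩ := hγ.eq_glideLift hδ
  rcases Int.even_or_odd' k with ⟨l, rfl | rfl⟩ <;> rcases hk with rfl | rfl
  · simp only [glideLift, ContinuousMap.coe_mk, g1, glide_zpow_bot_even hn] at d1
    exact bot_ne_top _ _ _ d1
  · simp only [glideLift, revLift, ContinuousMap.coe_mk, ContinuousMap.comp_apply,
      unitInterval.symm_one, g0, glide_zpow_bot_even hn] at d1
    exact bot_ne_top _ _ _ d1
  · simp only [glideLift, ContinuousMap.coe_mk, g0, glide_zpow_bot_odd hn] at d0
    exact bot_ne_top _ _ _ d0.symm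
  · simp only [glideLift, revLift, ContinuousMap.coe_mk, ContinuousMap.comp_apply,
      unitInterval.symm_zero, g1, glide_zpow_bot_odd hn] at d0
    exact bot_ne_top _ _ _ d0.symm

theorem Planar.ne {a : Arc n} {i j : ℤ} (h : a.Planar i j) : i ≠ j := by
  rintro rfl
  obtain ⟨γ, hγ, g0, g1⟩ := h
  have key : ∀ f : C(I, Mobius), (∀ t, proj (γ t) = f t) →
      f.HomotopicRel (ContinuousMap.const I (f 0)) {0, 1} := fun f hf =>
    homotopicRel_of_lifts (δ := ContinuousMap.const I (γ 0)) hf (fun t => hf 0) rfl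
      (by rw [g1]; exact g0.symm)
  rcases hγ with hγ | hγ
  · exact a.essential (key _ hγ)
  · have h1 := rev_homotopicRel (key _ hγ)
    rw [rev_rev] at h1
    have e : rev (ContinuousMap.const I ((rev a.curve) 0))
        = ContinuousMap.const I (a.curve 0) := by
      ext t
      simp only [Arc.rev, ContinuousMap.comp_apply, ContinuousMap.const_apply,
        ContinuousMap.coe_mk, unitInterval.symm_zero]
      have h2 := hγ 1
      have h3 := hγ 0
      simp only [Arc.rev, ContinuousMap.comp_apply, ContinuousMap.coe_mk, unitInterval.symm_zero,
        unitInterval.symm_one] at h2 h3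
      rw [← h2, ← h3, g0, g1]
    rw [e] at h1
    exact a.essential h1

theorem exists_planar_or_crossing (hn : 0 < n) (a : Arc n) :
    (∃ i j, a.Planar i j) ∨ ∃ p q, a.Crossing p q := by
  obtain ⟨i, hi⟩ := a.start_mem
  have hi : proj (bot n (i : ℕ)) = a.curve 0 := by
    rw [← hi]; simp [marked, bot, proj]
  obtain ⟨γ, hγ, h0⟩ := exists_lift a.curve _ hi
  have h1 : proj (γ 1) ∈ Set.range (marked n) := by rw [hγ]; exact a.end_mem
  rcases (proj_mem_marked hn).1 h1 with ⟨j, hj⟩ | ⟨j, hj⟩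
  · exact Or.inl ⟨_, _, γ, Or.inl hγ, h0, hj⟩
  · exact Or.inr ⟨_, _, γ, Or.inl hγ, h0, hj⟩

/-- The strip is simply connected: arcs that have lifts with the same extremities are homotopic. -/
theorem homotopic_of_isLift {a b : Arc n} {γ δ : C(I, Strip)} (hγ : a.IsLift γ) (hδ : b.IsLift δ)
    (h0 : γ 0 = δ 0) (h1 : γ 1 = δ 1) : a.Homotopic b := by
  rcases hγ with hγ | hγ <;> rcases hδ with hδ | hδ
  · exact Or.inl (homotopicRel_of_lifts hγ hδ h0 h1)
  · exact Or.inr (homotopicRel_of_lifts hγ hδ h0 h1)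
  · refine Or.inr ?_
    have := rev_homotopicRel (homotopicRel_of_lifts hγ hδ h0 h1)
    rwa [rev_rev] at this
  · refine Or.inl ?_
    have := rev_homotopicRel (homotopicRel_of_lifts hγ hδ h0 h1)
    rwa [rev_rev, rev_rev] at this

theorem Homotopic.exists_isLift {a b : Arc n} (h : a.Homotopic b) {γ : C(I, Strip)}
    (hγ : a.IsLift γ) : ∃ δ, b.IsLift δ ∧ δ 0 = γ 0 ∧ δ 1 = γ 1 := by
  have key : ∀ {f g : C(I, Mobius)}, f.HomotopicRel g {0, 1} → (∀ t, proj (γ t) = f t) →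
      ∃ δ : C(I, Strip), (∀ t, proj (δ t) = g t) ∧ δ 0 = γ 0 ∧ δ 1 = γ 1 := by
    intro f g hfg hf
    obtain ⟨δ, hδ, h0⟩ := exists_lift g (γ 0) (by rw [hf]; exact hfg.fst_eq_snd (by simp))
    exact ⟨δ, hδ, h0, (lift_one_eq hfg hf hδ h0.symm).symm⟩
  rcases h with h | h <;> rcases hγ with hγ | hγ
  · obtain ⟨δ, h1, h2⟩ := key h hγ; exact ⟨δ, Or.inl h1, h2⟩
  · obtain ⟨δ, h1, h2⟩ := key (rev_homotopicRel h) hγ; exact ⟨δ, Or.inr h1, h2⟩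
  · obtain ⟨δ, h1, h2⟩ := key h hγ; exact ⟨δ, Or.inr h1, h2⟩
  · have := rev_homotopicRel h
    rw [rev_rev] at this
    obtain ⟨δ, h1, h2⟩ := key this hγ; exact ⟨δ, Or.inl h1, h2⟩

end Arc

/-! ### Combinatorial description of the arcs -/

/-- The pairs of integers that encode the arcs of `M_n` up to isotopy. When `i < j`, the pair
`(i, j)` stands for the arc whose lifts join lower points of indices `i` and `j` (a boundary arc if
`j = i + 1`, a loop if `j = i + n`). When `j ≤ i`, it stands for the arc that crosses the core of
the Möbius strip, with a lift from the lower point of index `i` to the upper point of index `j`. -/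
def IsCode (n : ℤ) (c : ℤ × ℤ) : Prop := 0 ≤ c.1 ∧ c.1 < n ∧ 0 ≤ c.2 ∧ c.2 ≤ c.1 + n

/-- The lifts of two planar arcs are not interleaved. -/
def PlanarPlanar (n i j i' j' : ℤ) : Prop :=
  ¬ (i < i' ∧ i' < j ∧ j < j') ∧ ¬ (i' < i ∧ i < j' ∧ j' < j) ∧
    ¬ (i' + n < j ∧ j < j' + n) ∧ ¬ (i + n < j' ∧ j' < j + n)

/-- No extremity of the lifts of the crossing arc `(p, q)` is strictly between `i` and `j`. -/
def PlanarCrossing (n i j p q : ℤ) : Prop :=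
  ¬ (i < p ∧ p < j) ∧ ¬ (i < q ∧ q < j) ∧ ¬ (p + n < j) ∧ ¬ (q + n < j)

/-- The lifts of two crossing arcs are comparable. -/
def CrossingCrossing (p q p' q' : ℤ) : Prop :=
  q ≤ p' ∧ q' ≤ p ∧ (p ≤ p' ∧ q ≤ q' ∨ p' ≤ p ∧ q' ≤ q)

/-- The arcs encoded by two pairs do not cross. -/
def Compat (n : ℤ) (c d : ℤ × ℤ) : Prop :=
  (c.1 < c.2 → d.1 < d.2 → PlanarPlanar n c.1 c.2 d.1 d.2) ∧
  (c.1 < c.2 → d.2 ≤ d.1 → PlanarCrossing n c.1 c.2 d.1 d.2) ∧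
  (c.2 ≤ c.1 → d.1 < d.2 → PlanarCrossing n d.1 d.2 c.1 c.2) ∧
  (c.2 ≤ c.1 → d.2 ≤ d.1 → CrossingCrossing c.1 c.2 d.1 d.2)

theorem Compat.symm {n : ℤ} {c d : ℤ × ℤ} (h : Compat n c d) : Compat n d c := by
  simp only [Compat, PlanarPlanar, PlanarCrossing, CrossingCrossing] at h ⊢
  omega

theorem eq_zero_of_shift {n a b k : ℤ} (ha : 0 ≤ a) (ha' : a < n) (hb : 0 ≤ b) (hb' : b < n)
    (h : b = a + k * n) : k = 0 := by
  have h1 : -1 < k := by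
    by_contra! hc
    nlinarith
  have h2 : k < 1 := by
    by_contra! hc
    nlinarith
  omega

namespace Arc

variable {n : ℕ}

/-- The pair `c` encodes the arc `a`. -/
def HasCode (a : Arc n) (c : ℤ × ℤ) : Prop :=
  IsCode n c ∧ (c.1 < c.2 → a.Planar c.1 c.2) ∧ (c.2 ≤ c.1 → a.Crossing c.1 c.2)

theorem exists_hasCode (hn : 0 < n) (a : Arc n) : ∃ c, a.HasCode c := by
  have hn' : (0 : ℤ) < n := by exact_mod_cast hn
  have planar : ∀ i j, i < j → a.Planar i j → ∃ c, a.HasCode c := by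
    intro i j hij h
    have hle := h.le_add hn
    have h1 := Int.emod_nonneg i hn'.ne'
    have h2 := Int.emod_lt_of_pos i hn'
    have h3 := Int.emod_add_ediv_mul i n
    have h4 := h.shift hn (-(i / n))
    have e : i + -(i / n) * n = i % n := by linarith
    rw [e] at h4
    refine ⟨(i % n, j + -(i / n) * n), ⟨h1, h2, ?_, ?_⟩, fun _ => h4, fun hc => ?_⟩
    · simp only; linarith
    · simp only; linarith
    · simp only at hc; linarith
  rcases a.exists_planar_or_crossing hn with ⟨i, j, h⟩ | ⟨p, q, h⟩
  · rcases lt_or_gt_of_ne h.ne with hij | hij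
    · exact planar i j hij h
    · exact planar j i hij h.symm
  · obtain ⟨hb1, hb2⟩ := h.bounds hn
    have h1 := Int.emod_nonneg p hn'.ne'
    have h2 := Int.emod_lt_of_pos p hn'
    have h3 := Int.emod_add_ediv_mul p n
    have h4 := h.shift hn (-(p / n))
    have e : p + -(p / n) * n = p % n := by linarith
    rw [e] at h4
    set q' := q + -(p / n) * n with hq'
    have hb := h4.bounds hn
    by_cases hq : 0 ≤ q'
    · refine ⟨(p % n, q'), ⟨h1, h2, hq, ?_⟩, fun hc => ?_, fun _ => h4⟩
      · simp only; omega
      · simp only at hc; omega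
    · refine ⟨(q' + n, p % n), ⟨?_, ?_, h1, ?_⟩, fun hc => ?_, fun _ => h4.glide hn⟩ <;>
        simp only at * <;> omega

theorem HasCode.unique (hn : 0 < n) {a : Arc n} {c d : ℤ × ℤ} (hc : a.HasCode c)
    (hd : a.HasCode d) : c = d := by
  obtain ⟨⟨c1, c2, c3, c4⟩, cp, cc⟩ := hc
  obtain ⟨⟨d1, d2, d3, d4⟩, dp, dc⟩ := hd
  have hn' : (0 : ℤ) < n := by exact_mod_cast hn
  rcases lt_or_ge c.1 c.2 with hc | hc <;> rcases lt_or_ge d.1 d.2 with hd | hd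
  · obtain ⟨k, ⟨h1, h2⟩ | ⟨h1, h2⟩⟩ := (cp hc).eq_shift hn (dp hd)
    · obtain rfl := eq_zero_of_shift c1 c2 d1 d2 h1
      ext <;> linarith
    · linarith
  · exact (not_planar_and_crossing hn (cp hc) (dc hd)).elim
  · exact (not_planar_and_crossing hn (dp hd) (cc hc)).elim
  · obtain ⟨k, ⟨h1, h2⟩ | ⟨h1, h2⟩⟩ := (cc hc).eq_shift hn (dc hd)
    · obtain rfl := eq_zero_of_shift c1 c2 d1 d2 h1
      ext <;> linarith
    · have hk := eq_zero_of_shift c3 (by linarith) d1 d2 h1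
      obtain rfl := eq_zero_of_shift c1 c2 d3 (by linarith) h2
      omega

theorem HasCode.of_homotopic {a b : Arc n} {c : ℤ × ℤ} (hc : a.HasCode c) (h : a.Homotopic b) :
    b.HasCode c := by
  obtain ⟨h0, hp, hx⟩ := hc
  refine ⟨h0, fun h1 => ?_, fun h1 => ?_⟩
  · obtain ⟨γ, hγ, g0, g1⟩ := hp h1
    obtain ⟨δ, hδ, d0, d1⟩ := h.exists_isLift hγ
    exact ⟨δ, hδ, d0.trans g0, d1.trans g1⟩
  · obtain ⟨γ, hγ, g0, g1⟩ := hx h1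
    obtain ⟨δ, hδ, d0, d1⟩ := h.exists_isLift hγ
    exact ⟨δ, hδ, d0.trans g0, d1.trans g1⟩

theorem HasCode.homotopic {a b : Arc n} {c : ℤ × ℤ} (ha : a.HasCode c) (hb : b.HasCode c) :
    a.Homotopic b := by
  obtain ⟨-, ap, ac⟩ := ha
  obtain ⟨-, bp, bc⟩ := hb
  rcases lt_or_ge c.1 c.2 with hc | hc
  · obtain ⟨γ, hγ, g0, g1⟩ := ap hc
    obtain ⟨δ, hδ, d0, d1⟩ := bp hc
    exact homotopic_of_isLift hγ hδ (g0.trans d0.symm) (g1.trans d1.symm)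
  · obtain ⟨γ, hγ, g0, g1⟩ := ac hc
    obtain ⟨δ, hδ, d0, d1⟩ := bc hc
    exact homotopic_of_isLift hγ hδ (g0.trans d0.symm) (g1.trans d1.symm)

theorem planarCrossing_of_disjoint (hn : 0 < n) {a b : Arc n}
    (hab : Disjoint a.interior b.interior) {i j p q : ℤ} (ha : a.Planar i j) (hb : b.Crossing p q)
    (hi : i < n) (hp : 0 ≤ p) (hq : 0 ≤ q) : PlanarCrossing n i j p q := by
  have h1 := ha.not_mem_Ioo hn hab hb
  have h2 := ha.not_mem_Ioo hn hab (hb.glide hn)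
  have h3 := ha.not_mem_Ioo hn hab (hb.shift hn 1)
  have h4 := ha.not_mem_Ioo hn hab ((hb.shift hn (-1)).glide hn)
  refine ⟨h1, ?_, ?_, ?_⟩ <;> omega

/-- Disjoint arcs have compatible codes. -/
theorem HasCode.compat (hn : 0 < n) {a b : Arc n} (hab : Disjoint a.interior b.interior)
    {c d : ℤ × ℤ} (ha : a.HasCode c) (hb : b.HasCode d) : Compat n c d := by
  obtain ⟨⟨c1, c2, c3, c4⟩, cp, cc⟩ := ha
  obtain ⟨⟨d1, d2, d3, d4⟩, dp, dc⟩ := hb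
  refine ⟨fun h h' => ?_, fun h h' => ?_, fun h h' => ?_, fun h h' => ?_⟩
  · have h1 := (cp h).not_interleaved hn hab (dp h')
    have h2 := (dp h').not_interleaved hn hab.symm (cp h)
    have h3 := (cp h).not_interleaved hn hab ((dp h').shift hn 1)
    have h4 := (dp h').not_interleaved hn hab.symm ((cp h).shift hn 1)
    refine ⟨h1, h2, ?_, ?_⟩ <;> omega
  · exact planarCrossing_of_disjoint hn hab (cp h) (dc h') c2 d1 d3
  · exact planarCrossing_of_disjoint hn hab.symm (dp h') (cc h) d2 c1 c3
  · have h1 := (cc h).not_opposite hn hab (dc h')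
    have h2 := (dc h').not_opposite hn hab.symm (cc h)
    have h3 := (cc h).not_opposite hn hab ((dc h').glide hn)
    have h4 := (dc h').not_opposite hn hab.symm ((cc h).glide hn)
    refine ⟨?_, ?_, ?_⟩ <;> omega

end Arc

/-! ### Representatives of the arcs -/

/-- The lift that represents the code `c`: a parabola if `c` is planar, a segment otherwise. -/
noncomputable def stdX (n : ℕ) (c : ℤ × ℤ) (t : ℝ) : ℝ :=
  if c.1 < c.2 then 2 * c.1 / n + t * (2 * (c.2 - c.1) / n)
  else 2 * c.1 / n + t * (2 * (c.2 - c.1) / n + 1)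

/-- The height of the lift that represents the code `c`. All the parabolas have the same leading
coefficient, so that any two of them meet at most once. -/
noncomputable def stdY (n : ℕ) (c : ℤ × ℤ) (t : ℝ) : ℝ :=
  if c.1 < c.2 then t * (1 - t) * (2 * (c.2 - c.1) / n) ^ 2 / 3 else t

/-- The relevant translations: the lifts are too short to interact with the translates by at least
`2 * n`. -/
theorem shift_cases {n : ℤ} (hn : 0 < n) (m : ℤ) :
    (m = 0 ∧ m * n = 0) ∨ (m = 1 ∧ m * n = n) ∨ (m = -1 ∧ m * n = -n) ∨ 2 * n ≤ m * n ∨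
      m * n ≤ -(2 * n) := by
  rcases lt_trichotomy m 0 with h | rfl | h
  · by_cases h1 : m = -1
    · subst h1; right; right; left; constructor <;> ring
    · right; right; right; right
      have : m ≤ -2 := by omega
      nlinarith
  · left; simp
  · by_cases h1 : m = 1
    · subst h1; right; left; constructor <;> ring
    · right; right; right; left
      have : 2 ≤ m := by omega
      nlinarith

theorem stdX_planar {n : ℕ} {c : ℤ × ℤ} (h : c.1 < c.2) (t : ℝ) :
    stdX n c t = 2 * c.1 / n + t * (2 * (c.2 - c.1) / n) := if_pos h

theorem stdY_planar {n : ℕ} {c : ℤ × ℤ} (h : c.1 < c.2) (t : ℝ) :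
    stdY n c t = t * (1 - t) * (2 * (c.2 - c.1) / n) ^ 2 / 3 := if_pos h

theorem stdX_crossing {n : ℕ} {c : ℤ × ℤ} (h : c.2 ≤ c.1) (t : ℝ) :
    stdX n c t = 2 * c.1 / n + t * (2 * (c.2 - c.1) / n + 1) := if_neg (not_lt.2 h)

theorem stdY_crossing {n : ℕ} {c : ℤ × ℤ} (h : c.2 ≤ c.1) (t : ℝ) :
    stdY n c t = t := if_neg (not_lt.2 h)

theorem planar_width {n : ℕ} (hn : 0 < n) {c : ℤ × ℤ} (hc : IsCode n c) (h : c.1 < c.2) :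
    0 < 2 * ((c.2 : ℝ) - c.1) / n ∧ 2 * ((c.2 : ℝ) - c.1) / n ≤ 2 := by
  have hn' : (0 : ℝ) < n := by exact_mod_cast hn
  have h1 : (c.1 : ℝ) < c.2 := by exact_mod_cast h
  have h2 : (c.2 : ℝ) ≤ c.1 + n := by exact_mod_cast hc.2.2.2
  constructor
  · have : (0 : ℝ) < c.2 - c.1 := by linarith
    positivity
  · rw [div_le_iff₀ hn']; linarith

theorem crossing_width {n : ℕ} (hn : 0 < n) {c : ℤ × ℤ} (hc : IsCode n c) (h : c.2 ≤ c.1) :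
    -1 ≤ 2 * ((c.2 : ℝ) - c.1) / n + 1 ∧ 2 * ((c.2 : ℝ) - c.1) / n + 1 ≤ 1 := by
  have hn' : (0 : ℝ) < n := by exact_mod_cast hn
  have h1 : (c.2 : ℝ) ≤ c.1 := by exact_mod_cast h
  have h2 : (c.1 : ℝ) ≤ n := by exact_mod_cast hc.2.1.le
  have h3 : (0 : ℝ) ≤ c.2 := by exact_mod_cast hc.2.2.1
  constructor
  · have : -2 ≤ 2 * ((c.2 : ℝ) - c.1) / n := by rw [le_div_iff₀ hn']; linarith
    linarith
  · have : 2 * ((c.2 : ℝ) - c.1) / n ≤ 0 := by rw [div_le_iff₀ hn']; linarith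
    linarith

theorem stdY_planar_bounds {n : ℕ} (hn : 0 < n) {c : ℤ × ℤ} (hc : IsCode n c) (h : c.1 < c.2)
    {t : ℝ} (h0 : 0 ≤ t) (h1 : t ≤ 1) : 0 ≤ stdY n c t ∧ stdY n c t ≤ 1 / 3 := by
  obtain ⟨w0, w1⟩ := planar_width hn hc h
  rw [stdY_planar h]
  have h2 : 0 ≤ t * (1 - t) := mul_nonneg h0 (by linarith)
  have h3 : t * (1 - t) ≤ 1 / 4 := by nlinarith [sq_nonneg (t - 1 / 2)]
  have h4 : (2 * ((c.2 : ℝ) - c.1) / n) ^ 2 ≤ 4 := by nlinarith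
  have h5 : 0 ≤ (2 * ((c.2 : ℝ) - c.1) / n) ^ 2 := sq_nonneg _
  constructor
  · positivity
  · nlinarith

theorem stdY_mem {n : ℕ} (hn : 0 < n) {c : ℤ × ℤ} (hc : IsCode n c) (t : I) :
    stdY n c t ∈ I := by
  rcases lt_or_ge c.1 c.2 with h | h
  · obtain ⟨h1, h2⟩ := stdY_planar_bounds hn hc h t.2.1 t.2.2
    exact ⟨h1, by linarith⟩
  · rw [stdY_crossing h]; exact t.2

theorem stdY_pos {n : ℕ} (hn : 0 < n) {c : ℤ × ℤ} (hc : IsCode n c) {t : ℝ} (h0 : 0 < t)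
    (h1 : t < 1) : 0 < stdY n c t ∧ stdY n c t < 1 := by
  rcases lt_or_ge c.1 c.2 with h | h
  · obtain ⟨h3, h2⟩ := stdY_planar_bounds hn hc h h0.le h1.le
    refine ⟨?_, by linarith⟩
    rw [stdY_planar h]
    have := (planar_width hn hc h).1
    have : 0 < 1 - t := by linarith
    positivity
  · rw [stdY_crossing h]; exact ⟨h0, h1⟩

/-- The curve of the strip that represents the lift of an arc. -/
noncomputable def stdLift {n : ℕ} (hn : 0 < n) {c : ℤ × ℤ} (hc : IsCode n c) : C(I, Strip) where
  toFun t := (stdX n c t, ⟨stdY n c t, stdY_mem hn hc t⟩)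
  continuous_toFun := by
    refine Continuous.prodMk ?_ (Continuous.subtype_mk ?_ _)
    · rcases lt_or_ge c.1 c.2 with h | h
      · simp only [stdX_planar h]; fun_prop
      · simp only [stdX_crossing h]; fun_prop
    · rcases lt_or_ge c.1 c.2 with h | h
      · simp only [stdY_planar h]; fun_prop
      · simp only [stdY_crossing h]; fun_prop

theorem stdLift_zero {n : ℕ} (hn : 0 < n) {c : ℤ × ℤ} (hc : IsCode n c) :
    stdLift hn hc 0 = bot n c.1 := by
  rcases lt_or_ge c.1 c.2 with h | h
  · ext <;> simp [stdLift, stdX_planar h, stdY_planar h, bot]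
  · ext <;> simp [stdLift, stdX_crossing h, stdY_crossing h, bot]

theorem stdLift_one_planar {n : ℕ} (hn : 0 < n) {c : ℤ × ℤ} (hc : IsCode n c) (h : c.1 < c.2) :
    stdLift hn hc 1 = bot n c.2 := by
  ext <;> simp [stdLift, stdX_planar h, stdY_planar h, bot]
  ring

theorem stdLift_one_crossing {n : ℕ} (hn : 0 < n) {c : ℤ × ℤ} (hc : IsCode n c) (h : c.2 ≤ c.1) :
    stdLift hn hc 1 = top n c.2 := by
  ext <;> simp [stdLift, stdX_crossing h, stdY_crossing h, top]
  ring

/-- Two points of the representatives coincide when the glide reflection, iterated an even or an odd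
number of times, maps one to the other. -/
theorem proj_stdLift_eq {n : ℕ} {hn : 0 < n} {c d : ℤ × ℤ} {hc : IsCode n c} {hd : IsCode n d}
    {s t : I} (h : proj (stdLift hn hc s) = proj (stdLift hn hd t)) :
    ∃ m : ℤ, (stdX n c s + 2 * m = stdX n d t ∧ stdY n c s = stdY n d t) ∨
      (stdX n c s + 2 * m + 1 = stdX n d t ∧ 1 - stdY n c s = stdY n d t) := by
  obtain ⟨k, hk⟩ := proj_eq_iff.1 h
  rcases Int.even_or_odd' k with ⟨m, rfl | rfl⟩
  · rw [glide_zpow_two_mul] at hk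
    refine ⟨m, Or.inl ⟨(Prod.ext_iff.1 hk).1, ?_⟩⟩
    exact congrArg Subtype.val (Prod.ext_iff.1 hk).2
  · rw [glide_zpow_two_mul_add_one] at hk
    refine ⟨m, Or.inr ⟨(Prod.ext_iff.1 hk).1, ?_⟩⟩
    exact congrArg Subtype.val (Prod.ext_iff.1 hk).2

theorem unitInterval_eq_zero {s : I} (h : (s : ℝ) ≤ 0) : s = 0 := Subtype.ext (le_antisymm h s.2.1)

theorem unitInterval_eq_one {s : I} (h : 1 ≤ (s : ℝ)) : s = 1 := Subtype.ext (le_antisymm s.2.2 h)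

theorem abs_mul_lt_one {s w : ℝ} (h0 : 0 < s) (h1 : s < 1) (hw : -1 ≤ w) (hw' : w ≤ 1) :
    |(1 - 2 * s) * w| < 1 := by
  rw [abs_mul]
  have h2 : |1 - 2 * s| < 1 := by rw [abs_lt]; constructor <;> linarith
  have h3 : |w| ≤ 1 := by rw [abs_le]; exact ⟨hw, hw'⟩
  have := abs_nonneg (1 - 2 * s)
  have := abs_nonneg w
  nlinarith

theorem stdLift_simple {n : ℕ} (hn : 0 < n) {c : ℤ × ℤ} (hc : IsCode n c) (s t : I)
    (h : proj (stdLift hn hc s) = proj (stdLift hn hc t)) :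
    s = t ∨ (s = 0 ∧ t = 1) ∨ (s = 1 ∧ t = 0) := by
  have s0 := s.2.1; have s1 := s.2.2; have t0 := t.2.1; have t1 := t.2.2
  obtain ⟨m, ⟨hx, hy⟩ | ⟨hx, hy⟩⟩ := proj_stdLift_eq h
  · rcases lt_or_ge c.1 c.2 with hcp | hcp
    · obtain ⟨w0, w1⟩ := planar_width hn hc hcp
      rw [stdX_planar hcp, stdX_planar hcp] at hx
      set w := 2 * ((c.2 : ℝ) - c.1) / n
      have hx : ((t : ℝ) - s) * w = 2 * m := by linarith
      rcases lt_trichotomy m 0 with hm | rfl | hm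
      · have hm : (m : ℝ) ≤ -1 := by exact_mod_cast Int.le_sub_one_of_lt hm
        have h3 : ((s : ℝ) - t) * w ≥ 2 := by linarith
        have h4 : (s : ℝ) - t ≥ 1 := by
          by_contra! hlt
          nlinarith
        right; right
        exact ⟨unitInterval_eq_one (by linarith), unitInterval_eq_zero (by linarith)⟩
      · left
        have : ((t : ℝ) - s) * w = 0 := by simpa using hx
        rcases mul_eq_zero.1 this with h | h
        · ext; linarith
        · exact absurd h w0.ne'
      · have hm : (1 : ℝ) ≤ m := by exact_mod_cast hm
        have h4 : (t : ℝ) - s ≥ 1 := by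
          by_contra! hlt
          nlinarith
        right; left
        exact ⟨unitInterval_eq_zero (by linarith), unitInterval_eq_one (by linarith)⟩
    · rw [stdY_crossing hcp, stdY_crossing hcp] at hy
      left; ext; exact hy
  · rcases lt_or_ge c.1 c.2 with hcp | hcp
    · have h1 := (stdY_planar_bounds hn hc hcp s0 s1).2
      have h2 := (stdY_planar_bounds hn hc hcp t0 t1).2
      linarith
    · obtain ⟨w0, w1⟩ := crossing_width hn hc hcp
      rw [stdX_crossing hcp, stdX_crossing hcp] at hx
      rw [stdY_crossing hcp, stdY_crossing hcp] at hy
      set w := 2 * ((c.2 : ℝ) - c.1) / n + 1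
      have hx : ((t : ℝ) - s) * w = 2 * m + 1 := by linarith
      have hts : (t : ℝ) - s = 1 - 2 * s := by linarith
      rw [hts] at hx
      rcases le_or_gt 0 m with hm | hm
      · have hm : (0 : ℝ) ≤ m := by exact_mod_cast hm
        have h4 : (s : ℝ) ≤ 0 ∨ 1 ≤ (s : ℝ) := by
          by_contra! hc
          have := abs_lt.1 (abs_mul_lt_one hc.1 hc.2 w0 w1)
          linarith
        rcases h4 with h4 | h4
        · exact Or.inr (Or.inl ⟨unitInterval_eq_zero h4, unitInterval_eq_one (by linarith)⟩)
        · exact Or.inr (Or.inr ⟨unitInterval_eq_one h4, unitInterval_eq_zero (by linarith)⟩)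
      · have hm : (m : ℝ) ≤ -1 := by exact_mod_cast Int.le_sub_one_of_lt hm
        have h4 : (s : ℝ) ≤ 0 ∨ 1 ≤ (s : ℝ) := by
          by_contra! hc
          have := abs_lt.1 (abs_mul_lt_one hc.1 hc.2 w0 w1)
          linarith
        rcases h4 with h4 | h4
        · exact Or.inr (Or.inl ⟨unitInterval_eq_zero h4, unitInterval_eq_one (by linarith)⟩)
        · exact Or.inr (Or.inr ⟨unitInterval_eq_one h4, unitInterval_eq_zero (by linarith)⟩)

/-- The arc that represents a code. -/
noncomputable def stdArc {n : ℕ} (hn : 0 < n) {c : ℤ × ℤ} (hc : IsCode n c) : Arc n where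
  curve := ⟨fun t => proj (stdLift hn hc t), continuous_proj.comp (stdLift hn hc).continuous⟩
  start_mem := by
    change proj (stdLift hn hc 0) ∈ _
    rw [stdLift_zero]; exact proj_bot_mem hn _
  end_mem := by
    change proj (stdLift hn hc 1) ∈ _
    rcases lt_or_ge c.1 c.2 with h | h
    · rw [stdLift_one_planar hn hc h]; exact proj_bot_mem hn _
    · rw [stdLift_one_crossing hn hc h, proj_top]; exact proj_bot_mem hn _
  simple := stdLift_simple hn hc
  interior_not_mem := by
    intro t ht hmem
    obtain ⟨h1, h2⟩ := stdY_pos hn hc (t := t) (by exact_mod_cast ht.1) (by exact_mod_cast ht.2)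
    rcases (proj_mem_marked hn).1 hmem with ⟨i, hi⟩ | ⟨i, hi⟩
    · have : stdY n c t = 0 := congrArg (fun p : Strip => (p.2 : ℝ)) hi
      linarith
    · have : stdY n c t = 1 := congrArg (fun p : Strip => (p.2 : ℝ)) hi
      linarith
  essential := by
    intro hh
    have h1 : stdLift hn hc 1 = stdLift hn hc 0 :=
      lift_one_eq (δ := ContinuousMap.const I (stdLift hn hc 0)) hh (fun _ => rfl) (fun _ => rfl) rfl
    rw [stdLift_zero] at h1
    rcases lt_or_ge c.1 c.2 with h | h
    · rw [stdLift_one_planar hn hc h] at h1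
      exact h.ne' (bot_injective hn h1)
    · rw [stdLift_one_crossing hn hc h] at h1
      exact bot_ne_top _ _ _ h1.symm

theorem hasCode_stdArc {n : ℕ} (hn : 0 < n) {c : ℤ × ℤ} (hc : IsCode n c) :
    (stdArc hn hc).HasCode c :=
  ⟨hc, fun h => ⟨stdLift hn hc, Or.inl fun _ => rfl, stdLift_zero hn hc, stdLift_one_planar hn hc h⟩,
    fun h => ⟨stdLift hn hc, Or.inl fun _ => rfl, stdLift_zero hn hc, stdLift_one_crossing hn hc h⟩⟩

theorem eq_zero_of_convex {t A B : ℝ} (h0 : 0 < t) (h1 : t < 1)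
    (hAB : 0 ≤ A ∧ 0 ≤ B ∨ A ≤ 0 ∧ B ≤ 0) (h : (1 - t) * A + t * B = 0) : A = 0 ∧ B = 0 := by
  have h2 : 0 < 1 - t := by linarith
  rcases hAB with ⟨hA, hB⟩ | ⟨hA, hB⟩
  · have hA' := mul_nonneg h2.le hA
    have hB' := mul_nonneg h0.le hB
    have e1 : (1 - t) * A = 0 := by linarith
    have e2 : t * B = 0 := by linarith
    exact ⟨(mul_eq_zero.1 e1).resolve_left h2.ne', (mul_eq_zero.1 e2).resolve_left h0.ne'⟩
  · have hA' := mul_nonpos_of_nonneg_of_nonpos h2.le hA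
    have hB' := mul_nonpos_of_nonneg_of_nonpos h0.le hB
    have e1 : (1 - t) * A = 0 := by linarith
    have e2 : t * B = 0 := by linarith
    exact ⟨(mul_eq_zero.1 e1).resolve_left h2.ne', (mul_eq_zero.1 e2).resolve_left h0.ne'⟩

/-- Two comparable segments do not meet, as the difference of their abscissae has a constant sign. -/
theorem crossing_crossing_disjoint {n : ℕ} (hn : 0 < n) {c d : ℤ × ℤ} (hc : IsCode n c)
    (hd : IsCode n d) (hcd : Compat n c d) (hne : c ≠ d) (hcx : c.2 ≤ c.1) (hdx : d.2 ≤ d.1)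
    {s t : I} (t0 : (0 : ℝ) < t) (t1 : (t : ℝ) < 1)
    (h : proj (stdLift hn hc s) = proj (stdLift hn hd t)) : False := by
  have hn' : (0 : ℝ) < n := by exact_mod_cast hn
  have hnz : (0 : ℤ) < n := by exact_mod_cast hn
  have hcc := hcd.2.2.2 hcx hdx
  obtain ⟨c1, c2, c3, c4⟩ := hc
  obtain ⟨d1, d2, d3, d4⟩ := hd
  simp only [CrossingCrossing] at hcc
  have hne' : ¬ (c.1 = d.1 ∧ c.2 = d.2) := fun h => hne (Prod.ext h.1 h.2)
  obtain ⟨m, ⟨hx, hy⟩ | ⟨hx, hy⟩⟩ := proj_stdLift_eq h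
  · rw [stdX_crossing hcx, stdX_crossing hdx] at hx
    rw [stdY_crossing hcx, stdY_crossing hdx] at hy
    rw [hy] at hx
    have hsh := shift_cases hnz m
    generalize hK : m * (n : ℤ) = K at hsh
    have hK' : (K : ℝ) = m * n := by rw [← hK]; push_cast; ring
    have key : (1 - (t : ℝ)) * (((c.1 + K - d.1 : ℤ) : ℝ)) + t * (((c.2 + K - d.2 : ℤ) : ℝ)) = 0 := by
      push_cast; rw [hK']
      field_simp at hx
      linarith
    obtain ⟨e1, e2⟩ := eq_zero_of_convex t0 t1 (by
      rcases (by omega : (0 ≤ c.1 + K - d.1 ∧ 0 ≤ c.2 + K - d.2) ∨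
        (c.1 + K - d.1 ≤ 0 ∧ c.2 + K - d.2 ≤ 0)) with ⟨h1, h2⟩ | ⟨h1, h2⟩
      · left; constructor <;> exact_mod_cast ‹_›
      · right; constructor <;> exact_mod_cast ‹_›) key
    have e1 : c.1 + K - d.1 = 0 := by exact_mod_cast e1
    have e2 : c.2 + K - d.2 = 0 := by exact_mod_cast e2
    omega
  · rw [stdX_crossing hcx, stdX_crossing hdx] at hx
    rw [stdY_crossing hcx, stdY_crossing hdx] at hy
    have hs : (s : ℝ) = 1 - t := by linarith
    rw [hs] at hx
    have hsh := shift_cases hnz m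
    generalize hK : m * (n : ℤ) = K at hsh
    have hK' : (K : ℝ) = m * n := by rw [← hK]; push_cast; ring
    have key : (1 - (t : ℝ)) * (((c.2 + n + K - d.1 : ℤ) : ℝ)) + t * (((c.1 + K - d.2 : ℤ) : ℝ))
        = 0 := by
      push_cast; rw [hK']
      field_simp at hx
      linarith
    obtain ⟨e1, e2⟩ := eq_zero_of_convex t0 t1 (by
      rcases (by omega : (0 ≤ c.2 + n + K - d.1 ∧ 0 ≤ c.1 + K - d.2) ∨
        (c.2 + n + K - d.1 ≤ 0 ∧ c.1 + K - d.2 ≤ 0)) with ⟨h1, h2⟩ | ⟨h1, h2⟩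
      · left; constructor <;> exact_mod_cast ‹_›
      · right; constructor <;> exact_mod_cast ‹_›) key
    have e1 : c.2 + n + K - d.1 = 0 := by exact_mod_cast e1
    have e2 : c.1 + K - d.2 = 0 := by exact_mod_cast e2
    omega

/-- A parabola does not meet a segment of slope at least one that starts outside of its base. -/
theorem parabola_segment {x₁ l y w s t : ℝ} (hl : 0 < l) (hl2 : l ≤ 2) (hw : -1 ≤ w) (hw' : w ≤ 1)
    (s0 : 0 < s) (s1 : s < 1) (hy : y ≤ x₁ ∨ x₁ + l ≤ y)
    (hx : x₁ + s * l = y + t * w) (ht : s * (1 - s) * l ^ 2 / 3 = t) : False := by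
  have h1 : 0 < 1 - s := by linarith
  have p1 : 0 < s * l := by positivity
  have p2 : 0 < (1 - s) * l := by positivity
  have ht0 : 0 < t := by rw [← ht]; positivity
  have e : t = (s * l) * ((1 - s) * l) / 3 := by rw [← ht]; ring
  rcases hy with hy | hy
  · have h2 : s * l ≤ t := by nlinarith
    have h3 : (1 - s) * l < 2 := by nlinarith
    nlinarith
  · have h2 : (1 - s) * l ≤ t := by nlinarith
    have h3 : s * l < 2 := by nlinarith
    nlinarith

theorem planar_crossing_disjoint {n : ℕ} (hn : 0 < n) {c d : ℤ × ℤ} (hc : IsCode n c)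
    (hd : IsCode n d) (hcd : Compat n c d) (hcx : c.1 < c.2) (hdx : d.2 ≤ d.1)
    {s t : I} (s0 : (0 : ℝ) < s) (s1 : (s : ℝ) < 1)
    (h : proj (stdLift hn hc s) = proj (stdLift hn hd t)) : False := by
  have hn' : (0 : ℝ) < n := by exact_mod_cast hn
  have hnz : (0 : ℤ) < n := by exact_mod_cast hn
  have hcc := hcd.2.1 hcx hdx
  obtain ⟨w0, w1⟩ := planar_width hn hc hcx
  obtain ⟨v0, v1⟩ := crossing_width hn hd hdx
  obtain ⟨c1, c2, c3, c4⟩ := hc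
  obtain ⟨d1, d2, d3, d4⟩ := hd
  simp only [PlanarCrossing] at hcc
  have side : ∀ P : ℤ, (P ≤ c.1 ∨ c.2 ≤ P) →
      (2 * (P : ℝ) / n ≤ 2 * c.1 / n ∨ 2 * (c.1 : ℝ) / n + 2 * (c.2 - c.1) / n ≤ 2 * P / n) := by
    rintro P (hP | hP)
    · left
      have : (P : ℝ) ≤ c.1 := by exact_mod_cast hP
      gcongr
    · right
      have : (c.2 : ℝ) ≤ P := by exact_mod_cast hP
      rw [← add_div]
      gcongr
      linarith
  obtain ⟨m, hm⟩ := proj_stdLift_eq h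
  have hsh := shift_cases hnz m
  generalize hK : m * (n : ℤ) = K at hsh
  have hK' : (K : ℝ) = m * n := by rw [← hK]; push_cast; ring
  rcases hm with ⟨hx, hy⟩ | ⟨hx, hy⟩
  · rw [stdX_planar hcx, stdX_crossing hdx] at hx
    rw [stdY_planar hcx, stdY_crossing hdx] at hy
    refine parabola_segment w0 w1 v0 v1 s0 s1 (side (d.1 - K) (by omega)) ?_ hy
    have : 2 * (((d.1 - K : ℤ)) : ℝ) / n = 2 * d.1 / n - 2 * m := by
      push_cast; rw [hK']; field_simp
    rw [this]; linarith
  · rw [stdX_planar hcx, stdX_crossing hdx] at hx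
    rw [stdY_planar hcx, stdY_crossing hdx] at hy
    refine parabola_segment (t := 1 - t) w0 w1 (w := -(2 * ((d.2 : ℝ) - d.1) / n + 1)) (by linarith)
      (by linarith) s0 s1 (side (d.2 - K) (by omega)) ?_ (by linarith)
    have : 2 * (((d.2 - K : ℤ)) : ℝ) / n = 2 * d.2 / n - 2 * m := by
      push_cast; rw [hK']; field_simp
    rw [this]
    have : 2 * ((d.2 : ℝ) - d.1) / n = 2 * d.2 / n - 2 * d.1 / n := by ring
    rw [this] at hx ⊢
    linarith

/-- Two parabolas of the same leading coefficient whose extremities are not interleaved do not meet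
above the lower side of the strip. -/
theorem planar_planar_disjoint {n : ℕ} (hn : 0 < n) {c d : ℤ × ℤ} (hc : IsCode n c)
    (hd : IsCode n d) (hcd : Compat n c d) (hne : c ≠ d) (hcx : c.1 < c.2) (hdx : d.1 < d.2)
    {s t : I} (s0 : (0 : ℝ) < s) (s1 : (s : ℝ) < 1) (t0 : (0 : ℝ) < t) (t1 : (t : ℝ) < 1)
    (h : proj (stdLift hn hc s) = proj (stdLift hn hd t)) : False := by
  have hn' : (0 : ℝ) < n := by exact_mod_cast hn
  have hnz : (0 : ℤ) < n := by exact_mod_cast hn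
  have hcc := hcd.1 hcx hdx
  obtain ⟨m, ⟨hx, hy⟩ | ⟨hx, hy⟩⟩ := proj_stdLift_eq h
  · obtain ⟨c1, c2, c3, c4⟩ := hc
    obtain ⟨d1, d2, d3, d4⟩ := hd
    simp only [PlanarPlanar] at hcc
    have hne' : ¬ (c.1 = d.1 ∧ c.2 = d.2) := fun h => hne (Prod.ext h.1 h.2)
    have hsh := shift_cases hnz m
    generalize hK : m * (n : ℤ) = K at hsh
    have hK' : (K : ℝ) = m * n := by rw [← hK]; push_cast; ring
    rw [stdX_planar hcx, stdX_planar hdx] at hx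
    rw [stdY_planar hcx, stdY_planar hdx] at hy
    have hcl : (0 : ℝ) < c.2 - c.1 := by
      have : (c.1 : ℝ) < c.2 := by exact_mod_cast hcx
      linarith
    have hdl : (0 : ℝ) < d.2 - d.1 := by
      have : (d.1 : ℝ) < d.2 := by exact_mod_cast hdx
      linarith
    set u : ℝ := c.1 + K + s * (c.2 - c.1) with hu
    have hu' : u = d.1 + t * (d.2 - d.1) := by
      rw [hu, hK']
      field_simp at hx
      linarith
    have a1 : 0 < u - (c.1 + K) := by rw [hu]; have := mul_pos s0 hcl; linarith
    have a2 : 0 < (c.2 + K) - u := by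
      rw [hu]
      have := mul_pos (sub_pos.2 s1) hcl
      linarith
    have b1 : 0 < u - d.1 := by rw [hu']; have := mul_pos t0 hdl; linarith
    have b2 : 0 < d.2 - u := by
      rw [hu']
      have := mul_pos (sub_pos.2 t1) hdl
      linarith
    have hq : (u - (c.1 + K)) * ((c.2 + K) - u) = (u - d.1) * (d.2 - u) := by
      have e1 : (u - (c.1 + K)) * ((c.2 + K) - u) = s * (1 - s) * (c.2 - c.1) ^ 2 := by
        rw [hu]; ring
      have e2 : (u - d.1) * (d.2 - u) = t * (1 - t) * (d.2 - d.1) ^ 2 := by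
        rw [hu']; ring
      rw [e1, e2]
      field_simp at hy
      linarith
    have i1 : c.1 + K < d.2 := by
      have : ((c.1 + K : ℤ) : ℝ) < d.2 := by push_cast; linarith
      exact_mod_cast this
    have i2 : d.1 < c.2 + K := by
      have : (d.1 : ℝ) < ((c.2 + K : ℤ) : ℝ) := by push_cast; linarith
      exact_mod_cast this
    rcases (by omega : (d.1 ≤ c.1 + K ∧ c.2 + K ≤ d.2 ∧ (d.1 < c.1 + K ∨ c.2 + K < d.2)) ∨
      (c.1 + K ≤ d.1 ∧ d.2 ≤ c.2 + K ∧ (c.1 + K < d.1 ∨ d.2 < c.2 + K))) with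
      ⟨h1, h2, h3⟩ | ⟨h1, h2, h3⟩
    · have h1 : (d.1 : ℝ) ≤ c.1 + K := by exact_mod_cast h1
      have h2 : (c.2 : ℝ) + K ≤ d.2 := by exact_mod_cast h2
      rcases h3 with h3 | h3
      · have h3 : (d.1 : ℝ) < c.1 + K := by exact_mod_cast h3
        nlinarith
      · have h3 : (c.2 : ℝ) + K < d.2 := by exact_mod_cast h3
        nlinarith
    · have h1 : (c.1 : ℝ) + K ≤ d.1 := by exact_mod_cast h1
      have h2 : (d.2 : ℝ) ≤ c.2 + K := by exact_mod_cast h2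
      rcases h3 with h3 | h3
      · have h3 : (c.1 : ℝ) + K < d.1 := by exact_mod_cast h3
        nlinarith
      · have h3 : (d.2 : ℝ) < c.2 + K := by exact_mod_cast h3
        nlinarith
  · have h1 := (stdY_planar_bounds hn hc hcx s0.le s1.le).2
    have h2 := (stdY_planar_bounds hn hd hdx t0.le t1.le).2
    linarith

/-- The representatives of two distinct codes that do not cross have disjoint interiors. -/
theorem disjoint_interior_stdArc {n : ℕ} (hn : 0 < n) {c d : ℤ × ℤ} (hc : IsCode n c)
    (hd : IsCode n d) (hcd : Compat n c d) (hne : c ≠ d) :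
    Disjoint (stdArc hn hc).interior (stdArc hn hd).interior := by
  rw [Set.disjoint_left]
  rintro _ ⟨s, ⟨s0, s1⟩, rfl⟩ ⟨t, ⟨t0, t1⟩, h⟩
  have h : proj (stdLift hn hd t) = proj (stdLift hn hc s) := h
  have s0 : (0 : ℝ) < s := by exact_mod_cast s0
  have s1 : (s : ℝ) < 1 := by exact_mod_cast s1
  have t0 : (0 : ℝ) < t := by exact_mod_cast t0
  have t1 : (t : ℝ) < 1 := by exact_mod_cast t1
  rcases lt_or_ge c.1 c.2 with hcx | hcx <;> rcases lt_or_ge d.1 d.2 with hdx | hdx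
  · exact planar_planar_disjoint hn hc hd hcd hne hcx hdx s0 s1 t0 t1 h.symm
  · exact planar_crossing_disjoint hn hc hd hcd hcx hdx s0 s1 h.symm
  · exact planar_crossing_disjoint hn hd hc hcd.symm hdx hcx t0 t1 h
  · exact crossing_crossing_disjoint hn hc hd hcd hne hcx hdx t0 t1 h.symm

/-! ### Triangulations as sets of codes -/

/-- The code of an arc up to isotopy. -/
noncomputable def ArcClass.code {n : ℕ} (hn : 0 < n) : ArcClass n → ℤ × ℤ :=
  Quotient.lift (fun a => (a.exists_hasCode hn).choose) fun a b h =>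
    ((a.exists_hasCode hn).choose_spec.of_homotopic h).unique hn (b.exists_hasCode hn).choose_spec

theorem hasCode_code {n : ℕ} (hn : 0 < n) (a : Arc n) :
    a.HasCode (ArcClass.code hn (Quotient.mk (Arc.setoid n) a)) :=
  (a.exists_hasCode hn).choose_spec

theorem code_eq {n : ℕ} (hn : 0 < n) {a : Arc n} {c : ℤ × ℤ} (h : a.HasCode c) :
    ArcClass.code hn (Quotient.mk (Arc.setoid n) a) = c :=
  (hasCode_code hn a).unique hn h

theorem isCode_code {n : ℕ} (hn : 0 < n) (α : ArcClass n) : IsCode n (α.code hn) := by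
  induction α using Quotient.inductionOn with
  | h a => exact (hasCode_code hn a).1

theorem code_injective {n : ℕ} (hn : 0 < n) : Function.Injective (ArcClass.code (n := n) hn) := by
  intro α β h
  induction α using Quotient.inductionOn with
  | h a =>
    induction β using Quotient.inductionOn with
    | h b =>
      have hb := hasCode_code hn b
      rw [← h] at hb
      exact Quotient.sound ((hasCode_code hn a).homotopic hb)

/-- The arc up to isotopy with a given code. -/
noncomputable def ofCode {n : ℕ} (hn : 0 < n) {c : ℤ × ℤ} (hc : IsCode n c) : ArcClass n :=
  Quotient.mk (Arc.setoid n) (stdArc hn hc)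

theorem code_ofCode {n : ℕ} (hn : 0 < n) {c : ℤ × ℤ} (hc : IsCode n c) :
    (ofCode hn hc).code hn = c := code_eq hn (hasCode_stdArc hn hc)

/-- The standard representatives realize simultaneously any set of arcs with compatible codes. -/
theorem isRealizable_iff {n : ℕ} (hn : 0 < n) (A : Set (ArcClass n)) :
    IsRealizable A ↔ ∀ α ∈ A, ∀ β ∈ A, α ≠ β → Compat n (α.code hn) (β.code hn) := by
  constructor
  · rintro ⟨S, hS, rfl⟩ _ ⟨a, ha, rfl⟩ _ ⟨b, hb, rfl⟩ hne
    have hab : a ≠ b := fun h => hne (by rw [h])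
    exact (hasCode_code hn a).compat hn (hS ha hb hab).1 (hasCode_code hn b)
  · intro h
    refine ⟨{a | ∃ α ∈ A, a = stdArc hn (isCode_code hn α)}, ?_, ?_⟩
    · rintro _ ⟨α, hα, rfl⟩ _ ⟨β, hβ, rfl⟩ hne
      have hαβ : α ≠ β := by rintro rfl; exact hne rfl
      have hc : α.code hn ≠ β.code hn := fun h => hαβ (code_injective hn h)
      refine ⟨disjoint_interior_stdArc hn _ _ (h α hα β hβ hαβ) hc, fun hh => hc ?_⟩
      exact ((hasCode_stdArc hn (isCode_code hn α)).of_homotopic hh).unique hn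
        (hasCode_stdArc hn (isCode_code hn β))
    · have key : ∀ α : ArcClass n, Quotient.mk (Arc.setoid n) (stdArc hn (isCode_code hn α)) = α :=
        fun α => code_injective hn (code_ofCode hn (isCode_code hn α))
      ext β
      constructor
      · rintro ⟨_, ⟨α, hα, rfl⟩, rfl⟩
        rw [key]; exact hα
      · intro hβ
        exact ⟨_, ⟨β, hβ, rfl⟩, key β⟩

theorem code_ends {n : ℕ} (hn : 0 < n) (α : ArcClass n) :
    α.ends = s(proj (bot n (α.code hn).1), proj (bot n (α.code hn).2)) := by
  induction α using Quotient.inductionOn with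
  | h a =>
    have ha := hasCode_code hn a
    set c := ArcClass.code hn (Quotient.mk (Arc.setoid n) a)
    have key : ∃ γ, a.IsLift γ ∧ proj (γ 0) = proj (bot n c.1) ∧ proj (γ 1) = proj (bot n c.2) := by
      rcases lt_or_ge c.1 c.2 with h | h
      · obtain ⟨γ, hγ, g0, g1⟩ := ha.2.1 h
        exact ⟨γ, hγ, by rw [g0], by rw [g1]⟩
      · obtain ⟨γ, hγ, g0, g1⟩ := ha.2.2 h
        exact ⟨γ, hγ, by rw [g0], by rw [g1, proj_top]⟩
    obtain ⟨γ, hγ, g0, g1⟩ := key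
    change s(a.curve 0, a.curve 1) = _
    rw [← g0, ← g1]
    rcases hγ with hγ | hγ
    · rw [hγ, hγ]
    · rw [hγ, hγ, Sym2.eq_swap]
      simp [Arc.rev]

theorem proj_bot_eq_iff_dvd {n : ℕ} (hn : 0 < n) {i j : ℤ} :
    proj (bot n i) = proj (bot n j) ↔ (n : ℤ) ∣ j - i := by
  rw [proj_bot_eq_iff hn]
  constructor
  · rintro ⟨k, rfl⟩; exact ⟨k, by ring⟩
  · rintro ⟨k, hk⟩; exact ⟨k, by linarith⟩

/-- A set of codes whose arcs do not cross. -/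
def IsSystem (n : ℤ) (U : Finset (ℤ × ℤ)) : Prop :=
  (∀ c ∈ U, IsCode n c) ∧ ∀ c ∈ U, ∀ d ∈ U, Compat n c d

/-- The set of the codes of the arcs of a triangulation. -/
def IsTri (n : ℤ) (U : Finset (ℤ × ℤ)) : Prop :=
  IsSystem n U ∧ ∀ c, IsCode n c → (∀ d ∈ U, Compat n c d) → c ∈ U

/-- Two codes stand for arcs with the same extremities. -/
def SameEnds (n : ℤ) (c d : ℤ × ℤ) : Prop :=
  n ∣ d.1 - c.1 ∧ n ∣ d.2 - c.2 ∨ n ∣ d.1 - c.2 ∧ n ∣ d.2 - c.1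

/-- No arc of the set is a loop and no two of them have the same extremities. -/
def IsSimp (n : ℤ) (U : Finset (ℤ × ℤ)) : Prop :=
  (∀ c ∈ U, ¬ n ∣ c.2 - c.1) ∧ ∀ c ∈ U, ∀ d ∈ U, SameEnds n c d → c = d

/-- An element of a set of codes is replaced by another one. -/
def Flip (U V : Finset (ℤ × ℤ)) : Prop := ∃ α ∈ U, ∃ β ∉ U, V = insert β (U.erase α)

/-- `V` is obtained from `U` by `k` flips, all the intermediate triangulations being simplicial. -/
inductive SimpChain (n : ℤ) : ℕ → Finset (ℤ × ℤ) → Finset (ℤ × ℤ) → Prop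
  | refl {U : Finset (ℤ × ℤ)} (h : IsTri n U) (h' : IsSimp n U) : SimpChain n 0 U U
  | step {k : ℕ} {U V W : Finset (ℤ × ℤ)} (h : SimpChain n k U V) (hW : IsTri n W)
      (hW' : IsSimp n W) (hf : Flip V W) : SimpChain n (k + 1) U W

theorem compat_self {n : ℤ} {c : ℤ × ℤ} (h : IsCode n c) : Compat n c c := by
  simp only [IsCode, Compat, PlanarPlanar, PlanarCrossing, CrossingCrossing] at h ⊢
  omega

theorem finite_isCode (n : ℕ) : {c : ℤ × ℤ | IsCode n c}.Finite := by
  refine ((Set.finite_Icc (0 : ℤ) n).prod (Set.finite_Icc (0 : ℤ) (2 * n))).subset ?_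
  rintro c ⟨h1, h2, h3, h4⟩
  exact ⟨⟨h1, h2.le⟩, ⟨h3, by linarith⟩⟩

/-- The set of the codes of the elements of a set of arcs. -/
noncomputable def codes {n : ℕ} (hn : 0 < n) (A : Set (ArcClass n)) : Finset (ℤ × ℤ) :=
  (show ((fun α : ArcClass n => α.code hn) '' A).Finite from (finite_isCode n).subset
    (by rintro _ ⟨α, -, rfl⟩; exact isCode_code hn α)).toFinset

theorem mem_codes {n : ℕ} {hn : 0 < n} {A : Set (ArcClass n)} {c : ℤ × ℤ} :
    c ∈ codes hn A ↔ ∃ α ∈ A, α.code hn = c := by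
  simp [codes]

theorem code_mem_codes {n : ℕ} {hn : 0 < n} {A : Set (ArcClass n)} {α : ArcClass n} :
    α.code hn ∈ codes hn A ↔ α ∈ A := by
  rw [mem_codes]
  exact ⟨fun ⟨β, hβ, h⟩ => code_injective hn h ▸ hβ, fun h => ⟨α, h, rfl⟩⟩

theorem codes_injective {n : ℕ} (hn : 0 < n) : Function.Injective (codes (n := n) hn) := by
  intro A B h
  ext α
  rw [← code_mem_codes (hn := hn), h, code_mem_codes]

theorem exists_codes_eq {n : ℕ} (hn : 0 < n) {U : Finset (ℤ × ℤ)} (hU : ∀ c ∈ U, IsCode n c) :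
    ∃ A : Set (ArcClass n), codes hn A = U := by
  refine ⟨{α | α.code hn ∈ U}, ?_⟩
  ext c
  rw [mem_codes]
  exact ⟨fun ⟨β, hβ, h⟩ => h ▸ hβ, fun h => ⟨ofCode hn (hU c h), by simpa [code_ofCode] using h,
    code_ofCode hn _⟩⟩

theorem isSystem_codes_iff {n : ℕ} (hn : 0 < n) (A : Set (ArcClass n)) :
    IsSystem n (codes hn A) ↔ IsRealizable A := by
  rw [isRealizable_iff hn]
  constructor
  · intro h α hα β hβ _
    exact h.2 _ (code_mem_codes.2 hα) _ (code_mem_codes.2 hβ)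
  · intro h
    refine ⟨fun c hc => ?_, fun c hc d hd => ?_⟩
    · obtain ⟨α, -, rfl⟩ := mem_codes.1 hc
      exact isCode_code hn α
    · obtain ⟨α, hα, rfl⟩ := mem_codes.1 hc
      obtain ⟨β, hβ, rfl⟩ := mem_codes.1 hd
      by_cases hαβ : α = β
      · subst hαβ; exact compat_self (isCode_code hn α)
      · exact h α hα β hβ hαβ

theorem isTri_codes_iff {n : ℕ} (hn : 0 < n) (A : Set (ArcClass n)) :
    IsTri n (codes hn A) ↔ IsTriangulation A := by
  constructor
  · rintro ⟨h1, h2⟩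
    refine ⟨(isSystem_codes_iff hn A).1 h1, fun B hB hAB α hα => ?_⟩
    rw [← code_mem_codes (hn := hn)]
    refine h2 _ (isCode_code hn α) fun d hd => ?_
    obtain ⟨β, hβ, rfl⟩ := mem_codes.1 hd
    exact ((isSystem_codes_iff hn B).2 hB).2 _ (code_mem_codes.2 hα) _ (code_mem_codes.2 (hAB hβ))
  · rintro ⟨h1, h2⟩
    have h3 := (isSystem_codes_iff hn A).2 h1
    refine ⟨h3, fun c hc hcd => ?_⟩
    have h4 : IsRealizable (insert (ofCode hn hc) A) := by
      rw [isRealizable_iff hn]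
      rintro α (rfl | hα) β (rfl | hβ) hne
      · exact absurd rfl hne
      · rw [code_ofCode]; exact hcd _ (code_mem_codes.2 hβ)
      · rw [code_ofCode]; exact (hcd _ (code_mem_codes.2 hα)).symm
      · exact h3.2 _ (code_mem_codes.2 hα) _ (code_mem_codes.2 hβ)
    have h5 := h2 h4 (Set.subset_insert _ _) (Set.mem_insert _ _)
    rw [← code_mem_codes (hn := hn), code_ofCode] at h5
    exact h5

theorem isSimp_codes_iff {n : ℕ} (hn : 0 < n) (T : Triangulation n) :
    IsSimp n (codes hn T.1) ↔ IsSimplicial T := by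
  have hdiag : ∀ α : ArcClass n, α.ends.IsDiag ↔ (n : ℤ) ∣ (α.code hn).2 - (α.code hn).1 := by
    intro α
    rw [code_ends hn, Sym2.mk_isDiag_iff, proj_bot_eq_iff_dvd hn]
  have hends : ∀ α β : ArcClass n, α.ends = β.ends ↔ SameEnds n (α.code hn) (β.code hn) := by
    intro α β
    rw [code_ends hn, code_ends hn, Sym2.eq_iff, proj_bot_eq_iff_dvd hn, proj_bot_eq_iff_dvd hn,
      proj_bot_eq_iff_dvd hn, proj_bot_eq_iff_dvd hn, SameEnds]
    tauto
  constructor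
  · rintro ⟨h1, h2⟩
    refine ⟨fun α hα => ?_, fun α hα β hβ hαβ => ?_⟩
    · rw [hdiag]; exact h1 _ (code_mem_codes.2 hα)
    · exact code_injective hn
        (h2 _ (code_mem_codes.2 hα) _ (code_mem_codes.2 hβ) ((hends _ _).1 hαβ))
  · rintro ⟨h1, h2⟩
    refine ⟨fun c hc => ?_, fun c hc d hd hcd => ?_⟩
    · obtain ⟨α, hα, rfl⟩ := mem_codes.1 hc
      rw [← hdiag]; exact h1 _ hα
    · obtain ⟨α, hα, rfl⟩ := mem_codes.1 hc
      obtain ⟨β, hβ, rfl⟩ := mem_codes.1 hd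
      rw [h2 hα hβ ((hends _ _).2 hcd)]

theorem adj_iff_flip {n : ℕ} (hn : 0 < n) (T U : Triangulation n) :
    (flipGraph n).Adj T U ↔ Flip (codes hn T.1) (codes hn U.1) := by
  constructor
  · rintro ⟨α, hα, β, hβ, h⟩
    refine ⟨_, code_mem_codes.2 hα, β.code hn, fun h => hβ (code_mem_codes.1 h), ?_⟩
    ext c
    rw [mem_codes, h]
    simp only [Set.mem_insert_iff, Set.mem_sdiff, Set.mem_singleton_iff, Finset.mem_insert,
      Finset.mem_erase, mem_codes]
    constructor
    · rintro ⟨γ, rfl | ⟨h1, h2⟩, rfl⟩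
      · exact Or.inl rfl
      · exact Or.inr ⟨fun h => h2 (code_injective hn h), γ, h1, rfl⟩
    · rintro (rfl | ⟨h1, γ, h2, rfl⟩)
      · exact ⟨β, Or.inl rfl, rfl⟩
      · exact ⟨γ, Or.inr ⟨h2, fun h => h1 (by rw [h])⟩, rfl⟩
  · rintro ⟨c, hc, d, hd, h⟩
    obtain ⟨α, hα, rfl⟩ := mem_codes.1 hc
    have hd' : d ∈ codes hn U.1 := by rw [h]; exact Finset.mem_insert_self _ _
    obtain ⟨β, hβ, rfl⟩ := mem_codes.1 hd'
    refine ⟨α, hα, β, fun h => hd (code_mem_codes.2 h), ?_⟩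
    ext γ
    rw [← code_mem_codes (hn := hn), h]
    simp only [Set.mem_insert_iff, Set.mem_sdiff, Set.mem_singleton_iff, Finset.mem_insert,
      Finset.mem_erase, code_mem_codes, (code_injective hn).eq_iff, ne_eq]
    tauto

/-- The vertex of the simplicial flip-graph with a given set of codes. -/
theorem exists_vertex {n : ℕ} (hn : 0 < n) {U : Finset (ℤ × ℤ)} (hU : IsTri n U)
    (hU' : IsSimp n U) : ∃ T : {T : Triangulation n | IsSimplicial T}, codes hn T.1.1 = U := by
  obtain ⟨A, rfl⟩ := exists_codes_eq hn hU.1.1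
  exact ⟨⟨⟨A, (isTri_codes_iff hn A).1 hU⟩, (isSimp_codes_iff hn ⟨A, _⟩).1 hU'⟩, rfl⟩

theorem exists_walk_of_simpChain {n : ℕ} (hn : 0 < n) {k : ℕ} {U V : Finset (ℤ × ℤ)}
    (h : SimpChain n k U V) (S T : {T : Triangulation n | IsSimplicial T})
    (hS : codes hn S.1.1 = U) (hT : codes hn T.1.1 = V) :
    ∃ w : (simplicialFlipGraph n).Walk S T, w.length = k := by
  induction h generalizing T with
  | refl h h' =>
    have : S = T := Subtype.ext (Subtype.ext (codes_injective hn (hS.trans hT.symm)))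
    subst this
    exact ⟨.nil, rfl⟩
  | @step k U V W h hW hW' hf ih =>
    have hV : IsTri n V ∧ IsSimp n V := by cases h <;> exact ⟨‹_›, ‹_›⟩
    obtain ⟨R, hR⟩ := exists_vertex hn hV.1 hV.2
    obtain ⟨w, hw⟩ := ih R hS hR
    have hadj : (simplicialFlipGraph n).Adj R T := by
      change (flipGraph n).Adj R.1 T.1
      rw [adj_iff_flip hn, hR, hT]
      exact hf
    exact ⟨w.concat hadj, by simp [hw]⟩

theorem simpChain_of_walk {n : ℕ} (hn : 0 < n) {S T : {T : Triangulation n | IsSimplicial T}}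
    (w : (simplicialFlipGraph n).Walk S T) :
    SimpChain n w.length (codes hn S.1.1) (codes hn T.1.1) := by
  have hgood : ∀ R : {T : Triangulation n | IsSimplicial T},
      IsTri n (codes hn R.1.1) ∧ IsSimp n (codes hn R.1.1) := fun R =>
    ⟨(isTri_codes_iff hn _).2 R.1.2, (isSimp_codes_iff hn R.1).2 R.2⟩
  induction w using SimpleGraph.Walk.concatRec with
  | Hnil => exact .refl (hgood _).1 (hgood _).2
  | Hconcat p h ih =>
    rw [SimpleGraph.Walk.length_concat]
    exact .step ih (hgood _).1 (hgood _).2 ((adj_iff_flip hn _ _).1 h)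

/-- Bounds on the diameter of the simplicial flip-graph, in terms of sets of codes. -/
theorem diam_simplicialFlipGraph {n : ℕ} (hn : 0 < n) {b : ℕ} {l : ℤ}
    (hup : ∀ U V, IsTri n U → IsSimp n U → IsTri n V → IsSimp n V → ∃ k ≤ b, SimpChain n k U V)
    (hlow : ∃ U V, IsTri n U ∧ IsSimp n U ∧ IsTri n V ∧ IsSimp n V ∧
      ∀ k, SimpChain n k U V → l ≤ k) :
    (simplicialFlipGraph n).ediam ≠ ⊤ ∧ l ≤ ((simplicialFlipGraph n).diam : ℤ) ∧
      (simplicialFlipGraph n).diam ≤ b := by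
  have hgood : ∀ R : {T : Triangulation n | IsSimplicial T},
      IsTri n (codes hn R.1.1) ∧ IsSimp n (codes hn R.1.1) := fun R =>
    ⟨(isTri_codes_iff hn _).2 R.1.2, (isSimp_codes_iff hn R.1).2 R.2⟩
  have hle : (simplicialFlipGraph n).ediam ≤ b := by
    refine SimpleGraph.ediam_le_of_edist_le fun S T => ?_
    obtain ⟨k, hk, hc⟩ := hup _ _ (hgood S).1 (hgood S).2 (hgood T).1 (hgood T).2
    obtain ⟨w, hw⟩ := exists_walk_of_simpChain hn hc S T rfl rfl
    refine (SimpleGraph.Walk.edist_le w).trans ?_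
    rw [hw]
    exact_mod_cast hk
  have htop : (simplicialFlipGraph n).ediam ≠ ⊤ :=
    ne_top_of_le_ne_top (ENat.natCast_ne_top b) hle
  refine ⟨htop, ?_, ?_⟩
  · obtain ⟨U, V, hU, hU', hV, hV', h⟩ := hlow
    obtain ⟨S, hS⟩ := exists_vertex hn hU hU'
    obtain ⟨T, hT⟩ := exists_vertex hn hV hV'
    obtain ⟨k, -, hc⟩ := hup _ _ hU hU' hV hV'
    obtain ⟨w, -⟩ := exists_walk_of_simpChain hn hc S T hS hT
    obtain ⟨w', hw'⟩ := w.reachable.exists_walk_length_eq_dist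
    have h1 := simpChain_of_walk hn w'
    rw [hS, hT] at h1
    have h2 := h _ h1
    have h3 : (simplicialFlipGraph n).dist S T ≤ (simplicialFlipGraph n).diam :=
      SimpleGraph.dist_le_diam htop
    rw [hw'] at h2
    have : ((simplicialFlipGraph n).dist S T : ℤ) ≤ (simplicialFlipGraph n).diam := by
      exact_mod_cast h3
    linarith
  · have := ENat.toNat_le_toNat hle (ENat.natCast_ne_top b)
    simpa [SimpleGraph.diam] using this

/-! ### Contraction of boundary arcs -/

/-- The restriction to `[0, 2n)` of a monotone map `ℤ → ℤ` that commutes with the translations by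
`n` and `n'`. It describes the contraction of `M_n` onto `M_{n'}` along boundary arcs, the boundary
arc from `n - 1` to `n` not being contracted. -/
structure IsContraction (n n' : ℤ) (f : ℤ → ℤ) : Prop where
  mono : ∀ x y, 0 ≤ x → x ≤ y → y < 2 * n → f x ≤ f y
  add : ∀ x, 0 ≤ x → x < n → f (x + n) = f x + n'
  zero : f 0 = 0
  last : f (n - 1) < n'

/-- The planar arcs of a contracted surface do not degenerate to points. -/
def NonDeg (f : ℤ → ℤ) (c : ℤ × ℤ) : Prop := c.1 < c.2 → f c.1 < f c.2

instance (f : ℤ → ℤ) : DecidablePred (NonDeg f) := fun c => by unfold NonDeg; infer_instance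

/-- The image of a set of codes by a contraction. -/
def contract (f : ℤ → ℤ) (U : Finset (ℤ × ℤ)) : Finset (ℤ × ℤ) :=
  (U.filter (NonDeg f)).image (Prod.map f f)

theorem mem_contract {f : ℤ → ℤ} {U : Finset (ℤ × ℤ)} {d : ℤ × ℤ} :
    d ∈ contract f U ↔ ∃ c ∈ U, NonDeg f c ∧ Prod.map f f c = d := by
  simp [contract, and_assoc]

namespace IsContraction

variable {n n' n'' : ℤ} {f g : ℤ → ℤ}

/-- A monotone map reflects strict inequalities. -/
theorem lt (h : IsContraction n n' f) {x y : ℤ} (hx : x < 2 * n) (hy : 0 ≤ y)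
    (hxy : f x < f y) : x < y := by
  by_contra! hc
  exact absurd (h.mono y x hy hc hx) (by omega)

theorem pos (h : IsContraction n n' f) (hn : 0 < n) : 0 < n' := by
  have h1 := h.mono 0 (n - 1) le_rfl (by omega) (by omega)
  have h2 := h.zero
  have h3 := h.last
  omega

theorem nonneg (h : IsContraction n n' f) {x : ℤ} (h0 : 0 ≤ x) (hx : x < 2 * n) : 0 ≤ f x := by
  have := h.mono 0 x le_rfl h0 hx
  rw [h.zero] at this
  exact this

theorem lt_of_lt (h : IsContraction n n' f) {x : ℤ} (h0 : 0 ≤ x) (hx : x < n) : f x < n' :=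
  (h.mono x (n - 1) h0 (by omega) (by omega)).trans_lt h.last

theorem lt_two_mul (h : IsContraction n n' f) {x : ℤ} (h0 : 0 ≤ x) (hx : x < 2 * n) :
    f x < 2 * n' := by
  rcases lt_or_ge x n with hc | hc
  · have h1 := h.lt_of_lt h0 hc
    have h2 := h.pos (by omega)
    omega
  · have h1 := h.add (x - n) (by omega) (by omega)
    have h2 := h.lt_of_lt (x := x - n) (by omega) (by omega)
    rw [sub_add_cancel] at h1
    omega

theorem le_of_le (h : IsContraction n n' f) {x : ℤ} (h0 : n ≤ x) (hx : x < 2 * n) : n' ≤ f x := by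
  have h1 := h.add (x - n) (by omega) (by omega)
  have h2 := h.nonneg (x := x - n) (by omega) (by omega)
  rw [sub_add_cancel] at h1
  omega

theorem add_lt (h : IsContraction n n' f) {x y : ℤ} (hx : 0 ≤ x) (hx' : x < 2 * n) (hy : 0 ≤ y)
    (hy' : y < 2 * n) (hxy : f x + n' < f y) : x + n < y := by
  rcases lt_or_ge x n with hc | hc
  · rw [← h.add x hx hc] at hxy
    exact h.lt (by omega) hy hxy
  · have h1 := h.le_of_le hc hx'
    have h2 := h.lt_two_mul hy hy'
    omega

theorem lt_add (h : IsContraction n n' f) {x y : ℤ} (hx : 0 ≤ x) (hy' : y < 2 * n)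
    (hxy : f y < f x + n') : y < x + n := by
  rcases lt_or_ge x n with hc | hc
  · rw [← h.add x hx hc] at hxy
    exact h.lt hy' (by omega) hxy
  · omega

theorem comp (hn : 0 < n) (h : IsContraction n n' f) (h' : IsContraction n' n'' g) :
    IsContraction n n'' (g ∘ f) where
  mono x y hx hxy hy := h'.mono _ _ (h.nonneg hx (by omega)) (h.mono x y hx hxy hy)
    (h.lt_two_mul (by omega) hy)
  add x hx hxn := by
    simp only [Function.comp]
    rw [h.add x hx hxn, h'.add _ (h.nonneg hx (by omega)) (h.lt_of_lt hx hxn)]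
  zero := by simp [h.zero, h'.zero]
  last := h'.lt_of_lt (h.nonneg (by omega) (by omega)) h.last

theorem isCode (h : IsContraction n n' f) {c : ℤ × ℤ} (hc : IsCode n c) :
    IsCode n' (Prod.map f f c) := by
  obtain ⟨h1, h2, h3, h4⟩ := hc
  refine ⟨h.nonneg h1 (by omega), h.lt_of_lt h1 h2, h.nonneg h3 (by omega), ?_⟩
  simp only [Prod.map_snd, Prod.map_fst]
  rw [← h.add _ h1 h2]
  exact h.mono _ _ h3 h4 (by omega)

theorem planarPlanar (h : IsContraction n n' f) {i j i' j' : ℤ} (hi : 0 ≤ i ∧ i < 2 * n)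
    (hj : 0 ≤ j ∧ j < 2 * n) (hi' : 0 ≤ i' ∧ i' < 2 * n) (hj' : 0 ≤ j' ∧ j' < 2 * n)
    (H : PlanarPlanar n i j i' j') : PlanarPlanar n' (f i) (f j) (f i') (f j') := by
  obtain ⟨H1, H2, H3, H4⟩ := H
  refine ⟨fun hc => H1 ?_, fun hc => H2 ?_, fun hc => H3 ?_, fun hc => H4 ?_⟩
  · exact ⟨h.lt hi.2 hi'.1 hc.1, h.lt hi'.2 hj.1 hc.2.1, h.lt hj.2 hj'.1 hc.2.2⟩
  · exact ⟨h.lt hi'.2 hi.1 hc.1, h.lt hi.2 hj'.1 hc.2.1, h.lt hj'.2 hj.1 hc.2.2⟩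
  · exact ⟨h.add_lt hi'.1 hi'.2 hj.1 hj.2 hc.1, h.lt_add hj'.1 hj.2 hc.2⟩
  · exact ⟨h.add_lt hi.1 hi.2 hj'.1 hj'.2 hc.1, h.lt_add hj.1 hj'.2 hc.2⟩

theorem planarCrossing (h : IsContraction n n' f) {i j p q : ℤ} (hi : 0 ≤ i ∧ i < 2 * n)
    (hj : 0 ≤ j ∧ j < 2 * n) (hp : 0 ≤ p ∧ p < 2 * n) (hq : 0 ≤ q ∧ q < 2 * n)
    (H : PlanarCrossing n i j p q) : PlanarCrossing n' (f i) (f j) (f p) (f q) := by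
  obtain ⟨H1, H2, H3, H4⟩ := H
  refine ⟨fun hc => H1 ?_, fun hc => H2 ?_, fun hc => H3 ?_, fun hc => H4 ?_⟩
  · exact ⟨h.lt hi.2 hp.1 hc.1, h.lt hp.2 hj.1 hc.2⟩
  · exact ⟨h.lt hi.2 hq.1 hc.1, h.lt hq.2 hj.1 hc.2⟩
  · exact h.add_lt hp.1 hp.2 hj.1 hj.2 hc
  · exact h.add_lt hq.1 hq.2 hj.1 hj.2 hc

theorem crossingCrossing (h : IsContraction n n' f) {p q p' q' : ℤ} (hp : 0 ≤ p ∧ p < 2 * n)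
    (hq : 0 ≤ q ∧ q < 2 * n) (hp' : 0 ≤ p' ∧ p' < 2 * n) (hq' : 0 ≤ q' ∧ q' < 2 * n)
    (H : CrossingCrossing p q p' q') : CrossingCrossing (f p) (f q) (f p') (f q') := by
  obtain ⟨H1, H2, H3⟩ := H
  refine ⟨h.mono _ _ hq.1 H1 hp'.2, h.mono _ _ hq'.1 H2 hp.2, ?_⟩
  rcases H3 with ⟨H3, H4⟩ | ⟨H3, H4⟩
  · exact Or.inl ⟨h.mono _ _ hp.1 H3 hp'.2, h.mono _ _ hq.1 H4 hq'.2⟩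
  · exact Or.inr ⟨h.mono _ _ hp'.1 H3 hp.2, h.mono _ _ hq'.1 H4 hq.2⟩

theorem compat (h : IsContraction n n' f) {c d : ℤ × ℤ} (hc : IsCode n c) (hd : IsCode n d)
    (hc' : NonDeg f c) (hd' : NonDeg f d) (H : Compat n c d) :
    Compat n' (Prod.map f f c) (Prod.map f f d) := by
  have key : ∀ e : ℤ × ℤ, IsCode n e → (f e.1 < f e.2 → e.1 < e.2) := fun e he =>
    h.lt (by have := he.2.1; have := he.1; omega) he.2.2.1
  have key' : ∀ e : ℤ × ℤ, NonDeg f e → (f e.2 ≤ f e.1 → e.2 ≤ e.1) := fun e he h1 => by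
    by_contra! h2
    have := he h2
    omega
  have r1 : ∀ e : ℤ × ℤ, IsCode n e → 0 ≤ e.1 ∧ e.1 < 2 * n := fun e he => by
    have := he.1; have := he.2.1; omega
  have r2 : ∀ e : ℤ × ℤ, IsCode n e → 0 ≤ e.2 ∧ e.2 < 2 * n := fun e he => by
    have := he.2.1; have := he.2.2.1; have := he.2.2.2; omega
  obtain ⟨H1, H2, H3, H4⟩ := H
  refine ⟨fun e1 e2 => ?_, fun e1 e2 => ?_, fun e1 e2 => ?_, fun e1 e2 => ?_⟩
  · exact h.planarPlanar (r1 c hc) (r2 c hc) (r1 d hd) (r2 d hd) (H1 (key _ hc e1) (key _ hd e2))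
  · exact h.planarCrossing (r1 c hc) (r2 c hc) (r1 d hd) (r2 d hd)
      (H2 (key _ hc e1) (key' _ hd' e2))
  · exact h.planarCrossing (r1 d hd) (r2 d hd) (r1 c hc) (r2 c hc)
      (H3 (key' _ hc' e1) (key _ hd e2))
  · exact h.crossingCrossing (r1 c hc) (r2 c hc) (r1 d hd) (r2 d hd)
      (H4 (key' _ hc' e1) (key' _ hd' e2))

theorem isSystem (h : IsContraction n n' f) {U : Finset (ℤ × ℤ)} (hU : IsSystem n U) :
    IsSystem n' (contract f U) := by
  refine ⟨fun c hc => ?_, fun c hc d hd => ?_⟩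
  · obtain ⟨c, hcU, -, rfl⟩ := mem_contract.1 hc
    exact h.isCode (hU.1 c hcU)
  · obtain ⟨c, hcU, hc', rfl⟩ := mem_contract.1 hc
    obtain ⟨d, hdU, hd', rfl⟩ := mem_contract.1 hd
    exact h.compat (hU.1 c hcU) (hU.1 d hdU) hc' hd' (hU.2 c hcU d hdU)

theorem contract_comp (h : IsContraction n n' f) (h' : IsContraction n' n'' g)
    {U : Finset (ℤ × ℤ)} (hU : IsSystem n U) : contract (g ∘ f) U = contract g (contract f U) := by
  have key : ∀ c ∈ U, NonDeg (g ∘ f) c ↔ NonDeg f c ∧ NonDeg g (Prod.map f f c) := by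
    intro c hc
    obtain ⟨h1, h2, h3, h4⟩ := hU.1 c hc
    have h5 : ∀ x y, 0 ≤ x → x < 2 * n → 0 ≤ y → y < 2 * n → g (f x) < g (f y) → f x < f y :=
      fun x y hx hx' hy hy' H => h'.lt (h.lt_two_mul hx hx') (h.nonneg hy hy') H
    have h6 := h5 c.1 c.2 h1 (by omega) h3 (by omega)
    have h7 : f c.1 < f c.2 → c.1 < c.2 := h.lt (by omega) h3
    simp only [NonDeg, Function.comp, Prod.map_fst, Prod.map_snd]
    tauto
  ext d
  simp only [mem_contract]
  constructor
  · rintro ⟨c, hc, hc', rfl⟩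
    rw [key c hc] at hc'
    exact ⟨_, ⟨c, hc, hc'.1, rfl⟩, hc'.2, rfl⟩
  · rintro ⟨_, ⟨c, hc, hc', rfl⟩, hd', rfl⟩
    exact ⟨c, hc, (key c hc).2 ⟨hc', hd'⟩, rfl⟩

end IsContraction

/-- The contraction of the boundary arcs between `a` and `a + l`. -/
def squeeze (n a l x : ℤ) : ℤ :=
  if x ≤ a then x else if x ≤ a + l then a else if x ≤ a + n then x - l
  else if x ≤ a + l + n then a + n - l else x - 2 * l

theorem isContraction_squeeze {n a l : ℤ} (ha : 0 ≤ a) (hl : 0 ≤ l) (h : a + l < n) :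
    IsContraction n (n - l) (squeeze n a l) where
  mono x y hx hxy hy := by simp only [squeeze]; split_ifs <;> omega
  add x hx hx' := by simp only [squeeze]; split_ifs <;> omega
  zero := by rw [squeeze, if_pos ha]
  last := by simp only [squeeze]; split_ifs <;> omega

/-- Two arcs identified by the contraction of the boundary arc from `a` to `a + 1` form a triangle
with this boundary arc. -/
def IsTriangleOn (n a : ℤ) (c d : ℤ × ℤ) : Prop :=
  (c.1 = d.1 ∧ c.1 < a ∧ c.2 = a ∧ d.2 = a + 1) ∨
  (c.1 = d.1 ∧ a < c.1 ∧ c.2 = a + n ∧ d.2 = a + 1 + n) ∨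
  (c.2 = d.2 ∧ a + 1 < c.2 ∧ c.1 = a ∧ d.1 = a + 1) ∨
  (c.1 = d.1 ∧ a < c.1 ∧ c.2 = a ∧ d.2 = a + 1) ∨
  (c.2 = d.2 ∧ c.2 ≤ a ∧ c.1 = a ∧ d.1 = a + 1)

/-- Distinct arcs are identified by the contraction of a boundary arc only if they form a triangle
with it. -/
theorem isTriangleOn_of_eq {n a : ℤ} (ha : 0 ≤ a) (han : a + 1 < n) {c d : ℤ × ℤ}
    (hc : IsCode n c) (hd : IsCode n d) (hcd : Compat n c d) (hne : c ≠ d)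
    (hc' : NonDeg (squeeze n a 1) c) (hd' : NonDeg (squeeze n a 1) d)
    (h : Prod.map (squeeze n a 1) (squeeze n a 1) c = Prod.map (squeeze n a 1) (squeeze n a 1) d) :
    IsTriangleOn n a c d ∨ IsTriangleOn n a d c := by
  obtain ⟨i, j⟩ := c
  obtain ⟨i', j'⟩ := d
  obtain ⟨h1, h2, h3, h4⟩ := hc
  obtain ⟨h1', h2', h3', h4'⟩ := hd
  simp only [Prod.map_apply, Prod.mk.injEq, NonDeg, ne_eq] at *
  have key : ∀ x, 0 ≤ x → x < 2 * n → (x ≤ a ∧ squeeze n a 1 x = x) ∨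
      (a < x ∧ x ≤ a + n ∧ squeeze n a 1 x = x - 1) ∨ (a + n < x ∧ squeeze n a 1 x = x - 2) := by
    intro x hx hx'
    simp only [squeeze]
    split_ifs <;> omega
  have k1 := key i (by omega) (by omega)
  have k2 := key j (by omega) (by omega)
  have k3 := key i' (by omega) (by omega)
  have k4 := key j' (by omega) (by omega)
  generalize squeeze n a 1 i = u at *
  generalize squeeze n a 1 i' = u' at *
  generalize squeeze n a 1 j = v at *
  generalize squeeze n a 1 j' = v' at *
  have e1 : i' = i ∨ (i = a ∧ i' = a + 1) ∨ (i' = a ∧ i = a + 1) := by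
    clear k2 k4 hc' hd' hne
    omega
  have e2 : j' = j ∨ (j = a ∧ j' = a + 1) ∨ (j' = a ∧ j = a + 1) ∨
      (j = a + n ∧ j' = a + 1 + n) ∨ (j' = a + n ∧ j = a + 1 + n) := by
    clear k1 k3 hc' hd' hne
    omega
  have e3 : (i < j ∧ i' < j') ∨ (j ≤ i ∧ j' ≤ i') := by omega
  have e4 : i < j → ¬ (i = a ∧ j = a + 1) := by omega
  have e5 : i' < j' → ¬ (i' = a ∧ j' = a + 1) := by omega
  clear k1 k2 k3 k4 h key hc' hd'
  simp only [IsTriangleOn]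
  rcases e3 with ⟨e3, e3'⟩ | ⟨e3, e3'⟩
  · have H := hcd.1 e3 e3'
    clear hcd
    simp only [PlanarPlanar] at H
    rcases e1 with e1 | ⟨e1, e1'⟩ | ⟨e1, e1'⟩ <;>
    rcases e2 with e2 | ⟨e2, e2'⟩ | ⟨e2, e2'⟩ | ⟨e2, e2'⟩ | ⟨e2, e2'⟩ <;>
    first
    | exfalso; omega
    | exact Or.inl (Or.inl ⟨by omega, by omega, by omega, by omega⟩)
    | exact Or.inr (Or.inl ⟨by omega, by omega, by omega, by omega⟩)
    | exact Or.inl (Or.inr (Or.inl ⟨by omega, by omega, by omega, by omega⟩))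
    | exact Or.inr (Or.inr (Or.inl ⟨by omega, by omega, by omega, by omega⟩))
    | exact Or.inl (Or.inr (Or.inr (Or.inl ⟨by omega, by omega, by omega, by omega⟩)))
    | exact Or.inr (Or.inr (Or.inr (Or.inl ⟨by omega, by omega, by omega, by omega⟩)))
  · have H := hcd.2.2.2 e3 e3'
    clear hcd
    simp only [CrossingCrossing] at H
    rcases e1 with e1 | ⟨e1, e1'⟩ | ⟨e1, e1'⟩ <;>
    rcases e2 with e2 | ⟨e2, e2'⟩ | ⟨e2, e2'⟩ | ⟨e2, e2'⟩ | ⟨e2, e2'⟩ <;>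
    first
    | exfalso; omega
    | exact Or.inl (Or.inr (Or.inr (Or.inr (Or.inl ⟨by omega, by omega, by omega, by omega⟩))))
    | exact Or.inr (Or.inr (Or.inr (Or.inr (Or.inl ⟨by omega, by omega, by omega, by omega⟩))))
    | exact Or.inl (Or.inr (Or.inr (Or.inr (Or.inr ⟨by omega, by omega, by omega, by omega⟩))))
    | exact Or.inr (Or.inr (Or.inr (Or.inr (Or.inr ⟨by omega, by omega, by omega, by omega⟩))))

theorem IsTriangleOn.type {n a : ℤ} (ha : 0 ≤ a) {c d : ℤ × ℤ}
    (hc : IsCode n c) (h : IsTriangleOn n a c d) : (c.1 < c.2 ∧ d.1 < d.2) ∨ (c.2 ≤ c.1 ∧ d.2 ≤ d.1) := by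
  obtain ⟨h1, h2, h3, h4⟩ := hc
  simp only [IsTriangleOn] at h
  omega

theorem IsTriangleOn.unique {n a : ℤ} (ha : 0 ≤ a) (han : a + 1 < n) {c d c' d' : ℤ × ℤ}
    (hc : IsCode n c) (hd : IsCode n d) (hc' : IsCode n c') (hd' : IsCode n d')
    (h1 : Compat n c d') (h2 : Compat n d c') (h : IsTriangleOn n a c d)
    (h' : IsTriangleOn n a c' d') : c = c' ∧ d = d' := by
  obtain ⟨i, j⟩ := c
  obtain ⟨k, l⟩ := d
  obtain ⟨i', j'⟩ := c'
  obtain ⟨k', l'⟩ := d'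
  obtain ⟨a1, a2, a3, a4⟩ := hc
  obtain ⟨b1, b2, b3, b4⟩ := hd
  obtain ⟨a1', a2', a3', a4'⟩ := hc'
  obtain ⟨b1', b2', b3', b4'⟩ := hd'
  have t := h.type ha ⟨a1, a2, a3, a4⟩
  have t' := h'.type ha ⟨a1', a2', a3', a4'⟩
  simp only [IsTriangleOn, Prod.mk.injEq] at *
  rcases t with ⟨t1, t2⟩ | ⟨t1, t2⟩ <;> rcases t' with ⟨t1', t2'⟩ | ⟨t1', t2'⟩
  · have H1 := h1.1 t1 t2'
    have H2 := h2.1 t2 t1'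
    clear h1 h2
    simp only [PlanarPlanar] at H1 H2
    rcases h with h | h | h | h | h <;> rcases h' with h' | h' | h' | h' | h' <;> omega
  · have H1 := h1.2.1 t1 t2'
    have H2 := h2.2.1 t2 t1'
    clear h1 h2
    simp only [PlanarCrossing] at H1 H2
    rcases h with h | h | h | h | h <;> rcases h' with h' | h' | h' | h' | h' <;> omega
  · have H1 := h1.2.2.1 t1 t2'
    have H2 := h2.2.2.1 t2 t1'
    clear h1 h2
    simp only [PlanarCrossing] at H1 H2
    rcases h with h | h | h | h | h <;> rcases h' with h' | h' | h' | h' | h' <;> omega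
  · have H1 := h1.2.2.2 t1 t2'
    have H2 := h2.2.2.2 t2 t1'
    clear h1 h2
    simp only [CrossingCrossing] at H1 H2
    rcases h with h | h | h | h | h <;> rcases h' with h' | h' | h' | h' | h' <;> omega

/-! ### The number of arcs of a triangulation -/

theorem card_le_card_image_add_one {ι κ : Type*} [DecidableEq ι] [DecidableEq κ] (s : Finset ι)
    (g : ι → κ) (h : ∀ a ∈ s, ∀ b ∈ s, ∀ c ∈ s, ∀ d ∈ s, a ≠ b → c ≠ d → g a = g b → g c = g d →
      (c = a ∧ d = b) ∨ (c = b ∧ d = a)) : s.card ≤ (s.image g).card + 1 := by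
  by_cases hg : Set.InjOn g s
  · rw [Finset.card_image_of_injOn hg]; omega
  · simp only [Set.InjOn, not_forall] at hg
    obtain ⟨a, ha, b, hb, hab, hne⟩ := hg
    have hinj : Set.InjOn g (s.erase b : Finset ι) := by
      intro c hc d hd hcd
      by_contra hne'
      have hc' := Finset.mem_erase.1 hc
      have hd' := Finset.mem_erase.1 hd
      rcases h a ha b hb c hc'.2 d hd'.2 hne hne' hab hcd with h1 | h1
      · exact hd'.1 h1.2
      · exact hc'.1 h1.1
    have h1 := Finset.card_le_card (Finset.image_subset_image (f := g) (Finset.erase_subset b s))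
    rw [Finset.card_image_of_injOn hinj, Finset.card_erase_of_mem hb] at h1
    omega

/-- The contraction of a boundary arc removes at most two arcs: the boundary arc itself, and one of
the other two sides of the triangle incident to it. -/
theorem card_le_card_contract {n a : ℤ} (ha : 0 ≤ a) (han : a + 1 < n) {U : Finset (ℤ × ℤ)}
    (hU : IsSystem n U) : U.card ≤ (contract (squeeze n a 1) U).card + 2 := by
  have h1 : (U.filter (NonDeg (squeeze n a 1))).card ≤ (contract (squeeze n a 1) U).card + 1 := by
    refine card_le_card_image_add_one _ _ fun c hc d hd c' hc' d' hd' hne hne' e e' => ?_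
    simp only [Finset.mem_filter] at hc hd hc' hd'
    have k := isTriangleOn_of_eq ha han (hU.1 c hc.1) (hU.1 d hd.1) (hU.2 c hc.1 d hd.1) hne hc.2
      hd.2 e
    have k' := isTriangleOn_of_eq ha han (hU.1 c' hc'.1) (hU.1 d' hd'.1) (hU.2 c' hc'.1 d' hd'.1)
      hne' hc'.2 hd'.2 e'
    have key : ∀ x ∈ U, ∀ y ∈ U, ∀ x' ∈ U, ∀ y' ∈ U, IsTriangleOn n a x y →
        IsTriangleOn n a x' y' → x' = x ∧ y' = y := fun x hx y hy x' hx' y' hy' t t' => by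
      have := t.unique ha han (hU.1 x hx) (hU.1 y hy) (hU.1 x' hx') (hU.1 y' hy')
        (hU.2 x hx y' hy') (hU.2 y hy x' hx') t'
      exact ⟨this.1.symm, this.2.symm⟩
    rcases k with k | k <;> rcases k' with k' | k'
    · exact Or.inl (key c hc.1 d hd.1 c' hc'.1 d' hd'.1 k k')
    · exact Or.inr (key c hc.1 d hd.1 d' hd'.1 c' hc'.1 k k').symm
    · exact Or.inr (key d hd.1 c hc.1 c' hc'.1 d' hd'.1 k k')
    · exact Or.inl (key d hd.1 c hc.1 d' hd'.1 c' hc'.1 k k').symm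
  have h2 : (U.filter fun c => ¬ NonDeg (squeeze n a 1) c).card ≤ 1 := by
    refine (Finset.card_le_card (t := {(a, a + 1)}) ?_).trans_eq (Finset.card_singleton _)
    intro c hc
    rw [Finset.mem_filter] at hc
    obtain ⟨hc, hc'⟩ := hc
    simp only [NonDeg, squeeze] at hc'
    obtain ⟨h1, h2, h3, h4⟩ := hU.1 c hc
    rw [Finset.mem_singleton]
    refine Prod.ext ?_ ?_ <;> simp only <;> split_ifs at hc' <;> omega
  have h3 := Finset.card_filter_add_card_filter_not (s := U) (NonDeg (squeeze n a 1))
  omega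

/-- Contracting a boundary arc removes it and identifies the arcs of at most one pair, so that a set
of pairwise non-crossing arcs has at most two arcs for each vertex. -/
theorem IsSystem.card_le {n : ℕ} (hn : 0 < n) {U : Finset (ℤ × ℤ)} (hU : IsSystem n U) :
    U.card ≤ 2 * n := by
  induction n, hn using Nat.le_induction generalizing U with
  | base =>
    refine (Finset.card_le_card (t := {(0, 0), (0, 1)}) fun c hc => ?_).trans Finset.card_le_two
    obtain ⟨h1, h2, h3, h4⟩ := hU.1 c hc
    push_cast at *
    have e : c = (c.1, c.2) := rfl
    have h5 : c.1 = 0 := by omega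
    have h6 : c.2 = 0 ∨ c.2 = 1 := by omega
    rw [e, h5]
    rcases h6 with h6 | h6 <;> rw [h6] <;> simp
  | succ n hn ih =>
    have h1 := card_le_card_contract le_rfl (by push_cast; omega) hU (a := 0)
    have h2 := (isContraction_squeeze (n := ((n + 1 : ℕ) : ℤ)) (a := 0) (l := 1) le_rfl (by omega)
      (by push_cast; omega)).isSystem hU
    rw [show ((n + 1 : ℕ) : ℤ) - 1 = n by push_cast; ring] at h2
    have h3 := ih h2
    omega

/-- A set of pairwise non-crossing arcs of maximal size. -/
def Tight (n : ℤ) (U : Finset (ℤ × ℤ)) : Prop := IsSystem n U ∧ (U.card : ℤ) = 2 * n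

theorem IsSystem.insert {n : ℤ} {U : Finset (ℤ × ℤ)} (hU : IsSystem n U) {c : ℤ × ℤ}
    (hc : IsCode n c) (h : ∀ d ∈ U, Compat n c d) : IsSystem n (insert c U) := by
  refine ⟨fun d hd => ?_, fun d hd e he => ?_⟩
  · rcases Finset.mem_insert.1 hd with rfl | hd
    exacts [hc, hU.1 d hd]
  · rcases Finset.mem_insert.1 hd with rfl | hd' <;> rcases Finset.mem_insert.1 he with rfl | he'
    exacts [compat_self hc, h e he', (h d hd').symm, hU.2 d hd' e he']

theorem Tight.isTri {n : ℤ} (hn : 0 < n) {U : Finset (ℤ × ℤ)} (hU : Tight n U) : IsTri n U := by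
  refine ⟨hU.1, fun c hc h => ?_⟩
  by_contra hcU
  lift n to ℕ using hn.le
  have h1 := (hU.1.insert hc h).card_le (by omega)
  rw [Finset.card_insert_of_notMem hcU] at h1
  have := hU.2
  omega

theorem Flip.card_eq {U V : Finset (ℤ × ℤ)} (h : Flip U V) : V.card = U.card := by
  obtain ⟨α, hα, β, hβ, rfl⟩ := h
  have h1 : β ∉ U.erase α := fun h => hβ (Finset.mem_of_mem_erase h)
  rw [Finset.card_insert_of_notMem h1, Finset.card_erase_of_mem hα]
  have : 0 < U.card := Finset.card_pos.2 ⟨α, hα⟩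
  omega

theorem Flip.symm {U V : Finset (ℤ × ℤ)} (h : Flip U V) : Flip V U := by
  obtain ⟨α, hα, β, hβ, rfl⟩ := h
  have hne : α ≠ β := by rintro rfl; exact hβ hα
  refine ⟨β, Finset.mem_insert_self _ _, α, by simp [hne], ?_⟩
  rw [Finset.erase_insert (fun h => hβ (Finset.mem_of_mem_erase h)), Finset.insert_erase hα]

theorem Flip.tight {n : ℤ} {U V : Finset (ℤ × ℤ)} (h : Flip U V) (hU : Tight n U)
    (hV : IsSystem n V) : Tight n V := ⟨hV, by rw [h.card_eq, hU.2]⟩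

theorem Tight.contract_squeeze_one {n a : ℤ} (ha : 0 ≤ a) (han : a + 1 < n)
    {U : Finset (ℤ × ℤ)} (hU : Tight n U) : Tight (n - 1) (contract (squeeze n a 1) U) := by
  have h1 := (isContraction_squeeze ha (by omega) han).isSystem hU.1
  refine ⟨h1, le_antisymm ?_ ?_⟩
  · lift n to ℕ using by omega
    have h2 := IsSystem.card_le (n := n - 1) (by omega) (U := contract (squeeze n a 1) U)
      (by rw [Nat.cast_sub (by omega)]; exact h1)
    omega
  · have h2 := card_le_card_contract ha han hU.1
    have := hU.2
    omega

theorem contract_congr {n : ℤ} {f g : ℤ → ℤ} {U : Finset (ℤ × ℤ)} (hU : IsSystem n U)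
    (h : ∀ x, 0 ≤ x → x < 2 * n → f x = g x) : contract f U = contract g U := by
  have key : ∀ c ∈ U, f c.1 = g c.1 ∧ f c.2 = g c.2 := fun c hc => by
    obtain ⟨h1, h2, h3, h4⟩ := hU.1 c hc
    exact ⟨h _ h1 (by omega), h _ h3 (by omega)⟩
  ext d
  simp only [mem_contract]
  refine exists_congr fun c => and_congr_right fun hc => ?_
  obtain ⟨h1, h2⟩ := key c hc
  simp only [NonDeg, Prod.map, h1, h2]

theorem contract_id (U : Finset (ℤ × ℤ)) : contract id U = U := by
  ext d
  simp [mem_contract, NonDeg]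

theorem Tight.contract_squeeze {n a l : ℤ} (ha : 0 ≤ a) (hl : 0 ≤ l) (h : a + l < n)
    {U : Finset (ℤ × ℤ)} (hU : Tight n U) : Tight (n - l) (contract (squeeze n a l) U) := by
  lift l to ℕ using hl
  induction l with
  | zero =>
    have : contract (squeeze n a 0) U = U := by
      rw [contract_congr hU.1 (g := id), contract_id]
      intro x hx hx'
      simp only [squeeze, id]
      split_ifs <;> omega
    simpa [this] using hU
  | succ l ih =>
    push_cast at h ⊢
    have h1 := (ih (by omega)).contract_squeeze_one ha (by omega)
    rw [← (isContraction_squeeze ha (by omega) (by omega)).contract_comp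
      (isContraction_squeeze ha (by omega) (by omega)) hU.1] at h1
    rw [contract_congr hU.1 (g := squeeze (n - l) a 1 ∘ squeeze n a l), ← sub_sub]
    · exact h1
    · intro x hx hx'
      simp only [squeeze, Function.comp]
      split_ifs <;> omega

/-! ### Flips and contractions -/

/-- A contraction that preserves the sets of pairwise non-crossing arcs of maximal size. -/
structure IsGood (n n' : ℤ) (f : ℤ → ℤ) : Prop extends IsContraction n n' f where
  tight : ∀ U, Tight n U → Tight n' (contract f U)

theorem isGood_squeeze {n a l : ℤ} (ha : 0 ≤ a) (hl : 0 ≤ l) (h : a + l < n) :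
    IsGood n (n - l) (squeeze n a l) where
  toIsContraction := isContraction_squeeze ha hl h
  tight _ hU := hU.contract_squeeze ha hl h

theorem IsGood.comp {n n' n'' : ℤ} {f g : ℤ → ℤ} (hn : 0 < n) (h : IsGood n n' f)
    (h' : IsGood n' n'' g) : IsGood n n'' (g ∘ f) where
  toIsContraction := h.toIsContraction.comp hn h'.toIsContraction
  tight U hU := by
    rw [h.contract_comp h'.toIsContraction hU.1]
    exact h'.tight _ (h.tight U hU)

/-- Two arcs whose images by a contraction are non-degenerate and cross each other. -/
def Crosses (n' : ℤ) (f : ℤ → ℤ) (c d : ℤ × ℤ) : Prop :=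
  NonDeg f c ∧ NonDeg f d ∧ ¬ Compat n' (Prod.map f f c) (Prod.map f f d)

/-- The image of a flip by a contraction: either nothing changes or the images of the two exchanged
arcs cross and are exchanged by a flip. -/
theorem IsGood.flip {n n' : ℤ} {f : ℤ → ℤ} (h : IsGood n n' f) (hn : 0 < n) {U : Finset (ℤ × ℤ)}
    {α β : ℤ × ℤ} (hU : Tight n U) (hα : α ∈ U) (hβ : β ∉ U)
    (hV : Tight n (insert β (U.erase α))) :
    contract f (insert β (U.erase α)) = contract f U ∧ ¬ Crosses n' f α β ∨
      Crosses n' f α β ∧ Prod.map f f α ∈ contract f U ∧ Prod.map f f β ∉ contract f U ∧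
      contract f (insert β (U.erase α)) =
        insert (Prod.map f f β) ((contract f U).erase (Prod.map f f α)) := by
  have hn' := h.pos hn
  have tU := (h.tight U hU).isTri hn'
  have tV := (h.tight _ hV).isTri hn'
  set V := insert β (U.erase α)
  have hβV : β ∈ V := Finset.mem_insert_self _ _
  have memV : ∀ γ ∈ U, γ ≠ α → γ ∈ V := fun γ h1 h2 =>
    Finset.mem_insert_of_mem (Finset.mem_erase.2 ⟨h2, h1⟩)
  have memU : ∀ γ ∈ V, γ ≠ β → γ ∈ U := fun γ h1 h2 =>
    Finset.mem_of_mem_erase ((Finset.mem_insert.1 h1).resolve_left h2)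
  have cα := hU.1.1 α hα
  have cβ := hV.1.1 β hβV
  by_cases hc : Crosses n' f α β
  · right
    obtain ⟨hc1, hc2, hc3⟩ := id hc
    have mα : Prod.map f f α ∈ contract f U := mem_contract.2 ⟨α, hα, hc1, rfl⟩
    have mβ : Prod.map f f β ∈ contract f V := mem_contract.2 ⟨β, hβV, hc2, rfl⟩
    have nβ : Prod.map f f β ∉ contract f U := fun hh => hc3 (tU.1.2 _ mα _ hh)
    have nα : Prod.map f f α ∉ contract f V := fun hh => hc3 (tV.1.2 _ hh _ mβ)
    refine ⟨hc, mα, nβ, ?_⟩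
    ext d
    rw [Finset.mem_insert, Finset.mem_erase]
    constructor
    · intro hd
      obtain ⟨γ, h1, h2, rfl⟩ := mem_contract.1 hd
      by_cases h3 : γ = β
      · left; rw [h3]
      · refine Or.inr ⟨fun h4 => nα (h4 ▸ hd), mem_contract.2 ⟨γ, memU γ h1 h3, h2, rfl⟩⟩
    · rintro (rfl | ⟨h1, h2⟩)
      · exact mβ
      · obtain ⟨γ, h3, h4, rfl⟩ := mem_contract.1 h2
        exact mem_contract.2 ⟨γ, memV γ h3 (fun h5 => h1 (by rw [h5])), h4, rfl⟩
  · left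
    refine ⟨?_, hc⟩
    have hcomp : NonDeg f α → NonDeg f β → Compat n' (Prod.map f f α) (Prod.map f f β) :=
      fun h1 h2 => by by_contra h3; exact hc ⟨h1, h2, h3⟩
    refine Finset.Subset.antisymm (fun d hd => ?_) (fun d hd => ?_)
    · obtain ⟨γ, h1, h2, rfl⟩ := mem_contract.1 hd
      by_cases h3 : γ = β
      · subst h3
        refine tU.2 _ (h.isCode cβ) fun e he => ?_
        obtain ⟨δ, h4, h5, rfl⟩ := mem_contract.1 he
        by_cases h6 : δ = α
        · subst h6; exact (hcomp h5 h2).symm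
        · exact tV.1.2 _ hd _ (mem_contract.2 ⟨δ, memV δ h4 h6, h5, rfl⟩)
      · exact mem_contract.2 ⟨γ, memU γ h1 h3, h2, rfl⟩
    · obtain ⟨γ, h1, h2, rfl⟩ := mem_contract.1 hd
      by_cases h3 : γ = α
      · subst h3
        refine tV.2 _ (h.isCode cα) fun e he => ?_
        obtain ⟨δ, h4, h5, rfl⟩ := mem_contract.1 he
        by_cases h6 : δ = β
        · subst h6; exact hcomp h2 h5
        · exact tU.1.2 _ hd _ (mem_contract.2 ⟨δ, memU δ h4 h6, h5, rfl⟩)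
      · exact mem_contract.2 ⟨γ, memV γ h1 h3, h2, rfl⟩

/-! ### Exchangeable arcs -/

theorem compat_planar_planar {n i j i' j' : ℤ} (h : i < j) (h' : i' < j') :
    Compat n (i, j) (i', j') ↔ PlanarPlanar n i j i' j' := by
  simp only [Compat]
  exact ⟨fun H => H.1 h h', fun H => ⟨fun _ _ => H, fun _ _ => by omega, fun _ _ => by omega,
    fun _ _ => by omega⟩⟩

theorem compat_planar_crossing {n i j p q : ℤ} (h : i < j) (h' : q ≤ p) :
    Compat n (i, j) (p, q) ↔ PlanarCrossing n i j p q := by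
  simp only [Compat]
  exact ⟨fun H => H.2.1 h h', fun H => ⟨fun _ _ => by omega, fun _ _ => H, fun _ _ => by omega,
    fun _ _ => by omega⟩⟩

theorem compat_crossing_planar {n i j p q : ℤ} (h : i < j) (h' : q ≤ p) :
    Compat n (p, q) (i, j) ↔ PlanarCrossing n i j p q := by
  simp only [Compat]
  exact ⟨fun H => H.2.2.1 h' h, fun H => ⟨fun _ _ => by omega, fun _ _ => by omega, fun _ _ => H,
    fun _ _ => by omega⟩⟩

theorem compat_crossing_crossing {n p q p' q' : ℤ} (h : q ≤ p) (h' : q' ≤ p') :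
    Compat n (p, q) (p', q') ↔ CrossingCrossing p q p' q' := by
  simp only [Compat]
  exact ⟨fun H => H.2.2.2 h h', fun H => ⟨fun _ _ => by omega, fun _ _ => by omega,
    fun _ _ => by omega, fun _ _ => H⟩⟩

/-- A weak form of the fact that two arcs can be exchanged by a flip: an arc `γ` which is crossed
by no arc disjoint from `α` and `β` crosses both or neither of them, unless it is one of them. -/
def Exchangeable (n : ℤ) (α β : ℤ × ℤ) : Prop :=
  ∀ γ, IsCode n γ → (∀ w, IsCode n w → Compat n w α → Compat n w β → Compat n w γ) →
    γ ≠ α → γ ≠ β → (Compat n γ α ↔ Compat n γ β)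

theorem Exchangeable.symm {n : ℤ} {α β : ℤ × ℤ} (h : Exchangeable n α β) : Exchangeable n β α :=
  fun γ h1 h2 h3 h4 => (h γ h1 (fun w hw ha hb => h2 w hw hb ha) h4 h3).symm

/-- By maximality, an arc disjoint from `α` and `β` that crosses no arc of `U` would belong to `U`. -/
theorem exchangeable_of_flip {n : ℤ} {U : Finset (ℤ × ℤ)} {α β : ℤ × ℤ} (hU : IsTri n U)
    (hα : α ∈ U) (hV : IsTri n (insert β (U.erase α))) : Exchangeable n α β := by
  intro γ hγ hw hγα hγβ
  have hβV := Finset.mem_insert_self β (U.erase α)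
  have hW : ∀ w ∈ U.erase α, Compat n γ w := fun w hwW => by
    have h1 := Finset.mem_of_mem_erase hwW
    have h2 : w ∈ insert β (U.erase α) := Finset.mem_insert_of_mem hwW
    exact (hw w (hU.1.1 w h1) (hU.1.2 w h1 α hα) (hV.1.2 w h2 β hβV)).symm
  constructor
  · intro h
    have h1 : γ ∈ U := hU.2 γ hγ fun d hd => by
      by_cases hdα : d = α
      · rw [hdα]; exact h
      · exact hW d (Finset.mem_erase.2 ⟨hdα, hd⟩)
    exact hV.1.2 γ (Finset.mem_insert_of_mem (Finset.mem_erase.2 ⟨hγα, h1⟩)) β hβV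
  · intro h
    have h1 : γ ∈ insert β (U.erase α) := hV.2 γ hγ fun d hd => by
      rcases Finset.mem_insert.1 hd with rfl | hd
      · exact h
      · exact hW d hd
    have h2 := Finset.mem_of_mem_erase ((Finset.mem_insert.1 h1).resolve_left hγβ)
    exact hU.1.2 γ h2 α hα

/-- Two exchangeable planar arcs cross only once. -/
theorem Exchangeable.planar {n i j i' j' : ℤ} (h : Exchangeable n (i, j) (i', j'))
    (hc : IsCode n (i, j)) (hd : IsCode n (i', j')) (h1 : i < i') (h2 : i' < j) (h3 : j < j')
    (h4 : i + n < j') : False := by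
  obtain ⟨a1, a2, a3, a4⟩ := hc
  obtain ⟨b1, b2, b3, b4⟩ := hd
  simp only at *
  rcases lt_or_ge j (i + n) with hj | hj
  · have key : ∀ k l, (k = j ∧ l = j' ∧ j < n) ∨ (k = j - n ∧ l = j' - n ∧ n ≤ j) → False := by
      intro k l hkl
      have e1 : k < l := by omega
      have e2 := h (k, l) ⟨by simp only; omega, by simp only; omega, by simp only; omega,
        by simp only; omega⟩ ?_ (by simp only [ne_eq, Prod.mk.injEq]; omega)
          (by simp only [ne_eq, Prod.mk.injEq]; omega)
      · rw [compat_planar_planar e1 (by omega), compat_planar_planar e1 (by omega)] at e2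
        simp only [PlanarPlanar] at e2
        omega
      · rintro ⟨x, y⟩ ⟨w1, w2, w3, w4⟩ c1 c2
        simp only at w1 w2 w3 w4
        rcases lt_or_ge x y with hxy | hxy
        · rw [compat_planar_planar hxy (by omega)] at *
          simp only [PlanarPlanar] at *
          omega
        · rw [compat_crossing_planar (by omega) hxy] at *
          simp only [PlanarCrossing] at *
          omega
    exact key (if j < n then j else j - n) (if j < n then j' else j' - n) (by split_ifs <;> omega)
  · have e2 := h (i, i) ⟨by simp only; omega, by simp only; omega, by simp only; omega,
      by simp only; omega⟩ ?_ (by simp only [ne_eq, Prod.mk.injEq]; omega)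
        (by simp only [ne_eq, Prod.mk.injEq]; omega)
    · rw [compat_crossing_planar (by omega) le_rfl, compat_crossing_planar (by omega) le_rfl] at e2
      simp only [PlanarCrossing] at e2
      omega
    · rintro ⟨x, y⟩ ⟨w1, w2, w3, w4⟩ c1 c2
      simp only at w1 w2 w3 w4
      rcases lt_or_ge x y with hxy | hxy
      · rw [compat_planar_planar hxy (by omega)] at c1 c2
        rw [compat_planar_crossing hxy le_rfl]
        simp only [PlanarPlanar, PlanarCrossing] at *
        omega
      · rw [compat_crossing_planar (by omega) hxy] at c1 c2
        rw [compat_crossing_crossing hxy le_rfl]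
        simp only [PlanarCrossing, CrossingCrossing] at *
        omega

/-- A planar arc and a crossing arc that are exchangeable cross only once. -/
theorem Exchangeable.planar_crossing {n i j p q : ℤ} (h : Exchangeable n (i, j) (p, q))
    (hc : IsCode n (i, j)) (hd : IsCode n (p, q)) (hij : i < j) (hqp : q < p)
    (hp : (i < p ∧ p < j) ∨ p + n < j) (hq : (i < q ∧ q < j) ∨ q + n < j) : False := by
  obtain ⟨a1, a2, a3, a4⟩ := hc
  obtain ⟨b1, b2, b3, b4⟩ := hd
  simp only at *
  have key : ∀ k l, (k = q ∧ l = j ∧ i < q) ∨ (k = p ∧ l = j ∧ q ≤ i ∧ i < p) ∨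
      (k = q ∧ l = j - n ∧ p ≤ i) → False := by
    intro k l hkl
    have e1 : k < l := by omega
    have e2 := h (k, l) ⟨by simp only; omega, by simp only; omega, by simp only; omega,
      by simp only; omega⟩ ?_ (by simp only [ne_eq, Prod.mk.injEq]; omega)
        (by simp only [ne_eq, Prod.mk.injEq]; omega)
    · rw [compat_planar_planar e1 hij, compat_planar_crossing e1 hqp.le] at e2
      simp only [PlanarPlanar, PlanarCrossing] at e2
      omega
    · rintro ⟨x, y⟩ ⟨w1, w2, w3, w4⟩ c1 c2
      simp only at w1 w2 w3 w4
      rcases lt_or_ge x y with hxy | hxy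
      · rw [compat_planar_planar hxy hij] at c1
        rw [compat_planar_crossing hxy hqp.le] at c2
        rw [compat_planar_planar hxy e1]
        simp only [PlanarPlanar, PlanarCrossing] at *
        omega
      · rw [compat_crossing_planar hij hxy] at c1
        rw [compat_crossing_crossing hxy hqp.le] at c2
        rw [compat_crossing_planar e1 hxy]
        simp only [PlanarCrossing, CrossingCrossing] at *
        omega
  rcases lt_or_ge i q with hq' | hq'
  · exact key q j (by omega)
  · rcases lt_or_ge i p with hp' | hp'
    · exact key p j (by omega)
    · exact key q (j - n) (by omega)

/-! ### Separated contractions -/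

namespace IsContraction

variable {n n' nR nS : ℤ} {f R S : ℤ → ℤ}

theorem not_planarPlanar (h : IsContraction n n' f) {i j i' j' : ℤ} (hi : 0 ≤ i ∧ i < 2 * n)
    (hj : 0 ≤ j ∧ j < 2 * n) (hi' : 0 ≤ i' ∧ i' < 2 * n) (hj' : 0 ≤ j' ∧ j' < 2 * n)
    (H : ¬ PlanarPlanar n' (f i) (f j) (f i') (f j')) :
    ((f i < f i' ∧ f i' < f j ∧ f j < f j') ∧ (i < i' ∧ i' < j ∧ j < j')) ∨
    ((f i' < f i ∧ f i < f j' ∧ f j' < f j) ∧ (i' < i ∧ i < j' ∧ j' < j)) ∨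
    ((f i' + n' < f j ∧ f j < f j' + n') ∧ (i' + n < j ∧ j < j' + n)) ∨
    ((f i + n' < f j' ∧ f j' < f j + n') ∧ (i + n < j' ∧ j' < j + n)) := by
  by_contra hc
  simp only [not_or] at hc
  obtain ⟨H1, H2, H3, H4⟩ := hc
  exact H
   ⟨fun hc => H1 ⟨hc, h.lt hi.2 hi'.1 hc.1, h.lt hi'.2 hj.1 hc.2.1, h.lt hj.2 hj'.1 hc.2.2⟩,
    fun hc => H2 ⟨hc, h.lt hi'.2 hi.1 hc.1, h.lt hi.2 hj'.1 hc.2.1, h.lt hj'.2 hj.1 hc.2.2⟩,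
    fun hc => H3 ⟨hc, h.add_lt hi'.1 hi'.2 hj.1 hj.2 hc.1, h.lt_add hj'.1 hj.2 hc.2⟩,
    fun hc => H4 ⟨hc, h.add_lt hi.1 hi.2 hj'.1 hj'.2 hc.1, h.lt_add hj.1 hj'.2 hc.2⟩⟩

theorem not_planarCrossing (h : IsContraction n n' f) {i j p q : ℤ} (hi : 0 ≤ i ∧ i < 2 * n)
    (hj : 0 ≤ j ∧ j < 2 * n) (hp : 0 ≤ p ∧ p < 2 * n) (hq : 0 ≤ q ∧ q < 2 * n)
    (H : ¬ PlanarCrossing n' (f i) (f j) (f p) (f q)) :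
    ((f i < f p ∧ f p < f j) ∧ (i < p ∧ p < j)) ∨ ((f i < f q ∧ f q < f j) ∧ (i < q ∧ q < j)) ∨
    (f p + n' < f j ∧ p + n < j) ∨ (f q + n' < f j ∧ q + n < j) := by
  by_contra hc
  simp only [not_or] at hc
  obtain ⟨H1, H2, H3, H4⟩ := hc
  exact H
   ⟨fun hc => H1 ⟨hc, h.lt hi.2 hp.1 hc.1, h.lt hp.2 hj.1 hc.2⟩,
    fun hc => H2 ⟨hc, h.lt hi.2 hq.1 hc.1, h.lt hq.2 hj.1 hc.2⟩,
    fun hc => H3 ⟨hc, h.add_lt hp.1 hp.2 hj.1 hj.2 hc⟩,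
    fun hc => H4 ⟨hc, h.add_lt hq.1 hq.2 hj.1 hj.2 hc⟩⟩

theorem not_crossingCrossing (h : IsContraction n n' f) {p q p' q' : ℤ}
    (hp : 0 ≤ p ∧ p < 2 * n) (hq : 0 ≤ q ∧ q < 2 * n) (hp' : 0 ≤ p' ∧ p' < 2 * n)
    (hq' : 0 ≤ q' ∧ q' < 2 * n) (H : ¬ CrossingCrossing (f p) (f q) (f p') (f q')) :
    (f p' < f q ∧ p' < q) ∨ (f p < f q' ∧ p < q') ∨
    ((f p < f p' ∧ f q' < f q) ∧ (p < p' ∧ q' < q)) ∨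
    ((f p' < f p ∧ f q < f q') ∧ (p' < p ∧ q < q')) := by
  by_contra hc
  simp only [not_or] at hc
  obtain ⟨H1, H2, H3, H4⟩ := hc
  refine H ⟨not_lt.1 fun hc => H1 ⟨hc, h.lt hp'.2 hq.1 hc⟩,
    not_lt.1 fun hc => H2 ⟨hc, h.lt hp.2 hq'.1 hc⟩, ?_⟩
  have h3 : ¬ (f p < f p' ∧ f q' < f q) :=
    fun hc => H3 ⟨hc, h.lt hp.2 hp'.1 hc.1, h.lt hq'.2 hq.1 hc.2⟩
  have h4 : ¬ (f p' < f p ∧ f q < f q') :=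
    fun hc => H4 ⟨hc, h.lt hp'.2 hp.1 hc.1, h.lt hq.2 hq'.1 hc.2⟩
  omega

/-- If two contractions `R` and `S` are independent of each other and `f` consists of both, then
two exchangeable arcs whose images by `R` and by `S` cross have images by `f` that cross. -/
theorem crosses_of_separated (h : IsContraction n n' f) (hR : IsContraction n nR R)
    (hS : IsContraction n nS S)
    (sep : ∀ x y, 0 ≤ x → x < 2 * n → 0 ≤ y → y < 2 * n → R x < R y → S x < S y → f x < f y)
    {α β : ℤ × ℤ} (hα : IsCode n α) (hβ : IsCode n β) (hE : Exchangeable n α β)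
    (cR : Crosses nR R α β) (cS : Crosses nS S α β) : Crosses n' f α β := by
  obtain ⟨i, j⟩ := α
  obtain ⟨k, l⟩ := β
  obtain ⟨a1, a2, a3, a4⟩ := id hα
  obtain ⟨b1, b2, b3, b4⟩ := id hβ
  obtain ⟨R1, R2, R3⟩ := cR
  obtain ⟨S1, S2, S3⟩ := cS
  simp only [NonDeg, Prod.map_apply] at *
  have ri : 0 ≤ i ∧ i < 2 * n := by omega
  have rj : 0 ≤ j ∧ j < 2 * n := by omega
  have rk : 0 ≤ k ∧ k < 2 * n := by omega
  have rl : 0 ≤ l ∧ l < 2 * n := by omega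
  have sep1 : ∀ x y, (0 ≤ x ∧ x < 2 * n) → (0 ≤ y ∧ y < 2 * n) → R x < R y → S x < S y →
    f x < f y := fun x y hx hy => sep x y hx.1 hx.2 hy.1 hy.2
  have sep2 : ∀ x y, (0 ≤ x ∧ x < 2 * n) → (0 ≤ y ∧ y < 2 * n) → R x + nR < R y →
      S x + nS < S y → f x + n' < f y := fun x y hx hy h1 h2 => by
    have h3 := hR.add_lt hx.1 hx.2 hy.1 hy.2 h1
    have hx' : x < n := by omega
    rw [← hR.add x hx.1 hx'] at h1
    rw [← hS.add x hx.1 hx'] at h2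
    rw [← h.add x hx.1 hx']
    exact sep1 _ _ (by omega) hy h1 h2
  have sep3 : ∀ x y, (0 ≤ x ∧ x < 2 * n) → (0 ≤ y ∧ y < 2 * n) → R y < R x + nR →
      S y < S x + nS → f y < f x + n' := fun x y hx hy h1 h2 => by
    rcases lt_or_ge x n with hx' | hx'
    · rw [← hR.add x hx.1 hx'] at h1
      rw [← hS.add x hx.1 hx'] at h2
      rw [← h.add x hx.1 hx']
      exact sep1 _ _ hy (by omega) h1 h2
    · have h3 := h.lt_two_mul hy.1 hy.2
      have h4 := h.le_of_le hx' hx.2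
      omega
  have n1 : i < j → f i < f j := fun hc => sep1 i j ri rj (R1 hc) (S1 hc)
  have n2 : k < l → f k < f l := fun hc => sep1 k l rk rl (R2 hc) (S2 hc)
  refine ⟨n1, n2, ?_⟩
  rw [Prod.map_apply, Prod.map_apply]
  rcases lt_or_ge i j with hij | hij <;> rcases lt_or_ge k l with hkl | hkl
  · rw [compat_planar_planar (R1 hij) (R2 hkl)] at R3
    rw [compat_planar_planar (S1 hij) (S2 hkl)] at S3
    rw [compat_planar_planar (n1 hij) (n2 hkl)]
    rintro ⟨H1, H2, H3, H4⟩
    rcases hR.not_planarPlanar ri rj rk rl R3 with ⟨⟨x1, x2, x3⟩, X⟩ | ⟨⟨x1, x2, x3⟩, X⟩ |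
      ⟨⟨x1, x2⟩, X⟩ | ⟨⟨x1, x2⟩, X⟩ <;>
    rcases hS.not_planarPlanar ri rj rk rl S3 with ⟨⟨y1, y2, y3⟩, Y⟩ | ⟨⟨y1, y2, y3⟩, Y⟩ |
      ⟨⟨y1, y2⟩, Y⟩ | ⟨⟨y1, y2⟩, Y⟩
    · exact H1 ⟨sep1 _ _ ri rk x1 y1, sep1 _ _ rk rj x2 y2, sep1 _ _ rj rl x3 y3⟩
    · omega
    · omega
    · exact hE.planar hα hβ X.1 X.2.1 X.2.2 Y.1
    · omega
    · exact H2 ⟨sep1 _ _ rk ri x1 y1, sep1 _ _ ri rl x2 y2, sep1 _ _ rl rj x3 y3⟩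
    · exact hE.symm.planar hβ hα X.1 X.2.1 X.2.2 Y.1
    · omega
    · omega
    · exact hE.symm.planar hβ hα Y.1 Y.2.1 Y.2.2 X.1
    · exact H3 ⟨sep2 _ _ rk rj x1 y1, sep3 _ _ rl rj x2 y2⟩
    · omega
    · exact hE.planar hα hβ Y.1 Y.2.1 Y.2.2 X.1
    · omega
    · omega
    · exact H4 ⟨sep2 _ _ ri rl x1 y1, sep3 _ _ rj rl x2 y2⟩
  · have cR := hR.mono l k rl.1 hkl rk.2
    have cS := hS.mono l k rl.1 hkl rk.2
    rw [compat_planar_crossing (R1 hij) cR] at R3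
    rw [compat_planar_crossing (S1 hij) cS] at S3
    rw [compat_planar_crossing (n1 hij) (h.mono l k rl.1 hkl rk.2)]
    have hlk : l < k → (i < k ∧ k < j ∨ k + n < j) → (i < l ∧ l < j ∨ l + n < j) → False :=
      fun h1 h2 h3 => hE.planar_crossing hα hβ hij h1 h2 h3
    rintro ⟨H1, H2, H3, H4⟩
    rcases hkl.eq_or_lt with rfl | hkl
    · rcases hR.not_planarCrossing ri rj rl rl R3 with ⟨⟨x1, x2⟩, X⟩ | ⟨⟨x1, x2⟩, X⟩ |
        ⟨x1, X⟩ | ⟨x1, X⟩ <;>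
      rcases hS.not_planarCrossing ri rj rl rl S3 with ⟨⟨y1, y2⟩, Y⟩ | ⟨⟨y1, y2⟩, Y⟩ |
        ⟨y1, Y⟩ | ⟨y1, Y⟩ <;>
      first
      | exact H1 ⟨sep1 _ _ ri rl x1 y1, sep1 _ _ rl rj x2 y2⟩
      | exact H3 (sep2 _ _ rl rj x1 y1)
      | omega
    · replace hlk := hlk hkl
      rcases hR.not_planarCrossing ri rj rk rl R3 with ⟨⟨x1, x2⟩, X⟩ | ⟨⟨x1, x2⟩, X⟩ |
        ⟨x1, X⟩ | ⟨x1, X⟩ <;>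
      rcases hS.not_planarCrossing ri rj rk rl S3 with ⟨⟨y1, y2⟩, Y⟩ | ⟨⟨y1, y2⟩, Y⟩ |
        ⟨y1, Y⟩ | ⟨y1, Y⟩ <;>
      first
      | exact H1 ⟨sep1 _ _ ri rk x1 y1, sep1 _ _ rk rj x2 y2⟩
      | exact H2 ⟨sep1 _ _ ri rl x1 y1, sep1 _ _ rl rj x2 y2⟩
      | exact H3 (sep2 _ _ rk rj x1 y1)
      | exact H4 (sep2 _ _ rl rj x1 y1)
      | exact hlk (by omega) (by omega)
  · have cR := hR.mono j i rj.1 hij ri.2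
    have cS := hS.mono j i rj.1 hij ri.2
    rw [compat_crossing_planar (R2 hkl) cR] at R3
    rw [compat_crossing_planar (S2 hkl) cS] at S3
    rw [compat_crossing_planar (n2 hkl) (h.mono j i rj.1 hij ri.2)]
    have hlk : j < i → (k < i ∧ i < l ∨ i + n < l) → (k < j ∧ j < l ∨ j + n < l) → False :=
      fun h1 h2 h3 => hE.symm.planar_crossing hβ hα hkl h1 h2 h3
    rintro ⟨H1, H2, H3, H4⟩
    rcases hij.eq_or_lt with rfl | hij
    · rcases hR.not_planarCrossing rk rl rj rj R3 with ⟨⟨x1, x2⟩, X⟩ | ⟨⟨x1, x2⟩, X⟩ |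
        ⟨x1, X⟩ | ⟨x1, X⟩ <;>
      rcases hS.not_planarCrossing rk rl rj rj S3 with ⟨⟨y1, y2⟩, Y⟩ | ⟨⟨y1, y2⟩, Y⟩ |
        ⟨y1, Y⟩ | ⟨y1, Y⟩ <;>
      first
      | exact H1 ⟨sep1 _ _ rk rj x1 y1, sep1 _ _ rj rl x2 y2⟩
      | exact H3 (sep2 _ _ rj rl x1 y1)
      | omega
    · replace hlk := hlk hij
      rcases hR.not_planarCrossing rk rl ri rj R3 with ⟨⟨x1, x2⟩, X⟩ | ⟨⟨x1, x2⟩, X⟩ |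
        ⟨x1, X⟩ | ⟨x1, X⟩ <;>
      rcases hS.not_planarCrossing rk rl ri rj S3 with ⟨⟨y1, y2⟩, Y⟩ | ⟨⟨y1, y2⟩, Y⟩ |
        ⟨y1, Y⟩ | ⟨y1, Y⟩ <;>
      first
      | exact H1 ⟨sep1 _ _ rk ri x1 y1, sep1 _ _ ri rl x2 y2⟩
      | exact H2 ⟨sep1 _ _ rk rj x1 y1, sep1 _ _ rj rl x2 y2⟩
      | exact H3 (sep2 _ _ ri rl x1 y1)
      | exact H4 (sep2 _ _ rj rl x1 y1)
      | exact hlk (by omega) (by omega)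
  · rw [compat_crossing_crossing (hR.mono j i rj.1 hij ri.2) (hR.mono l k rl.1 hkl rk.2)] at R3
    rw [compat_crossing_crossing (hS.mono j i rj.1 hij ri.2) (hS.mono l k rl.1 hkl rk.2)] at S3
    rw [compat_crossing_crossing (h.mono j i rj.1 hij ri.2) (h.mono l k rl.1 hkl rk.2)]
    rintro ⟨H1, H2, H3⟩
    rcases hR.not_crossingCrossing ri rj rk rl R3 with ⟨x1, X⟩ | ⟨x1, X⟩ | ⟨⟨x1, x2⟩, X⟩ |
      ⟨⟨x1, x2⟩, X⟩ <;>
    rcases hS.not_crossingCrossing ri rj rk rl S3 with ⟨y1, Y⟩ | ⟨y1, Y⟩ | ⟨⟨y1, y2⟩, Y⟩ |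
      ⟨⟨y1, y2⟩, Y⟩ <;>
    first
    | exact absurd (sep1 _ _ rk rj x1 y1) (by omega)
    | exact absurd (sep1 _ _ ri rl x1 y1) (by omega)
    | (have := sep1 _ _ ri rk x1 y1; have := sep1 _ _ rl rj x2 y2; omega)
    | (have := sep1 _ _ rk ri x1 y1; have := sep1 _ _ rj rl x2 y2; omega)
    | omega

end IsContraction

/-! ### Weighted flip paths and their exhaustive exploration -/

/-- `V` is obtained from `U` by a sequence of flips, each of which has a weight that depends on the
two exchanged arcs. The total weight is `k`. -/
inductive Path (n : ℤ) (wt : ℤ × ℤ → ℤ × ℤ → ℕ) : ℕ → Finset (ℤ × ℤ) → Finset (ℤ × ℤ) → Prop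
  | refl {U : Finset (ℤ × ℤ)} (h : Tight n U) : Path n wt 0 U U
  | step {k : ℕ} {U V : Finset (ℤ × ℤ)} {α β : ℤ × ℤ} (h : Path n wt k U V) (hα : α ∈ V)
      (hβ : β ∉ V) (hW : Tight n (insert β (V.erase α))) :
      Path n wt (k + wt α β) U (insert β (V.erase α))

theorem Path.tight_right {n : ℤ} {wt : ℤ × ℤ → ℤ × ℤ → ℕ} {k : ℕ} {U V : Finset (ℤ × ℤ)}
    (h : Path n wt k U V) : Tight n V := by
  cases h <;> assumption

theorem Path.tight_left {n : ℤ} {wt : ℤ × ℤ → ℤ × ℤ → ℕ} {k : ℕ} {U V : Finset (ℤ × ℤ)}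
    (h : Path n wt k U V) : Tight n U := by
  induction h with
  | refl h => exact h
  | step _ _ _ _ ih => exact ih

theorem beq_eq_false {a b : ℕ} (h : a ≠ b) : Nat.beq a b = false := by
  rw [← Bool.not_eq_true, Nat.beq_eq]; exact h

theorem blt_eq_false {a b : ℕ} (h : ¬ a < b) : Nat.blt a b = false := by
  rw [← Bool.not_eq_true, Nat.blt_eq]; exact h

/-- Binary search trees that map the codes of the explored triangulations to weights. The functions
below are defined with recursors so that the kernel evaluates them efficiently. -/
inductive Tree
  | leaf : Tree
  | node (l : Tree) (k v : ℕ) (r : Tree) : Tree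

namespace Tree

/-- The value of a key. -/
noncomputable def find (k : ℕ) (t : Tree) : Option ℕ :=
  t.rec none fun _ k' v _ ihl ihr =>
    bif Nat.beq k k' then some v else bif Nat.blt k k' then ihl else ihr

/-- Insertion of a key and its value. -/
noncomputable def insert (k v : ℕ) (t : Tree) : Tree :=
  t.rec (node leaf k v leaf) fun l k' v' r ihl ihr =>
    bif Nat.beq k k' then node l k v r else
      bif Nat.blt k k' then node ihl k' v' r else node l k' v' ihr

theorem find_node (k : ℕ) (l : Tree) (k' v : ℕ) (r : Tree) : (node l k' v r).find k =
    bif Nat.beq k k' then some v else bif Nat.blt k k' then l.find k else r.find k := rfl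

theorem insert_node (k v : ℕ) (l : Tree) (k' v' : ℕ) (r : Tree) : (node l k' v' r).insert k v =
    bif Nat.beq k k' then node l k v r else
      bif Nat.blt k k' then node (l.insert k v) k' v' r else node l k' v' (r.insert k v) := rfl

theorem find_insert (k k' v : ℕ) (t : Tree) :
    (t.insert k v).find k' = if k' = k then some v else t.find k' := by
  induction t with
  | leaf =>
    change (node leaf k v leaf).find k' = _
    by_cases h : k' = k
    · simp [find_node, h]
    · rw [find_node, beq_eq_false h, if_neg h, cond_false]
      cases Nat.blt k' k <;> rfl
  | node l c w r ihl ihr =>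
    rw [insert_node, find_node]
    by_cases h1 : k = c
    · subst h1
      by_cases h2 : k' = k
      · simp [find_node, h2]
      · simp [find_node, h2, beq_eq_false h2]
    · have h1' : Nat.beq k c = false := beq_eq_false h1
      rw [h1', cond_false]
      by_cases h3 : k < c
      · have h3' : Nat.blt k c = true := by simpa using h3
        rw [h3', cond_true, find_node, ihl]
        by_cases h2 : k' = k
        · subst h2; simp [h1', h3']
        · simp [h2]
      · have h3' : Nat.blt k c = false := blt_eq_false h3
        rw [h3', cond_false, find_node, ihr]
        by_cases h2 : k' = k
        · subst h2; simp [h1', h3']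
        · simp [h2]

end Tree

/-- The right fold of a list. -/
noncomputable def fold {α β : Type} (f : α → β → β) (b : β) (l : List α) : β :=
  l.rec b fun a _ ih => f a ih

theorem fold_eq {α β : Type} (f : α → β → β) (b : β) (l : List α) : fold f b l = l.foldr f b := by
  induction l with
  | nil => rfl
  | cons a l ih => rw [List.foldr_cons, ← ih]; rfl

/-- An arc, as a power of two, the set of the arcs that do not cross it, and, for each of several
contractions, the set of the arcs that do not cross it after contraction. Sets of arcs are encoded
in base two. -/
structure Entry where
  /-- the arc -/
  bit : ℕ
  /-- the arcs that do not cross it -/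
  comp : ℕ
  /-- the arcs that do not cross it after contraction -/
  wts : List ℕ

/-- Boolean version of `Compat` for non-negative codes. -/
def compatB (n i j k l : ℕ) : Bool :=
  bif Nat.blt i j then
    bif Nat.blt k l then
      !((Nat.blt i k && Nat.blt k j && Nat.blt j l) ||
        (Nat.blt k i && Nat.blt i l && Nat.blt l j) ||
        (Nat.blt (k + n) j && Nat.blt j (l + n)) || (Nat.blt (i + n) l && Nat.blt l (j + n)))
    else !((Nat.blt i k && Nat.blt k j) || (Nat.blt i l && Nat.blt l j) || Nat.blt (k + n) j ||
      Nat.blt (l + n) j)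
  else
    bif Nat.blt k l then
      !((Nat.blt k i && Nat.blt i l) || (Nat.blt k j && Nat.blt j l) || Nat.blt (i + n) l ||
        Nat.blt (j + n) l)
    else Nat.ble j k && Nat.ble l i &&
      ((Nat.ble i k && Nat.ble j l) || (Nat.ble k i && Nat.ble l j))

theorem compatB_iff (n i j k l : ℕ) :
    compatB n i j k l = true ↔ Compat n ((i : ℤ), (j : ℤ)) ((k : ℤ), (l : ℤ)) := by
  have key : ∀ a b : ℕ, Nat.blt a b = decide (a < b) := fun a b => by
    rw [Bool.eq_iff_iff, Nat.blt_eq, decide_eq_true_iff]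
  have key' : ∀ a b : ℕ, Nat.ble a b = decide (a ≤ b) := fun a b => by
    rw [Bool.eq_iff_iff, Nat.ble_eq, decide_eq_true_iff]
  by_cases h1 : i < j <;> by_cases h2 : k < l
  · rw [compat_planar_planar (by omega) (by omega)]
    simp only [compatB, key, key', h1, h2, PlanarPlanar, decide_true, cond_true,
      Bool.not_eq_true', Bool.or_eq_false_iff, Bool.and_eq_false_iff, decide_eq_false_iff_not]
    omega
  · rw [compat_planar_crossing (by omega) (by omega)]
    simp only [compatB, key, key', h1, h2, PlanarCrossing, decide_true, decide_false, cond_true,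
      cond_false, Bool.not_eq_true', Bool.or_eq_false_iff, Bool.and_eq_false_iff,
      decide_eq_false_iff_not]
    omega
  · rw [compat_crossing_planar (by omega) (by omega)]
    simp only [compatB, key, key', h1, h2, PlanarCrossing, decide_true, decide_false, cond_true,
      cond_false, Bool.not_eq_true', Bool.or_eq_false_iff, Bool.and_eq_false_iff,
      decide_eq_false_iff_not]
    omega
  · rw [compat_crossing_crossing (by omega) (by omega)]
    simp only [compatB, key, key', h1, h2, CrossingCrossing, decide_false, cond_false,
      Bool.and_eq_true, Bool.or_eq_true, decide_eq_true_iff]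
    omega

/-- Version of `squeeze` for natural numbers. -/
def squeezeN (n a l x : ℕ) : ℕ :=
  bif Nat.ble x a then x else bif Nat.ble x (a + l) then a else bif Nat.ble x (a + n) then x - l
  else bif Nat.ble x (a + l + n) then a + n - l else x - 2 * l

theorem squeezeN_eq {n a l : ℕ} (h : a + l < n) (x : ℕ) :
    (squeezeN n a l x : ℤ) = squeeze n a l x := by
  simp only [squeezeN, squeeze, cond_eq_ite, Nat.ble_eq]
  split_ifs <;> omega

/-- Boolean version of `Crosses`. -/
def crossesB (n a l i j k m : ℕ) : Bool :=
  (bif Nat.blt i j then Nat.blt (squeezeN n a l i) (squeezeN n a l j) else true) &&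
  (bif Nat.blt k m then Nat.blt (squeezeN n a l k) (squeezeN n a l m) else true) &&
  !(compatB (n - l) (squeezeN n a l i) (squeezeN n a l j) (squeezeN n a l k) (squeezeN n a l m))

theorem crossesB_iff {n a l : ℕ} (h : a + l < n) (i j k m : ℕ) :
    crossesB n a l i j k m = true ↔
      Crosses (n - l) (squeeze n a l) ((i : ℤ), (j : ℤ)) ((k : ℤ), (m : ℤ)) := by
  have e : ((n - l : ℕ) : ℤ) = (n : ℤ) - l := by omega
  simp only [crossesB, Crosses, NonDeg, Prod.map_apply, ← squeezeN_eq h, Bool.and_eq_true,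
    Bool.not_eq_true', ← Bool.not_eq_true (compatB _ _ _ _ _), compatB_iff, e, and_assoc,
    cond_eq_ite, Nat.blt_eq, Nat.cast_lt]
  split_ifs <;> simp_all

/-- The codes of the interior arcs of `M_n`. -/
def codesList (n : ℕ) : List (ℕ × ℕ) :=
  (List.range n).flatMap fun i =>
    ((List.range (i + n + 1)).filter fun j => !(Nat.beq j (i + 1))).map fun j => (i, j)

theorem mem_codesList {n : ℕ} {c : ℕ × ℕ} :
    c ∈ codesList n ↔ c.1 < n ∧ c.2 ≤ c.1 + n ∧ c.2 ≠ c.1 + 1 := by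
  obtain ⟨i, j⟩ := c
  simp only [codesList, List.mem_flatMap, List.mem_range, List.mem_map, List.mem_filter,
    Bool.not_eq_true', Prod.mk.injEq, ← Bool.not_eq_true, Nat.beq_eq]
  constructor
  · rintro ⟨i', h1, j', ⟨h2, h3⟩, rfl, rfl⟩
    exact ⟨h1, by omega, h3⟩
  · rintro ⟨h1, h2, h3⟩
    exact ⟨i, h1, j, ⟨by omega, h3⟩, rfl, rfl⟩

/-- The position of a code in the encoding of sets of arcs in base two. -/
def pos (c : ℕ × ℕ) : ℕ := 12 * c.1 + c.2

/-- The set of the arcs that satisfy a given property. -/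
noncomputable def mask (l : List (ℕ × ℕ)) (p : ℕ × ℕ → Bool) : ℕ :=
  fold (fun c acc => bif p c then Nat.lor (2 ^ pos c) acc else acc) 0 l

theorem testBit_mask (l : List (ℕ × ℕ)) (p : ℕ × ℕ → Bool) (k : ℕ) :
    (mask l p).testBit k = true ↔ ∃ c ∈ l, p c = true ∧ pos c = k := by
  simp only [mask, fold_eq]
  induction l with
  | nil => simp
  | cons c l ih =>
    rw [List.foldr_cons]
    by_cases hc : p c
    · rw [hc, cond_true]
      change (2 ^ pos c ||| _).testBit k = true ↔ _
      rw [Nat.testBit_or, Bool.or_eq_true, ih, Nat.testBit_two_pow]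
      simp [hc]
    · rw [Bool.not_eq_true] at hc
      rw [hc, cond_false, ih]
      simp [hc]

/-- The list of the interior arcs of `M_n`, and how they cross, before and after the contractions
of some intervals. -/
noncomputable def entries (n : ℕ) (fs : List (ℕ × ℕ)) : List Entry :=
  (codesList n).map fun c =>
    ⟨2 ^ pos c, mask (codesList n) fun d => compatB n c.1 c.2 d.1 d.2,
     fs.map fun f => mask (codesList n) fun d => !crossesB n f.1 f.2 c.1 c.2 d.1 d.2⟩

/-- The arcs of a triangulation. -/
noncomputable def arcsOf (E : List Entry) (s : ℕ) : List Entry :=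
  fold (fun e acc => bif Nat.beq (Nat.land s e.bit) 0 then acc else e :: acc) [] E

/-- The arcs that can replace the arc `a` of the triangulation `s`. -/
noncomputable def residue (full : ℕ) (B : List Entry) (s a : ℕ) : ℕ :=
  Nat.xor (fold (fun e acc => bif Nat.beq e.bit a then acc else Nat.land e.comp acc) full B) s

/-- The number of contractions that make a flip trivial. -/
noncomputable def weight (b : ℕ) (ws : List ℕ) : ℕ :=
  fold (fun w acc => bif Nat.beq (Nat.land w b) 0 then acc else acc + 1) 0 ws

/-- The flips of a triangulation: the new arc, the weight and the new triangulation. -/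
noncomputable def flips (full : ℕ) (E : List Entry) (s : ℕ) : List (ℕ × ℕ × ℕ) :=
  let B := arcsOf E s
  fold (fun e acc => let r := residue full B s e.bit; bif Nat.beq r 0 then acc else
    (r, weight r e.wts, Nat.xor (Nat.xor s e.bit) r) :: acc) [] B

/-- Exploration of the triangulations by increasing distance `w`, up to distance `b`. The lists
`l0`, `l1`, `l2` are made up of triangulations at distance `w`, `w + 1`, `w + 2`. -/
noncomputable def search (full : ℕ) (E : List Entry) (b fuel : ℕ) :
    ℕ → Tree → List ℕ → List ℕ → List ℕ → Option Tree :=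
  fuel.rec (fun _ _ _ _ _ => none) fun _ ih w t l0 l1 l2 =>
    match l0 with
    | [] => bif Nat.beq w b then some t else ih (w + 1) t l1 l2 []
    | s :: l0 =>
      match t.find s with
      | some _ => ih w t l0 l1 l2
      | none =>
        let F := flips full E s
        bif fold (fun x acc => Nat.beq x.1 (2 ^ Nat.log2 x.1) && acc) true F then
          ih w (t.insert s w)
            (fold (fun x acc => bif Nat.beq x.2.1 0 then x.2.2 :: acc else acc) l0 F)
            (fold (fun x acc => bif Nat.beq x.2.1 1 then x.2.2 :: acc else acc) l1 F)
            (fold (fun x acc => bif Nat.beq x.2.1 2 then x.2.2 :: acc else acc) l2 F)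
        else none

/-- Whether the distance from `s` to `t` is greater than `b`. -/
noncomputable def avoids (n b s t : ℕ) (fs : List (ℕ × ℕ)) : Bool :=
  match search (mask (codesList n) fun _ => true) (entries n fs) b 20000 0 .leaf [s] [] [] with
  | none => false
  | some T => match T.find t with
    | none => true
    | some _ => false

theorem mem_fold_filter (k : ℕ) (l : List ℕ) (F : List (ℕ × ℕ × ℕ)) (s : ℕ) :
    s ∈ fold (fun x acc => bif Nat.beq x.2.1 k then x.2.2 :: acc else acc) l F ↔
      s ∈ l ∨ ∃ r, (r, k, s) ∈ F := by
  rw [fold_eq]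
  induction F with
  | nil => simp
  | cons x F ih =>
    rw [List.foldr_cons]
    obtain ⟨r, k', s'⟩ := x
    by_cases h : k' = k
    · subst h
      simp only [Nat.beq_refl, cond_true, List.mem_cons, ih, Prod.mk.injEq, true_and]
      constructor
      · rintro (h | h | ⟨r', h⟩)
        exacts [Or.inr ⟨r, Or.inl ⟨rfl, h⟩⟩, Or.inl h, Or.inr ⟨r', Or.inr h⟩]
      · rintro (h | ⟨r', ⟨-, h⟩ | h⟩)
        exacts [Or.inr (Or.inl h), Or.inl h, Or.inr (Or.inr ⟨r', h⟩)]
    · have h' : Nat.beq k' k = false := beq_eq_false h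
      simp only [h', cond_false, ih, List.mem_cons, Prod.mk.injEq, Ne.symm h, false_and, and_false,
        false_or]

theorem fold_and (F : List (ℕ × ℕ × ℕ)) :
    fold (fun x acc => Nat.beq x.1 (2 ^ Nat.log2 x.1) && acc) true F = true ↔
      ∀ x ∈ F, x.1 = 2 ^ Nat.log2 x.1 := by
  rw [fold_eq]
  induction F with
  | nil => simp
  | cons x F ih => rw [List.foldr_cons, Bool.and_eq_true, ih]; simp

/-- The invariant of the exploration. -/
theorem search_spec (full : ℕ) (E : List Entry) (b fuel w : ℕ) (t : Tree) (l0 l1 l2 : List ℕ)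
    (T : Tree) (h : search full E b fuel w t l0 l1 l2 = some T) (hw : w ≤ b)
    (ht : ∀ s v, t.find s = some v → v ≤ w) :
    (∀ s v, t.find s = some v → T.find s = some v) ∧
    (∀ s ∈ l0, ∃ v ≤ w, T.find s = some v) ∧
    (∀ s ∈ l1, w + 1 ≤ b → ∃ v ≤ w + 1, T.find s = some v) ∧
    (∀ s ∈ l2, w + 2 ≤ b → ∃ v ≤ w + 2, T.find s = some v) ∧
    (∀ s v, T.find s = some v → t.find s = some v ∨
      ∀ r k s', (r, k, s') ∈ flips full E s → r = 2 ^ Nat.log2 r ∧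
        (k ≤ 2 → v + k ≤ b → ∃ v' ≤ v + k, T.find s' = some v')) := by
  induction fuel generalizing w t l0 l1 l2 with
  | zero => exact absurd h (by simp [search])
  | succ fuel ih =>
    cases l0 with
    | nil =>
      change (bif Nat.beq w b then some t else search full E b fuel (w + 1) t l1 l2 []) = some T
        at h
      by_cases hwb : w = b
      · subst hwb
        simp only [Nat.beq_refl, cond_true, Option.some.injEq] at h
        subst h
        exact ⟨fun s v h => h, by simp, by omega, by omega, fun s v h => Or.inl h⟩
      · have hwb' : Nat.beq w b = false := beq_eq_false hwb
        rw [hwb', cond_false] at h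
        obtain ⟨h1, h2, h3, -, h5⟩ := ih _ _ _ _ _ h (by omega)
          (fun s v hs => (ht s v hs).trans (by omega))
        exact ⟨h1, by simp, fun s hs _ => h2 s hs, fun s hs hb => h3 s hs (by omega), h5⟩
    | cons s l0 =>
      have h' : (match t.find s with
        | some _ => search full E b fuel w t l0 l1 l2
        | none =>
          bif fold (fun x acc => Nat.beq x.1 (2 ^ Nat.log2 x.1) && acc) true (flips full E s) then
            search full E b fuel w (t.insert s w)
              (fold (fun x acc => bif Nat.beq x.2.1 0 then x.2.2 :: acc else acc) l0
                (flips full E s))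
              (fold (fun x acc => bif Nat.beq x.2.1 1 then x.2.2 :: acc else acc) l1
                (flips full E s))
              (fold (fun x acc => bif Nat.beq x.2.1 2 then x.2.2 :: acc else acc) l2
                (flips full E s))
          else none) = some T := h
      clear h
      cases hf : t.find s with
      | some v =>
        rw [hf] at h'
        obtain ⟨h1, h2, h3, h4, h5⟩ := ih _ _ _ _ _ h' hw ht
        refine ⟨h1, ?_, h3, h4, h5⟩
        intro s' hs'
        rcases List.mem_cons.1 hs' with rfl | hs'
        · exact ⟨v, ht _ _ hf, h1 _ _ hf⟩
        · exact h2 s' hs'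
      | none =>
        rw [hf] at h'
        by_cases hg : fold (fun x acc => Nat.beq x.1 (2 ^ Nat.log2 x.1) && acc) true
          (flips full E s) = true
        · simp only [hg, cond_true] at h'
          have ht' : ∀ s' v, (t.insert s w).find s' = some v → v ≤ w := by
            intro s' v
            rw [Tree.find_insert]
            split_ifs with hs
            · rintro ⟨⟩; exact le_rfl
            · exact ht s' v
          obtain ⟨h1, h2, h3, h4, h5⟩ := ih _ _ _ _ _ h' hw ht'
          simp only [mem_fold_filter] at h2 h3 h4
          rw [fold_and] at hg
          have hsT : T.find s = some w := h1 s w (by rw [Tree.find_insert, if_pos rfl])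
          refine ⟨fun s' v hs' => h1 s' v ?_, fun s' hs' => ?_, fun s' hs' => h3 s' (Or.inl hs'),
            fun s' hs' => h4 s' (Or.inl hs'), fun s' v hs' => ?_⟩
          · rw [Tree.find_insert, if_neg]
            · exact hs'
            · rintro rfl; rw [hf] at hs'; cases hs'
          · rcases List.mem_cons.1 hs' with rfl | hs'
            · exact ⟨w, le_rfl, hsT⟩
            · exact h2 s' (Or.inl hs')
          · rcases h5 s' v hs' with h6 | h6
            · rw [Tree.find_insert] at h6
              split_ifs at h6 with hss
              · subst hss
                cases h6
                refine Or.inr fun r k s'' hr => ⟨hg _ hr, fun hk hb => ?_⟩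
                interval_cases k
                · exact h2 s'' (Or.inr ⟨r, hr⟩)
                · exact h3 s'' (Or.inr ⟨r, hr⟩) hb
                · exact h4 s'' (Or.inr ⟨r, hr⟩) hb
              · exact Or.inl h6
            · exact Or.inr h6
        · rw [Bool.not_eq_true] at hg
          simp [hg] at h'

/-! ### Correctness of the exploration -/

/-- The entry of an arc in the list `entries n fs`. -/
noncomputable def entry (n : ℕ) (fs : List (ℕ × ℕ)) (c : ℕ × ℕ) : Entry :=
  ⟨2 ^ pos c, mask (codesList n) fun d => compatB n c.1 c.2 d.1 d.2,
    fs.map fun f => mask (codesList n) fun d => !crossesB n f.1 f.2 c.1 c.2 d.1 d.2⟩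

theorem mem_entries {n : ℕ} {fs : List (ℕ × ℕ)} {e : Entry} :
    e ∈ entries n fs ↔ ∃ c ∈ codesList n, entry n fs c = e := List.mem_map

theorem land_two_pow (s k : ℕ) : Nat.beq (Nat.land s (2 ^ k)) 0 = !s.testBit k := by
  have h : Nat.land s (2 ^ k) = (s.testBit k).toNat * 2 ^ k := Nat.and_two_pow s k
  rw [h]
  cases s.testBit k
  · simp
  · simp only [Bool.toNat_true, one_mul, Bool.not_true]
    exact beq_eq_false (by positivity)

theorem mem_arcsOf {E : List Entry} {s : ℕ} {e : Entry} :
    e ∈ arcsOf E s ↔ e ∈ E ∧ Nat.beq (Nat.land s e.bit) 0 = false := by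
  rw [arcsOf, fold_eq]
  induction E with
  | nil => simp
  | cons e' E ih =>
    rw [List.foldr_cons]
    cases h : Nat.beq (Nat.land s e'.bit) 0
    · rw [cond_false, List.mem_cons, ih, List.mem_cons]
      constructor
      · rintro (rfl | h')
        exacts [⟨Or.inl rfl, h⟩, ⟨Or.inr h'.1, h'.2⟩]
      · rintro ⟨rfl | h1, h2⟩
        exacts [Or.inl rfl, Or.inr ⟨h1, h2⟩]
    · rw [cond_true, ih, List.mem_cons]
      constructor
      · rintro ⟨h1, h2⟩
        exact ⟨Or.inr h1, h2⟩
      · rintro ⟨rfl | h1, h2⟩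
        · rw [h] at h2; cases h2
        · exact ⟨h1, h2⟩

theorem testBit_fold_land (full : ℕ) (B : List Entry) (a k : ℕ) :
    (fold (fun e acc => bif Nat.beq e.bit a then acc else Nat.land e.comp acc) full B).testBit k =
      true ↔ full.testBit k = true ∧ ∀ e ∈ B, e.bit ≠ a → e.comp.testBit k = true := by
  rw [fold_eq]
  induction B with
  | nil => simp
  | cons e B ih =>
    rw [List.foldr_cons]
    by_cases h : e.bit = a
    · rw [h, Nat.beq_refl, cond_true, ih]
      simp [h]
    · rw [beq_eq_false h, cond_false]
      change (e.comp &&& _).testBit k = true ↔ _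
      rw [Nat.testBit_and, Bool.and_eq_true, ih]
      simp only [List.mem_cons, forall_eq_or_imp, ne_eq, h, not_false_eq_true, true_imp_iff]
      tauto

theorem mem_flips {full : ℕ} {E : List Entry} {s : ℕ} {x : ℕ × ℕ × ℕ} :
    x ∈ flips full E s ↔ ∃ e ∈ arcsOf E s, residue full (arcsOf E s) s e.bit ≠ 0 ∧
      x = (residue full (arcsOf E s) s e.bit, weight (residue full (arcsOf E s) s e.bit) e.wts,
        Nat.xor (Nat.xor s e.bit) (residue full (arcsOf E s) s e.bit)) := by
  rw [flips]
  generalize arcsOf E s = B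
  have key : ∀ C : List Entry, (x ∈ fold (fun e acc =>
      let r := residue full B s e.bit; bif Nat.beq r 0 then acc else
    (r, weight r e.wts, Nat.xor (Nat.xor s e.bit) r) :: acc) [] C ↔
      ∃ e ∈ C, residue full B s e.bit ≠ 0 ∧
      x = (residue full B s e.bit, weight (residue full B s e.bit) e.wts,
        Nat.xor (Nat.xor s e.bit) (residue full B s e.bit))) := by
    intro C
    rw [fold_eq]
    induction C with
    | nil => simp
    | cons e C ih =>
      rw [List.foldr_cons]
      by_cases h : residue full B s e.bit = 0
      · simp only [h, Nat.beq_refl, cond_true, List.mem_cons, exists_eq_or_imp, ne_eq,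
          not_true_eq_false, false_and, false_or]
        exact ih
      · simp only [beq_eq_false h, cond_false, List.mem_cons, exists_eq_or_imp, ne_eq, h,
          not_false_eq_true, true_and]
        exact or_congr Iff.rfl ih
  exact key B

open Classical in
/-- The number of contractions of a list that make the flip exchanging two arcs trivial. -/
noncomputable def wtOf (n : ℕ) (fs : List (ℕ × ℕ)) (α β : ℤ × ℤ) : ℕ :=
  fs.foldr (fun f acc =>
    if Crosses ((n : ℤ) - f.2) (squeeze n f.1 f.2) α β then acc else acc + 1) 0

/-- The pair of integers that corresponds to a pair of natural numbers. -/
def toZ (c : ℕ × ℕ) : ℤ × ℤ := (c.1, c.2)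

theorem toZ_injective : Function.Injective toZ := by
  rintro ⟨a, b⟩ ⟨c, d⟩ h
  simp only [toZ, Prod.mk.injEq, Nat.cast_inj] at h
  rw [h.1, h.2]

theorem exists_toZ {n : ℕ} {c : ℤ × ℤ} (hc : IsCode n c) (h : c.2 ≠ c.1 + 1) :
    ∃ d ∈ codesList n, toZ d = c := by
  obtain ⟨i, j⟩ := c
  obtain ⟨h1, h2, h3, h4⟩ := hc
  simp only at *
  lift i to ℕ using h1
  lift j to ℕ using h3
  exact ⟨(i, j), mem_codesList.2 ⟨by simp only; omega, by simp only; omega, by simp only; omega⟩,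
    rfl⟩

theorem pos_injOn {n : ℕ} (hn : n ≤ 6) {c d : ℕ × ℕ} (hc : c ∈ codesList n)
    (hd : d ∈ codesList n) (h : pos c = pos d) : c = d := by
  rw [mem_codesList] at hc hd
  simp only [pos] at h
  refine Prod.ext ?_ ?_ <;> omega

/-- The number `s` encodes the set of the interior arcs of `U`. -/
def Rep (n s : ℕ) (U : Finset (ℤ × ℤ)) : Prop :=
  ∀ k, s.testBit k = true ↔ ∃ c ∈ codesList n, toZ c ∈ U ∧ pos c = k

theorem Rep.testBit {n s : ℕ} {U : Finset (ℤ × ℤ)} (h : Rep n s U) (hn : n ≤ 6) {c : ℕ × ℕ}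
    (hc : c ∈ codesList n) : s.testBit (pos c) = true ↔ toZ c ∈ U := by
  rw [h]
  exact ⟨fun ⟨d, hd, h1, h2⟩ => pos_injOn hn hd hc h2 ▸ h1, fun h => ⟨c, hc, h, rfl⟩⟩

theorem compat_boundary {n : ℤ} {c d : ℤ × ℤ} (hc : IsCode n c) (hd : IsCode n d)
    (h : c.2 = c.1 + 1) : Compat n c d := by
  obtain ⟨h1, h2, h3, h4⟩ := hc
  obtain ⟨h1', h2', h3', h4'⟩ := hd
  simp only [Compat, PlanarPlanar, PlanarCrossing, CrossingCrossing]
  omega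

theorem wtOf_eq {n : ℕ} (hn : n ≤ 6) {fs : List (ℕ × ℕ)} (hfs : ∀ f ∈ fs, f.1 + f.2 < n)
    {c d : ℕ × ℕ} (hd : d ∈ codesList n) :
    weight (2 ^ pos d) (entry n fs c).wts = wtOf n fs (toZ c) (toZ d) := by
  simp only [weight, entry, wtOf, fold_eq]
  induction fs with
  | nil => rfl
  | cons f fs ih =>
    rw [List.map_cons, List.foldr_cons, List.foldr_cons,
      ih fun f' hf' => hfs f' (List.mem_cons_of_mem _ hf'), land_two_pow]
    have h1 := crossesB_iff (hfs f List.mem_cons_self) c.1 c.2 d.1 d.2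
    have h2 : (mask (codesList n) fun d => !crossesB n f.1 f.2 c.1 c.2 d.1 d.2).testBit (pos d) =
        !crossesB n f.1 f.2 c.1 c.2 d.1 d.2 := by
      rw [Bool.eq_iff_iff, testBit_mask]
      exact ⟨fun ⟨e, he, h3, h4⟩ => pos_injOn hn he hd h4 ▸ h3, fun h => ⟨d, hd, h, rfl⟩⟩
    rw [h2]
    simp only [toZ, ← h1]
    cases crossesB n f.1 f.2 c.1 c.2 d.1 d.2 <;> simp

/-- Every flip appears in the list of the flips. -/
theorem exists_mem_flips {n : ℕ} (hn0 : 0 < n) (hn : n ≤ 6) {fs : List (ℕ × ℕ)}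
    (hfs : ∀ f ∈ fs, f.1 + f.2 < n) {s : ℕ} {U : Finset (ℤ × ℤ)} {α β : ℤ × ℤ} (hs : Rep n s U)
    (hU : Tight n U) (hα : α ∈ U) (hβ : β ∉ U) (hV : Tight n (insert β (U.erase α)))
    (hgood : ∀ r k s', (r, k, s') ∈ flips (mask (codesList n) fun _ => true) (entries n fs) s →
      r = 2 ^ Nat.log2 r) :
    ∃ r s', (r, wtOf n fs α β, s') ∈
      flips (mask (codesList n) fun _ => true) (entries n fs) s ∧
        Rep n s' (insert β (U.erase α)) := by
  have hn0' : (0 : ℤ) < n := by omega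
  have tU := hU.isTri hn0'
  have tV := hV.isTri hn0'
  have hβV := Finset.mem_insert_self β (U.erase α)
  have hne : α ≠ β := by rintro rfl; exact hβ hα
  have hαV : α ∉ insert β (U.erase α) := by simp [hne]
  have bα : α.2 ≠ α.1 + 1 := fun h => hαV <| tV.2 _ (tU.1.1 α hα) fun d hd =>
    compat_boundary (tU.1.1 α hα) (tV.1.1 d hd) h
  have bβ : β.2 ≠ β.1 + 1 := fun h => hβ <| tU.2 _ (tV.1.1 β hβV) fun d hd =>
    compat_boundary (tV.1.1 β hβV) (tU.1.1 d hd) h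
  obtain ⟨a, ha, rfl⟩ := exists_toZ (tU.1.1 α hα) bα
  obtain ⟨b, hb, rfl⟩ := exists_toZ (tV.1.1 β hβV) bβ
  set full := mask (codesList n) fun _ => true
  set r := residue full (arcsOf (entries n fs) s) s (2 ^ pos a) with hr
  have mema : entry n fs a ∈ arcsOf (entries n fs) s := by
    rw [mem_arcsOf, mem_entries]
    refine ⟨⟨a, ha, rfl⟩, ?_⟩
    change Nat.beq (Nat.land s (2 ^ pos a)) 0 = false
    rw [land_two_pow, (hs.testBit hn ha).2 hα, Bool.not_true]
  have hrb : r.testBit (pos b) = true := by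
    change (fold _ full _ ^^^ s).testBit (pos b) = true
    have h1 : s.testBit (pos b) = false := by
      rw [← Bool.not_eq_true, hs.testBit hn hb]; exact hβ
    rw [Nat.testBit_xor, h1, Bool.xor_false, testBit_fold_land]
    refine ⟨(testBit_mask _ _ _).2 ⟨b, hb, rfl, rfl⟩, fun e he hea => ?_⟩
    obtain ⟨he1, he2⟩ := mem_arcsOf.1 he
    obtain ⟨c, hc, rfl⟩ := mem_entries.1 he1
    change Nat.beq (Nat.land s (2 ^ pos c)) 0 = false at he2
    rw [land_two_pow, Bool.not_eq_false', hs.testBit hn hc] at he2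
    change (mask (codesList n) fun d => compatB n c.1 c.2 d.1 d.2).testBit (pos b) = true
    rw [testBit_mask]
    refine ⟨b, hb, ?_, rfl⟩
    rw [compatB_iff]
    refine tV.1.2 _ (Finset.mem_insert_of_mem (Finset.mem_erase.2 ⟨?_, he2⟩)) _ hβV
    intro h
    have : c = a := toZ_injective h
    subst this
    exact hea rfl
  have hr0 : r ≠ 0 := by rintro h; rw [h] at hrb; simp at hrb
  have hflip : (r, weight r (entry n fs a).wts, Nat.xor (Nat.xor s (2 ^ pos a)) r) ∈
      flips full (entries n fs) s := mem_flips.2 ⟨_, mema, hr0, rfl⟩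
  have hrp : r = 2 ^ pos b := by
    have h1 := hgood _ _ _ hflip
    rw [h1, Nat.testBit_two_pow, decide_eq_true_iff] at hrb
    rw [h1, hrb]
  refine ⟨r, Nat.xor (Nat.xor s (2 ^ pos a)) r, ?_, ?_⟩
  · rw [← wtOf_eq hn hfs hb, ← hrp]
    exact hflip
  · intro k
    have hxor : (Nat.xor (Nat.xor s (2 ^ pos a)) r).testBit k =
        ((s.testBit k ^^ decide (pos a = k)) ^^ decide (pos b = k)) := by
      change ((s ^^^ 2 ^ pos a) ^^^ r).testBit k = _
      rw [Nat.testBit_xor, Nat.testBit_xor, hrp, Nat.testBit_two_pow, Nat.testBit_two_pow]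
    rw [hxor]
    by_cases h1 : pos a = k
    · subst h1
      have h2 : pos b ≠ pos a := fun h => hne (by rw [pos_injOn hn hb ha h])
      rw [(hs.testBit hn ha).2 hα]
      simp only [decide_true, Bool.xor_self, h2, decide_false, Bool.false_eq_true,
        false_iff, not_exists, not_and]
      intro c hc hcV hca
      rw [pos_injOn hn hc ha hca] at hcV
      exact hαV hcV
    · by_cases h2 : pos b = k
      · subst h2
        have h3 : s.testBit (pos b) = false := by
          rw [← Bool.not_eq_true, hs.testBit hn hb]; exact hβ
        simp only [h3, h1, decide_false, Bool.xor_false, decide_true, Bool.false_xor, true_iff]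
        exact ⟨b, hb, hβV, rfl⟩
      · simp only [h1, h2, decide_false, Bool.xor_false]
        rw [hs k]
        refine exists_congr fun c => and_congr_right fun hc => and_congr_left fun hck => ?_
        have h3 : toZ c ≠ toZ a := fun h => h1 (by rw [← toZ_injective h, hck])
        have h4 : toZ c ≠ toZ b := fun h => h2 (by rw [← toZ_injective h, hck])
        simp [h3, h4]

/-- A successful exploration bounds the weights of the paths. -/
theorem lt_of_avoids {n : ℕ} (hn0 : 0 < n) (hn : n ≤ 6) {fs : List (ℕ × ℕ)}
    (hfs : ∀ f ∈ fs, f.1 + f.2 < n) (hlen : fs.length ≤ 2) {b s t : ℕ} {U V : Finset (ℤ × ℤ)}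
    (hs : Rep n s U) (ht : Rep n t V) (h : avoids n b s t fs = true) {k : ℕ}
    (hp : Path n (wtOf n fs) k U V) : b < k := by
  by_contra! hk
  simp only [avoids] at h
  split at h
  · cases h
  · rename_i T hT
    obtain ⟨-, h1, -, -, h2⟩ := search_spec _ _ _ _ _ _ _ _ _ _ hT (Nat.zero_le b)
      (fun s v hs => by cases hs)
    have hwt : ∀ α β, wtOf n fs α β ≤ 2 := by
      intro α β
      refine le_trans ?_ hlen
      clear hfs hlen hT h hp h2
      induction fs with
      | nil => simp [wtOf]
      | cons f fs ih =>
        simp only [wtOf, List.foldr_cons, List.length_cons] at ih ⊢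
        split_ifs <;> omega
    have key : ∀ {k : ℕ} {V : Finset (ℤ × ℤ)}, Path n (wtOf n fs) k U V → k ≤ b →
        ∃ t, Rep n t V ∧ ∃ v ≤ k, T.find t = some v := by
      clear hp h ht V hk k
      intro k V hp
      induction hp with
      | refl _ => exact fun _ => ⟨s, hs, h1 s (by simp)⟩
      | @step k U V α β hp hα hβ hW ih =>
        intro hk
        obtain ⟨u, hu, v, hv, huv⟩ := ih hs (by omega)
        have h3 := (h2 u v huv).resolve_left (by intro h; cases h)
        obtain ⟨r, s', hr, hs'⟩ := exists_mem_flips hn0 hn hfs hu hp.tight_right hα hβ hW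
          fun r k s' h => (h3 r k s' h).1
        obtain ⟨v', hv', hv''⟩ := (h3 _ _ _ hr).2 (hwt α β) (by omega)
        exact ⟨s', hs', v', by omega, hv''⟩
    obtain ⟨t', ht', v, -, hv⟩ := key hp hk
    have : t' = t := Nat.eq_of_testBit_eq fun i => by
      rw [Bool.eq_iff_iff, ht' i, ht i]
    rw [this] at hv
    rw [hv] at h
    cases h

/-! ### Zigzag triangulations -/

/-- The only crossing arc of `U` is a one-sided loop at the vertex opposite to the vertex `0`, and
its planar arcs form a zigzag around `0`. -/
def IsZig (m : ℤ) (U : Finset (ℤ × ℤ)) : Prop :=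
  ∀ c, c ∈ U ↔ IsCode m c ∧ (c.2 = c.1 + 1 ∨ (c.1 = (m + 1) / 2 ∧ c.2 = (m + 1) / 2) ∨
    (c.1 < c.2 ∧ (c.1 + c.2 = 2 * m ∨ c.1 + c.2 = 2 * m + 1)))

/-- The only crossing arc of `U` is a one-sided loop at the vertex `0`, and its planar arcs form a
zigzag around the opposite vertex. -/
def IsZag (m : ℤ) (U : Finset (ℤ × ℤ)) : Prop :=
  ∀ c, c ∈ U ↔ IsCode m c ∧ (c.2 = c.1 + 1 ∨ (c.1 = 0 ∧ c.2 = 0) ∨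
    (c.1 < c.2 ∧ (c.1 + c.2 = m ∨ c.1 + c.2 = m + 1)))

theorem squeeze_cases {n a l : ℤ} (hl : 0 ≤ l) (_ : a + l < n) (x : ℤ) :
    (x ≤ a ∧ squeeze n a l x = x) ∨ (a ≤ x ∧ x ≤ a + l ∧ squeeze n a l x = a) ∨
    (a + l ≤ x ∧ x ≤ a + n ∧ squeeze n a l x = x - l) ∨
    (a + n ≤ x ∧ x ≤ a + l + n ∧ squeeze n a l x = a + n - l) ∨
    (a + l + n ≤ x ∧ squeeze n a l x = x - 2 * l) := by
  simp only [squeeze]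
  split_ifs <;> omega

theorem isZig_contract_one {m : ℤ} {U : Finset (ℤ × ℤ)} (hU : IsZig m U) (hm : 3 ≤ m) :
    IsZig (m - 1) (contract (squeeze m (m / 2) 1) U) := by
  have hc := isContraction_squeeze (n := m) (a := m / 2) (l := 1) (by omega) (by omega) (by omega)
  obtain ⟨k, hk⟩ : ∃ k, (k = m / 2 ∧ (m = 2 * k ∨ m = 2 * k + 1)) := ⟨m / 2, rfl, by omega⟩
  have key : ∀ x, 0 ≤ x → x < 2 * m → (x ≤ k ∧ squeeze m k 1 x = x) ∨
      (k + 1 ≤ x ∧ x ≤ k + m ∧ squeeze m k 1 x = x - 1) ∨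
      (k + m + 1 ≤ x ∧ squeeze m k 1 x = x - 2) := by
    intro x h1 h2
    have := squeeze_cases (n := m) (a := k) (l := 1) (by omega) (by omega) x
    omega
  rw [← hk.1] at hc ⊢
  rintro ⟨i', j'⟩
  rw [mem_contract]
  constructor
  · rintro ⟨⟨i, j⟩, h1, h2, h3⟩
    obtain ⟨h4, h5⟩ := (hU _).1 h1
    have h6 := hc.isCode h4
    rw [h3] at h6
    refine ⟨h6, ?_⟩
    obtain ⟨h7, h8, h9, h10⟩ := h4
    simp only [NonDeg, Prod.map_apply, Prod.mk.injEq] at *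
    have k1 := key i h7 (by omega)
    have k2 := key j h9 (by omega)
    generalize squeeze m k 1 i = u at *
    generalize squeeze m k 1 j = v at *
    obtain ⟨rfl, rfl⟩ := h3
    clear hU hc key
    rcases h5 with h5 | h5 | h5
    · left; omega
    · right; left; omega
    · omega
  · rintro ⟨⟨h7, h8, h9, h10⟩, h5⟩
    simp only at *
    suffices hs : ∃ i j, IsCode m (i, j) ∧ (j = i + 1 ∨ (i = (m + 1) / 2 ∧ j = (m + 1) / 2) ∨
        (i < j ∧ (i + j = 2 * m ∨ i + j = 2 * m + 1))) ∧ squeeze m k 1 i = i' ∧ squeeze m k 1 j = j' ∧ (i < j → i' < j') by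
      obtain ⟨i, j, h0, h1, rfl, rfl, h3⟩ := hs
      exact ⟨(i, j), (hU _).2 ⟨h0, h1⟩, h3, rfl⟩
    rcases h5 with h5 | h5 | h5
    · rcases lt_or_ge i' k with h | h
      · have k1 := key i' h7 (by omega)
        have k2 := key j' h9 (by omega)
        exact ⟨i', j', ⟨h7, by simp only; omega, h9, by simp only; omega⟩, Or.inl h5, by omega,
          by omega, by omega⟩
      · have k1 := key (i' + 1) (by omega) (by omega)
        have k2 := key (j' + 1) (by omega) (by omega)
        exact ⟨i' + 1, j' + 1, ⟨by simp only; omega, by simp only; omega, by simp only; omega,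
          by simp only; omega⟩, Or.inl (by omega), by omega, by omega, by omega⟩
    · have k1 := key ((m + 1) / 2) (by omega) (by omega)
      exact ⟨(m + 1) / 2, (m + 1) / 2, ⟨by simp only; omega, by simp only; omega, by simp only; omega,
        by simp only; omega⟩, Or.inr (Or.inl ⟨rfl, rfl⟩), by omega, by omega,
        fun h => absurd h (lt_irrefl _)⟩
    · have k1 := key (i' + 1) (by omega) (by omega)
      have k2 := key (j' + 1) (by omega) (by omega)
      exact ⟨i' + 1, j' + 1, ⟨by simp only; omega, by simp only; omega, by simp only; omega,
        by simp only; omega⟩, Or.inr (Or.inr (by omega)), by omega, by omega, by omega⟩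

theorem isZag_contract_one {m : ℤ} {U : Finset (ℤ × ℤ)} (hU : IsZag m U) (hm : 3 ≤ m) :
    IsZag (m - 1) (contract (squeeze m (m / 2) 1) U) := by
  have hc := isContraction_squeeze (n := m) (a := m / 2) (l := 1) (by omega) (by omega) (by omega)
  obtain ⟨k, hk⟩ : ∃ k, (k = m / 2 ∧ (m = 2 * k ∨ m = 2 * k + 1)) := ⟨m / 2, rfl, by omega⟩
  have key : ∀ x, 0 ≤ x → x < 2 * m → (x ≤ k ∧ squeeze m k 1 x = x) ∨
      (k + 1 ≤ x ∧ x ≤ k + m ∧ squeeze m k 1 x = x - 1) ∨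
      (k + m + 1 ≤ x ∧ squeeze m k 1 x = x - 2) := by
    intro x h1 h2
    have := squeeze_cases (n := m) (a := k) (l := 1) (by omega) (by omega) x
    omega
  rw [← hk.1] at hc ⊢
  rintro ⟨i', j'⟩
  rw [mem_contract]
  constructor
  · rintro ⟨⟨i, j⟩, h1, h2, h3⟩
    obtain ⟨h4, h5⟩ := (hU _).1 h1
    have h6 := hc.isCode h4
    rw [h3] at h6
    refine ⟨h6, ?_⟩
    obtain ⟨h7, h8, h9, h10⟩ := h4
    simp only [NonDeg, Prod.map_apply, Prod.mk.injEq] at *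
    have k1 := key i h7 (by omega)
    have k2 := key j h9 (by omega)
    generalize squeeze m k 1 i = u at *
    generalize squeeze m k 1 j = v at *
    obtain ⟨rfl, rfl⟩ := h3
    clear hU hc key
    rcases h5 with h5 | h5 | h5
    · left; omega
    · right; left; omega
    · omega
  · rintro ⟨⟨h7, h8, h9, h10⟩, h5⟩
    simp only at *
    suffices hs : ∃ i j, IsCode m (i, j) ∧ (j = i + 1 ∨ (i = 0 ∧ j = 0) ∨
        (i < j ∧ (i + j = m ∨ i + j = m + 1))) ∧ squeeze m k 1 i = i' ∧ squeeze m k 1 j = j' ∧ (i < j → i' < j') by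
      obtain ⟨i, j, h0, h1, rfl, rfl, h3⟩ := hs
      exact ⟨(i, j), (hU _).2 ⟨h0, h1⟩, h3, rfl⟩
    rcases h5 with h5 | h5 | h5
    · rcases lt_or_ge i' k with h | h
      · have k1 := key i' h7 (by omega)
        have k2 := key j' h9 (by omega)
        exact ⟨i', j', ⟨h7, by simp only; omega, h9, by simp only; omega⟩, Or.inl h5, by omega,
          by omega, by omega⟩
      · have k1 := key (i' + 1) (by omega) (by omega)
        have k2 := key (j' + 1) (by omega) (by omega)
        exact ⟨i' + 1, j' + 1, ⟨by simp only; omega, by simp only; omega, by simp only; omega,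
          by simp only; omega⟩, Or.inl (by omega), by omega, by omega, by omega⟩
    · have k1 := key (0) (by omega) (by omega)
      exact ⟨0, 0, ⟨by simp only; omega, by simp only; omega, by simp only; omega,
        by simp only; omega⟩, Or.inr (Or.inl ⟨rfl, rfl⟩), by omega, by omega,
        fun h => absurd h (lt_irrefl _)⟩
    · have k1 := key (i') (by omega) (by omega)
      have k2 := key (j' + 1) (by omega) (by omega)
      exact ⟨i', j' + 1, ⟨by simp only; omega, by simp only; omega, by simp only; omega,
        by simp only; omega⟩, Or.inr (Or.inr (by omega)), by omega, by omega, by omega⟩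

/-- The contraction of `M_m` onto `M_6` that only keeps the five boundary arcs between `b` and
`b + 5` and the boundary arc from `m - 1` to `m`. -/
def keep (m b : ℤ) : ℤ → ℤ := squeeze (m - b) 5 (m - 6 - b) ∘ squeeze m 0 b

theorem isGood_keep {m b : ℤ} (hb : 0 ≤ b) (h : b + 5 < m) : IsGood m 6 (keep m b) := by
  have h1 := isGood_squeeze (n := m) (a := 0) (l := b) le_rfl hb (by omega)
  have h2 := isGood_squeeze (n := m - b) (a := 5) (l := m - 6 - b) (by omega) (by omega) (by omega)
  have h3 := h1.comp (by omega) h2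
  rwa [show m - b - (m - 6 - b) = 6 by ring] at h3

theorem keep_cases {m b x : ℤ} (hb : 0 ≤ b) (h : b + 5 < m) (hx : 0 ≤ x) (hx' : x < 2 * m) :
    (x ≤ b ∧ keep m b x = 0) ∨ (b ≤ x ∧ x ≤ b + 5 ∧ keep m b x = x - b) ∨
    (b + 5 ≤ x ∧ x ≤ m - 1 ∧ keep m b x = 5) ∨
    (m ≤ x ∧ x ≤ m + b ∧ keep m b x = 6) ∨
    (m + b ≤ x ∧ x ≤ m + b + 5 ∧ keep m b x = x - m - b + 6) ∨
    (m + b + 5 ≤ x ∧ keep m b x = 11) := by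
  simp only [keep, Function.comp]
  have k1 := squeeze_cases (n := m) (a := 0) (l := b) hb (by omega) x
  have k2 := squeeze_cases (n := m - b) (a := 5) (l := m - 6 - b) (by omega) (by omega)
    (squeeze m 0 b x)
  generalize squeeze (m - b) 5 (m - 6 - b) (squeeze m 0 b x) = u at *
  generalize squeeze m 0 b x = v at *
  rcases le_or_gt x b with c1 | c1
  · exact Or.inl ⟨c1, by omega⟩
  refine Or.inr ?_
  rcases le_or_gt x (b + 5) with c2 | c2
  · exact Or.inl ⟨c1.le, c2, by omega⟩
  refine Or.inr ?_
  rcases le_or_gt x (m - 1) with c3 | c3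
  · exact Or.inl ⟨c2.le, c3, by omega⟩
  refine Or.inr ?_
  rcases le_or_gt x (m + b) with c4 | c4
  · exact Or.inl ⟨by omega, c4, by omega⟩
  refine Or.inr ?_
  rcases le_or_gt x (m + b + 5) with c5 | c5
  · exact Or.inl ⟨c4.le, c5, by omega⟩
  exact Or.inr ⟨c5.le, by omega⟩

/-- The contraction of boundary arcs that `keep m b` keeps is independent of `keep m b`: two points
separated by both are separated by the common contraction. -/
theorem keep_separated {m b a l x y : ℤ} (hb : 0 ≤ b) (h : b + 5 < m) (ha : 1 ≤ a) (hl : 0 ≤ l)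
    (hal : a + l ≤ 4) (hx : 0 ≤ x) (hx' : x < 2 * m) (hy : 0 ≤ y) (hy' : y < 2 * m)
    (h1 : keep m b x < keep m b y) (h2 : squeeze m (b + a) l x < squeeze m (b + a) l y) :
    (squeeze 6 a l ∘ keep m b) x < (squeeze 6 a l ∘ keep m b) y := by
  simp only [Function.comp]
  by_contra! hc
  have k1 := squeeze_cases (n := 6) (a := a) (l := l) hl (by omega) (keep m b x)
  have k2 := squeeze_cases (n := 6) (a := a) (l := l) hl (by omega) (keep m b y)
  have k3 : (a ≤ keep m b x ∧ keep m b y ≤ a + l) ∨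
      (a + 6 ≤ keep m b x ∧ keep m b y ≤ a + 6 + l) := by
    generalize squeeze 6 a l (keep m b x) = u1 at *
    generalize squeeze 6 a l (keep m b y) = u2 at *
    generalize keep m b x = u3 at *
    generalize keep m b y = u4 at *
    omega
  clear k1 k2 hc
  have k4 := keep_cases hb h hx hx'
  have k5 := keep_cases hb h hy hy'
  have k4' : (keep m b x ≤ 4 → 1 ≤ keep m b x → x = b + keep m b x) ∧
      (7 ≤ keep m b x → keep m b x ≤ 10 → x = b + m + keep m b x - 6) := by
    generalize keep m b x = u3 at *
    omega
  have k5' : (keep m b y ≤ 4 → 1 ≤ keep m b y → y = b + keep m b y) ∧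
      (7 ≤ keep m b y → keep m b y ≤ 10 → y = b + m + keep m b y - 6) := by
    generalize keep m b y = u4 at *
    omega
  clear k4 k5
  have k6 : (b + a ≤ x ∧ x < y ∧ y ≤ b + a + l) ∨
      (b + a + m ≤ x ∧ x < y ∧ y ≤ b + a + m + l) := by
    rcases k3 with k3 | k3 <;> omega
  clear k3 k4' k5' h1
  have k7 := squeeze_cases (n := m) (a := b + a) (l := l) hl (by omega) x
  have k8 := squeeze_cases (n := m) (a := b + a) (l := l) hl (by omega) y
  generalize squeeze m (b + a) l x = u5 at *
  generalize squeeze m (b + a) l y = u6 at *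
  omega

/-! ### A lower bound on the distance between zigzag triangulations -/

theorem Path.congr {n : ℤ} {wt wt' : ℤ × ℤ → ℤ × ℤ → ℕ} {k : ℕ} {U V : Finset (ℤ × ℤ)}
    (h : Path n wt k U V) (he : ∀ α β, IsCode n α → IsCode n β → wt α β = wt' α β) :
    Path n wt' k U V := by
  induction h with
  | refl h => exact .refl h
  | @step k U V α β h hα hβ hW ih =>
    rw [he α β (h.tight_right.1.1 α hα) (hW.1.1 β (Finset.mem_insert_self _ _))]
    exact .step ih hα hβ hW

open Classical in
theorem wtOf_pair (n a l a' l' : ℕ) (α β : ℤ × ℤ) : wtOf n [(a, l), (a', l')] α β =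
    (if Crosses ((n : ℤ) - l) (squeeze n a l) α β then 0 else 1) +
      if Crosses ((n : ℤ) - l') (squeeze n a' l') α β then 0 else 1 := by
  simp only [wtOf, List.foldr_cons, List.foldr_nil]
  split_ifs <;> rfl

/-- All the flips become trivial when all the boundary arcs but one are contracted. -/
theorem wtOf_eq_one {n : ℕ} (hn : 0 < n) {α β : ℤ × ℤ} (hα : IsCode n α) (hβ : IsCode n β) :
    wtOf n [(0, n - 1)] α β = 1 := by
  have hc := isContraction_squeeze (n := n) (a := (0 : ℕ)) (l := (n - 1 : ℕ)) (by omega) (by omega)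
    (by omega)
  simp only [wtOf, List.foldr_cons, List.foldr_nil]
  rw [if_neg]
  rintro ⟨-, -, h⟩
  apply h
  obtain ⟨h1, h2, h3, h4⟩ := hc.isCode hα
  obtain ⟨h5, h6, h7, h8⟩ := hc.isCode hβ
  simp only [Compat, PlanarPlanar, PlanarCrossing, CrossingCrossing]
  omega

/-- A path is contracted by `R`, `S` and `S'` simultaneously, where `R` is independent of `S` and of
`S'`. In `M_6`, the weight of a flip is the number of the contractions `squeeze 6 a l` and
`squeeze 6 a' l'` that make it trivial: as the flip is not trivial in `M_6`, it is then trivial in as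
many of the contractions `S` and `S'`. -/
theorem Path.project {m : ℤ} (hm : 0 < m) {R S S' : ℤ → ℤ} {a l a' l' : ℕ}
    (hal : a + l < 6) (hal' : a' + l' < 6)
    (hR : IsGood m 6 R) (hS : IsGood m (m - l) S) (hS' : IsGood m (m - l') S')
    (sep : ∀ x y, 0 ≤ x → x < 2 * m → 0 ≤ y → y < 2 * m → R x < R y → S x < S y →
      (squeeze 6 a l ∘ R) x < (squeeze 6 a l ∘ R) y)
    (sep' : ∀ x y, 0 ≤ x → x < 2 * m → 0 ≤ y → y < 2 * m → R x < R y → S' x < S' y →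
      (squeeze 6 a' l' ∘ R) x < (squeeze 6 a' l' ∘ R) y)
    {k : ℕ} {U V : Finset (ℤ × ℤ)} (h : Path m (fun _ _ => 1) k U V) :
    ∃ p q w, Path (m - l) (fun _ _ => 1) p (contract S U) (contract S V) ∧
      Path (m - l') (fun _ _ => 1) q (contract S' U) (contract S' V) ∧
      Path 6 (wtOf 6 [(a, l), (a', l')]) w (contract R U) (contract R V) ∧
      p ≤ k ∧ q ≤ k ∧ w + p + q ≤ 2 * k := by
  classical
  induction h with
  | @refl U h =>
    exact ⟨0, 0, 0, .refl (hS.tight _ h), .refl (hS'.tight _ h), .refl (hR.tight _ h), le_rfl,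
      le_rfl, le_rfl⟩
  | @step k U V α β h hα hβ hW ih =>
    obtain ⟨p, q, w, hp, hq, hw, hpk, hqk, hsum⟩ := ih
    have tV := h.tight_right
    have cα := tV.1.1 α hα
    have cβ := hW.1.1 β (Finset.mem_insert_self _ _)
    have hE := exchangeable_of_flip (tV.isTri hm) hα (hW.isTri hm)
    have stepS : ∀ {n' : ℤ} {f : ℤ → ℤ} {r : ℕ} (wt : ℤ × ℤ → ℤ × ℤ → ℕ), IsGood m n' f →
        Path n' wt r (contract f U) (contract f V) →
        Path n' wt (r + if Crosses n' f α β then wt (Prod.map f f α) (Prod.map f f β) else 0)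
          (contract f U) (contract f (insert β (V.erase α))) := by
      intro n' f r wt hf hr
      rcases hf.flip hm tV hα hβ hW with ⟨h1, h2⟩ | ⟨h1, h2, h3, h4⟩
      · rw [h1, if_neg h2]; exact hr
      · rw [if_pos h1]
        have h5 := hf.tight _ hW
        rw [h4] at h5 ⊢
        exact .step hr h2 h3 h5
    have comp : ∀ {a l : ℕ} {S : ℤ → ℤ}, a + l < 6 → IsGood m (m - l) S →
        (∀ x y, 0 ≤ x → x < 2 * m → 0 ≤ y → y < 2 * m → R x < R y → S x < S y →
          (squeeze 6 a l ∘ R) x < (squeeze 6 a l ∘ R) y) →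
        Crosses 6 R α β → Crosses (m - l) S α β →
        Crosses (6 - l) (squeeze 6 a l) (Prod.map R R α) (Prod.map R R β) := by
      intro a l S hal hS sep h1 h2
      have hf := hR.toIsContraction.comp hm
        (isContraction_squeeze (n := 6) (a := a) (l := l) (by omega) (by omega) (by omega))
      obtain ⟨h3, h4, h5⟩ := hf.crosses_of_separated hR.toIsContraction hS.toIsContraction sep cα
        cβ hE h1 h2
      have key : ∀ c, IsCode m c → NonDeg (squeeze 6 a l ∘ R) c →
          NonDeg (squeeze 6 a l) (Prod.map R R c) := fun c hc hc' h =>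
        hc' (hR.toIsContraction.lt (by have := hc.1; have := hc.2.1; omega) hc.2.2.1 h)
      exact ⟨key α cα h3, key β cβ h4, h5⟩
    refine ⟨_, _, _, stepS _ hS hp, stepS _ hS' hq, stepS _ hR hw, ?_, ?_, ?_⟩
    · split_ifs <;> omega
    · split_ifs <;> omega
    · have h1 := comp hal hS sep
      have h2 := comp hal' hS' sep'
      rw [wtOf_pair]
      push_cast
      split_ifs <;> first | omega | (exfalso; tauto)

theorem rep_mask {n : ℕ} {p : ℕ × ℕ → Bool} {U : Finset (ℤ × ℤ)}
    (h : ∀ c ∈ codesList n, p c = true ↔ toZ c ∈ U) : Rep n (mask (codesList n) p) U := by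
  intro k
  rw [testBit_mask]
  exact exists_congr fun c => and_congr_right fun hc => by rw [h c hc]

/-- The base two code of `IsZig`. -/
noncomputable def zigMask (n : ℕ) : ℕ := mask (codesList n) fun c =>
  (Nat.beq c.1 ((n + 1) / 2) && Nat.beq c.2 ((n + 1) / 2)) ||
    (Nat.blt c.1 c.2 && (Nat.beq (c.1 + c.2) (2 * n) || Nat.beq (c.1 + c.2) (2 * n + 1)))

/-- The base two code of `IsZag`. -/
noncomputable def zagMask (n : ℕ) : ℕ := mask (codesList n) fun c =>
  (Nat.beq c.1 0 && Nat.beq c.2 0) ||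
    (Nat.blt c.1 c.2 && (Nat.beq (c.1 + c.2) n || Nat.beq (c.1 + c.2) (n + 1)))

theorem isCode_toZ {n : ℕ} {c : ℕ × ℕ} (hc : c ∈ codesList n) : IsCode n (toZ c) := by
  rw [mem_codesList] at hc
  refine ⟨?_, ?_, ?_, ?_⟩ <;> simp only [toZ] <;> omega

theorem IsZig.rep {n : ℕ} {U : Finset (ℤ × ℤ)} (hU : IsZig n U) :
    Rep n (zigMask n) U := by
  refine rep_mask fun c hc => ?_
  have h1 := isCode_toZ hc
  rw [mem_codesList] at hc
  rw [hU, and_iff_right h1]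
  simp only [Bool.or_eq_true, Bool.and_eq_true, Nat.beq_eq, Nat.blt_eq, toZ]
  omega

theorem IsZag.rep {n : ℕ} {U : Finset (ℤ × ℤ)} (hU : IsZag n U) :
    Rep n (zagMask n) U := by
  refine rep_mask fun c hc => ?_
  have h1 := isCode_toZ hc
  rw [mem_codesList] at hc
  rw [hU, and_iff_right h1]
  simp only [Bool.or_eq_true, Bool.and_eq_true, Nat.beq_eq, Nat.blt_eq, toZ]
  omega

set_option maxRecDepth 100000

theorem avoids_two : avoids 2 0 (zigMask 2) (zagMask 2) [(0, 1)] = true := by decide +kernel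

theorem avoids_three : avoids 3 2 (zigMask 3) (zagMask 3) [(0, 2)] = true := by decide +kernel

theorem avoids_four : avoids 4 5 (zigMask 4) (zagMask 4) [(0, 3)] = true := by decide +kernel

theorem avoids_five : avoids 5 7 (zigMask 5) (zagMask 5) [(0, 4)] = true := by decide +kernel

theorem avoids_six : avoids 6 10 (zigMask 6) (zagMask 6) [(0, 5)] = true := by decide +kernel

/-- The base two code of a list of arcs of `M_6`. -/
noncomputable def listMask (l : List (ℕ × ℕ)) : ℕ := mask (codesList 6) fun c =>
  fold (fun d acc => (Nat.beq c.1 d.1 && Nat.beq c.2 d.2) || acc) false l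

theorem avoids_even : avoids 6 11 (listMask [(2, 2), (4, 6), (4, 7), (3, 7), (3, 8), (2, 8)])
    (listMask [(0, 0), (0, 6), (0, 5), (0, 4), (1, 4), (1, 3)]) [(1, 2), (1, 3)] = true := by
  decide +kernel

theorem avoids_odd : avoids 6 11 (listMask [(3, 3), (5, 7), (4, 7), (4, 8), (3, 8), (3, 9)])
    (listMask [(0, 0), (0, 6), (0, 5), (1, 5), (1, 4), (2, 4)]) [(2, 2), (1, 3)] = true := by
  decide +kernel

theorem listMask_iff {l : List (ℕ × ℕ)} {c : ℕ × ℕ} :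
    fold (fun d acc => (Nat.beq c.1 d.1 && Nat.beq c.2 d.2) || acc) false l = true ↔ c ∈ l := by
  rw [fold_eq]
  induction l with
  | nil => simp
  | cons d l ih =>
    rw [List.foldr_cons, Bool.or_eq_true, ih, Bool.and_eq_true, Nat.beq_eq, Nat.beq_eq,
      List.mem_cons, Prod.ext_iff]

theorem rep_listMask {l : List (ℕ × ℕ)} {U : Finset (ℤ × ℤ)}
    (h1 : ∀ c ∈ U, c.2 ≠ c.1 + 1 → ∃ d ∈ l, toZ d = c) (h2 : ∀ d ∈ l, toZ d ∈ U) :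
    Rep 6 (listMask l) U := by
  refine rep_mask fun c hc => ?_
  rw [listMask_iff]
  refine ⟨h2 c, fun h => ?_⟩
  rw [mem_codesList] at hc
  obtain ⟨d, hd, hdc⟩ := h1 _ h (by simp only [toZ]; omega)
  rwa [← toZ_injective hdc]

theorem mem_contract_mk {f : ℤ → ℤ} {U : Finset (ℤ × ℤ)} (i j : ℤ) {i' j' : ℤ} (h : (i, j) ∈ U)
    (hi : f i = i') (hj : f j = j') (hij : i < j → i' < j') : (i', j') ∈ contract f U := by
  subst hi hj
  exact mem_contract.2 ⟨(i, j), h, hij, rfl⟩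

/-- The encoding of the image by `keep m b` of a set of arcs. -/
theorem rep_keep {m b : ℤ} {P : ℤ → ℤ → Prop} {U : Finset (ℤ × ℤ)}
    (hU : ∀ c, c ∈ U ↔ IsCode m c ∧ (c.2 = c.1 + 1 ∨ P c.1 c.2)) {l : List (ℕ × ℕ)}
    (hb : 0 ≤ b) (hm : b + 5 < m)
    (h1 : ∀ i j, IsCode m (i, j) → P i j → keep m b j ≠ keep m b i + 1 →
      ∃ d ∈ l, keep m b i = d.1 ∧ keep m b j = d.2)
    (h2 : ∀ d ∈ l, ∃ i j, IsCode m (i, j) ∧ P i j ∧ keep m b i = d.1 ∧ keep m b j = d.2 ∧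
      (i < j → d.1 < d.2)) : Rep 6 (listMask l) (contract (keep m b) U) := by
  refine rep_listMask ?_ fun d hd => ?_
  · rintro ⟨i', j'⟩ hc hne
    obtain ⟨⟨i, j⟩, h3, h4, h5⟩ := mem_contract.1 hc
    obtain ⟨h6, h7⟩ := (hU _).1 h3
    simp only [NonDeg, Prod.map_apply, Prod.mk.injEq] at *
    obtain ⟨rfl, rfl⟩ := h5
    have h8 : P i j := h7.resolve_left fun h => by
      obtain ⟨a1, a2, a3, a4⟩ := h6
      have k1 := keep_cases hb hm a1 (by simp only at *; omega)
      have k2 := keep_cases hb hm a3 (by simp only at *; omega)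
      simp only at k1 k2
      subst h
      omega
    obtain ⟨d, hd, h9, h10⟩ := h1 i j h6 h8 hne
    exact ⟨d, hd, by rw [toZ, h9, h10]⟩
  · obtain ⟨i, j, h3, h4, h5, h6, h7⟩ := h2 d hd
    exact mem_contract_mk i j ((hU _).2 ⟨h3, Or.inr h4⟩) h5 h6 (by exact_mod_cast h7)

theorem keep_eq {m b x y : ℤ} (hb : 0 ≤ b) (h : b + 5 < m)
    (hx : (b ≤ x ∧ x ≤ b + 5 ∧ y = x - b) ∨ (0 ≤ x ∧ x ≤ b ∧ y = 0) ∨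
      (b + 5 ≤ x ∧ x ≤ m - 1 ∧ y = 5) ∨ (m ≤ x ∧ x ≤ m + b ∧ y = 6) ∨
      (m + b ≤ x ∧ x ≤ m + b + 5 ∧ y = x - (m + b) + 6)) : keep m b x = y := by
  have := keep_cases (x := x) hb h (by omega) (by omega)
  omega

theorem rep_zig_even {k : ℤ} (hk : 4 ≤ k) {U : Finset (ℤ × ℤ)} (hU : IsZig (2 * k) U) :
    Rep 6 (listMask [(2, 2), (4, 6), (4, 7), (3, 7), (3, 8), (2, 8)])
      (contract (keep (2 * k) (k - 2)) U) := by
  refine rep_keep (P := fun i j => (i = (2 * k + 1) / 2 ∧ j = (2 * k + 1) / 2) ∨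
    (i < j ∧ (i + j = 2 * (2 * k) ∨ i + j = 2 * (2 * k) + 1))) hU (by omega)
    (by omega) ?_ ?_
  · rintro i j ⟨h4, h5, h6, h7⟩ h8 hne
    simp only at *
    have k1 := keep_cases (m := 2 * k) (b := k - 2) (x := i) (by omega) (by omega) h4 (by omega)
    have k2 := keep_cases (m := 2 * k) (b := k - 2) (x := j) (by omega) (by omega) h6 (by omega)
    generalize keep (2 * k) (k - 2) i = u at *
    generalize keep (2 * k) (k - 2) j = v at *
    rcases h8 with h8 | h8
    · exact ⟨(2, 2), by simp, by simp only; push_cast; omega,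
        by simp only; push_cast; omega⟩
    · have k1' : 2 ≤ u ∧ u ≤ 5 := by omega
      have k2' : 6 ≤ v ∧ v ≤ 8 := by omega
      have k3 : (u = 4 ∧ v = 6) ∨ (u = 4 ∧ v = 7) ∨ (u = 3 ∧ v = 7) ∨ (u = 3 ∧ v = 8) ∨ (u = 2 ∧ v = 8) := by
        omega
      rcases k3 with ⟨rfl, rfl⟩ | ⟨rfl, rfl⟩ | ⟨rfl, rfl⟩ | ⟨rfl, rfl⟩ | ⟨rfl, rfl⟩
      · exact ⟨(4, 6), by simp, rfl, rfl⟩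
      · exact ⟨(4, 7), by simp, rfl, rfl⟩
      · exact ⟨(3, 7), by simp, rfl, rfl⟩
      · exact ⟨(3, 8), by simp, rfl, rfl⟩
      · exact ⟨(2, 8), by simp, rfl, rfl⟩
  · simp only [List.mem_cons, List.not_mem_nil, or_false, forall_eq_or_imp, forall_eq]
    push_cast
    refine ⟨⟨k, k, ?_⟩, ⟨k + 2, 3 * k - 2, ?_⟩, ⟨k + 2, 3 * k - 1, ?_⟩, ⟨k + 1, 3 * k - 1, ?_⟩, ⟨k + 1, 3 * k, ?_⟩, ⟨k, 3 * k, ?_⟩⟩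
    all_goals
      refine ⟨⟨?_, ?_, ?_, ?_⟩, ?_, keep_eq ?_ ?_ ?_, keep_eq ?_ ?_ ?_, ?_⟩ <;>
        first | omega | exact fun _ => by norm_num

theorem rep_zig_odd {k : ℤ} (hk : 3 ≤ k) {U : Finset (ℤ × ℤ)} (hU : IsZig (2 * k + 1) U) :
    Rep 6 (listMask [(3, 3), (5, 7), (4, 7), (4, 8), (3, 8), (3, 9)])
      (contract (keep (2 * k + 1) (k - 2)) U) := by
  refine rep_keep (P := fun i j => (i = (2 * k + 1 + 1) / 2 ∧ j = (2 * k + 1 + 1) / 2) ∨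
    (i < j ∧ (i + j = 2 * (2 * k + 1) ∨ i + j = 2 * (2 * k + 1) + 1))) hU (by omega)
    (by omega) ?_ ?_
  · rintro i j ⟨h4, h5, h6, h7⟩ h8 hne
    simp only at *
    have k1 := keep_cases (m := 2 * k + 1) (b := k - 2) (x := i) (by omega) (by omega) h4 (by omega)
    have k2 := keep_cases (m := 2 * k + 1) (b := k - 2) (x := j) (by omega) (by omega) h6 (by omega)
    generalize keep (2 * k + 1) (k - 2) i = u at *
    generalize keep (2 * k + 1) (k - 2) j = v at *
    rcases h8 with h8 | h8
    · exact ⟨(3, 3), by simp, by simp only; push_cast; omega,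
        by simp only; push_cast; omega⟩
    · have k1' : 3 ≤ u ∧ u ≤ 5 := by omega
      have k2' : 6 ≤ v ∧ v ≤ 9 := by omega
      have k3 : (u = 5 ∧ v = 7) ∨ (u = 4 ∧ v = 7) ∨ (u = 4 ∧ v = 8) ∨ (u = 3 ∧ v = 8) ∨ (u = 3 ∧ v = 9) := by
        omega
      rcases k3 with ⟨rfl, rfl⟩ | ⟨rfl, rfl⟩ | ⟨rfl, rfl⟩ | ⟨rfl, rfl⟩ | ⟨rfl, rfl⟩
      · exact ⟨(5, 7), by simp, rfl, rfl⟩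
      · exact ⟨(4, 7), by simp, rfl, rfl⟩
      · exact ⟨(4, 8), by simp, rfl, rfl⟩
      · exact ⟨(3, 8), by simp, rfl, rfl⟩
      · exact ⟨(3, 9), by simp, rfl, rfl⟩
  · simp only [List.mem_cons, List.not_mem_nil, or_false, forall_eq_or_imp, forall_eq]
    push_cast
    refine ⟨⟨k + 1, k + 1, ?_⟩, ⟨k + 3, 3 * k, ?_⟩, ⟨k + 2, 3 * k, ?_⟩, ⟨k + 2, 3 * k + 1, ?_⟩, ⟨k + 1, 3 * k + 1, ?_⟩, ⟨k + 1, 3 * k + 2, ?_⟩⟩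
    all_goals
      refine ⟨⟨?_, ?_, ?_, ?_⟩, ?_, keep_eq ?_ ?_ ?_, keep_eq ?_ ?_ ?_, ?_⟩ <;>
        first | omega | exact fun _ => by norm_num

theorem rep_zag_even {k : ℤ} (hk : 4 ≤ k) {U : Finset (ℤ × ℤ)} (hU : IsZag (2 * k) U) :
    Rep 6 (listMask [(0, 0), (0, 6), (0, 5), (0, 4), (1, 4), (1, 3)])
      (contract (keep (2 * k) (k - 2)) U) := by
  refine rep_keep (P := fun i j => (i = 0 ∧ j = 0) ∨
    (i < j ∧ (i + j = 2 * k ∨ i + j = 2 * k + 1))) hU (by omega)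
    (by omega) ?_ ?_
  · rintro i j ⟨h4, h5, h6, h7⟩ h8 hne
    simp only at *
    have k1 := keep_cases (m := 2 * k) (b := k - 2) (x := i) (by omega) (by omega) h4 (by omega)
    have k2 := keep_cases (m := 2 * k) (b := k - 2) (x := j) (by omega) (by omega) h6 (by omega)
    generalize keep (2 * k) (k - 2) i = u at *
    generalize keep (2 * k) (k - 2) j = v at *
    rcases h8 with h8 | h8
    · exact ⟨(0, 0), by simp, by simp only; push_cast; omega,
        by simp only; push_cast; omega⟩
    · have k1' : 0 ≤ u ∧ u ≤ 2 := by omega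
      have k2' : 3 ≤ v ∧ v ≤ 6 := by omega
      have k3 : (u = 0 ∧ v = 6) ∨ (u = 0 ∧ v = 5) ∨ (u = 0 ∧ v = 4) ∨ (u = 1 ∧ v = 4) ∨ (u = 1 ∧ v = 3) := by
        omega
      rcases k3 with ⟨rfl, rfl⟩ | ⟨rfl, rfl⟩ | ⟨rfl, rfl⟩ | ⟨rfl, rfl⟩ | ⟨rfl, rfl⟩
      · exact ⟨(0, 6), by simp, rfl, rfl⟩
      · exact ⟨(0, 5), by simp, rfl, rfl⟩
      · exact ⟨(0, 4), by simp, rfl, rfl⟩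
      · exact ⟨(1, 4), by simp, rfl, rfl⟩
      · exact ⟨(1, 3), by simp, rfl, rfl⟩
  · simp only [List.mem_cons, List.not_mem_nil, or_false, forall_eq_or_imp, forall_eq]
    push_cast
    refine ⟨⟨0, 0, ?_⟩, ⟨0, 2 * k, ?_⟩, ⟨1, 2 * k - 1, ?_⟩, ⟨k - 2, k + 2, ?_⟩, ⟨k - 1, k + 2, ?_⟩, ⟨k - 1, k + 1, ?_⟩⟩
    all_goals
      refine ⟨⟨?_, ?_, ?_, ?_⟩, ?_, keep_eq ?_ ?_ ?_, keep_eq ?_ ?_ ?_, ?_⟩ <;>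
        first | omega | exact fun _ => by norm_num

theorem rep_zag_odd {k : ℤ} (hk : 3 ≤ k) {U : Finset (ℤ × ℤ)} (hU : IsZag (2 * k + 1) U) :
    Rep 6 (listMask [(0, 0), (0, 6), (0, 5), (1, 5), (1, 4), (2, 4)])
      (contract (keep (2 * k + 1) (k - 2)) U) := by
  refine rep_keep (P := fun i j => (i = 0 ∧ j = 0) ∨
    (i < j ∧ (i + j = 2 * k + 1 ∨ i + j = 2 * k + 1 + 1))) hU (by omega)
    (by omega) ?_ ?_
  · rintro i j ⟨h4, h5, h6, h7⟩ h8 hne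
    simp only at *
    have k1 := keep_cases (m := 2 * k + 1) (b := k - 2) (x := i) (by omega) (by omega) h4 (by omega)
    have k2 := keep_cases (m := 2 * k + 1) (b := k - 2) (x := j) (by omega) (by omega) h6 (by omega)
    generalize keep (2 * k + 1) (k - 2) i = u at *
    generalize keep (2 * k + 1) (k - 2) j = v at *
    rcases h8 with h8 | h8
    · exact ⟨(0, 0), by simp, by simp only; push_cast; omega,
        by simp only; push_cast; omega⟩
    · have k1' : 0 ≤ u ∧ u ≤ 2 := by omega
      have k2' : 3 ≤ v ∧ v ≤ 6 := by omega
      have k3 : (u = 0 ∧ v = 6) ∨ (u = 0 ∧ v = 5) ∨ (u = 1 ∧ v = 5) ∨ (u = 1 ∧ v = 4) ∨ (u = 2 ∧ v = 4) := by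
        omega
      rcases k3 with ⟨rfl, rfl⟩ | ⟨rfl, rfl⟩ | ⟨rfl, rfl⟩ | ⟨rfl, rfl⟩ | ⟨rfl, rfl⟩
      · exact ⟨(0, 6), by simp, rfl, rfl⟩
      · exact ⟨(0, 5), by simp, rfl, rfl⟩
      · exact ⟨(1, 5), by simp, rfl, rfl⟩
      · exact ⟨(1, 4), by simp, rfl, rfl⟩
      · exact ⟨(2, 4), by simp, rfl, rfl⟩
  · simp only [List.mem_cons, List.not_mem_nil, or_false, forall_eq_or_imp, forall_eq]
    push_cast
    refine ⟨⟨0, 0, ?_⟩, ⟨0, 2 * k + 1, ?_⟩, ⟨1, 2 * k, ?_⟩, ⟨k - 1, k + 3, ?_⟩, ⟨k - 1, k + 2, ?_⟩, ⟨k, k + 2, ?_⟩⟩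
    all_goals
      refine ⟨⟨?_, ?_, ?_, ?_⟩, ?_, keep_eq ?_ ?_ ?_, keep_eq ?_ ?_ ?_, ?_⟩ <;>
        first | omega | exact fun _ => by norm_num


theorem squeeze_squeeze {n a l a' x : ℤ} (ha : 0 ≤ a') (hl : 0 ≤ l) (h' : a + l < n) (h : a' + l + 1 < n)
    (ha' : a' = a ∨ a' = a - 1) :
    (squeeze (n - l) a' 1 ∘ squeeze n a l) x = squeeze n a' (l + 1) x := by
  have k1 := squeeze_cases (n := n) hl h' x
  have k2 := squeeze_cases (n := n - l) (a := a') (l := 1) (by omega) (by omega) (squeeze n a l x)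
  have k3 := squeeze_cases (n := n) (a := a') (l := l + 1) (by omega) (by omega) x
  simp only [Function.comp]
  generalize squeeze (n - l) a' 1 (squeeze n a l x) = u at *
  generalize squeeze n a l x = v at *
  rcases ha' with rfl | rfl <;> omega

theorem contract_squeeze_squeeze {n a l a' : ℤ} {U : Finset (ℤ × ℤ)} (hU : IsSystem n U)
    (ha0 : 0 ≤ a) (ha : 0 ≤ a') (hl : 0 ≤ l) (h' : a + l < n) (h : a' + l + 1 < n)
    (ha' : a' = a ∨ a' = a - 1) :
    contract (squeeze (n - l) a' 1) (contract (squeeze n a l) U) =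
      contract (squeeze n a' (l + 1)) U := by
  rw [← (isContraction_squeeze ha0 hl h').contract_comp
    (isContraction_squeeze ha (by omega) (by omega)) hU]
  exact contract_congr hU fun x _ _ => squeeze_squeeze ha hl h' h ha'

theorem IsZig.contract_two {m : ℤ} {U : Finset (ℤ × ℤ)} (hU : IsZig m U) (hT : IsSystem m U)
    (hm : 4 ≤ m) : IsZig (m - 2) (contract (squeeze m ((m + 1) / 2 - 1) 2) U) := by
  have h1 := isZig_contract_one (isZig_contract_one hU (by omega)) (by omega)
  have h2 := contract_squeeze_squeeze (a := m / 2) (l := 1) (a' := (m - 1) / 2) hT (by omega)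
    (by omega) (by omega) (by omega) (by omega) (by omega)
  rw [h2, sub_sub, show (m - 1) / 2 = (m + 1) / 2 - 1 by omega] at h1
  exact h1

theorem IsZig.contract_three {m : ℤ} {U : Finset (ℤ × ℤ)} (hU : IsZig m U) (hT : IsSystem m U)
    (hm : 5 ≤ m) : IsZig (m - 3) (contract (squeeze m (m / 2 - 1) 3) U) := by
  have h1 := isZig_contract_one (hU.contract_two hT (by omega)) (by omega)
  have h2 := contract_squeeze_squeeze (a := (m + 1) / 2 - 1) (l := 2) (a' := (m - 2) / 2) hT
    (by omega) (by omega) (by omega) (by omega) (by omega) (by omega)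
  rw [h2, sub_sub, show (m - 2) / 2 = m / 2 - 1 by omega] at h1
  exact h1

theorem IsZag.contract_two {m : ℤ} {U : Finset (ℤ × ℤ)} (hU : IsZag m U) (hT : IsSystem m U)
    (hm : 4 ≤ m) : IsZag (m - 2) (contract (squeeze m ((m + 1) / 2 - 1) 2) U) := by
  have h1 := isZag_contract_one (isZag_contract_one hU (by omega)) (by omega)
  have h2 := contract_squeeze_squeeze (a := m / 2) (l := 1) (a' := (m - 1) / 2) hT (by omega)
    (by omega) (by omega) (by omega) (by omega) (by omega)
  rw [h2, sub_sub, show (m - 1) / 2 = (m + 1) / 2 - 1 by omega] at h1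
  exact h1

theorem IsZag.contract_three {m : ℤ} {U : Finset (ℤ × ℤ)} (hU : IsZag m U) (hT : IsSystem m U)
    (hm : 5 ≤ m) : IsZag (m - 3) (contract (squeeze m (m / 2 - 1) 3) U) := by
  have h1 := isZag_contract_one (hU.contract_two hT (by omega)) (by omega)
  have h2 := contract_squeeze_squeeze (a := (m + 1) / 2 - 1) (l := 2) (a' := (m - 2) / 2) hT
    (by omega) (by omega) (by omega) (by omega) (by omega) (by omega)
  rw [h2, sub_sub, show (m - 2) / 2 = m / 2 - 1 by omega] at h1
  exact h1

/-- The weight of a path in `M_6` between the images of zigzag triangulations. -/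
theorem twelve_le_of_path {m : ℤ} (hm : 7 ≤ m) {b : ℤ} (hb : b = m / 2 - 2) {a : ℕ}
    (ha : (a : ℤ) = (m + 1) / 2 - 1 - b) {U V : Finset (ℤ × ℤ)} (hU : IsZig m U) (hV : IsZag m V)
    {w : ℕ} (h : Path 6 (wtOf 6 [(a, 2), (1, 3)]) w (contract (keep m b) U)
      (contract (keep m b) V)) : 12 ≤ w := by
  subst hb
  have hp : (∃ k, m = 2 * k) ∨ ∃ k, m = 2 * k + 1 := by
    rcases Int.even_or_odd m with ⟨k, hk⟩ | ⟨k, hk⟩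
    · exact Or.inl ⟨k, by omega⟩
    · exact Or.inr ⟨k, hk⟩
  rcases hp with ⟨k, rfl⟩ | ⟨k, rfl⟩
  · obtain rfl : a = 1 := by omega
    have e : (2 * k) / 2 - 2 = k - 2 := by omega
    rw [e] at h
    exact lt_of_avoids (n := 6) (by omega) le_rfl (by simp) (by simp)
      (rep_zig_even (by omega) hU) (rep_zag_even (by omega) hV) avoids_even h
  · obtain rfl : a = 2 := by omega
    have e : (2 * k + 1) / 2 - 2 = k - 2 := by omega
    rw [e] at h
    exact lt_of_avoids (n := 6) (by omega) le_rfl (by simp) (by simp)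
      (rep_zig_odd (by omega) hU) (rep_zag_odd (by omega) hV) avoids_odd h

/-- The distance between the zigzag triangulations. -/
theorem le_of_path {m : ℕ} (hm : 2 ≤ m) {U V : Finset (ℤ × ℤ)} (hU : IsZig m U) (hV : IsZag m V)
    {k : ℕ} (h : Path m (fun _ _ => 1) k U V) : 5 * m / 2 ≤ k + 4 := by
  induction m using Nat.strong_induction_on generalizing U V k with
  | _ m ih =>
    have base : ∀ b, m ≤ 6 → avoids m b (zigMask m) (zagMask m) [(0, m - 1)] = true → b < k :=
      fun b hm6 hb => lt_of_avoids (by omega) hm6 (by simp; omega) (by simp) hU.rep hV.rep hb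
        (h.congr fun α β hα hβ => (wtOf_eq_one (by omega) hα hβ).symm)
    rcases lt_or_ge m 7 with hm7 | hm7
    · interval_cases m
      · have := base 0 (by omega) avoids_two; omega
      · have := base 2 (by omega) avoids_three; omega
      · have := base 5 (by omega) avoids_four; omega
      · have := base 7 (by omega) avoids_five; omega
      · have := base 10 (by omega) avoids_six; omega
    · obtain ⟨a, ha⟩ : ∃ a : ℕ, (a : ℤ) = ((m : ℤ) + 1) / 2 - 1 - ((m : ℤ) / 2 - 2) :=
        ⟨(((m : ℤ) + 1) / 2 - 1 - ((m : ℤ) / 2 - 2)).toNat, by omega⟩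
      have hR := isGood_keep (m := m) (b := (m : ℤ) / 2 - 2) (by omega) (by omega)
      have hS := isGood_squeeze (n := m) (a := ((m : ℤ) + 1) / 2 - 1) (l := 2) (by omega)
        (by omega) (by omega)
      have hS' := isGood_squeeze (n := m) (a := (m : ℤ) / 2 - 1) (l := 3) (by omega)
        (by omega) (by omega)
      have tU := h.tight_left.1
      have tV := h.tight_right.1
      obtain ⟨p, q, w, hp, hq, hw, hpk, hqk, hsum⟩ := h.project (a := a) (l := 2) (a' := 1)
        (l' := 3) (by omega) (by omega) (by omega) hR hS hS'
        (fun x y hx hx' hy hy' h1 h2 => keep_separated (by omega) (by omega) (by omega) (by omega)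
          (by push_cast; omega) hx hx' hy hy' h1
          (by rw [ha, show (m : ℤ) / 2 - 2 + (((m : ℤ) + 1) / 2 - 1 - ((m : ℤ) / 2 - 2)) =
            ((m : ℤ) + 1) / 2 - 1 by ring]; exact h2))
        (fun x y hx hx' hy hy' h1 h2 => keep_separated (by omega) (by omega) (by omega) (by omega)
          (by norm_num) hx hx' hy hy' h1
          (by push_cast; rw [show (m : ℤ) / 2 - 2 + 1 = (m : ℤ) / 2 - 1 by ring]; exact h2))
      have h12 := twelve_le_of_path (by omega) rfl ha hU hV hw
      have e2 : ((m : ℤ) - (2 : ℕ)) = ((m - 2 : ℕ) : ℤ) := by omega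
      have e3 : ((m : ℤ) - (3 : ℕ)) = ((m - 3 : ℕ) : ℤ) := by omega
      have zU2 := hU.contract_two tU (by omega)
      have zV2 := hV.contract_two tV (by omega)
      have zU3 := hU.contract_three tU (by omega)
      have zV3 := hV.contract_three tV (by omega)
      rw [e2] at hp
      rw [e3] at hq
      rw [show (m : ℤ) - 2 = ((m - 2 : ℕ) : ℤ) by omega] at zU2 zV2
      rw [show (m : ℤ) - 3 = ((m - 3 : ℕ) : ℤ) by omega] at zU3 zV3
      have i2 := ih (m - 2) (by omega) (by omega) zU2 zV2 hp
      have i3 := ih (m - 3) (by omega) (by omega) zU3 zV3 hq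
      omega

/-! ### Simplicial triangulations at a large distance -/

theorem SimpChain.path {n : ℤ} {k : ℕ} {U V : Finset (ℤ × ℤ)} (h : SimpChain n k U V)
    (hU : Tight n U) : Path n (fun _ _ => 1) k U V := by
  induction h with
  | refl h h' => exact .refl hU
  | @step k U V W h hW hW' hf ih =>
    have hp := ih hU
    have hT := hf.tight hp.tight_right hW.1
    obtain ⟨α, hα, β, hβ, rfl⟩ := hf
    exact .step hp hα hβ hT

/-- The number of crossing arcs whose image by a contraction is a given arc. -/
def fiberCard (F : ℤ → ℤ) (ζ : ℤ × ℤ) (U : Finset (ℤ × ℤ)) : ℕ :=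
  (U.filter fun c => c.2 ≤ c.1 ∧ Prod.map F F c = ζ).card

theorem fiberCard_flip {F : ℤ → ℤ} {ζ α β : ℤ × ℤ} {U : Finset (ℤ × ℤ)} (hα : α ∈ U)
    (hβ : β ∉ U) :
    fiberCard F ζ (insert β (U.erase α)) + (if α.2 ≤ α.1 ∧ Prod.map F F α = ζ then 1 else 0) =
      fiberCard F ζ U + (if β.2 ≤ β.1 ∧ Prod.map F F β = ζ then 1 else 0) := by
  have h1 : β ∉ (U.filter fun c => c.2 ≤ c.1 ∧ Prod.map F F c = ζ).erase α := fun h =>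
    hβ (Finset.mem_filter.1 (Finset.mem_of_mem_erase h)).1
  have h2 : (if α.2 ≤ α.1 ∧ Prod.map F F α = ζ then
      (U.filter fun c => c.2 ≤ c.1 ∧ Prod.map F F c = ζ).card - 1 + 1 else
      (U.filter fun c => c.2 ≤ c.1 ∧ Prod.map F F c = ζ).card) = fiberCard F ζ U := by
    split_ifs with h
    · have : 0 < (U.filter fun c => c.2 ≤ c.1 ∧ Prod.map F F c = ζ).card :=
        Finset.card_pos.2 ⟨α, Finset.mem_filter.2 ⟨hα, h⟩⟩
      rw [fiberCard]
      omega
    · rfl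
  rw [← h2, fiberCard, Finset.filter_insert, Finset.filter_erase]
  have h3 : α ∈ (U.filter fun c => c.2 ≤ c.1 ∧ Prod.map F F c = ζ) ↔
    α.2 ≤ α.1 ∧ Prod.map F F α = ζ := by simp [hα]
  split_ifs with h4 h5 h5
  · rw [Finset.card_insert_of_notMem h1, Finset.card_erase_of_mem (h3.2 h5)]
  · rw [Finset.card_insert_of_notMem h1, Finset.erase_eq_of_notMem (fun h => h5 (h3.1 h))]
  · rw [Finset.card_erase_of_mem (h3.2 h5)]
  · rw [Finset.erase_eq_of_notMem (fun h => h5 (h3.1 h))]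

theorem exists_of_fiberCard {F : ℤ → ℤ} {ζ : ℤ × ℤ} {U : Finset (ℤ × ℤ)}
    (h : 1 ≤ fiberCard F ζ U) : ∃ γ ∈ U, γ.2 ≤ γ.1 ∧ Prod.map F F γ = ζ := by
  obtain ⟨γ, hγ⟩ := Finset.card_pos.1 h
  exact ⟨γ, (Finset.mem_filter.1 hγ).1, (Finset.mem_filter.1 hγ).2⟩

/-- The flips that remove, but for the last one, the arcs in the fiber of `ζ` and those that
insert, but for the first one, arcs in the fiber of `η` are made trivial by the contraction. As
`ζ` and `η` cross, these flips are distinct. -/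
theorem Path.fiberCard_le {n m : ℤ} (hn : 0 < n) {F : ℤ → ℤ} (hF : IsGood n m F) {ζ η : ℤ × ℤ}
    (hζη : ¬ Compat m ζ η) {k : ℕ} {U V : Finset (ℤ × ℤ)} (h : Path n (fun _ _ => 1) k U V) :
    ∃ p, Path m (fun _ _ => 1) p (contract F U) (contract F V) ∧
      p + (fiberCard F ζ U - 1) + (fiberCard F η V - 1) ≤
        k + (fiberCard F ζ V - 1) + (fiberCard F η U - 1) := by
  induction h with
  | refl h => exact ⟨0, .refl (hF.tight _ h), by omega⟩
  | @step k U V α β h hα hβ hW ih =>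
    obtain ⟨p, hp, hle⟩ := ih
    have e1 := fiberCard_flip (F := F) (ζ := ζ) hα hβ
    have e2 := fiberCard_flip (F := F) (ζ := η) hα hβ
    have tW := hF.tight _ hW
    have memW : ∀ γ ∈ insert β (V.erase α), γ.2 ≤ γ.1 →
        Prod.map F F γ ∈ contract F (insert β (V.erase α)) := fun γ hγ h =>
      mem_contract.2 ⟨γ, hγ, fun h' => by omega, rfl⟩
    have memV : ∀ γ ∈ V, γ.2 ≤ γ.1 → Prod.map F F γ ∈ contract F V := fun γ hγ h =>
      mem_contract.2 ⟨γ, hγ, fun h' => by omega, rfl⟩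
    have hboth : ¬ (1 ≤ fiberCard F ζ (insert β (V.erase α)) ∧
        1 ≤ fiberCard F η (insert β (V.erase α))) := by
      rintro ⟨h1, h2⟩
      obtain ⟨γ, hγ, hγ1, hγ2⟩ := exists_of_fiberCard h1
      obtain ⟨δ, hδ, hδ1, hδ2⟩ := exists_of_fiberCard h2
      apply hζη
      rw [← hγ2, ← hδ2]
      exact tW.1.2 _ (memW γ hγ hγ1) _ (memW δ hδ hδ1)
    rcases hF.flip hn h.tight_right hα hβ hW with ⟨h1, h2⟩ | ⟨h1, h2, h3, h4⟩
    · refine ⟨p, by rw [h1]; exact hp, ?_⟩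
      split_ifs at e1 e2 <;> omega
    · refine ⟨p + 1, ?_, ?_⟩
      · rw [h4] at tW ⊢
        exact .step hp h2 h3 tW
      · have hβW : Prod.map F F β ∈ contract F (insert β (V.erase α)) := by
          rw [h4]; exact Finset.mem_insert_self _ _
        have a1 : ¬ (fiberCard F ζ (insert β (V.erase α)) < fiberCard F ζ V ∧
            1 ≤ fiberCard F ζ (insert β (V.erase α))) := by
          rintro ⟨h5, h6⟩
          obtain ⟨γ, hγ, hγ1, hγ2⟩ := exists_of_fiberCard h6
          have h7 : Prod.map F F α = ζ := by
            by_contra hc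
            rw [if_neg (show ¬ (α.2 ≤ α.1 ∧ Prod.map F F α = ζ) from fun h => hc h.2)] at e1
            omega
          refine h1.2.2 ?_
          rw [h7, ← hγ2]
          exact tW.1.2 _ (memW γ hγ hγ1) _ hβW
        have a2 : ¬ (fiberCard F η V < fiberCard F η (insert β (V.erase α)) ∧
            1 ≤ fiberCard F η V) := by
          rintro ⟨h5, h6⟩
          obtain ⟨γ, hγ, hγ1, hγ2⟩ := exists_of_fiberCard h6
          have h7 : Prod.map F F β = η := by
            by_contra hc
            rw [if_neg (show ¬ (β.2 ≤ β.1 ∧ Prod.map F F β = η) from fun h => hc h.2)] at e2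
            omega
          apply h3
          rw [h7, ← hγ2]
          exact memV γ hγ hγ1
        have hle1 : ∀ p : Prop, [Decidable p] → (if p then 1 else 0 : ℕ) ≤ 1 := by
          intro p _; split_ifs <;> omega
        have l1 := hle1 (α.2 ≤ α.1 ∧ Prod.map F F α = ζ)
        have l2 := hle1 (α.2 ≤ α.1 ∧ Prod.map F F α = η)
        have l3 := hle1 (β.2 ≤ β.1 ∧ Prod.map F F β = ζ)
        have l4 := hle1 (β.2 ≤ β.1 ∧ Prod.map F F β = η)
        clear memW memV tW h1 h2 h3 h4 hβW hp
        revert e1 e2 l1 l2 l3 l4 a1 a2 hboth hle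
        generalize (if α.2 ≤ α.1 ∧ Prod.map F F α = ζ then 1 else 0 : ℕ) = i1
        generalize (if α.2 ≤ α.1 ∧ Prod.map F F α = η then 1 else 0 : ℕ) = i2
        generalize (if β.2 ≤ β.1 ∧ Prod.map F F β = ζ then 1 else 0 : ℕ) = i3
        generalize (if β.2 ≤ β.1 ∧ Prod.map F F β = η then 1 else 0 : ℕ) = i4
        generalize fiberCard F ζ (insert β (V.erase α)) = f1
        generalize fiberCard F η (insert β (V.erase α)) = f2
        generalize fiberCard F ζ V = f3
        generalize fiberCard F η V = f4
        generalize fiberCard F ζ U = f5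
        generalize fiberCard F η U = f6
        intros
        omega

/-- The five crossing arcs that join non-consecutive vertices among five consecutive ones. -/
def Pentagram (y : ℤ) (c : ℤ × ℤ) : Prop :=
  (c.1 = y + 2 ∧ c.2 = y) ∨ (c.1 = y + 3 ∧ c.2 = y) ∨ (c.1 = y + 3 ∧ c.2 = y + 1) ∨
    (c.1 = y + 4 ∧ c.2 = y + 1) ∨ (c.1 = y + 4 ∧ c.2 = y + 2)

instance (y : ℤ) : DecidablePred (Pentagram y) := fun c => by unfold Pentagram; infer_instance

instance (n : ℤ) : DecidablePred (IsCode n) := fun c => by unfold IsCode; infer_instance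

/-- The codes that satisfy a given property. -/
noncomputable def codesWith (n : ℤ) (P : ℤ × ℤ → Prop) [DecidablePred P] : Finset (ℤ × ℤ) :=
  (Finset.Icc 0 n ×ˢ Finset.Icc 0 (2 * n)).filter fun c => IsCode n c ∧ P c

theorem mem_codesWith {n : ℤ} {P : ℤ × ℤ → Prop} [DecidablePred P] {c : ℤ × ℤ} :
    c ∈ codesWith n P ↔ IsCode n c ∧ P c := by
  simp only [codesWith, Finset.mem_filter, Finset.mem_product, Finset.mem_Icc,
    and_iff_right_iff_imp]
  rintro ⟨⟨h1, h2, h3, h4⟩, -⟩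
  omega

/-- The arcs of a simplicial version of the triangulations in `IsZig`: the one-sided loop is
replaced by a pentagram on the vertices `y, …, y + 4` and the vertex `0` by five vertices. -/
def ZigArc (n y : ℤ) (c : ℤ × ℤ) : Prop :=
  c.2 = c.1 + 1 ∨ Pentagram y c ∨ (c.1 = n - 1 ∧ n + 1 ≤ c.2 ∧ c.2 ≤ n + 4) ∨
    (c.1 < c.2 ∧ c.2 ≤ c.1 + n - 4 ∧ (c.1 + c.2 = 2 * n + 4 ∨ c.1 + c.2 = 2 * n + 5))

/-- The arcs of a simplicial version of the triangulations in `IsZag`: the one-sided loop is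
replaced by a pentagram on the vertices `0, …, 4` and the opposite vertex by five vertices. -/
def ZagArc (n y : ℤ) (c : ℤ × ℤ) : Prop :=
  c.2 = c.1 + 1 ∨ Pentagram 0 c ∨ (y ≤ c.1 ∧ c.1 ≤ y + 3 ∧ c.2 = y + 5) ∨
    (4 ≤ c.1 ∧ c.1 ≤ y - 1 ∧ y + 5 ≤ c.2 ∧ c.2 ≤ n ∧
      (c.1 + c.2 = n + 4 ∨ c.1 + c.2 = n + 5))

instance (n y : ℤ) : DecidablePred (ZigArc n y) := fun c => by unfold ZigArc; infer_instance

instance (n y : ℤ) : DecidablePred (ZagArc n y) := fun c => by unfold ZagArc; infer_instance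

theorem sameEnds_cases {n : ℤ} {c d : ℤ × ℤ} (hc : IsCode n c) (hd : IsCode n d)
    (h : SameEnds n c d) : (d.1 = c.1 ∧ (d.2 = c.2 ∨ d.2 = c.2 + n ∨ d.2 = c.2 - n)) ∨
    ((c.2 = d.1 ∨ c.2 = d.1 + n) ∧ (d.2 = c.1 ∨ d.2 = c.1 + n)) := by
  obtain ⟨h1, h2, h3, h4⟩ := hc
  obtain ⟨h5, h6, h7, h8⟩ := hd
  have key : ∀ x : ℤ, n ∣ x → -2 * n < x → x < 2 * n → x = 0 ∨ x = n ∨ x = - n := by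
    rintro x ⟨k, rfl⟩ hx hx'
    have k1 : -2 < k := by by_contra!; nlinarith
    have k2 : k < 2 := by by_contra!; nlinarith
    have : k = -1 ∨ k = 0 ∨ k = 1 := by omega
    rcases this with rfl | rfl | rfl <;> simp
  rcases h with ⟨ha, hb⟩ | ⟨ha, hb⟩
  · have := key _ ha (by omega) (by omega)
    have := key _ hb (by omega) (by omega)
    omega
  · have := key _ ha (by omega) (by omega)
    have := key _ hb (by omega) (by omega)
    omega

theorem loop_cases {n : ℤ} {c : ℤ × ℤ} (hc : IsCode n c) (h : n ∣ c.2 - c.1) :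
    c.2 = c.1 ∨ c.2 = c.1 + n := by
  obtain ⟨h1, h2, h3, h4⟩ := hc
  obtain ⟨k, hk⟩ := h
  have k1 : -1 < k := by by_contra!; nlinarith
  have k2 : k < 2 := by by_contra!; nlinarith
  have : k = 0 ∨ k = 1 := by omega
  rcases this with rfl | rfl <;> omega

theorem card_codesWith {n : ℕ} (hn : 0 < n) {P : ℤ × ℤ → Prop} [DecidablePred P]
    (hs : IsSystem n (codesWith n P)) (g : ℕ → ℤ × ℤ)
    (hg : ∀ k < 2 * n, IsCode n (g k) ∧ P (g k))
    (hinj : ∀ k < 2 * n, ∀ l < 2 * n, g k = g l → k = l) : Tight n (codesWith n P) := by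
  refine ⟨hs, ?_⟩
  have h1 := hs.card_le hn
  have h2 := Finset.card_le_card_of_injOn (s := Finset.range (2 * n)) (t := codesWith n P) g
    (fun k hk => by
      simp only [Finset.coe_range, Set.mem_Iio] at hk
      exact mem_codesWith.2 (hg k hk))
    (fun k hk l hl h => hinj k (by simpa using hk) l (by simpa using hl) h)
  rw [Finset.card_range] at h2
  omega

theorem isSystem_of_arcs {n : ℤ} {P : ℤ × ℤ → Prop} [DecidablePred P]
    (h : ∀ i j k l, IsCode n (i, j) → IsCode n (k, l) → P (i, j) → P (k, l) → j ≠ i + 1 →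
      l ≠ k + 1 → Compat n (i, j) (k, l)) : IsSystem n (codesWith n P) := by
  refine ⟨fun c hc => (mem_codesWith.1 hc).1, fun c hc d hd => ?_⟩
  obtain ⟨c1, c2⟩ := mem_codesWith.1 hc
  obtain ⟨d1, d2⟩ := mem_codesWith.1 hd
  by_cases h1 : c.2 = c.1 + 1
  · exact compat_boundary c1 d1 h1
  · by_cases h2 : d.2 = d.1 + 1
    · exact (compat_boundary d1 c1 h2).symm
    · exact h _ _ _ _ c1 d1 c2 d2 h1 h2

theorem isSystem_zig {n y : ℤ} (hn : 10 ≤ n) (hy : y = (n - 7) / 2 + 4) :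
    IsSystem n (codesWith n (ZigArc n y)) := by
  refine isSystem_of_arcs fun i j k l ⟨h1, h2, h3, h4⟩ ⟨h5, h6, h7, h8⟩ hc hd hij hkl => ?_
  simp only [ZigArc, Pentagram] at *
  rcases hc with hc | hc | hc | hc
  · omega
  · rcases hd with hd | hd | hd | hd
    · omega
    · rw [compat_crossing_crossing (by omega) (by omega)]
      simp only [CrossingCrossing]; omega
    · rw [compat_crossing_planar (by omega) (by omega)]
      simp only [PlanarCrossing]; omega
    · rw [compat_crossing_planar (by omega) (by omega)]
      simp only [PlanarCrossing]; omega
  · rcases hd with hd | hd | hd | hd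
    · omega
    · rw [compat_planar_crossing (by omega) (by omega)]
      simp only [PlanarCrossing]; omega
    · rw [compat_planar_planar (by omega) (by omega)]
      simp only [PlanarPlanar]; omega
    · rw [compat_planar_planar (by omega) (by omega)]
      simp only [PlanarPlanar]; omega
  · rcases hd with hd | hd | hd | hd
    · omega
    · rw [compat_planar_crossing (by omega) (by omega)]
      simp only [PlanarCrossing]; omega
    · rw [compat_planar_planar (by omega) (by omega)]
      simp only [PlanarPlanar]; omega
    · rw [compat_planar_planar (by omega) (by omega)]
      simp only [PlanarPlanar]; omega

theorem isSystem_zag {n y : ℤ} (hn : 10 ≤ n) (hy : y = (n - 7) / 2 + 4) :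
    IsSystem n (codesWith n (ZagArc n y)) := by
  refine isSystem_of_arcs fun i j k l ⟨h1, h2, h3, h4⟩ ⟨h5, h6, h7, h8⟩ hc hd hij hkl => ?_
  simp only [ZagArc, Pentagram] at *
  rcases hc with hc | hc | hc | hc
  · omega
  · rcases hd with hd | hd | hd | hd
    · omega
    · rw [compat_crossing_crossing (by omega) (by omega)]
      simp only [CrossingCrossing]; omega
    · rw [compat_crossing_planar (by omega) (by omega)]
      simp only [PlanarCrossing]; omega
    · rw [compat_crossing_planar (by omega) (by omega)]
      simp only [PlanarCrossing]; omega
  · rcases hd with hd | hd | hd | hd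
    · omega
    · rw [compat_planar_crossing (by omega) (by omega)]
      simp only [PlanarCrossing]; omega
    · rw [compat_planar_planar (by omega) (by omega)]
      simp only [PlanarPlanar]; omega
    · rw [compat_planar_planar (by omega) (by omega)]
      simp only [PlanarPlanar]; omega
  · rcases hd with hd | hd | hd | hd
    · omega
    · rw [compat_planar_crossing (by omega) (by omega)]
      simp only [PlanarCrossing]; omega
    · rw [compat_planar_planar (by omega) (by omega)]
      simp only [PlanarPlanar]; omega
    · rw [compat_planar_planar (by omega) (by omega)]
      simp only [PlanarPlanar]; omega

/-! ### Contraction of the pentagrams -/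

/-- The contraction that maps the vertices `0, …, 4` to `0` and the vertices `z + 4, …, z + 8`
to `z`. -/
def collapse (m z : ℤ) : ℤ → ℤ := squeeze (m + 4) z 4 ∘ squeeze (m + 8) 0 4

theorem isGood_collapse {m z : ℤ} (hz : 0 ≤ z) (h : z < m) : IsGood (m + 8) m (collapse m z) := by
  have h1 := isGood_squeeze (n := m + 8) (a := 0) (l := 4) le_rfl (by omega) (by omega)
  have h2 := isGood_squeeze (n := m + 4) (a := z) (l := 4) hz (by omega) (by omega)
  rw [show m + 8 - 4 = m + 4 by ring] at h1
  rw [show m + 4 - 4 = m by ring] at h2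
  exact h1.comp (by omega) h2

theorem collapse_cases {m z : ℤ} (hz : 0 ≤ z) (h : z < m) (x : ℤ) (hx : 0 ≤ x)
    (hx' : x < 2 * (m + 8)) : (x ≤ 4 ∧ collapse m z x = 0) ∨
    (4 ≤ x ∧ x ≤ z + 4 ∧ collapse m z x = x - 4) ∨
    (z + 4 ≤ x ∧ x ≤ z + 8 ∧ collapse m z x = z) ∨
    (z + 8 ≤ x ∧ x ≤ m + 8 ∧ collapse m z x = x - 8) ∨
    (m + 8 ≤ x ∧ x ≤ m + 12 ∧ collapse m z x = m) ∨
    (m + 12 ≤ x ∧ x ≤ m + z + 12 ∧ collapse m z x = x - 12) ∨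
    (m + z + 12 ≤ x ∧ x ≤ m + z + 16 ∧ collapse m z x = m + z) ∨
    (m + z + 16 ≤ x ∧ collapse m z x = x - 16) := by
  have h1 := squeeze_cases (n := m + 8) (a := 0) (l := 4) (by omega) (by omega) x
  have h2 := squeeze_cases (n := m + 4) (a := z) (l := 4) (by omega) (by omega)
    (squeeze (m + 8) 0 4 x)
  simp only [collapse, Function.comp]
  generalize squeeze (m + 8) 0 4 x = u at *
  generalize squeeze (m + 4) z 4 u = v at *
  rcases le_or_gt x 4 with c1 | c1
  · exact Or.inl ⟨c1, by omega⟩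
  refine Or.inr ?_
  rcases le_or_gt x (z + 4) with c2 | c2
  · exact Or.inl ⟨c1.le, c2, by omega⟩
  refine Or.inr ?_
  rcases le_or_gt x (z + 8) with c3 | c3
  · exact Or.inl ⟨c2.le, c3, by omega⟩
  refine Or.inr ?_
  rcases le_or_gt x (m + 8) with c4 | c4
  · exact Or.inl ⟨c3.le, c4, by omega⟩
  refine Or.inr ?_
  rcases le_or_gt x (m + 12) with c5 | c5
  · exact Or.inl ⟨c4.le, c5, by omega⟩
  refine Or.inr ?_
  rcases le_or_gt x (m + z + 12) with c6 | c6
  · exact Or.inl ⟨c5.le, c6, by omega⟩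
  refine Or.inr ?_
  rcases le_or_gt x (m + z + 16) with c7 | c7
  · exact Or.inl ⟨c6.le, c7, by omega⟩
  exact Or.inr ⟨c7.le, by omega⟩

theorem isZig_contract_collapse {m z : ℤ} (hm : 2 ≤ m) (hz : m = 2 * z ∨ m = 2 * z - 1) :
    IsZig m (contract (collapse m z) (codesWith (m + 8) (ZigArc (m + 8) (z + 4)))) := by
  have hc := (isGood_collapse (m := m) (z := z) (by omega) (by omega)).toIsContraction
  have key := collapse_cases (m := m) (z := z) (by omega) (by omega)
  have hz2 : (m + 1) / 2 = z := by omega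
  rintro ⟨i', j'⟩
  constructor
  · rw [mem_contract]
    rintro ⟨⟨i, j⟩, h1, h2, h3⟩
    obtain ⟨h4, h5⟩ := mem_codesWith.1 h1
    have h6 := hc.isCode h4
    rw [h3] at h6
    refine ⟨h6, ?_⟩
    obtain ⟨h7, h8, h9, h10⟩ := h4
    simp only [NonDeg, Prod.map_apply, Prod.mk.injEq, ZigArc, Pentagram] at *
    have k1 := key i h7 (by omega)
    have k2 := key j h9 (by omega)
    generalize collapse m z i = u at *
    generalize collapse m z j = v at *
    obtain ⟨rfl, rfl⟩ := h3
    clear hc key h1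
    rcases h5 with h5 | h5 | h5 | h5
    · left; omega
    · right; left; omega
    · left; omega
    · right; right; omega
  · rintro ⟨⟨h7, h8, h9, h10⟩, h5⟩
    simp only at *
    have mem : ∀ i j, 0 ≤ i → i < m + 8 → 0 ≤ j → j ≤ i + (m + 8) → ZigArc (m + 8) (z + 4) (i, j) →
        (i, j) ∈ codesWith (m + 8) (ZigArc (m + 8) (z + 4)) := fun i j h1 h2 h3 h4 h5 =>
      mem_codesWith.2 ⟨⟨h1, h2, h3, h4⟩, h5⟩
    simp only [ZigArc, Pentagram] at mem
    rcases h5 with h5 | h5 | h5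
    · rcases lt_or_ge i' z with h | h
      · have k1 := key (i' + 4) (by omega) (by omega)
        have k2 := key (j' + 4) (by omega) (by omega)
        exact mem_contract_mk (i' + 4) (j' + 4) (mem _ _ (by omega) (by omega) (by omega)
          (by omega) (by omega)) (by omega) (by omega) (by omega)
      · have k1 := key (i' + 8) (by omega) (by omega)
        have k2 := key (j' + 8) (by omega) (by omega)
        exact mem_contract_mk (i' + 8) (j' + 8) (mem _ _ (by omega) (by omega) (by omega)
          (by omega) (by omega)) (by omega) (by omega) (by omega)
    · have k1 := key (z + 6) (by omega) (by omega)
      have k2 := key (z + 4) (by omega) (by omega)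
      exact mem_contract_mk (z + 6) (z + 4) (mem _ _ (by omega) (by omega) (by omega)
        (by omega) (by omega)) (by omega) (by omega) (by omega)
    · rcases eq_or_ne j' (i' + 1) with h | h
      · rcases eq_or_ne i' (m - 1) with h' | h'
        · have k1 := key (i' + 8) (by omega) (by omega)
          have k2 := key (i' + 9) (by omega) (by omega)
          exact mem_contract_mk (i' + 8) (i' + 9) (mem _ _ (by omega) (by omega) (by omega)
            (by omega) (by omega)) (by omega) (by omega) (by omega)
        · exfalso; omega
      · have k1 := key (i' + 8) (by omega) (by omega)
        have k2 := key (j' + 12) (by omega) (by omega)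
        have b1 : z ≤ i' := by omega
        have b2 : m ≤ j' := by omega
        have b3 : j' ≤ m + z := by omega
        clear key mem hc
        have e1 : collapse m z (i' + 8) = i' := by omega
        have e2 : collapse m z (j' + 12) = j' := by omega
        have e3 : ZigArc (m + 8) (z + 4) (i' + 8, j' + 12) :=
          Or.inr (Or.inr (Or.inr ⟨by simp only; omega, by simp only; omega, by simp only; omega⟩))
        exact mem_contract_mk (i' + 8) (j' + 12) (mem_codesWith.2 ⟨⟨by simp only; omega,
          by simp only; omega, by simp only; omega, by simp only; omega⟩, e3⟩) e1 e2 (by omega)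

theorem isZag_contract_collapse {m z : ℤ} (hm : 2 ≤ m) (hz : m = 2 * z ∨ m = 2 * z - 1) :
    IsZag m (contract (collapse m z) (codesWith (m + 8) (ZagArc (m + 8) (z + 4)))) := by
  have hc := (isGood_collapse (m := m) (z := z) (by omega) (by omega)).toIsContraction
  have key := collapse_cases (m := m) (z := z) (by omega) (by omega)
  rintro ⟨i', j'⟩
  constructor
  · rw [mem_contract]
    rintro ⟨⟨i, j⟩, h1, h2, h3⟩
    obtain ⟨h4, h5⟩ := mem_codesWith.1 h1
    have h6 := hc.isCode h4
    rw [h3] at h6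
    refine ⟨h6, ?_⟩
    obtain ⟨h7, h8, h9, h10⟩ := h4
    simp only [NonDeg, Prod.map_apply, Prod.mk.injEq, ZagArc, Pentagram] at *
    have k1 := key i h7 (by omega)
    have k2 := key j h9 (by omega)
    generalize collapse m z i = u at *
    generalize collapse m z j = v at *
    obtain ⟨rfl, rfl⟩ := h3
    clear hc key h1
    rcases h5 with h5 | h5 | h5 | h5
    · left; omega
    · right; left; omega
    · left; omega
    · right; right; omega
  · rintro ⟨⟨h7, h8, h9, h10⟩, h5⟩
    simp only at *
    have mem : ∀ i j, 0 ≤ i → i < m + 8 → 0 ≤ j → j ≤ i + (m + 8) → ZagArc (m + 8) (z + 4) (i, j) →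
        (i, j) ∈ codesWith (m + 8) (ZagArc (m + 8) (z + 4)) := fun i j h1 h2 h3 h4 h5 =>
      mem_codesWith.2 ⟨⟨h1, h2, h3, h4⟩, h5⟩
    simp only [ZagArc, Pentagram] at mem
    rcases h5 with h5 | h5 | h5
    · rcases lt_or_ge i' z with h | h
      · have k1 := key (i' + 4) (by omega) (by omega)
        have k2 := key (j' + 4) (by omega) (by omega)
        exact mem_contract_mk (i' + 4) (j' + 4) (mem _ _ (by omega) (by omega) (by omega)
          (by omega) (by omega)) (by omega) (by omega) (by omega)
      · have k1 := key (i' + 8) (by omega) (by omega)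
        have k2 := key (j' + 8) (by omega) (by omega)
        exact mem_contract_mk (i' + 8) (j' + 8) (mem _ _ (by omega) (by omega) (by omega)
          (by omega) (by omega)) (by omega) (by omega) (by omega)
    · have k1 := key 2 (by omega) (by omega)
      have k2 := key 0 (by omega) (by omega)
      exact mem_contract_mk 2 0 (mem _ _ (by omega) (by omega) (by omega)
        (by omega) (by omega)) (by omega) (by omega) (by omega)
    · rcases eq_or_ne j' (i' + 1) with h | h
      · rcases lt_or_ge i' z with h' | h'
        · have k1 := key (i' + 4) (by omega) (by omega)
          have k2 := key (j' + 4) (by omega) (by omega)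
          exact mem_contract_mk (i' + 4) (j' + 4) (mem _ _ (by omega) (by omega) (by omega)
            (by omega) (by omega)) (by omega) (by omega) (by omega)
        · have k1 := key (i' + 8) (by omega) (by omega)
          have k2 := key (j' + 8) (by omega) (by omega)
          exact mem_contract_mk (i' + 8) (j' + 8) (mem _ _ (by omega) (by omega) (by omega)
            (by omega) (by omega)) (by omega) (by omega) (by omega)
      · have k1 := key (i' + 4) (by omega) (by omega)
        have k2 := key (j' + 8) (by omega) (by omega)
        have b1 : i' ≤ z := by omega
        have b2 : z ≤ j' := by omega
        have b3 : j' ≤ m := by omega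
        clear key mem hc
        have e1 : collapse m z (i' + 4) = i' := by omega
        have e2 : collapse m z (j' + 8) = j' := by omega
        have e3 : ZagArc (m + 8) (z + 4) (i' + 4, j' + 8) :=
          Or.inr (Or.inr (Or.inr ⟨by simp only; omega, by simp only; omega, by simp only; omega,
            by simp only; omega, by simp only; omega⟩))
        exact mem_contract_mk (i' + 4) (j' + 8) (mem_codesWith.2 ⟨⟨by simp only; omega,
          by simp only; omega, by simp only; omega, by simp only; omega⟩, e3⟩) e1 e2 (by omega)

/-- The arcs are listed explicitly: boundary arcs, then the pentagram, the arcs between the pentagram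
and the zigzag, and the zigzag. -/
theorem tight_zig {n : ℕ} {y : ℤ} (hn : 10 ≤ n) (hy : y = ((n : ℤ) - 7) / 2 + 4) :
    Tight n (codesWith n (ZigArc n y)) := by
  have h7 : (n : ℤ) = 2 * y - 1 ∨ (n : ℤ) = 2 * y := by omega
  refine card_codesWith (by omega) (isSystem_zig (by omega) hy)
    (fun k => if (k : ℤ) < n then ((k : ℤ), (k : ℤ) + 1) else
      if (k : ℤ) < n + 5 then (y + 2 + (k - n + 1) / 2, y + (k - n) / 2) else
      if (k : ℤ) < n + 9 then ((n : ℤ) - 1, (k : ℤ) - 4) else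
      ((n : ℤ) - (k - n - 7) / 2, (n : ℤ) + 4 + (k - n - 6) / 2)) ?_ ?_
  · intro k hk
    have hk' : (k : ℤ) < 2 * n := by omega
    have hk0 : 0 ≤ (k : ℤ) := by omega
    generalize (k : ℤ) = k at *
    clear hk hy
    simp only [ZigArc, Pentagram, IsCode]
    split_ifs with h1 h2 h3
    · exact ⟨by simp only; omega, Or.inl (by simp only)⟩
    · exact ⟨by simp only; omega, Or.inr (Or.inl (by simp only; omega))⟩
    · exact ⟨by simp only; omega, Or.inr (Or.inr (Or.inl ⟨rfl, by simp only; omega, by simp only; omega⟩))⟩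
    · exact ⟨by simp only; omega, Or.inr (Or.inr (Or.inr ⟨by simp only; omega,
        by simp only; omega, by simp only; omega⟩))⟩
  · intro k hk l hl
    split_ifs <;> simp only [Prod.mk.injEq] <;> omega

theorem tight_zag {n : ℕ} {y : ℤ} (hn : 10 ≤ n) (hy : y = ((n : ℤ) - 7) / 2 + 4) :
    Tight n (codesWith n (ZagArc n y)) := by
  have h7 : (n : ℤ) = 2 * y - 1 ∨ (n : ℤ) = 2 * y := by omega
  refine card_codesWith (by omega) (isSystem_zag (by omega) hy)
    (fun k => if (k : ℤ) < n then ((k : ℤ), (k : ℤ) + 1) else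
      if (k : ℤ) < n + 5 then (2 + (k - n + 1) / 2, (k - n) / 2) else
      if (k : ℤ) < n + 9 then (y + (k - n - 5), y + 5) else
      (4 + (k - n - 8) / 2, (n : ℤ) - (k - n - 9) / 2)) ?_ ?_
  · intro k hk
    have hk' : (k : ℤ) < 2 * n := by omega
    have hk0 : 0 ≤ (k : ℤ) := by omega
    generalize (k : ℤ) = k at *
    clear hk hy
    simp only [ZagArc, Pentagram, IsCode]
    split_ifs with h1 h2 h3
    · exact ⟨by simp only; omega, Or.inl (by simp only)⟩
    · exact ⟨by simp only; omega, Or.inr (Or.inl (by simp only; omega))⟩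
    · exact ⟨by simp only; omega, Or.inr (Or.inr (Or.inl ⟨by simp only; omega, by simp only; omega, rfl⟩))⟩
    · exact ⟨by simp only; omega, Or.inr (Or.inr (Or.inr ⟨by simp only; omega,
        by simp only; omega, by simp only; omega, by simp only; omega, by simp only; omega⟩))⟩
  · intro k hk l hl
    split_ifs <;> simp only [Prod.mk.injEq] <;> omega

theorem isSimp_codesWith {n : ℤ} {P : ℤ × ℤ → Prop} [DecidablePred P]
    (hloop : ∀ i j, IsCode n (i, j) → P (i, j) → j = i ∨ j = i + n → False)
    (hpar : ∀ i j, IsCode n (i, j) → P (i, j) → IsCode n (i, j + n) → P (i, j + n) → False)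
    (hrev : ∀ i j k l, IsCode n (i, j) → P (i, j) → IsCode n (k, l) → P (k, l) →
      (j = k ∨ j = k + n) → (l = i ∨ l = i + n) → False) :
    IsSimp n (codesWith n P) := by
  refine ⟨?_, ?_⟩
  · rintro ⟨i, j⟩ hc h
    obtain ⟨h1, h2⟩ := mem_codesWith.1 hc
    exact hloop i j h1 h2 (loop_cases h1 h)
  · rintro ⟨i, j⟩ hc ⟨k, l⟩ hd h
    obtain ⟨h1, h2⟩ := mem_codesWith.1 hc
    obtain ⟨h3, h4⟩ := mem_codesWith.1 hd
    rcases sameEnds_cases h1 h3 h with ⟨h5, h6⟩ | ⟨h5, h6⟩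
    · simp only at h5 h6
      subst h5
      rcases h6 with h6 | h6 | h6
      · rw [h6]
      · subst h6
        exact (hpar _ _ h1 h2 h3 h4).elim
      · obtain rfl : j = l + n := by omega
        exact (hpar _ _ h3 h4 h1 h2).elim
    · exact (hrev _ _ _ _ h1 h2 h3 h4 h5 h6).elim

theorem isSimp_zig {n y : ℤ} (hn : 10 ≤ n) (hy : y = (n - 7) / 2 + 4) :
    IsSimp n (codesWith n (ZigArc n y)) := by
  have h7 : n = 2 * y - 1 ∨ n = 2 * y := by omega
  refine isSimp_codesWith ?_ ?_ ?_
  · rintro i j ⟨h1, h2, h3, h4⟩ h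
    simp only [ZigArc, Pentagram] at *
    omega
  · rintro i j ⟨h1, h2, h3, h4⟩ h ⟨h5, h6, h7, h8⟩ h'
    simp only [ZigArc, Pentagram] at *
    rcases h with h | h | h | h <;> omega
  · rintro i j k l ⟨h1, h2, h3, h4⟩ h ⟨h5, h6, h7, h8⟩ h' ha hb
    simp only [ZigArc, Pentagram] at *
    rcases h with h | h | h | h <;> rcases h' with h' | h' | h' | h' <;> omega

theorem isSimp_zag {n y : ℤ} (hn : 10 ≤ n) (hy : y = (n - 7) / 2 + 4) :
    IsSimp n (codesWith n (ZagArc n y)) := by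
  have h7 : n = 2 * y - 1 ∨ n = 2 * y := by omega
  refine isSimp_codesWith ?_ ?_ ?_
  · rintro i j ⟨h1, h2, h3, h4⟩ h
    simp only [ZagArc, Pentagram] at *
    omega
  · rintro i j ⟨h1, h2, h3, h4⟩ h ⟨h5, h6, h7, h8⟩ h'
    simp only [ZagArc, Pentagram] at *
    rcases h with h | h | h | h <;> omega
  · rintro i j k l ⟨h1, h2, h3, h4⟩ h ⟨h5, h6, h7, h8⟩ h' ha hb
    simp only [ZagArc, Pentagram] at *
    rcases h with h | h | h | h <;> rcases h' with h' | h' | h' | h' <;> omega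

theorem five_le_fiberCard {F : ℤ → ℤ} {y u : ℤ} {U : Finset (ℤ × ℤ)}
    (hU : ∀ c, Pentagram y c → c ∈ U) (hF : ∀ x, y ≤ x → x ≤ y + 4 → F x = u) :
    5 ≤ fiberCard F (u, u) U := by
  have h : ({(y + 2, y), (y + 3, y), (y + 3, y + 1), (y + 4, y + 1), (y + 4, y + 2)} :
      Finset (ℤ × ℤ)) ⊆ U.filter fun c => c.2 ≤ c.1 ∧ Prod.map F F c = (u, u) := by
    intro c hc
    have hp : Pentagram y c := by
      simp only [Finset.mem_insert, Finset.mem_singleton] at hc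
      simp only [Pentagram]
      rcases hc with rfl | rfl | rfl | rfl | rfl <;> simp
    refine Finset.mem_filter.2 ⟨hU c hp, ?_, ?_⟩
    · simp only [Pentagram] at hp
      omega
    · simp only [Pentagram] at hp
      ext
      · exact hF _ (by omega) (by omega)
      · exact hF _ (by omega) (by omega)
  have h2 := Finset.card_le_card h
  rw [fiberCard]
  refine le_trans (le_of_eq ?_) h2
  rw [Finset.card_insert_of_notMem (by simp), Finset.card_insert_of_notMem (by simp),
    Finset.card_insert_of_notMem (by simp), Finset.card_insert_of_notMem (by simp),
    Finset.card_singleton]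

theorem fiberCard_eq_zero {n : ℤ} {P : ℤ × ℤ → Prop} [DecidablePred P] {F : ℤ → ℤ} {ζ : ℤ × ℤ}
    (h : ∀ c, IsCode n c → P c → c.2 ≤ c.1 → F c.1 = ζ.1 → F c.2 = ζ.2 → False) :
    fiberCard F ζ (codesWith n P) = 0 := by
  rw [fiberCard, Finset.card_eq_zero, Finset.filter_eq_empty_iff]
  rintro c hc ⟨h1, h2⟩
  obtain ⟨h3, h4⟩ := mem_codesWith.1 hc
  exact h c h3 h4 h1 (congrArg Prod.fst h2) (congrArg Prod.snd h2)

/-- Two explicit simplicial triangulations at distance at least `5n/2 - 16`. -/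
theorem exists_simpChain_le_of_ten_le {n : ℕ} (hn : 10 ≤ n) :
    ∃ U V, IsTri n U ∧ IsSimp n U ∧ IsTri n V ∧ IsSimp n V ∧
      ∀ k, SimpChain n k U V → 5 * (n : ℤ) / 2 - 16 ≤ k := by
  obtain ⟨m, rfl⟩ : ∃ m, n = m + 8 := ⟨n - 8, by omega⟩
  obtain ⟨z, hz, hy⟩ : ∃ z : ℤ, ((m : ℤ) = 2 * z ∨ (m : ℤ) = 2 * z - 1) ∧
      z + 4 = (((m + 8 : ℕ) : ℤ) - 7) / 2 + 4 := ⟨((m : ℤ) + 1) / 2, by omega, by push_cast; omega⟩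
  have tU := tight_zig hn hy
  have tV := tight_zag hn hy
  have h10 : (10 : ℤ) ≤ ((m + 8 : ℕ) : ℤ) := by omega
  refine ⟨_, _, tU.isTri (by omega), isSimp_zig h10 hy, tV.isTri (by omega), isSimp_zag h10 hy,
    fun k hk => ?_⟩
  have hp := hk.path tU
  push_cast at hp tU tV
  have hg := isGood_collapse (m := m) (z := z) (by omega) (by omega)
  have key := collapse_cases (m := m) (z := z) (by omega) (by omega)
  have hcross : ¬ Compat m (z, z) (0, 0) := by
    rw [compat_crossing_crossing le_rfl le_rfl]
    simp only [CrossingCrossing]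
    omega
  obtain ⟨p, hp1, hp2⟩ := hp.fiberCard_le (by omega) hg hcross
  have f1 : 5 ≤ fiberCard (collapse m z) (z, z)
      (codesWith ((m : ℤ) + 8) (ZigArc ((m : ℤ) + 8) (z + 4))) := by
    refine five_le_fiberCard (y := z + 4) (fun c hc => mem_codesWith.2 ⟨?_, Or.inr (Or.inl hc)⟩)
      fun x h1 h2 => ?_
    · simp only [Pentagram, IsCode] at hc ⊢
      omega
    · have := key x (by omega) (by omega)
      omega
  have f2 : 5 ≤ fiberCard (collapse m z) (0, 0)
      (codesWith ((m : ℤ) + 8) (ZagArc ((m : ℤ) + 8) (z + 4))) := by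
    refine five_le_fiberCard (y := 0) (fun c hc => mem_codesWith.2 ⟨?_, Or.inr (Or.inl hc)⟩)
      fun x h1 h2 => ?_
    · simp only [Pentagram, IsCode] at hc ⊢
      omega
    · have := key x (by omega) (by omega)
      omega
  have f3 : fiberCard (collapse m z) (0, 0)
      (codesWith ((m : ℤ) + 8) (ZigArc ((m : ℤ) + 8) (z + 4))) = 0 := by
    refine fiberCard_eq_zero fun c ⟨h1, h2, h3, h4⟩ h5 h6 h7 _ => ?_
    have := key c.1 h1 (by omega)
    simp only [ZigArc, Pentagram] at *
    omega
  have f4 : fiberCard (collapse m z) (z, z)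
      (codesWith ((m : ℤ) + 8) (ZagArc ((m : ℤ) + 8) (z + 4))) = 0 := by
    refine fiberCard_eq_zero fun c ⟨h1, h2, h3, h4⟩ h5 h6 _ h7 => ?_
    have := key c.2 h3 (by omega)
    simp only [ZagArc, Pentagram] at *
    omega
  have h := le_of_path (by omega) (isZig_contract_collapse (by omega) hz)
    (isZag_contract_collapse (by omega) hz) hp1
  push_cast
  omega

/-- The arcs of the triangulations made of a pentagram on the vertices `y, …, y + 4` and of a fan
around the vertex `y + 4`. -/
def FanArc (n y : ℤ) (c : ℤ × ℤ) : Prop :=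
  c.2 = c.1 + 1 ∨ Pentagram y c ∨ (c.1 = y + 4 ∧ y + 6 ≤ c.2 ∧ c.2 ≤ y + n)

instance (n y : ℤ) : DecidablePred (FanArc n y) := fun c => by unfold FanArc; infer_instance

theorem isSystem_fan {n y : ℤ} : IsSystem n (codesWith n (FanArc n y)) := by
  refine isSystem_of_arcs fun i j k l ⟨h1, h2, h3, h4⟩ ⟨h5, h6, h7, h8⟩ hc hd hij hkl => ?_
  simp only [FanArc, Pentagram] at *
  rcases hc with hc | hc | hc
  · omega
  · rcases hd with hd | hd | hd
    · omega
    · rw [compat_crossing_crossing (by omega) (by omega)]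
      simp only [CrossingCrossing]; omega
    · rw [compat_crossing_planar (by omega) (by omega)]
      simp only [PlanarCrossing]; omega
  · rcases hd with hd | hd | hd
    · omega
    · rw [compat_planar_crossing (by omega) (by omega)]
      simp only [PlanarCrossing]; omega
    · rw [compat_planar_planar (by omega) (by omega)]
      simp only [PlanarPlanar]; omega

theorem tight_fan {n : ℕ} {y : ℤ} (hy : 0 ≤ y) (hyn : y + 5 ≤ n) :
    Tight n (codesWith n (FanArc n y)) := by
  refine card_codesWith (by omega) (isSystem_fan)
    (fun k => if (k : ℤ) < n then ((k : ℤ), (k : ℤ) + 1) else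
      if (k : ℤ) < n + 5 then (y + 2 + (k - n + 1) / 2, y + (k - n) / 2) else
      (y + 4, y + k - n + 1)) ?_ ?_
  · intro k hk
    have hk' : (k : ℤ) < 2 * n := by omega
    have hk0 : 0 ≤ (k : ℤ) := by omega
    generalize (k : ℤ) = k at *
    clear hk
    simp only [FanArc, Pentagram, IsCode]
    split_ifs with h1 h2
    · exact ⟨by simp only; omega, Or.inl (by simp only)⟩
    · exact ⟨by simp only; omega, Or.inr (Or.inl (by simp only; omega))⟩
    · exact ⟨by simp only; omega, Or.inr (Or.inr ⟨rfl, by simp only; omega,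
        by simp only; omega⟩)⟩
  · intro k hk l hl
    split_ifs <;> simp only [Prod.mk.injEq] <;> omega

theorem isSimp_fan {n y : ℤ} (hy : 0 ≤ y) (hyn : y + 5 ≤ n) :
    IsSimp n (codesWith n (FanArc n y)) := by
  refine isSimp_codesWith ?_ ?_ ?_
  · rintro i j ⟨h1, h2, h3, h4⟩ h
    simp only [FanArc, Pentagram] at *
    omega
  · rintro i j ⟨h1, h2, h3, h4⟩ h ⟨h5, h6, h7, h8⟩ h'
    simp only [FanArc, Pentagram] at *
    rcases h with h | h | h <;> omega
  · rintro i j k l ⟨h1, h2, h3, h4⟩ h ⟨h5, h6, h7, h8⟩ h' ha hb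
    simp only [FanArc, Pentagram] at *
    rcases h with h | h | h <;> rcases h' with h' | h' | h' <;> omega

theorem SimpChain.card_sdiff_le {n : ℤ} {k : ℕ} {U V : Finset (ℤ × ℤ)} (h : SimpChain n k U V) :
    (U \ V).card ≤ k := by
  induction h with
  | refl h h' => simp
  | @step k U V W h hW hW' hf ih =>
    obtain ⟨α, hα, β, hβ, rfl⟩ := hf
    have : U \ insert β (V.erase α) ⊆ insert α (U \ V) := by
      intro c
      simp only [Finset.mem_sdiff, Finset.mem_insert, Finset.mem_erase]
      tauto
    have h1 := Finset.card_le_card this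
    have h2 := Finset.card_insert_le α (U \ V)
    omega

/-- For small `n`, the distance between two fans is bounded below by the number of the arcs that they
do not share. -/
theorem exists_simpChain_le {n : ℕ} (hn : 5 ≤ n) :
    ∃ U V, IsTri n U ∧ IsSimp n U ∧ IsTri n V ∧ IsSimp n V ∧
      ∀ k, SimpChain n k U V → 5 * (n : ℤ) / 2 - 16 ≤ k := by
  rcases le_or_gt 10 n with h | h
  · exact exists_simpChain_le_of_ten_le h
  have t1 := tight_fan (n := n) (y := 0) (by omega) (by omega)
  have t2 := tight_fan (n := n) (y := n - 5) (by omega) (by omega)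
  refine ⟨_, _, t1.isTri (by omega), isSimp_fan (by omega) (by omega), t2.isTri (by omega),
    isSimp_fan (by omega) (by omega), fun k hk => ?_⟩
  have h1 := hk.card_sdiff_le
  have key : ∀ i j, IsCode n (i, j) → FanArc n 0 (i, j) → ¬ FanArc n ((n : ℤ) - 5) (i, j) →
      (i, j) ∈ codesWith n (FanArc n 0) \ codesWith n (FanArc n ((n : ℤ) - 5)) := fun i j a b d =>
    Finset.mem_sdiff.2 ⟨mem_codesWith.2 ⟨a, b⟩, fun h => d (mem_codesWith.1 h).2⟩
  simp only [IsCode, FanArc, Pentagram] at key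
  rcases lt_or_ge n 7 with h7 | h7
  · omega
  rcases lt_or_ge n 8 with h8 | h8
  · have h2 : 1 ≤ (codesWith n (FanArc n 0) \ codesWith n (FanArc n ((n : ℤ) - 5))).card :=
      Finset.card_pos.2 ⟨(2, 0), key _ _ (by omega) (by omega) (by omega)⟩
    omega
  · have h2 : ({(2, 0), (3, 0), (3, 1), (4, 1), (4, 2), (4, 6)} : Finset (ℤ × ℤ)) ⊆
        codesWith n (FanArc n 0) \ codesWith n (FanArc n ((n : ℤ) - 5)) := by
      intro c hc
      simp only [Finset.mem_insert, Finset.mem_singleton] at hc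
      rcases hc with rfl | rfl | rfl | rfl | rfl | rfl <;>
        exact key _ _ (by omega) (by omega) (by omega)
    have h3 := Finset.card_le_card h2
    have h4 : ({(2, 0), (3, 0), (3, 1), (4, 1), (4, 2), (4, 6)} : Finset (ℤ × ℤ)).card = 6 := by
      decide
    omega

/-! ### Rotations and chains of flips -/

theorem SimpChain.isTri_right {n : ℤ} {k : ℕ} {U V : Finset (ℤ × ℤ)} (h : SimpChain n k U V) :
    IsTri n V ∧ IsSimp n V := by
  cases h with
  | refl h h' => exact ⟨h, h'⟩
  | step _ hW hW' _ => exact ⟨hW, hW'⟩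

theorem SimpChain.single {n : ℤ} {U V : Finset (ℤ × ℤ)} (hU : IsTri n U) (hU' : IsSimp n U)
    (hV : IsTri n V) (hV' : IsSimp n V) (h : Flip U V) : SimpChain n 1 U V :=
  .step (.refl hU hU') hV hV' h

theorem SimpChain.trans {n : ℤ} {k l : ℕ} {U V W : Finset (ℤ × ℤ)} (h : SimpChain n k U V)
    (h' : SimpChain n l V W) : SimpChain n (k + l) U W := by
  induction h' with
  | refl _ _ => exact h
  | step _ hW hW' hf ih => exact .step (ih h) hW hW' hf

theorem SimpChain.symm {n : ℤ} {k : ℕ} {U V : Finset (ℤ × ℤ)} (h : SimpChain n k U V) :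
    SimpChain n k V U := by
  induction h with
  | refl h h' => exact .refl h h'
  | @step k U V W h hW hW' hf ih =>
    have := (SimpChain.single hW hW' h.isTri_right.1 h.isTri_right.2 hf.symm).trans ih
    rwa [add_comm] at this

/-- A permutation of the codes that preserves compatibility, coincidence of the extremities and the
length of planar arcs. -/
structure IsMotion (n : ℤ) (f : ℤ × ℤ → ℤ × ℤ) : Prop where
  isCode : ∀ c, IsCode n c → IsCode n (f c)
  inj : ∀ c d, IsCode n c → IsCode n d → f c = f d → c = d
  surj : ∀ d, IsCode n d → ∃ c, IsCode n c ∧ f c = d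
  compat : ∀ c d, IsCode n c → IsCode n d → (Compat n (f c) (f d) ↔ Compat n c d)
  loop : ∀ c, IsCode n c → (n ∣ (f c).2 - (f c).1 ↔ n ∣ c.2 - c.1)
  ends : ∀ c d, IsCode n c → IsCode n d → (SameEnds n (f c) (f d) ↔ SameEnds n c d)
  planar : ∀ c, IsCode n c → ((f c).1 < (f c).2 ↔ c.1 < c.2)
  length : ∀ c, IsCode n c → c.1 < c.2 → (f c).2 - (f c).1 = c.2 - c.1

namespace IsMotion

variable {n : ℤ} {f g : ℤ × ℤ → ℤ × ℤ}

theorem comp (hg : IsMotion n g) (hf : IsMotion n f) : IsMotion n (g ∘ f) where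
  isCode c h := hg.isCode _ (hf.isCode c h)
  inj c d hc hd h := hf.inj c d hc hd (hg.inj _ _ (hf.isCode c hc) (hf.isCode d hd) h)
  surj d hd := by
    obtain ⟨c, hc, rfl⟩ := hg.surj d hd
    obtain ⟨b, hb, rfl⟩ := hf.surj c hc
    exact ⟨b, hb, rfl⟩
  compat c d hc hd := (hg.compat _ _ (hf.isCode c hc) (hf.isCode d hd)).trans (hf.compat c d hc hd)
  loop c hc := (hg.loop _ (hf.isCode c hc)).trans (hf.loop c hc)
  ends c d hc hd := (hg.ends _ _ (hf.isCode c hc) (hf.isCode d hd)).trans (hf.ends c d hc hd)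
  planar c hc := (hg.planar _ (hf.isCode c hc)).trans (hf.planar c hc)
  length c hc h := (hg.length _ (hf.isCode c hc) ((hf.planar c hc).2 h)).trans (hf.length c hc h)

theorem exists_inverse (hf : IsMotion n f) :
    ∃ g, IsMotion n g ∧ ∀ c, IsCode n c → g (f c) = c := by
  have : ∀ d, ∃ c, IsCode n d → IsCode n c ∧ f c = d := fun d => by
    by_cases h : IsCode n d
    · obtain ⟨c, hc⟩ := hf.surj d h
      exact ⟨c, fun _ => hc⟩
    · exact ⟨d, fun h' => absurd h' h⟩
  choose g hg using this
  have hgf : ∀ c, IsCode n c → g (f c) = c := fun c hc =>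
    hf.inj _ _ (hg _ (hf.isCode c hc)).1 hc (hg _ (hf.isCode c hc)).2
  refine ⟨g, ⟨fun c hc => (hg c hc).1, fun c d hc hd h => ?_, fun d hd => ⟨f d, hf.isCode d hd,
    hgf d hd⟩, fun c d hc hd => ?_, fun c hc => ?_, fun c d hc hd => ?_, fun c hc => ?_,
    fun c hc h => ?_⟩, hgf⟩
  · rw [← (hg c hc).2, h, (hg d hd).2]
  · rw [← hf.compat _ _ (hg c hc).1 (hg d hd).1, (hg c hc).2, (hg d hd).2]
  · rw [← hf.loop _ (hg c hc).1, (hg c hc).2]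
  · rw [← hf.ends _ _ (hg c hc).1 (hg d hd).1, (hg c hc).2, (hg d hd).2]
  · rw [← hf.planar _ (hg c hc).1, (hg c hc).2]
  · have h1 : (g c).1 < (g c).2 := by
      rw [← hf.planar _ (hg c hc).1, (hg c hc).2]; exact h
    rw [← hf.length _ (hg c hc).1 h1, (hg c hc).2]

theorem mem_image (hf : IsMotion n f) {U : Finset (ℤ × ℤ)} (hU : ∀ c ∈ U, IsCode n c) {c : ℤ × ℤ}
    (hc : IsCode n c) : f c ∈ U.image f ↔ c ∈ U := by
  rw [Finset.mem_image]
  exact ⟨fun ⟨d, hd, h⟩ => hf.inj _ _ (hU d hd) hc h ▸ hd, fun h => ⟨c, h, rfl⟩⟩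

theorem isTri (hf : IsMotion n f) {U : Finset (ℤ × ℤ)} (hU : IsTri n U) : IsTri n (U.image f) := by
  refine ⟨⟨fun c hc => ?_, fun c hc d hd => ?_⟩, fun c hc h => ?_⟩
  · obtain ⟨c, hc', rfl⟩ := Finset.mem_image.1 hc
    exact hf.isCode c (hU.1.1 c hc')
  · obtain ⟨c, hc', rfl⟩ := Finset.mem_image.1 hc
    obtain ⟨d, hd', rfl⟩ := Finset.mem_image.1 hd
    exact (hf.compat c d (hU.1.1 c hc') (hU.1.1 d hd')).2 (hU.1.2 c hc' d hd')
  · obtain ⟨c, hc', rfl⟩ := hf.surj c hc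
    rw [hf.mem_image hU.1.1 hc']
    exact hU.2 c hc' fun d hd => (hf.compat c d hc' (hU.1.1 d hd)).1
      (h _ (Finset.mem_image_of_mem f hd))

theorem isSimp (hf : IsMotion n f) {U : Finset (ℤ × ℤ)} (hU : ∀ c ∈ U, IsCode n c)
    (h : IsSimp n U) : IsSimp n (U.image f) := by
  refine ⟨fun c hc => ?_, fun c hc d hd h' => ?_⟩
  · obtain ⟨c, hc', rfl⟩ := Finset.mem_image.1 hc
    rw [hf.loop c (hU c hc')]
    exact h.1 c hc'
  · obtain ⟨c, hc', rfl⟩ := Finset.mem_image.1 hc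
    obtain ⟨d, hd', rfl⟩ := Finset.mem_image.1 hd
    rw [h.2 c hc' d hd' ((hf.ends c d (hU c hc') (hU d hd')).1 h')]

theorem image_flip (hf : IsMotion n f) {U : Finset (ℤ × ℤ)} (hU : ∀ c ∈ U, IsCode n c)
    {α β : ℤ × ℤ} (hα : α ∈ U) :
    (insert β (U.erase α)).image f = insert (f β) ((U.image f).erase (f α)) := by
  rw [Finset.image_insert]
  congr 1
  ext c
  simp only [Finset.mem_image, Finset.mem_erase]
  constructor
  · rintro ⟨d, ⟨h1, h2⟩, rfl⟩
    exact ⟨fun h => h1 (hf.inj _ _ (hU d h2) (hU α hα) h), d, h2, rfl⟩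
  · rintro ⟨h1, d, h2, rfl⟩
    exact ⟨d, ⟨fun h => h1 (by rw [h]), h2⟩, rfl⟩

theorem flip (hf : IsMotion n f) {U V : Finset (ℤ × ℤ)} (hU : ∀ c ∈ U, IsCode n c)
    (hV : ∀ c ∈ V, IsCode n c) (h : Flip U V) : Flip (U.image f) (V.image f) := by
  obtain ⟨α, hα, β, hβ, rfl⟩ := h
  exact ⟨f α, Finset.mem_image_of_mem f hα, f β,
    fun h => hβ ((hf.mem_image hU (hV β (Finset.mem_insert_self _ _))).1 h), hf.image_flip hU hα⟩

theorem simpChain (hf : IsMotion n f) {k : ℕ} {U V : Finset (ℤ × ℤ)} (h : SimpChain n k U V) :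
    SimpChain n k (U.image f) (V.image f) := by
  induction h with
  | refl h h' => exact .refl (hf.isTri h) (hf.isSimp h.1.1 h')
  | step h hW hW' hg ih =>
    exact .step ih (hf.isTri hW) (hf.isSimp hW.1.1 hW') (hf.flip h.isTri_right.1.1.1 hW.1.1 hg)

theorem image_image (hg : ∀ c, IsCode n c → g (f c) = c) {U : Finset (ℤ × ℤ)}
    (hU : ∀ c ∈ U, IsCode n c) : (U.image f).image g = U := by
  ext c
  simp only [Finset.mem_image]
  constructor
  · rintro ⟨_, ⟨d, h, rfl⟩, rfl⟩
    rwa [hg d (hU d h)]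
  · intro h
    exact ⟨_, ⟨c, h, rfl⟩, hg c (hU c h)⟩

end IsMotion

/-- The effect on codes of the rotation of the surface that moves the vertex `0` to `1`. -/
def rot (n : ℤ) (c : ℤ × ℤ) : ℤ × ℤ :=
  if c.1 + 1 < n then (c.1 + 1, c.2 + 1) else
    if c.1 < c.2 then (0, c.2 + 1 - n) else if c.2 + 1 < n then (c.2 + 1, 0) else (0, 0)

theorem rot_cases {n : ℤ} {c : ℤ × ℤ} (hc : IsCode n c) :
    (c.1 + 1 < n ∧ (rot n c).1 = c.1 + 1 ∧ (rot n c).2 = c.2 + 1) ∨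
    (c.1 + 1 = n ∧ c.1 < c.2 ∧ (rot n c).1 = 0 ∧ (rot n c).2 = c.2 + 1 - n) ∨
    (c.1 + 1 = n ∧ c.2 ≤ c.1 ∧ c.2 + 1 < n ∧ (rot n c).1 = c.2 + 1 ∧ (rot n c).2 = 0) ∨
    (c.1 + 1 = n ∧ c.2 ≤ c.1 ∧ c.2 + 1 = n ∧ (rot n c).1 = 0 ∧ (rot n c).2 = 0) := by
  obtain ⟨h1, h2, h3, h4⟩ := hc
  simp only [rot]
  split_ifs <;> omega

theorem rot_mod {n : ℤ} {c : ℤ × ℤ} (hc : IsCode n c) :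
    (∃ k l : ℤ, (rot n c).1 = c.1 + 1 + n * k ∧ (rot n c).2 = c.2 + 1 + n * l) ∨
      ∃ k l : ℤ, (rot n c).1 = c.2 + 1 + n * k ∧ (rot n c).2 = c.1 + 1 + n * l := by
  rcases rot_cases hc with h | h | h | h
  · exact Or.inl ⟨0, 0, by linarith, by linarith⟩
  · exact Or.inl ⟨-1, -1, by linarith, by linarith⟩
  · exact Or.inr ⟨0, -1, by linarith, by linarith⟩
  · exact Or.inl ⟨-1, -1, by linarith, by linarith⟩

theorem dvd_shift {n a b k l : ℤ} : n ∣ (a + 1 + n * k) - (b + 1 + n * l) ↔ n ∣ a - b := by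
  rw [show (a + 1 + n * k) - (b + 1 + n * l) = (a - b) + n * (k - l) by ring]
  exact (Int.dvd_add_left (dvd_mul_right _ _))

theorem isMotion_rot (n : ℤ) : IsMotion n (rot n) where
  isCode c hc := by
    have h := rot_cases hc
    simp only [IsCode] at *
    omega
  inj c d hc hd h := by
    have h1 := rot_cases hc
    have h2 := rot_cases hd
    rw [← h] at h2
    simp only [IsCode] at *
    ext <;> omega
  surj d hd := by
    have hd' := hd
    simp only [IsCode] at hd'
    rcases lt_or_ge 0 d.1 with h1 | h1
    · rcases lt_or_ge 0 d.2 with h2 | h2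
      · have hc : IsCode n (d.1 - 1, d.2 - 1) := by simp only [IsCode]; omega
        refine ⟨_, hc, ?_⟩
        have := rot_cases hc
        simp only at this
        ext <;> omega
      · have hc : IsCode n (n - 1, d.1 - 1) := by simp only [IsCode]; omega
        refine ⟨_, hc, ?_⟩
        have := rot_cases hc
        simp only at this
        ext <;> omega
    · have hc : IsCode n (n - 1, d.2 - 1 + n) := by simp only [IsCode]; omega
      refine ⟨_, hc, ?_⟩
      have := rot_cases hc
      simp only at this
      ext <;> omega
  compat c d hc hd := by
    have h1 := rot_cases hc
    have h2 := rot_cases hd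
    obtain ⟨i, j⟩ := c
    obtain ⟨k, l⟩ := d
    generalize rot n (i, j) = c' at *
    generalize rot n (k, l) = d' at *
    simp only [IsCode] at hc hd
    obtain ⟨c1, c2, c3, c4⟩ := hc
    obtain ⟨d1, d2, d3, d4⟩ := hd
    simp only at *
    obtain ⟨i', j'⟩ := c'
    obtain ⟨k', l'⟩ := d'
    simp only at *
    rcases h1 with ⟨h1, rfl, rfl⟩ | ⟨h1, h1', rfl, rfl⟩ | ⟨h1, h1', h1'', rfl, rfl⟩ |
      ⟨h1, h1', h1'', rfl, rfl⟩ <;>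
    rcases h2 with ⟨h2, rfl, rfl⟩ | ⟨h2, h2', rfl, rfl⟩ | ⟨h2, h2', h2'', rfl, rfl⟩ |
      ⟨h2, h2', h2'', rfl, rfl⟩ <;>
    rcases lt_or_ge i j with hij | hij <;> rcases lt_or_ge k l with hkl | hkl <;>
    first
    | omega
    | (rw [compat_planar_planar (by omega) (by omega), compat_planar_planar (by omega) (by omega)]
       simp only [PlanarPlanar]; omega)
    | (rw [compat_planar_crossing (by omega) (by omega),
         compat_planar_crossing (by omega) (by omega)]
       simp only [PlanarCrossing]; omega)
    | (rw [compat_crossing_planar (by omega) (by omega),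
         compat_crossing_planar (by omega) (by omega)]
       simp only [PlanarCrossing]; omega)
    | (rw [compat_crossing_crossing (by omega) (by omega),
         compat_crossing_crossing (by omega) (by omega)]
       simp only [CrossingCrossing]; omega)
  loop c hc := by
    rcases rot_mod hc with ⟨k, l, h1, h2⟩ | ⟨k, l, h1, h2⟩
    · rw [h1, h2, dvd_shift]
    · rw [h1, h2, dvd_shift, ← dvd_neg, neg_sub]
  ends c d hc hd := by
    simp only [SameEnds]
    rcases rot_mod hc with ⟨k, l, h1, h2⟩ | ⟨k, l, h1, h2⟩ <;>
    rcases rot_mod hd with ⟨k', l', h3, h4⟩ | ⟨k', l', h3, h4⟩ <;>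
    rw [h1, h2, h3, h4, dvd_shift, dvd_shift, dvd_shift, dvd_shift] <;> tauto
  planar c hc := by
    have h := rot_cases hc
    simp only [IsCode] at hc
    omega
  length c hc h' := by
    have h := rot_cases hc
    simp only [IsCode] at hc
    omega

theorem exists_isMotion_planar {n i j : ℤ} (hc : IsCode n (i, j)) (h : i < j) :
    ∃ f, IsMotion n f ∧ f (i, j) = (0, j - i) := by
  obtain ⟨k, hk⟩ : ∃ k : ℕ, (k : ℤ) = n - 1 - i := ⟨(n - 1 - i).toNat, by
    have := hc.2.1; simp only at this; omega⟩
  induction k generalizing i j with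
  | zero =>
    refine ⟨rot n, isMotion_rot n, ?_⟩
    have := rot_cases hc
    simp only [IsCode] at *
    ext <;> simp only <;> omega
  | succ k ih =>
    have h1 := rot_cases hc
    have h2 := (isMotion_rot n).isCode _ hc
    have h3 : rot n (i, j) = (i + 1, j + 1) := by
      simp only at h1
      ext <;> simp only <;> omega
    rw [h3] at h2
    obtain ⟨f, hf, hf'⟩ := ih h2 (by omega) (by push_cast at hk; omega)
    exact ⟨f ∘ rot n, hf.comp (isMotion_rot n), by simp [h3, hf']⟩

theorem exists_isMotion_crossing {n p q : ℤ} (hc : IsCode n (p, q)) (h : q < p) :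
    ∃ f, IsMotion n f ∧ f (p, q) = (n - (p - q), 0) := by
  obtain ⟨k, hk⟩ : ∃ k : ℕ, (k : ℤ) = n - 1 - p := ⟨(n - 1 - p).toNat, by
    have := hc.2.1; simp only at this; omega⟩
  induction k generalizing p q with
  | zero =>
    refine ⟨rot n, isMotion_rot n, ?_⟩
    have := rot_cases hc
    simp only [IsCode] at *
    ext <;> simp only <;> omega
  | succ k ih =>
    have h1 := rot_cases hc
    have h2 := (isMotion_rot n).isCode _ hc
    have h3 : rot n (p, q) = (p + 1, q + 1) := by
      simp only at h1
      ext <;> simp only <;> omega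
    rw [h3] at h2
    obtain ⟨f, hf, hf'⟩ := ih h2 (by omega) (by push_cast at hk; omega)
    exact ⟨f ∘ rot n, hf.comp (isMotion_rot n), by simp [h3, hf']⟩

/-! ### Flips in quadrilaterals -/

/-- The arcs `α` and `β` are the diagonals of a quadrilateral whose sides are the elements of `S`:
only `β` crosses `α` but no side, and conversely. -/
structure IsQuad (n : ℤ) (S : Finset (ℤ × ℤ)) (α β : ℤ × ℤ) : Prop where
  isCode_left : IsCode n α
  isCode_right : IsCode n β
  notMem_left : α ∉ S
  notMem_right : β ∉ S
  not_compat : ¬ Compat n α β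
  left : ∀ w, IsCode n w → (∀ s ∈ S, Compat n w s) → w ≠ β → Compat n w α
  right : ∀ w, IsCode n w → (∀ s ∈ S, Compat n w s) → w ≠ α → Compat n w β

theorem IsQuad.symm {n : ℤ} {S : Finset (ℤ × ℤ)} {α β : ℤ × ℤ} (h : IsQuad n S α β) :
    IsQuad n S β α :=
  ⟨h.isCode_right, h.isCode_left, h.notMem_right, h.notMem_left, fun hc => h.not_compat hc.symm,
    h.right, h.left⟩

theorem IsQuad.notMem {n : ℤ} {S U : Finset (ℤ × ℤ)} {α β : ℤ × ℤ} (h : IsQuad n S α β)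
    (hU : IsTri n U) (hα : α ∈ U) : β ∉ U := fun hβ => h.not_compat (hU.1.2 α hα β hβ)

theorem IsQuad.isTri {n : ℤ} {S U : Finset (ℤ × ℤ)} {α β : ℤ × ℤ} (h : IsQuad n S α β)
    (hU : IsTri n U) (hS : S ⊆ U) : IsTri n (insert β (U.erase α)) := by
  have hβ : ∀ c ∈ U.erase α, Compat n c β := fun c hc => by
    obtain ⟨h1, h2⟩ := Finset.mem_erase.1 hc
    exact h.right c (hU.1.1 c h2) (fun s hs => hU.1.2 c h2 s (hS hs)) h1
  have hSV : S ⊆ insert β (U.erase α) := fun s hs =>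
    Finset.mem_insert_of_mem (Finset.mem_erase.2 ⟨fun e => h.notMem_left (e ▸ hs), hS hs⟩)
  refine ⟨IsSystem.insert ⟨fun c hc => hU.1.1 c (Finset.mem_of_mem_erase hc), fun c hc d hd =>
    hU.1.2 c (Finset.mem_of_mem_erase hc) d (Finset.mem_of_mem_erase hd)⟩ h.isCode_right
    fun c hc => (hβ c hc).symm, fun c hc hV => ?_⟩
  by_cases hcβ : c = β
  · rw [hcβ]; exact Finset.mem_insert_self _ _
  have hcα : c ≠ α := by
    rintro rfl
    exact h.not_compat (hV β (Finset.mem_insert_self _ _))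
  refine Finset.mem_insert_of_mem (Finset.mem_erase.2 ⟨hcα, hU.2 c hc fun d hd => ?_⟩)
  by_cases hdα : d = α
  · rw [hdα]
    exact h.left c hc (fun s hs => hV s (hSV hs)) hcβ
  · exact hV d (Finset.mem_insert_of_mem (Finset.mem_erase.2 ⟨hdα, hd⟩))

theorem isQuad_of_forall {n : ℤ} {s₁ s₂ s₃ s₄ α β : ℤ × ℤ} (hα : IsCode n α) (hβ : IsCode n β)
    (hα' : α ≠ s₁ ∧ α ≠ s₂ ∧ α ≠ s₃ ∧ α ≠ s₄) (hβ' : β ≠ s₁ ∧ β ≠ s₂ ∧ β ≠ s₃ ∧ β ≠ s₄)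
    (h : ¬ Compat n α β)
    (h' : ∀ i j, IsCode n (i, j) → Compat n (i, j) s₁ → Compat n (i, j) s₂ → Compat n (i, j) s₃ →
      Compat n (i, j) s₄ → ((i, j) ≠ β → Compat n (i, j) α) ∧ ((i, j) ≠ α → Compat n (i, j) β)) :
    IsQuad n {s₁, s₂, s₃, s₄} α β where
  isCode_left := hα
  isCode_right := hβ
  notMem_left := by simpa using hα'
  notMem_right := by simpa using hβ'
  not_compat := h
  left w hw hs := (h' w.1 w.2 hw (hs _ (by simp)) (hs _ (by simp)) (hs _ (by simp))
    (hs _ (by simp))).1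
  right w hw hs := (h' w.1 w.2 hw (hs _ (by simp)) (hs _ (by simp)) (hs _ (by simp))
    (hs _ (by simp))).2

/-- The quadrilateral with two vertices at the bottom of the strip and two at the top. -/
theorem isQuad_crossing {n p p' q q' : ℤ} (h1 : 0 ≤ q) (h2 : q < q') (h3 : q' ≤ p) (h4 : p < p')
    (h5 : p' < n) :
    IsQuad n {(p, q), (p', q'), (p, p'), (q, q')} (p, q') (p', q) := by
  refine isQuad_of_forall (by simp only [IsCode]; omega) (by simp only [IsCode]; omega)
    (by simp only [ne_eq, Prod.mk.injEq]; omega) (by simp only [ne_eq, Prod.mk.injEq]; omega) ?_ ?_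
  · rw [compat_crossing_crossing (by omega) (by omega)]
    simp only [CrossingCrossing]
    omega
  · rintro i j ⟨w1, w2, w3, w4⟩ h₁ h₂ h₃ h₄
    simp only [ne_eq, Prod.mk.injEq] at *
    rcases lt_or_ge i j with h | h
    · rw [compat_planar_crossing (by omega) (by omega)] at h₁ h₂
      rw [compat_planar_planar (by omega) (by omega)] at h₃ h₄
      rw [compat_planar_crossing (by omega) (by omega),
        compat_planar_crossing (by omega) (by omega)]
      simp only [PlanarCrossing, PlanarPlanar] at *
      omega
    · rw [compat_crossing_crossing (by omega) (by omega)] at h₁ h₂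
      rw [compat_crossing_planar (by omega) (by omega)] at h₃ h₄
      rw [compat_crossing_crossing (by omega) (by omega),
        compat_crossing_crossing (by omega) (by omega)]
      simp only [CrossingCrossing, PlanarCrossing] at *
      omega

/-- The quadrilateral with two vertices at the bottom of the strip and two at the top, one of those at the
bottom being the lift `n` of the vertex `0`. -/
theorem isQuad_crossing_last {n p q q' : ℤ} (h1 : 0 < q) (h2 : q < q') (h3 : q' ≤ p) (h4 : p < n) :
    IsQuad n {(p, q), (q', 0), (p, n), (q, q')} (p, q') (q, 0) := by
  refine isQuad_of_forall (by simp only [IsCode]; omega) (by simp only [IsCode]; omega)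
    (by simp only [ne_eq, Prod.mk.injEq]; omega) (by simp only [ne_eq, Prod.mk.injEq]; omega) ?_ ?_
  · rw [compat_crossing_crossing (by omega) (by omega)]
    simp only [CrossingCrossing]
    omega
  · rintro i j ⟨w1, w2, w3, w4⟩ h₁ h₂ h₃ h₄
    simp only [ne_eq, Prod.mk.injEq] at *
    rcases lt_or_ge i j with h | h
    · rw [compat_planar_crossing (by omega) (by omega)] at h₁ h₂
      rw [compat_planar_planar (by omega) (by omega)] at h₃ h₄
      rw [compat_planar_crossing (by omega) (by omega),
        compat_planar_crossing (by omega) (by omega)]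
      simp only [PlanarCrossing, PlanarPlanar] at *
      omega
    · rw [compat_crossing_crossing (by omega) (by omega)] at h₁ h₂
      rw [compat_crossing_planar (by omega) (by omega)] at h₃ h₄
      rw [compat_crossing_crossing (by omega) (by omega),
        compat_crossing_crossing (by omega) (by omega)]
      simp only [CrossingCrossing, PlanarCrossing] at *
      omega

/-- The quadrilateral with three vertices at the bottom of the strip and one at the top. -/
theorem isQuad_planar {n a b c t : ℤ} (h1 : 0 ≤ t) (h2 : t ≤ a) (h3 : a < b) (h4 : b < c)
    (h5 : c < n) :
    IsQuad n {(a, b), (b, c), (a, t), (c, t)} (b, t) (a, c) := by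
  refine isQuad_of_forall (by simp only [IsCode]; omega) (by simp only [IsCode]; omega)
    (by simp only [ne_eq, Prod.mk.injEq]; omega) (by simp only [ne_eq, Prod.mk.injEq]; omega) ?_ ?_
  · rw [compat_crossing_planar (by omega) (by omega)]
    simp only [PlanarCrossing]
    omega
  · rintro i j ⟨w1, w2, w3, w4⟩ h₁ h₂ h₃ h₄
    simp only [ne_eq, Prod.mk.injEq] at *
    rcases lt_or_ge i j with h | h
    · rw [compat_planar_crossing (by omega) (by omega)] at h₃ h₄
      rw [compat_planar_planar (by omega) (by omega)] at h₁ h₂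
      rw [compat_planar_crossing (by omega) (by omega),
        compat_planar_planar (by omega) (by omega)]
      simp only [PlanarCrossing, PlanarPlanar] at *
      omega
    · rw [compat_crossing_crossing (by omega) (by omega)] at h₃ h₄
      rw [compat_crossing_planar (by omega) (by omega)] at h₁ h₂
      rw [compat_crossing_crossing (by omega) (by omega),
        compat_crossing_planar (by omega) (by omega)]
      simp only [CrossingCrossing, PlanarCrossing] at *
      omega

/-- The quadrilateral with three vertices at the bottom of the strip, the last one being the lift `n`
of the vertex `0`, and one vertex at the top. -/
theorem isQuad_planar_last {n a b t : ℤ} (h1 : 0 < t) (h2 : t ≤ a) (h3 : a < b) (h4 : b < n) :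
    IsQuad n {(a, b), (b, n), (a, t), (t, 0)} (b, t) (a, n) := by
  refine isQuad_of_forall (by simp only [IsCode]; omega) (by simp only [IsCode]; omega)
    (by simp only [ne_eq, Prod.mk.injEq]; omega) (by simp only [ne_eq, Prod.mk.injEq]; omega) ?_ ?_
  · rw [compat_crossing_planar (by omega) (by omega)]
    simp only [PlanarCrossing]
    omega
  · rintro i j ⟨w1, w2, w3, w4⟩ h₁ h₂ h₃ h₄
    simp only [ne_eq, Prod.mk.injEq] at *
    rcases lt_or_ge i j with h | h
    · rw [compat_planar_crossing (by omega) (by omega)] at h₃ h₄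
      rw [compat_planar_planar (by omega) (by omega)] at h₁ h₂
      rw [compat_planar_crossing (by omega) (by omega),
        compat_planar_planar (by omega) (by omega)]
      simp only [PlanarCrossing, PlanarPlanar] at *
      omega
    · rw [compat_crossing_crossing (by omega) (by omega)] at h₃ h₄
      rw [compat_crossing_planar (by omega) (by omega)] at h₁ h₂
      rw [compat_crossing_crossing (by omega) (by omega),
        compat_crossing_planar (by omega) (by omega)]
      simp only [CrossingCrossing, PlanarCrossing] at *
      omega

/-- The quadrilateral made of the triangles incident to the planar arc `(0, w)`, whose third vertices
are `k` below the arc and `y` on the other side of the strip. -/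
theorem isQuad_top {n k w y : ℤ} (h1 : 0 < k) (h2 : k < w) (h3 : w < y) (h4 : y < n) :
    IsQuad n {(0, k), (k, w), (y, 0), (y, w)} (0, w) (y, k) := by
  refine isQuad_of_forall (by simp only [IsCode]; omega) (by simp only [IsCode]; omega)
    (by simp only [ne_eq, Prod.mk.injEq]; omega) (by simp only [ne_eq, Prod.mk.injEq]; omega) ?_ ?_
  · rw [compat_planar_crossing (by omega) (by omega)]
    simp only [PlanarCrossing]
    omega
  · rintro i j ⟨w1, w2, w3, w4⟩ h₁ h₂ h₃ h₄
    simp only [ne_eq, Prod.mk.injEq] at *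
    rcases lt_or_ge i j with h | h
    · rw [compat_planar_crossing (by omega) (by omega)] at h₃ h₄
      rw [compat_planar_planar (by omega) (by omega)] at h₁ h₂
      rw [compat_planar_planar (by omega) (by omega),
        compat_planar_crossing (by omega) (by omega)]
      simp only [PlanarCrossing, PlanarPlanar] at *
      omega
    · rw [compat_crossing_crossing (by omega) (by omega)] at h₃ h₄
      rw [compat_crossing_planar (by omega) (by omega)] at h₁ h₂
      rw [compat_crossing_planar (by omega) (by omega),
        compat_crossing_crossing (by omega) (by omega)]
      simp only [CrossingCrossing, PlanarCrossing] at *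
      omega

/-! ### Removal of the planar arcs -/

theorem IsTri.boundary_mem {n : ℤ} {U : Finset (ℤ × ℤ)} (hU : IsTri n U) {i : ℤ} (h0 : 0 ≤ i)
    (hi : i < n) : (i, i + 1) ∈ U := by
  have hc : IsCode n (i, i + 1) := by simp only [IsCode]; omega
  exact hU.2 _ hc fun d hd => compat_boundary hc (hU.1.1 d hd) rfl

theorem SameEnds.symm {n : ℤ} {c d : ℤ × ℤ} (h : SameEnds n c d) : SameEnds n d c := by
  rcases h with ⟨h1, h2⟩ | ⟨h1, h2⟩
  · exact Or.inl ⟨by rwa [← dvd_neg, neg_sub], by rwa [← dvd_neg, neg_sub]⟩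
  · exact Or.inr ⟨by rwa [← dvd_neg, neg_sub], by rwa [← dvd_neg, neg_sub]⟩

theorem IsSimp.insert_erase {n : ℤ} {U : Finset (ℤ × ℤ)} (h : IsSimp n U) {α β : ℤ × ℤ}
    (hβ : ¬ n ∣ β.2 - β.1) (hc : ∀ c ∈ U, c ≠ α → ¬ SameEnds n β c) :
    IsSimp n (insert β (U.erase α)) := by
  refine ⟨fun c hc => ?_, fun c hc' d hd' hs => ?_⟩
  · rcases Finset.mem_insert.1 hc with rfl | hc
    · exact hβ
    · exact h.1 c (Finset.mem_of_mem_erase hc)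
  · rcases Finset.mem_insert.1 hc' with rfl | hc'' <;>
    rcases Finset.mem_insert.1 hd' with rfl | hd''
    · rfl
    · exact (hc d (Finset.mem_of_mem_erase hd'') (Finset.ne_of_mem_erase hd'') hs).elim
    · exact (hc c (Finset.mem_of_mem_erase hc'') (Finset.ne_of_mem_erase hc'') hs.symm).elim
    · exact h.2 c (Finset.mem_of_mem_erase hc'') d (Finset.mem_of_mem_erase hd'') hs

/-- A vertex that is below no planar arc is incident to a crossing arc. -/
theorem IsTri.exists_crossing {n : ℤ} (hn : 0 < n) {U : Finset (ℤ × ℤ)} (hU : IsTri n U)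
    (h0 : ∀ c ∈ U, c.1 < c.2 → c.2 ≤ n) :
    ∃ r, 0 ≤ r ∧ (r, 0) ∈ U ∧ ∀ c ∈ U, c.2 ≤ c.1 → r ≤ c.1 := by
  rcases (U.filter fun c => c.2 ≤ c.1).eq_empty_or_nonempty with he | hne
  · have he' : ∀ c ∈ U, c.1 < c.2 := fun c hc => by
      by_contra! h
      exact Finset.notMem_empty c (he ▸ Finset.mem_filter.2 ⟨hc, h⟩)
    refine ⟨0, le_rfl, hU.2 _ (by simp only [IsCode]; omega) fun d hd => ?_, fun c hc h => ?_⟩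
    · rw [show d = (d.1, d.2) from rfl, compat_crossing_planar (he' d hd) le_rfl]
      have h1 := h0 d hd (he' d hd)
      have h2 := hU.1.1 d hd
      simp only [IsCode] at h2
      simp only [PlanarCrossing]
      omega
    · have := he' c hc
      omega
  · obtain ⟨c, hc, hmin⟩ := Finset.exists_min_image _ (fun c : ℤ × ℤ => c.1) hne
    obtain ⟨hc, hc'⟩ := Finset.mem_filter.1 hc
    have hmin' : ∀ d ∈ U, d.2 ≤ d.1 → c.1 ≤ d.1 := fun d hd h =>
      hmin d (Finset.mem_filter.2 ⟨hd, h⟩)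
    have hcode := hU.1.1 c hc
    refine ⟨c.1, hcode.1, hU.2 _ ?_ fun d hd => ?_, hmin'⟩
    · simp only [IsCode] at *
      omega
    · have h1 := hU.1.2 c hc d hd
      have h2 := h0 d hd
      have h3 := hmin' d hd
      have h4 := hU.1.1 d hd
      obtain ⟨i, j⟩ := d
      obtain ⟨p, q⟩ := c
      simp only [IsCode] at *
      rcases lt_or_ge i j with h | h
      · rw [compat_crossing_planar h (by omega)] at h1 ⊢
        simp only [PlanarCrossing] at *
        omega
      · rw [compat_crossing_crossing (by omega) h] at h1 ⊢
        simp only [CrossingCrossing] at *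
        omega

theorem not_dvd_of_lt {n x : ℤ} (h : 0 < x) (h' : x < n) : ¬ n ∣ x := fun hd =>
  absurd (Int.le_of_dvd h hd) (by omega)

/-- In a simplicial triangulation, an arc is neither a loop nor parallel to a boundary arc. -/
theorem IsSimp.code_bounds {n : ℤ} (hn : 2 < n) {U : Finset (ℤ × ℤ)} (hU : IsTri n U)
    (hs : IsSimp n U) {c : ℤ × ℤ} (hc : c ∈ U) :
    (c.1 < c.2 → c.2 = c.1 + 1 ∨ c.1 + 2 ≤ c.2 ∧ c.2 ≤ c.1 + n - 2) ∧
      (c.2 ≤ c.1 → c.2 + 2 ≤ c.1 ∧ c.1 ≤ c.2 + n - 2) := by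
  obtain ⟨i, j⟩ := c
  obtain ⟨h1, h2, h3, h4⟩ := hU.1.1 _ hc
  have hl := hs.1 _ hc
  simp only at *
  have l1 : j ≠ i := fun e => hl (by rw [e, sub_self]; exact dvd_zero n)
  have l2 : j ≠ i + n := fun e => hl (by rw [e]; simp)
  have e1 : j ≠ i - 1 := fun e => by
    have hb := hU.boundary_mem (i := j) (by omega) (by omega)
    have := hs.2 _ hc _ hb (Or.inr ⟨by simp, by simp [e]⟩)
    simp only [Prod.mk.injEq] at this
    omega
  have e2 : j ≠ i - n + 1 := fun e => by
    have hb := hU.boundary_mem (i := i) (by omega) (by omega)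
    have := hs.2 _ hc _ hb (Or.inl ⟨by simp, by simp only [e]; ring_nf; simp⟩)
    simp only [Prod.mk.injEq] at this
    omega
  have e3 : j ≠ i + n - 1 := fun e => by
    rcases eq_or_ne i 0 with h | h
    · have hb := hU.boundary_mem (i := n - 1) (by omega) (by omega)
      have := hs.2 _ hc _ hb (Or.inr ⟨by simp [e, h], by simp [h]⟩)
      simp only [Prod.mk.injEq] at this
      omega
    · have hb := hU.boundary_mem (i := i - 1) (by omega) (by omega)
      have := hs.2 _ hc _ hb (Or.inr ⟨⟨-1, by simp only [e]; ring⟩, by simp⟩)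
      simp only [Prod.mk.injEq] at this
      omega
  omega

/-- The flip of a longest planar arc leads to a crossing arc between the third vertices of the
incident triangles, and preserves simpliciality. -/
theorem IsTri.exists_flip {n : ℤ} (hn : 2 < n) {U : Finset (ℤ × ℤ)} (hU : IsTri n U)
    (hs : IsSimp n U) {w : ℤ} (hw : (0, w) ∈ U) (hw2 : 2 ≤ w)
    (hmax : ∀ c ∈ U, c.1 < c.2 → c.2 - c.1 ≤ w) :
    ∃ β, β ∉ U ∧ β.2 ≤ β.1 ∧ IsTri n (insert β (U.erase (0, w))) ∧
      IsSimp n (insert β (U.erase (0, w))) := by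
  have hwn := (hs.code_bounds hn hU hw).1 (by simp only; omega)
  have pl : ∀ i j, (i, j) ∈ U → i < j →
      (0 ≤ i ∧ i < n ∧ j ≤ i + n) ∧ j - i ≤ w ∧ PlanarPlanar n i j 0 w := fun i j h hij => by
    have h1 := hU.1.2 _ h _ hw
    rw [compat_planar_planar hij (by omega)] at h1
    have h2 := hU.1.1 _ h
    exact ⟨⟨h2.1, h2.2.1, h2.2.2.2⟩, hmax _ h hij, h1⟩
  have cr : ∀ p q, (p, q) ∈ U → q ≤ p →
      (p < n ∧ 0 ≤ q ∧ q ≠ p) ∧ PlanarCrossing n 0 w p q := fun p q h hpq => by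
    have h1 := hU.1.2 _ hw _ h
    rw [compat_planar_crossing (by omega) hpq] at h1
    have h2 := hU.1.1 _ h
    exact ⟨⟨h2.2.1, h2.2.2.1, fun e => hs.1 _ h (by simp [e])⟩, h1⟩
  simp only [PlanarPlanar, PlanarCrossing] at pl cr
  have h0 : ∀ i j, (i, j) ∈ U → i < j → j ≤ n := fun i j h hij => by
    have := pl i j h hij
    omega
  -- The third vertex of the triangle above the arc.
  obtain ⟨r, hr, hrU, -⟩ := hU.exists_crossing (by omega) fun c hc => h0 c.1 c.2 hc
  obtain ⟨⟨y, y0⟩, hy, hymax⟩ := Finset.exists_max_image (U.filter fun c => c.2 ≤ c.1 ∧ c.2 = 0)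
    (fun c => c.1) ⟨_, Finset.mem_filter.2 ⟨hrU, hr, rfl⟩⟩
  obtain ⟨hyU, hy0, rfl⟩ := Finset.mem_filter.1 hy
  have hymax' : ∀ s, (s, 0) ∈ U → 0 ≤ s → s ≤ y := fun s h h' =>
    hymax (s, 0) (Finset.mem_filter.2 ⟨h, h', rfl⟩)
  have hyw : (y, w) ∈ U := by
    have c1 := cr _ _ hyU hy0
    refine hU.2 _ (by simp only [IsCode]; omega) ?_
    rintro ⟨i, j⟩ hd
    have h1 := hU.1.2 _ hyU _ hd
    rcases lt_or_ge i j with h | h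
    · rw [compat_crossing_planar h (by omega)] at h1 ⊢
      have := pl i j hd h
      simp only [PlanarCrossing] at h1 ⊢
      omega
    · rw [compat_crossing_crossing (by omega) h] at h1 ⊢
      have c2 := cr i j hd h
      have c3 : j = 0 → i ≤ y := fun e => hymax' i (e ▸ hd) (by omega)
      simp only [CrossingCrossing] at h1 ⊢
      omega
  -- The third vertex of the triangle below the arc.
  obtain ⟨⟨k0, k⟩, hk, hkmax⟩ := Finset.exists_max_image
    (U.filter fun c => c.1 = 0 ∧ 0 < c.2 ∧ c.2 < w) (fun c => c.2)
    ⟨(0, 0 + 1), Finset.mem_filter.2 ⟨hU.boundary_mem le_rfl (by omega), rfl, by simp only; omega,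
      by simp only; omega⟩⟩
  obtain ⟨hkU, hk0, hk1, hk2⟩ := Finset.mem_filter.1 hk
  simp only at hk0 hk1 hk2
  subst hk0
  have hkmax' : ∀ l, (0, l) ∈ U → 0 < l → l < w → l ≤ k := fun l h h' h'' =>
    hkmax (0, l) (Finset.mem_filter.2 ⟨h, rfl, h', h''⟩)
  have hkw : (k, w) ∈ U := by
    refine hU.2 _ (by simp only [IsCode]; omega) ?_
    rintro ⟨i, j⟩ hd
    have h1 := hU.1.2 _ hkU _ hd
    rcases lt_or_ge i j with h | h
    · rw [compat_planar_planar (by omega) (by omega)] at h1 ⊢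
      have := pl i j hd h
      have c3 : i = 0 → j < w → j ≤ k := fun e e' => hkmax' j (e ▸ hd) (by omega) e'
      simp only [PlanarPlanar] at h1 ⊢
      omega
    · rw [compat_planar_crossing (by omega) (by omega)] at h1 ⊢
      have := cr i j hd h
      simp only [PlanarCrossing] at h1 ⊢
      omega
  have c1 := cr _ _ hyU hy0
  have c2 := cr _ _ hyw (by omega)
  have hq : IsQuad n {(0, k), (k, w), (y, 0), (y, w)} (0, w) (y, k) :=
    isQuad_top hk1 hk2 (by omega) (by omega)
  have hβ := hq.notMem hU hw
  refine ⟨(y, k), hβ, by simp only; omega, hq.isTri hU ?_, hs.insert_erase ?_ ?_⟩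
  · intro s hs
    simp only [Finset.mem_insert, Finset.mem_singleton] at hs
    rcases hs with rfl | rfl | rfl | rfl <;> assumption
  · rw [← dvd_neg, neg_sub]
    exact not_dvd_of_lt (by simp only; omega) (by simp only; omega)
  · rintro ⟨i, j⟩ hc hne h
    have h1 := sameEnds_cases hq.isCode_right (hU.1.1 _ hc) h
    simp only at h1
    rcases lt_or_ge i j with hij | hij
    · have := pl i j hc hij
      have := h0 i j hc hij
      omega
    · have := cr i j hc hij
      have h2 : i = y → j ≠ k := fun e e' => hβ (e ▸ e' ▸ hc)
      omega

/-- Only the boundary arcs are planar. -/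
def IsPure (U : Finset (ℤ × ℤ)) : Prop := ∀ c ∈ U, c.1 < c.2 → c.2 = c.1 + 1

/-- The number of planar arcs that are not boundary arcs. -/
def planarCard (U : Finset (ℤ × ℤ)) : ℕ := (U.filter fun c => c.1 + 1 < c.2).card

theorem IsTri.exists_flip_planarCard {n : ℤ} (hn : 2 < n) {U : Finset (ℤ × ℤ)} (hU : IsTri n U)
    (hs : IsSimp n U) (hp : ¬ IsPure U) :
    ∃ V, SimpChain n 1 U V ∧ planarCard V < planarCard U := by
  have hne : (U.filter fun c => c.1 < c.2).Nonempty :=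
    ⟨(0, 0 + 1), Finset.mem_filter.2 ⟨hU.boundary_mem le_rfl (by omega), by simp only; omega⟩⟩
  obtain ⟨⟨i, j⟩, hc, hmax⟩ := Finset.exists_max_image _ (fun c : ℤ × ℤ => c.2 - c.1) hne
  obtain ⟨hcU, hij⟩ := Finset.mem_filter.1 hc
  have hmax' : ∀ d ∈ U, d.1 < d.2 → d.2 - d.1 ≤ j - i := fun d hd h =>
    hmax d (Finset.mem_filter.2 ⟨hd, h⟩)
  have hw2 : 2 ≤ j - i := by
    by_contra! h
    refine hp fun d hd hd' => ?_
    have := hmax' d hd hd'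
    omega
  obtain ⟨f, hf, hfc⟩ := exists_isMotion_planar (hU.1.1 _ hcU) hij
  obtain ⟨g, hg, hgf⟩ := hf.exists_inverse
  have hU' := hf.isTri hU
  have hs' := hf.isSimp hU.1.1 hs
  have hw' : (0, j - i) ∈ U.image f := hfc ▸ Finset.mem_image_of_mem f hcU
  obtain ⟨β, hβ, hβ', hV, hVs⟩ := hU'.exists_flip hn hs' hw' hw2 fun d hd h => by
    obtain ⟨e, he, rfl⟩ := Finset.mem_image.1 hd
    have h1 := (hf.planar e (hU.1.1 e he)).1 h
    rw [hf.length e (hU.1.1 e he) h1]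
    exact hmax' e he h1
  have hβc := hV.1.1 β (Finset.mem_insert_self _ _)
  have hg0 : g (0, j - i) = (i, j) := by rw [← hfc, hgf _ (hU.1.1 _ hcU)]
  have h1 := hg.simpChain (SimpChain.single hU' hs' hV hVs ⟨_, hw', β, hβ, rfl⟩)
  rw [IsMotion.image_image hgf hU.1.1, hg.image_flip hU'.1.1 hw',
    IsMotion.image_image hgf hU.1.1, hg0] at h1
  refine ⟨_, h1, ?_⟩
  have h2 : ¬ (g β).1 + 1 < (g β).2 := fun h => by
    have := (hg.planar β hβc).1 (by omega)
    omega
  rw [planarCard, Finset.filter_insert, if_neg h2, Finset.filter_erase]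
  exact Finset.card_erase_lt_of_mem (Finset.mem_filter.2 ⟨hcU, by simp only; omega⟩)

theorem IsTri.exists_isPure {n : ℤ} (hn : 2 < n) {U : Finset (ℤ × ℤ)} (hU : IsTri n U)
    (hs : IsSimp n U) : ∃ V, IsPure V ∧ ∃ k ≤ planarCard U, SimpChain n k U V := by
  obtain ⟨m, hm⟩ : ∃ m, planarCard U = m := ⟨_, rfl⟩
  induction m using Nat.strong_induction_on generalizing U with
  | _ m ih =>
    by_cases hp : IsPure U
    · exact ⟨U, hp, 0, Nat.zero_le _, .refl hU hs⟩
    · obtain ⟨V, h1, h2⟩ := hU.exists_flip_planarCard hn hs hp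
      obtain ⟨W, hW, k, hk, h3⟩ := ih _ (by omega) h1.isTri_right.1 h1.isTri_right.2 rfl
      exact ⟨W, hW, 1 + k, by omega, h1.trans h3⟩

/-- There are at most `2 * n` arcs, including the `n` boundary arcs. -/
theorem IsTri.planarCard_le {n : ℕ} (hn : 0 < n) {U : Finset (ℤ × ℤ)} (hU : IsTri n U) :
    planarCard U ≤ n := by
  have h1 := hU.1.card_le hn
  have h2 : (U.filter fun c => ¬ c.1 + 1 < c.2).card + planarCard U = U.card := by
    rw [planarCard, add_comm]
    exact Finset.card_filter_add_card_filter_not _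
  have h3 := Finset.card_le_card_of_injOn (s := Finset.range n)
    (t := U.filter fun c => ¬ c.1 + 1 < c.2) (fun k => ((k : ℤ), (k : ℤ) + 1))
    (fun k hk => by
      have hk' : k < n := by simpa using hk
      exact Finset.mem_filter.2 ⟨hU.boundary_mem (by omega) (by omega), by simp⟩)
    (fun k _ l _ h => by simpa using h)
  rw [Finset.card_range] at h3
  omega

/-! ### Triangulations without planar arcs -/

/-- A simplicial triangulation all of whose planar arcs are boundary arcs. -/
structure IsPureTri (n : ℤ) (U : Finset (ℤ × ℤ)) : Prop where
  isTri : IsTri n U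
  isSimp : IsSimp n U
  isPure : IsPure U

namespace IsPureTri

variable {n : ℤ} {U : Finset (ℤ × ℤ)}

theorem bounds (h : IsPureTri n U) (hn : 2 < n) {p q : ℤ} (hc : (p, q) ∈ U) (hpq : q ≤ p) :
    p < n ∧ 0 ≤ q ∧ q + 2 ≤ p ∧ p ≤ q + n - 2 := by
  have h1 := h.isTri.1.1 _ hc
  have h2 := (h.isSimp.code_bounds hn h.isTri hc).2 hpq
  exact ⟨h1.2.1, h1.2.2.1, h2⟩

theorem crossing (h : IsPureTri n U) {p q s t : ℤ} (hc : (p, q) ∈ U) (hpq : q ≤ p)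
    (hd : (s, t) ∈ U) (hst : t ≤ s) : CrossingCrossing p q s t := by
  have := h.isTri.1.2 _ hc _ hd
  rwa [compat_crossing_crossing hpq hst] at this

/-- Only the crossing arcs matter for maximality. -/
theorem mem_of_forall (h : IsPureTri n U) {p q : ℤ} (hpn : p < n) (hq : 0 ≤ q) (hpq : q ≤ p)
    (hc : ∀ s t, (s, t) ∈ U → t ≤ s → CrossingCrossing p q s t) : (p, q) ∈ U := by
  have hcode : IsCode n (p, q) := by simp only [IsCode]; omega
  refine h.isTri.2 _ hcode ?_
  rintro ⟨s, t⟩ hd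
  rcases lt_or_ge s t with hst | hst
  · exact (compat_boundary (h.isTri.1.1 _ hd) hcode (h.isPure _ hd hst)).symm
  · rw [compat_crossing_crossing hpq hst]
    exact hc s t hd hst

/-- The crossing arcs form a path with unit steps in the plane. -/
theorem step (h : IsPureTri n U) (hn : 2 < n) {p q : ℤ} (hc : (p, q) ∈ U) (hpq : q ≤ p) :
    (p, q + 1) ∈ U ∨ p + 1 < n ∧ (p + 1, q) ∈ U ∨ p + 1 = n ∧ (q, 0) ∈ U := by
  have hb := h.bounds hn hc hpq
  by_contra! hne
  obtain ⟨h1, h2, h3⟩ := hne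
  -- An arc that crosses `(p, q + 1)` but not `(p, q)` is the continuation of a horizontal step.
  have key : ∃ s t, (s, t) ∈ U ∧ t ≤ s ∧ ¬ CrossingCrossing p (q + 1) s t := by
    by_contra! hall
    exact h1 (h.mem_of_forall hb.1 (by omega) (by omega) hall)
  obtain ⟨s, t, hd, hst, hx⟩ := key
  have hdb := h.bounds hn hd hst
  have h4 := h.crossing hc hpq hd hst
  rcases lt_or_ge (p + 1) n with hp | hp
  · refine h2 hp (h.mem_of_forall hp hb.2.1 (by omega) fun s' t' he hst' => ?_)
    have h5 := h.crossing hc hpq he hst'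
    have h6 := h.crossing hd hst he hst'
    simp only [CrossingCrossing] at *
    omega
  · refine h3 (by omega) (h.mem_of_forall (by omega) le_rfl (by omega) fun s' t' he hst' => ?_)
    have h5 := h.crossing hc hpq he hst'
    have h6 := h.crossing hd hst he hst'
    have h7 := h.bounds hn he hst'
    simp only [CrossingCrossing] at *
    omega

theorem exists_start (h : IsPureTri n U) (hn : 2 < n) :
    ∃ r, 0 ≤ r ∧ (r, 0) ∈ U ∧ ∀ c ∈ U, c.2 ≤ c.1 → r ≤ c.1 :=
  h.isTri.exists_crossing (by omega) fun c hc hc' => by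
    have h1 := h.isPure c hc hc'
    have h2 := (h.isTri.1.1 c hc).2.1
    omega

theorem image (h : IsPureTri n U) {f : ℤ × ℤ → ℤ × ℤ} (hf : IsMotion n f) :
    IsPureTri n (U.image f) where
  isTri := hf.isTri h.isTri
  isSimp := hf.isSimp h.isTri.1.1 h.isSimp
  isPure := by
    intro c hc hc'
    obtain ⟨d, hd, rfl⟩ := Finset.mem_image.1 hc
    have h1 := (hf.planar d (h.isTri.1.1 d hd)).1 hc'
    have h2 := hf.length d (h.isTri.1.1 d hd) h1
    have h3 := h.isPure d hd h1
    omega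

/-- From the first arc on, all the sums of coordinates are reached. -/
theorem exists_sum (h : IsPureTri n U) (hn : 2 < n) {r : ℤ} (hr : 0 ≤ r) (hrU : (r, 0) ∈ U)
    (hmin : ∀ c ∈ U, c.2 ≤ c.1 → r ≤ c.1) (k : ℕ) (hk : (k : ℤ) < n) :
    ∃ p q, (p, q) ∈ U ∧ q ≤ p ∧ p + q = r + k := by
  induction k with
  | zero => exact ⟨r, 0, hrU, hr, by simp⟩
  | succ k ih =>
    push_cast at hk ⊢
    obtain ⟨p, q, h1, h2, h3⟩ := ih (by omega)
    have hb := h.bounds hn h1 h2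
    rcases h.step hn h1 h2 with h4 | ⟨-, h4⟩ | ⟨h4, h5⟩
    · exact ⟨p, q + 1, h4, by omega, by omega⟩
    · exact ⟨p + 1, q, h4, by omega, by omega⟩
    · have := hmin _ h5 (by simp only; omega)
      simp only at this
      omega

/-- Two paths whose extremities are on the same sides of each other meet. -/
theorem exists_common_of_le {V : Finset (ℤ × ℤ)} (hU : IsPureTri n U) (hV : IsPureTri n V)
    (hn : 2 < n) {r r' : ℤ} (hr : 0 ≤ r) (hrU : (r, 0) ∈ U)
    (hmin : ∀ c ∈ U, c.2 ≤ c.1 → r ≤ c.1) (hrV : (r', 0) ∈ V)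
    (hmin' : ∀ c ∈ V, c.2 ≤ c.1 → r' ≤ c.1) (hrr : r ≤ r') :
    ∃ c, c ∈ U ∧ c ∈ V ∧ c.2 ≤ c.1 := by
  rcases hrr.eq_or_lt with rfl | hrr
  · exact ⟨_, hrU, hrV, hr⟩
  by_contra! hne
  have hdis : ∀ p q, (p, q) ∈ U → q ≤ p → (p, q) ∉ V := fun p q h1 h2 h3 => by
    have := hne _ h1 h3
    simp only at this
    omega
  have hb' := hV.bounds hn hrV (by omega)
  have key : ∀ k : ℕ, r' + k < r + n → ∃ p q p' q', (p, q) ∈ U ∧ q ≤ p ∧ p + q = r' + k ∧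
      (p', q') ∈ V ∧ q' ≤ p' ∧ p' + q' = r' + k ∧ p < p' := by
    intro k
    induction k with
    | zero =>
      intro _
      obtain ⟨p, q, h1, h2, h3⟩ := hU.exists_sum hn hr hrU hmin (r' - r).toNat (by omega)
      have hb := hU.bounds hn h1 h2
      refine ⟨p, q, r', 0, h1, h2, by push_cast; omega, hrV, by omega, by simp, ?_⟩
      by_contra! h
      obtain rfl : p = r' := by omega
      obtain rfl : q = 0 := by omega
      exact hdis _ _ h1 h2 hrV
    | succ k ih =>
      intro hk
      push_cast at hk ⊢
      obtain ⟨p, q, p', q', h1, h2, h3, h4, h5, h6, h7⟩ := ih (by omega)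
      have hb1 := hU.bounds hn h1 h2
      have hb2 := hV.bounds hn h4 h5
      have s1 : ∃ s t, (s, t) ∈ U ∧ t ≤ s ∧ s + t = r' + (k + 1) ∧ s ≤ p + 1 := by
        rcases hU.step hn h1 h2 with h | ⟨-, h⟩ | ⟨h, -⟩
        · exact ⟨p, q + 1, h, by omega, by omega, by omega⟩
        · exact ⟨p + 1, q, h, by omega, by omega, by omega⟩
        · omega
      have s2 : ∃ s t, (s, t) ∈ V ∧ t ≤ s ∧ s + t = r' + (k + 1) ∧ p' ≤ s := by
        rcases hV.step hn h4 h5 with h | ⟨-, h⟩ | ⟨h, h'⟩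
        · exact ⟨p', q' + 1, h, by omega, by omega, by omega⟩
        · exact ⟨p' + 1, q', h, by omega, by omega, by omega⟩
        · have := hmin' _ h' (by simp only; omega)
          simp only at this
          omega
      obtain ⟨s, t, a1, a2, a3, a4⟩ := s1
      obtain ⟨s', t', b1, b2, b3, b4⟩ := s2
      refine ⟨s, t, s', t', a1, a2, a3, b1, b2, b3, ?_⟩
      by_contra! h
      obtain rfl : s = s' := by omega
      obtain rfl : t = t' := by omega
      exact hdis _ _ a1 a2 b1
  obtain ⟨p, q, p', q', h1, h2, h3, h4, h5, h6, h7⟩ := key (r + n - 1 - r').toNat (by omega)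
  have hb1 := hV.bounds hn h4 h5
  have hx := hU.crossing hrU hr h1 h2
  simp only [CrossingCrossing] at hx
  omega

/-- Two triangulations without planar arcs have a crossing arc in common. -/
theorem exists_common {V : Finset (ℤ × ℤ)} (hU : IsPureTri n U) (hV : IsPureTri n V) (hn : 2 < n) :
    ∃ c, c ∈ U ∧ c ∈ V ∧ c.2 ≤ c.1 := by
  obtain ⟨r, h1, h2, h3⟩ := hU.exists_start hn
  obtain ⟨r', h1', h2', h3'⟩ := hV.exists_start hn
  rcases le_total r r' with h | h
  · exact hU.exists_common_of_le hV hn h1 h2 h3 h2' h3' h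
  · obtain ⟨c, c1, c2, c3⟩ := hV.exists_common_of_le hU hn h1' h2' h3' h2 h3 h
    exact ⟨c, c2, c1, c3⟩

end IsPureTri

/-- The code of the crossing arc with a lift from the bottom vertex `s ≤ n` to the top vertex
`t`. -/
def enc (n s t : ℤ) : ℤ × ℤ := if s < n then (s, t) else (t, 0)

theorem enc_of_lt {n s t : ℤ} (h : s < n) : enc n s t = (s, t) := if_pos h

theorem enc_self {n t : ℤ} : enc n n t = (t, 0) := if_neg (lt_irrefl n)

/-- A path with unit steps from `(v, 0)` to `(n, v)`. It is parametrized by the sum of the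
coordinates, and `f` is the first coordinate. -/
structure IsLatticePath (n v : ℤ) (f : ℤ → ℤ) : Prop where
  start : f v = v
  finish : f (n + v) = n
  step : ∀ ξ, v ≤ ξ → ξ < n + v → f (ξ + 1) = f ξ ∨ f (ξ + 1) = f ξ + 1
  lower : ∀ ξ, v ≤ ξ → ξ ≤ n + v → 2 ≤ 2 * f ξ - ξ
  upper : ∀ ξ, v ≤ ξ → ξ ≤ n + v → 2 * f ξ - ξ ≤ n - 2

theorem IsLatticePath.mono {n v : ℤ} {f : ℤ → ℤ} (h : IsLatticePath n v f) {ξ τ : ℤ} (h1 : v ≤ ξ)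
    (h2 : ξ ≤ τ) (h3 : τ ≤ n + v) : f ξ ≤ f τ ∧ f τ ≤ f ξ + (τ - ξ) := by
  obtain ⟨k, rfl⟩ : ∃ k : ℕ, τ = ξ + k := ⟨(τ - ξ).toNat, by omega⟩
  induction k with
  | zero => simp
  | succ k ih =>
    push_cast at h3 ⊢
    have h4 := ih (by omega) (by omega)
    have h5 := h.step (ξ + k) (by omega) (by omega)
    rw [← add_assoc]
    omega

theorem IsLatticePath.bounds {n v : ℤ} {f : ℤ → ℤ} (h : IsLatticePath n v f) {ξ : ℤ} (h1 : v ≤ ξ)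
    (h3 : ξ ≤ n + v) : v ≤ f ξ ∧ f ξ ≤ n ∧ f ξ ≤ ξ ∧ ξ - f ξ ≤ v := by
  have h4 := h.mono le_rfl h1 h3
  have h5 := h.mono h1 h3 le_rfl
  rw [h.start] at h4
  rw [h.finish] at h5
  omega

/-- The path, cut at one of its arcs, as the graph of a function of the sum of the coordinates. -/
theorem IsPureTri.exists_path {n v : ℤ} (hn : 2 < n) {U : Finset (ℤ × ℤ)} (h : IsPureTri n U)
    (hv : (v, 0) ∈ U) (hv0 : 0 ≤ v) : ∃ f, IsLatticePath n v f ∧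
      ∀ c, c ∈ U ↔ IsCode n c ∧ (c.2 = c.1 + 1 ∨
        ∃ ξ, v ≤ ξ ∧ ξ ≤ n + v ∧ c = enc n (f ξ) (ξ - f ξ)) := by
  have hvb := h.bounds hn hv hv0
  -- Existence of a vertex of the path for every value of the sum of the coordinates.
  have ex : ∀ k : ℕ, (k : ℤ) ≤ n → ∃ s t, v ≤ s ∧ s ≤ n ∧ 0 ≤ t ∧ t ≤ v ∧ s + t = v + k ∧
      enc n s t ∈ U := by
    intro k
    induction k with
    | zero => exact fun _ => ⟨v, 0, le_rfl, by omega, le_rfl, hv0, by simp, by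
        rwa [enc_of_lt hvb.1]⟩
    | succ k ih =>
      intro hk
      push_cast at hk ⊢
      obtain ⟨s, t, h1, h2, h3, h4, h5, h6⟩ := ih (by omega)
      rcases h2.lt_or_eq with h2 | rfl
      · rw [enc_of_lt h2] at h6
        have hb := h.bounds hn h6 (by omega)
        rcases h.step hn h6 (by omega) with h7 | ⟨h7, h8⟩ | ⟨h7, h8⟩
        · have := h.crossing hv hv0 h7 (by omega)
          simp only [CrossingCrossing] at this
          exact ⟨s, t + 1, h1, h2.le, by omega, by omega, by omega, by rwa [enc_of_lt h2]⟩
        · exact ⟨s + 1, t, by omega, by omega, h3, h4, by omega, by rwa [enc_of_lt h7]⟩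
        · exact ⟨s + 1, t, by omega, by omega, h3, h4, by omega, by rwa [h7, enc_self]⟩
      · rw [enc_self] at h6
        have hb := h.bounds hn h6 h3
        rcases h.step hn h6 h3 with h7 | ⟨h7, h8⟩ | ⟨h7, h8⟩
        · have := h.crossing hv hv0 h7 (by omega)
          simp only [CrossingCrossing] at this
          omega
        · exact ⟨s, t + 1, h1, le_rfl, by omega, by omega, by omega, by rwa [enc_self]⟩
        · omega
  have ex' : ∀ ξ, ∃ s, v ≤ ξ → ξ ≤ n + v → v ≤ s ∧ s ≤ n ∧ 0 ≤ ξ - s ∧ ξ - s ≤ v ∧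
      enc n s (ξ - s) ∈ U := fun ξ => by
    by_cases hξ : v ≤ ξ ∧ ξ ≤ n + v
    · obtain ⟨s, t, h1, h2, h3, h4, h5, h6⟩ := ex (ξ - v).toNat (by omega)
      obtain rfl : t = ξ - s := by omega
      exact ⟨s, fun _ _ => ⟨h1, h2, h3, h4, h6⟩⟩
    · exact ⟨0, fun h1 h2 => absurd ⟨h1, h2⟩ hξ⟩
  choose f hf using ex'
  -- The lifts of the arcs between the two lifts of `(v, 0)` are comparable.
  have cmp : ∀ s t s' t', v ≤ s → s ≤ n → 0 ≤ t → t ≤ v → v ≤ s' → s' ≤ n → 0 ≤ t' → t' ≤ v →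
      enc n s t ∈ U → enc n s' t' ∈ U → (s ≤ s' ∧ t ≤ t') ∨ (s' ≤ s ∧ t' ≤ t) := by
    intro s t s' t' a1 a2 a3 a4 b1 b2 b3 b4 h1 h2
    rcases a2.lt_or_eq with a2 | rfl <;> rcases b2.lt_or_eq with b2 | rfl
    · rw [enc_of_lt a2] at h1
      rw [enc_of_lt b2] at h2
      have := h.crossing h1 (by omega) h2 (by omega)
      simp only [CrossingCrossing] at this
      omega
    · rw [enc_of_lt a2] at h1
      rw [enc_self] at h2
      have := h.crossing h1 (by omega) h2 (by omega)
      simp only [CrossingCrossing] at this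
      omega
    · rw [enc_self] at h1
      rw [enc_of_lt b2] at h2
      have := h.crossing h1 (by omega) h2 (by omega)
      simp only [CrossingCrossing] at this
      omega
    · omega
  have bd : ∀ ξ, v ≤ ξ → ξ ≤ n + v → 2 ≤ 2 * f ξ - ξ ∧ 2 * f ξ - ξ ≤ n - 2 := by
    intro ξ h1 h2
    obtain ⟨a1, a2, a3, a4, a5⟩ := hf ξ h1 h2
    rcases a2.lt_or_eq with a2 | a2
    · rw [enc_of_lt a2] at a5
      have := h.bounds hn a5 (by omega)
      omega
    · rw [a2, enc_self] at a5
      have := h.bounds hn a5 (by omega)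
      omega
  refine ⟨f, ⟨?_, ?_, fun ξ h1 h2 => ?_, fun ξ h1 h2 => (bd ξ h1 h2).1,
    fun ξ h1 h2 => (bd ξ h1 h2).2⟩, ?_⟩
  · have := hf v le_rfl (by omega)
    omega
  · have := hf (n + v) (by omega) le_rfl
    omega
  · obtain ⟨a1, a2, a3, a4, a5⟩ := hf ξ h1 (by omega)
    obtain ⟨b1, b2, b3, b4, b5⟩ := hf (ξ + 1) (by omega) (by omega)
    have := cmp _ _ _ _ a1 a2 a3 a4 b1 b2 b3 b4 a5 b5
    omega
  · rintro ⟨p, q⟩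
    constructor
    · intro hc
      refine ⟨h.isTri.1.1 _ hc, ?_⟩
      rcases lt_or_ge p q with hpq | hpq
      · exact Or.inl (h.isPure _ hc hpq)
      · right
        have hb := h.bounds hn hc hpq
        have hx := h.crossing hv hv0 hc hpq
        simp only [CrossingCrossing] at hx
        rcases lt_or_ge p v with hpv | hpv
        · obtain rfl : q = 0 := by omega
          refine ⟨n + p, by omega, by omega, ?_⟩
          obtain ⟨b1, b2, b3, b4, b5⟩ := hf (n + p) (by omega) (by omega)
          have h3 : f (n + p) = n := by
            have := cmp n p _ _ (by omega) le_rfl (by omega) hpv.le b1 b2 b3 b4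
              (by rwa [enc_self]) b5
            omega
          rw [h3, enc_self, add_sub_cancel_left]
        · refine ⟨p + q, by omega, by omega, ?_⟩
          obtain ⟨b1, b2, b3, b4, b5⟩ := hf (p + q) (by omega) (by omega)
          have h3 : f (p + q) = p := by
            have := cmp p q _ _ hpv hb.1.le hb.2.1 (by omega) b1 b2 b3 b4
              (by rwa [enc_of_lt hb.1]) b5
            omega
          rw [h3, enc_of_lt hb.1, add_sub_cancel_left]
    · rintro ⟨hc, h1 | ⟨ξ, h1, h2, h3⟩⟩
      · simp only at h1
        rw [h1]
        exact h.isTri.boundary_mem hc.1 hc.2.1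
      · rw [h3]
        exact (hf ξ h1 h2).2.2.2.2

/-! ### Stars between two paths -/

/-- The arc is on the part of a path where the sum of the coordinates is between `lo` and `hi`. -/
def OnPath (n : ℤ) (f : ℤ → ℤ) (lo hi : ℤ) (c : ℤ × ℤ) : Prop :=
  ∃ ξ, lo ≤ ξ ∧ ξ ≤ hi ∧ c = enc n (f ξ) (ξ - f ξ)

/-- The arcs of a triangulation made of the beginning, until the sum of the coordinates is `l`, of
a path `f` from `(v, 0)`, of the end, from the sum `r`, of a path `g` to `(n, v)`, and of the arcs
between the vertex `v + 2` and the vertices that are between the two paths. -/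
def StarArc (n v : ℤ) (f : ℤ → ℤ) (l : ℤ) (g : ℤ → ℤ) (r : ℤ) (c : ℤ × ℤ) : Prop :=
  c.2 = c.1 + 1 ∨ OnPath n f v l c ∨ OnPath n g r (n + v) c ∨
    (c.1 = v + 2 ∧ l - f l ≤ c.2 ∧ c.2 ≤ r - g r) ∨ (c.1 = v ∧ c.2 = v + 2 ∧ f l = v) ∨
    (c.1 = v + 2 ∧ v + 2 < c.2 ∧ c.2 ≤ g r)

open Classical in
/-- The set of the codes of the arcs in `StarArc`. -/
noncomputable def star (n v : ℤ) (f : ℤ → ℤ) (l : ℤ) (g : ℤ → ℤ) (r : ℤ) : Finset (ℤ × ℤ) :=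
  codesWith n (StarArc n v f l g r)

theorem mem_star {n v : ℤ} {f : ℤ → ℤ} {l : ℤ} {g : ℤ → ℤ} {r : ℤ} {c : ℤ × ℤ} :
    c ∈ star n v f l g r ↔ IsCode n c ∧ StarArc n v f l g r c := by
  classical
  exact mem_codesWith

/-- The conditions on the two paths that make the arcs in `StarArc` simplicial: the vertex `v + 2`
is not joined twice to `v` or to `0`. -/
structure StarData (n v : ℤ) (f : ℤ → ℤ) (l : ℤ) (g : ℤ → ℤ) (r : ℤ) : Prop where
  two_le : 2 ≤ v
  le_sub : v ≤ n - 4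
  le_left : v ≤ l
  right_le : r ≤ n + v
  left : ∀ ξ, v ≤ ξ → ξ ≤ l → v ≤ f ξ ∧ f ξ ≤ v + 1 ∧ f ξ ≤ ξ ∧ ξ - f ξ ≤ v ∧
    2 ≤ 2 * f ξ - ξ ∧ 2 * f ξ - ξ ≤ n - 2
  right : ∀ ξ, r ≤ ξ → ξ ≤ n + v → v + 3 ≤ g ξ ∧ g ξ ≤ n ∧ g ξ ≤ ξ ∧ ξ - g ξ ≤ v ∧
    2 ≤ 2 * g ξ - ξ ∧ 2 * g ξ - ξ ≤ n - 2
  le_of_le : l - f l ≤ r - g r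
  not_top : f l = v → r - g r < v
  not_bot : g r = n → 1 ≤ l - f l

namespace StarData

variable {n v l r : ℤ} {f g : ℤ → ℤ}

theorem onPath_left (h : StarData n v f l g r) {c : ℤ × ℤ} (hc : OnPath n f v l c) :
    v ≤ c.1 ∧ c.1 ≤ v + 1 ∧ 0 ≤ c.2 ∧ c.2 ≤ v ∧ v ≤ c.1 + c.2 ∧ c.1 + c.2 ≤ l ∧
      2 ≤ c.1 - c.2 ∧ c.1 - c.2 ≤ n - 2 := by
  obtain ⟨ξ, h1, h2, rfl⟩ := hc
  have h3 := h.left ξ h1 h2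
  have h4 := h.le_sub
  rw [enc_of_lt (by omega)]
  simp only
  omega

theorem onPath_right (h : StarData n v f l g r) {c : ℤ × ℤ} (hc : OnPath n g r (n + v) c) :
    (v + 3 ≤ c.1 ∧ c.1 < n ∧ 0 ≤ c.2 ∧ c.2 ≤ v ∧ r ≤ c.1 + c.2 ∧ 2 ≤ c.1 - c.2 ∧
      c.1 - c.2 ≤ n - 2) ∨ (c.2 = 0 ∧ 2 ≤ c.1 ∧ c.1 ≤ v ∧ r ≤ n + c.1) := by
  obtain ⟨ξ, h1, h2, rfl⟩ := hc
  obtain ⟨h3, h4, h5⟩ := h.right ξ h1 h2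
  rcases h4.lt_or_eq with h4 | h4
  · rw [enc_of_lt h4]
    simp only
    omega
  · rw [h4] at h5 ⊢
    rw [enc_self]
    exact Or.inr ⟨rfl, by simp only; omega, by simp only; omega, by simp only; omega⟩

theorem left_mem (h : StarData n v f l g r) {ξ : ℤ} (h1 : v ≤ ξ) (h2 : ξ ≤ l) :
    (f ξ, ξ - f ξ) ∈ star n v f l g r := by
  have h3 := h.left ξ h1 h2
  have h4 := h.le_sub
  have h5 := h.two_le
  refine mem_star.2 ⟨by simp only [IsCode]; omega, Or.inr (Or.inl ⟨ξ, h1, h2, ?_⟩)⟩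
  rw [enc_of_lt (by omega)]

theorem right_mem (h : StarData n v f l g r) {ξ : ℤ} (h1 : r ≤ ξ) (h2 : ξ ≤ n + v) :
    enc n (g ξ) (ξ - g ξ) ∈ star n v f l g r := by
  have h3 := h.right ξ h1 h2
  have h4 := h.le_sub
  have h5 := h.two_le
  refine mem_star.2 ⟨?_, Or.inr (Or.inr (Or.inl ⟨ξ, h1, h2, rfl⟩))⟩
  rcases h3.2.1.lt_or_eq with h6 | h6
  · rw [enc_of_lt h6]; simp only [IsCode]; omega
  · rw [h6, enc_self]; simp only [IsCode]; omega

theorem boundary_mem {i j : ℤ} (h1 : 0 ≤ i) (h2 : i < n)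
    (h3 : j = i + 1) : (i, j) ∈ star n v f l g r :=
  mem_star.2 ⟨by simp only [IsCode]; omega, Or.inl h3⟩

theorem crossing_mem (h : StarData n v f l g r) {j : ℤ} (h1 : l - f l ≤ j)
    (h2 : j ≤ r - g r) : (v + 2, j) ∈ star n v f l g r := by
  have h3 := h.left l h.le_left le_rfl
  have h4 := h.right r le_rfl h.right_le
  have h5 := h.le_sub
  exact mem_star.2 ⟨by simp only [IsCode]; omega,
    Or.inr (Or.inr (Or.inr (Or.inl ⟨rfl, h1, h2⟩)))⟩

theorem left_planar_mem (h : StarData n v f l g r) {i : ℤ} (h1 : f l ≤ i) (h2 : i < v + 2) :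
    (i, v + 2) ∈ star n v f l g r := by
  have h3 := h.left l h.le_left le_rfl
  have h5 := h.le_sub
  have h6 := h.two_le
  refine mem_star.2 ⟨by simp only [IsCode]; omega, ?_⟩
  rcases eq_or_ne i v with h7 | h7
  · exact Or.inr (Or.inr (Or.inr (Or.inr (Or.inl ⟨h7, rfl, by omega⟩))))
  · exact Or.inl (by simp only; omega)

theorem right_planar_mem (h : StarData n v f l g r) {i : ℤ} (h1 : v + 2 < i) (h2 : i ≤ g r) :
    (v + 2, i) ∈ star n v f l g r := by
  have h3 := h.right r le_rfl h.right_le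
  have h5 := h.le_sub
  have h6 := h.two_le
  exact mem_star.2 ⟨by simp only [IsCode]; omega,
    Or.inr (Or.inr (Or.inr (Or.inr (Or.inr ⟨rfl, h1, h2⟩))))⟩

/-- The arcs of a star, in a form where the arcs on the paths are described by inequalities. -/
theorem cases (h : StarData n v f l g r) {i j : ℤ} (hc : (i, j) ∈ star n v f l g r) :
    (0 ≤ i ∧ i < n ∧ 0 ≤ j ∧ j ≤ i + n) ∧ (j = i + 1 ∨
      (v ≤ i ∧ i ≤ v + 1 ∧ 0 ≤ j ∧ j ≤ v ∧ 2 ≤ i - j ∧ i - j ≤ n - 2) ∨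
      (v + 3 ≤ i ∧ i < n ∧ 0 ≤ j ∧ j ≤ v ∧ 2 ≤ i - j ∧ i - j ≤ n - 2) ∨
      (j = 0 ∧ 2 ≤ i ∧ i ≤ v) ∨
      (i = v + 2 ∧ l - f l ≤ j ∧ j ≤ r - g r) ∨ (i = v ∧ j = v + 2 ∧ f l = v) ∨
      (i = v + 2 ∧ v + 2 < j ∧ j ≤ g r)) := by
  obtain ⟨h1, h2⟩ := mem_star.1 hc
  refine ⟨h1, ?_⟩
  rcases h2 with h2 | h2 | h2 | h2 | h2 | h2
  · exact Or.inl h2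
  · obtain ⟨a1, a2, a3, a4, -, -, a5, a6⟩ := h.onPath_left h2
    exact Or.inr (Or.inl ⟨a1, a2, a3, a4, a5, a6⟩)
  · rcases h.onPath_right h2 with ⟨a1, a2, a3, a4, -, a5, a6⟩ | ⟨a1, a2, a3, -⟩
    · exact Or.inr (Or.inr (Or.inl ⟨a1, a2, a3, a4, a5, a6⟩))
    · exact Or.inr (Or.inr (Or.inr (Or.inl ⟨a1, a2, a3⟩)))
  · exact Or.inr (Or.inr (Or.inr (Or.inr (Or.inl h2))))
  · exact Or.inr (Or.inr (Or.inr (Or.inr (Or.inr (Or.inl h2)))))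
  · exact Or.inr (Or.inr (Or.inr (Or.inr (Or.inr (Or.inr h2)))))

theorem isSimp (h : StarData n v f l g r) : IsSimp n (star n v f l g r) := by
  classical
  have h3 := h.left l h.le_left le_rfl
  have h4 := h.right r le_rfl h.right_le
  have h5 := h.le_sub
  have h6 := h.two_le
  have h7 := h.not_top
  have h8 := h.not_bot
  refine isSimp_codesWith (P := StarArc n v f l g r) ?_ ?_ ?_
  · intro i j hc hP he
    have := h.cases (mem_star.2 ⟨hc, hP⟩)
    omega
  · intro i j hc hP hc' hP'
    have h1 := h.cases (mem_star.2 ⟨hc, hP⟩)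
    have h2 := h.cases (mem_star.2 ⟨hc', hP'⟩)
    obtain ⟨h1, h1'⟩ := h1
    obtain ⟨h2, h2'⟩ := h2
    rcases h1' with h1' | h1' | h1' | h1' | h1' | h1' | h1' <;> omega
  · intro i j k m hc hP hc' hP' e1 e2
    have h1 := h.cases (mem_star.2 ⟨hc, hP⟩)
    have h2 := h.cases (mem_star.2 ⟨hc', hP'⟩)
    obtain ⟨h1, h1'⟩ := h1
    obtain ⟨h2, h2'⟩ := h2
    rcases h1' with h1' | h1' | h1' | h1' | h1' | h1' | h1' <;> omega

end StarData

/-- The flip in a quadrilateral, when it is known that one of the two sets is a triangulation. -/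
theorem simpChain_of_quad {n : ℤ} {S U V : Finset (ℤ × ℤ)} {α β : ℤ × ℤ} (hq : IsQuad n S α β)
    (hSU : S ⊆ U) (hα : α ∈ U) (hβ : β ∉ U) (hUV : ∀ c, c ∈ V ↔ c = β ∨ c ∈ U ∧ c ≠ α)
    (sU : IsSimp n U) (sV : IsSimp n V) (h : IsTri n U ∨ IsTri n V) : SimpChain n 1 U V := by
  have hne : α ≠ β := fun e => hβ (e ▸ hα)
  have e1 : V = insert β (U.erase α) := by
    ext c
    rw [hUV, Finset.mem_insert, Finset.mem_erase, and_comm]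
  have e2 : U = insert α (V.erase β) := by
    ext c
    rw [Finset.mem_insert, Finset.mem_erase, hUV]
    constructor
    · intro hc
      by_cases h1 : c = α
      · exact Or.inl h1
      · exact Or.inr ⟨fun h2 => hβ (h2 ▸ hc), Or.inr ⟨hc, h1⟩⟩
    · rintro (rfl | ⟨h1, h2 | h2⟩)
      · exact hα
      · exact absurd h2 h1
      · exact h2.1
  have hSV : S ⊆ V := fun s hs => (hUV s).2 (Or.inr ⟨hSU hs, fun e => hq.notMem_left (e ▸ hs)⟩)
  have hU : IsTri n U := by
    rcases h with h | h
    · exact h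
    · rw [e2]
      exact hq.symm.isTri h hSV
  have hV : IsTri n V := by
    rw [e1]
    exact hq.isTri hU hSU
  exact .single hU sU hV sV ⟨α, hα, β, hβ, e1⟩

theorem onPath_succ {n : ℤ} {f : ℤ → ℤ} {lo hi : ℤ} (h : lo ≤ hi + 1) {c : ℤ × ℤ} :
    OnPath n f lo (hi + 1) c ↔
      OnPath n f lo hi c ∨ c = enc n (f (hi + 1)) (hi + 1 - f (hi + 1)) := by
  constructor
  · rintro ⟨ξ, h1, h2, h3⟩
    rcases h2.lt_or_eq with h2 | rfl
    · exact Or.inl ⟨ξ, h1, by omega, h3⟩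
    · exact Or.inr h3
  · rintro (⟨ξ, h1, h2, h3⟩ | h3)
    · exact ⟨ξ, h1, by omega, h3⟩
    · exact ⟨hi + 1, h, le_rfl, h3⟩

theorem onPath_eq_or {n : ℤ} {f : ℤ → ℤ} {lo hi : ℤ} (h : lo ≤ hi) {c : ℤ × ℤ} :
    OnPath n f lo hi c ↔ OnPath n f (lo + 1) hi c ∨ c = enc n (f lo) (lo - f lo) := by
  constructor
  · rintro ⟨ξ, h1, h2, h3⟩
    rcases h1.lt_or_eq with h1 | rfl
    · exact Or.inl ⟨ξ, by omega, h2, h3⟩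
    · exact Or.inr h3
  · rintro (⟨ξ, h1, h2, h3⟩ | h3)
    · exact ⟨ξ, by omega, h2, h3⟩
    · exact ⟨lo, le_rfl, h, h3⟩

theorem star_congr {n v l r : ℤ} {f f' g g' : ℤ → ℤ} (hl : v ≤ l) (hr : r ≤ n + v)
    (h : ∀ ξ, v ≤ ξ → ξ ≤ l → f ξ = f' ξ) (h' : ∀ ξ, r ≤ ξ → ξ ≤ n + v → g ξ = g' ξ) :
    star n v f l g r = star n v f' l g' r := by
  have h1 : ∀ c, OnPath n f v l c ↔ OnPath n f' v l c := fun c => by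
    constructor
    · rintro ⟨ξ, a, b, rfl⟩
      exact ⟨ξ, a, b, by rw [h ξ a b]⟩
    · rintro ⟨ξ, a, b, rfl⟩
      exact ⟨ξ, a, b, by rw [h ξ a b]⟩
  have h2 : ∀ c, OnPath n g r (n + v) c ↔ OnPath n g' r (n + v) c := fun c => by
    constructor
    · rintro ⟨ξ, a, b, rfl⟩
      exact ⟨ξ, a, b, by rw [h' ξ a b]⟩
    · rintro ⟨ξ, a, b, rfl⟩
      exact ⟨ξ, a, b, by rw [h' ξ a b]⟩
  ext c
  rw [mem_star, mem_star, StarArc, StarArc, h1, h2, h l hl le_rfl, h' r le_rfl hr]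

namespace StarData

variable {n v l r : ℤ} {f g : ℤ → ℤ}

/-- The last arc of the left path is flipped to an arc incident to `v + 2`. -/
theorem simpChain_left (h : StarData n v f (l + 1) g r) (h' : StarData n v f l g r)
    (hstep : f (l + 1) = f l ∨ f (l + 1) = f l + 1)
    (ht : IsTri n (star n v f (l + 1) g r) ∨ IsTri n (star n v f l g r)) :
    SimpChain n 1 (star n v f (l + 1) g r) (star n v f l g r) := by
  have b1 := h.left (l + 1) h.le_left le_rfl
  have b2 := h'.left l h'.le_left le_rfl
  have b3 := h.right r le_rfl h.right_le
  have b4 := h.le_sub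
  have b5 := h.two_le
  have b6 := h.le_of_le
  have b7 := h'.le_of_le
  have b8 := h'.le_left
  have m1 := h.left_mem h.le_left le_rfl
  have m2 := h.left_mem h'.le_left (by omega)
  rcases hstep with hs | hs
  · have hq := isQuad_crossing (n := n) (p := f l) (p' := v + 2) (q := l - f l)
      (q' := l + 1 - f l) (by omega) (by omega) (by omega) (by omega) (by omega)
    rw [hs] at m1
    refine simpChain_of_quad hq ?_ m1 ?_ ?_ h.isSimp h'.isSimp ht
    · intro s hs'
      simp only [Finset.mem_insert, Finset.mem_singleton] at hs'
      rcases hs' with rfl | rfl | rfl | rfl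
      · exact m2
      · exact h.crossing_mem (by omega) (by omega)
      · exact h.left_planar_mem (by omega) (by omega)
      · exact boundary_mem (by omega) (by omega) (by omega)
    · intro hm
      obtain ⟨-, hm⟩ := h.cases hm
      omega
    · rintro ⟨i, j⟩
      rw [mem_star, mem_star, StarArc, StarArc, onPath_succ (by omega), enc_of_lt (by omega), hs]
      simp only [Prod.mk.injEq, ne_eq]
      have pl := h'.onPath_left (c := (i, j))
      have pr := h.onPath_right (c := (i, j))
      simp only at pl pr
      simp only [IsCode]
      by_cases hL : OnPath n f v l (i, j) <;>
        by_cases hR : OnPath n g r (n + v) (i, j) <;>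
        simp only [hL, hR, true_imp_iff, false_imp_iff, true_or, or_true, false_or, and_true]
          at pl pr ⊢ <;>
        by_cases hi : i = v + 2 <;>
        (try simp only [hi, true_and, false_and, false_or, or_false] at pl pr ⊢) <;>
        omega
  · have hq := isQuad_planar (n := n) (a := v) (b := v + 1) (c := v + 2) (t := l - f l)
      (by omega) (by omega) (by omega) (by omega) (by omega)
    obtain ⟨hs1, hs2⟩ : f l = v ∧ f (l + 1) = v + 1 := by omega
    rw [hs2] at m1
    rw [hs1] at m2 hq
    rw [show l + 1 - (v + 1) = l - v by ring] at m1
    refine simpChain_of_quad hq ?_ m1 ?_ ?_ h.isSimp h'.isSimp ht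
    · intro s hs'
      simp only [Finset.mem_insert, Finset.mem_singleton] at hs'
      rcases hs' with rfl | rfl | rfl | rfl
      · exact boundary_mem (by omega) (by omega) (by omega)
      · exact boundary_mem (by omega) (by omega) (by omega)
      · exact m2
      · exact h.crossing_mem (by omega) (by omega)
    · intro hm
      obtain ⟨-, hm⟩ := h.cases hm
      omega
    · rintro ⟨i, j⟩
      rw [mem_star, mem_star, StarArc, StarArc, onPath_succ (by omega), enc_of_lt (by omega), hs1,
        hs2]
      simp only [Prod.mk.injEq, ne_eq]
      have pl := h'.onPath_left (c := (i, j))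
      have pr := h.onPath_right (c := (i, j))
      simp only at pl pr
      simp only [IsCode]
      by_cases hL : OnPath n f v l (i, j) <;>
        by_cases hR : OnPath n g r (n + v) (i, j) <;>
        simp only [hL, hR, true_imp_iff, false_imp_iff, true_or, or_true, false_or, and_true]
          at pl pr ⊢ <;>
        by_cases hi : i = v + 2 <;>
        (try simp only [hi, true_and, false_and, false_or, or_false] at pl pr ⊢) <;>
        omega

theorem mem_star_vertical (h : StarData n v f l g r) (h' : StarData n v f l g (r + 1))
    (hs : g (r + 1) = g r) (c : ℤ × ℤ) : c ∈ star n v f l g (r + 1) ↔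
      c = (v + 2, r + 1 - g r) ∨ c ∈ star n v f l g r ∧ c ≠ enc n (g r) (r - g r) := by
  have b1 := h.right r le_rfl h.right_le
  have b2 := h'.right (r + 1) le_rfl h'.right_le
  have b3 := h.left l h.le_left le_rfl
  have b4 := h.le_sub
  have b5 := h.two_le
  have b6 := h.le_of_le
  have b7 := h'.le_of_le
  have b8 := h'.right_le
  obtain ⟨i, j⟩ := c
  rcases b1.2.1.lt_or_eq with hn | hn
  · rw [mem_star, mem_star, StarArc, StarArc, onPath_eq_or (lo := r) (by omega), enc_of_lt hn, hs]
    simp only [Prod.mk.injEq, ne_eq]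
    have pl := h.onPath_left (c := (i, j))
    have pr := h'.onPath_right (c := (i, j))
    simp only at pl pr
    simp only [IsCode]
    by_cases hL : OnPath n f v l (i, j) <;>
      by_cases hR : OnPath n g (r + 1) (n + v) (i, j) <;>
      simp only [hL, hR, true_imp_iff, false_imp_iff, true_or, or_true, false_or, and_true]
        at pl pr ⊢ <;>
      by_cases hi : i = v + 2 <;>
      (try simp only [hi, true_and, false_and, false_or, or_false] at pl pr ⊢) <;>
      omega
  · rw [mem_star, mem_star, StarArc, StarArc, onPath_eq_or (lo := r) (by omega), hs, hn, enc_self]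
    simp only [Prod.mk.injEq, ne_eq]
    have pl := h.onPath_left (c := (i, j))
    have pr := h'.onPath_right (c := (i, j))
    simp only at pl pr
    simp only [IsCode]
    by_cases hL : OnPath n f v l (i, j) <;>
      by_cases hR : OnPath n g (r + 1) (n + v) (i, j) <;>
      simp only [hL, hR, true_imp_iff, false_imp_iff, true_or, or_true, false_or, and_true]
        at pl pr ⊢ <;>
      by_cases hi : i = v + 2 <;>
      (try simp only [hi, true_and, false_and, false_or, or_false] at pl pr ⊢) <;>
      omega

theorem mem_star_horizontal (h : StarData n v f l g r) (h' : StarData n v f l g (r + 1))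
    (hs : g (r + 1) = g r + 1) (c : ℤ × ℤ) : c ∈ star n v f l g (r + 1) ↔
      c = (v + 2, g r + 1) ∨ c ∈ star n v f l g r ∧ c ≠ enc n (g r) (r - g r) := by
  have b1 := h.right r le_rfl h.right_le
  have b2 := h'.right (r + 1) le_rfl h'.right_le
  have b3 := h.left l h.le_left le_rfl
  have b4 := h.le_sub
  have b5 := h.two_le
  have b6 := h.le_of_le
  have b7 := h'.le_of_le
  have b8 := h'.right_le
  obtain ⟨i, j⟩ := c
  have hn : g r < n := by omega
  rw [mem_star, mem_star, StarArc, StarArc, onPath_eq_or (lo := r) (by omega), enc_of_lt hn, hs]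
  simp only [Prod.mk.injEq, ne_eq]
  have pl := h.onPath_left (c := (i, j))
  have pr := h'.onPath_right (c := (i, j))
  simp only at pl pr
  simp only [IsCode]
  by_cases hL : OnPath n f v l (i, j) <;>
    by_cases hR : OnPath n g (r + 1) (n + v) (i, j) <;>
    simp only [hL, hR, true_imp_iff, false_imp_iff, true_or, or_true, false_or, and_true]
      at pl pr ⊢ <;>
    by_cases hi : i = v + 2 <;>
    (try simp only [hi, true_and, false_and, false_or, or_false] at pl pr ⊢) <;>
    omega

/-- The first arc of the right path is flipped to an arc incident to `v + 2`. -/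
theorem simpChain_right (h : StarData n v f l g r) (h' : StarData n v f l g (r + 1))
    (hstep : g (r + 1) = g r ∨ g (r + 1) = g r + 1)
    (ht : IsTri n (star n v f l g r) ∨ IsTri n (star n v f l g (r + 1))) :
    SimpChain n 1 (star n v f l g r) (star n v f l g (r + 1)) := by
  have b1 := h.right r le_rfl h.right_le
  have b2 := h'.right (r + 1) le_rfl h'.right_le
  have b3 := h.left l h.le_left le_rfl
  have b4 := h.le_sub
  have b5 := h.two_le
  have b6 := h.le_of_le
  have b7 := h'.le_of_le
  have b8 := h'.right_le
  have m1 := h.right_mem le_rfl h.right_le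
  have m2 := h.right_mem (ξ := r + 1) (by omega) h'.right_le
  rcases hstep with hs | hs
  · have hβ : (v + 2, r + 1 - g r) ∉ star n v f l g r := fun hm => by
      obtain ⟨-, hm⟩ := h.cases hm
      omega
    have hV := h.mem_star_vertical h' hs
    rcases b1.2.1.lt_or_eq with hn | hn
    · rw [enc_of_lt hn] at m1 hV
      rw [hs, enc_of_lt hn] at m2
      refine simpChain_of_quad (isQuad_crossing (n := n) (p := v + 2) (p' := g r) (q := r - g r)
        (q' := r + 1 - g r) (by omega) (by omega) (by omega) (by omega) (by omega)).symm ?_ m1 hβ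
        hV h.isSimp h'.isSimp ht
      intro s hs'
      simp only [Finset.mem_insert, Finset.mem_singleton] at hs'
      rcases hs' with rfl | rfl | rfl | rfl
      · exact h.crossing_mem (by omega) (by omega)
      · exact m2
      · exact h.right_planar_mem (by omega) (by omega)
      · exact boundary_mem (by omega) (by omega) (by omega)
    · rw [hn] at hβ
      rw [hn, enc_self] at m1 hV
      rw [hs, hn, enc_self] at m2
      refine simpChain_of_quad (isQuad_crossing_last (n := n) (p := v + 2) (q := r - n)
        (q' := r + 1 - n) (by omega) (by omega) (by omega) (by omega)).symm ?_ m1 hβ hV h.isSimp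
        h'.isSimp ht
      intro s hs'
      simp only [Finset.mem_insert, Finset.mem_singleton] at hs'
      rcases hs' with rfl | rfl | rfl | rfl
      · exact h.crossing_mem (by omega) (by omega)
      · exact m2
      · exact h.right_planar_mem (by omega) (by omega)
      · exact boundary_mem (by omega) (by omega) (by omega)
  · have hβ : (v + 2, g r + 1) ∉ star n v f l g r := fun hm => by
      obtain ⟨-, hm⟩ := h.cases hm
      omega
    have hV := h.mem_star_horizontal h' hs
    have hn : g r < n := by omega
    rw [enc_of_lt hn] at m1 hV
    rw [hs, show r + 1 - (g r + 1) = r - g r by ring] at m2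
    rcases lt_or_ge (g r + 1) n with hn' | hn'
    · rw [enc_of_lt hn'] at m2
      refine simpChain_of_quad (isQuad_planar (n := n) (a := v + 2) (b := g r) (c := g r + 1)
        (t := r - g r) (by omega) (by omega) (by omega) (by omega) (by omega)) ?_ m1 hβ hV h.isSimp
        h'.isSimp ht
      intro s hs'
      simp only [Finset.mem_insert, Finset.mem_singleton] at hs'
      rcases hs' with rfl | rfl | rfl | rfl
      · exact h.right_planar_mem (by omega) (by omega)
      · exact boundary_mem (by omega) (by omega) (by omega)
      · exact h.crossing_mem (by omega) (by omega)
      · exact m2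
    · have hn'' : g r + 1 = n := by omega
      rw [hn'', enc_self] at m2
      rw [hn''] at hβ hV
      refine simpChain_of_quad (isQuad_planar_last (n := n) (a := v + 2) (b := g r)
        (t := r - g r) (by omega) (by omega) (by omega) (by omega)) ?_ m1 hβ hV h.isSimp
        h'.isSimp ht
      intro s hs'
      simp only [Finset.mem_insert, Finset.mem_singleton] at hs'
      rcases hs' with rfl | rfl | rfl | rfl
      · exact h.right_planar_mem (by omega) (by omega)
      · exact boundary_mem (by omega) (by omega) (by omega)
      · exact h.crossing_mem (by omega) (by omega)
      · exact m2

end StarData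

/-! ### The two final stars -/

/-- A flip in a quadrilateral that inserts a crossing arc which is neither a loop nor parallel to a
boundary arc. -/
theorem IsPureTri.flip {n : ℤ} {U S : Finset (ℤ × ℤ)} {α β : ℤ × ℤ} (h : IsPureTri n U)
    (hq : IsQuad n S α β) (hS : S ⊆ U) (hα : α ∈ U) (hβ : β.2 + 2 ≤ β.1)
    (hβ' : β.1 ≤ β.2 + n - 2) :
    IsPureTri n (insert β (U.erase α)) ∧ SimpChain n 1 U (insert β (U.erase α)) := by
  have hβU := hq.notMem h.isTri hα
  have ht := hq.isTri h.isTri hS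
  have hs : IsSimp n (insert β (U.erase α)) := by
    refine h.isSimp.insert_erase ?_ ?_
    · rw [← dvd_neg, neg_sub]
      exact not_dvd_of_lt (by omega) (by omega)
    · rintro ⟨i, j⟩ hc hne hse
      have h1 := sameEnds_cases hq.isCode_right (h.isTri.1.1 _ hc) hse
      have h2 := hq.isCode_right
      have h3 := h.isTri.1.1 _ hc
      have h4 : i = β.1 → j ≠ β.2 := fun e e' => hβU (by rw [e, e'] at hc; exact hc)
      have h5 := h.isPure _ hc
      simp only [IsCode] at *
      omega
  refine ⟨⟨ht, hs, fun c hc hc' => ?_⟩, .single h.isTri h.isSimp ht hs ⟨α, hα, β, hβU, rfl⟩⟩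
  rcases Finset.mem_insert.1 hc with rfl | hc
  · omega
  · exact h.isPure c (Finset.mem_of_mem_erase hc) hc'

/-- The beginning of a path that turns right at `v`. -/
def turn (v ξ : ℤ) : ℤ := if ξ ≤ v then v else v + 1

/-- The end of a path with a last vertical step. -/
def lastUp (n v ξ : ℤ) : ℤ := if ξ < n + v then n - 1 else n

/-- The end of a path with a last but one horizontal step and a last vertical step. -/
def lastRight (n v ξ : ℤ) : ℤ := if ξ ≤ n + v - 2 then n - 1 else n

/-- The star around the vertex `v + 2` that misses the lift of `v` at the bottom of the strip and
the lift of `0` at the bottom right. -/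
noncomputable def starOne (n v : ℤ) : Finset (ℤ × ℤ) :=
  star n v (turn v) (v + 1) (lastUp n v) (n + v - 1)

/-- The star around the vertex `v + 2` that misses the lifts of `v` and `0` at the top of the
strip. -/
noncomputable def starTwo (n v : ℤ) : Finset (ℤ × ℤ) :=
  star n v (fun _ => v) (v + 1) (lastRight n v) (n + v - 1)

theorem onPath_self {n : ℤ} {f : ℤ → ℤ} {a : ℤ} {c : ℤ × ℤ} :
    OnPath n f a a c ↔ c = enc n (f a) (a - f a) :=
  ⟨fun ⟨ξ, h1, h2, h3⟩ => by rwa [le_antisymm h2 h1] at h3, fun h => ⟨a, le_rfl, le_rfl, h⟩⟩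

/-- The corner of the right path next to its end is flipped. -/
theorem simpChain_corner {n v : ℤ} {f : ℤ → ℤ} {l : ℤ} (hv : 3 ≤ v)
    (h : StarData n v f l (lastUp n v) (n + v - 2))
    (h' : StarData n v f l (lastRight n v) (n + v - 2))
    (ht : IsTri n (star n v f l (lastUp n v) (n + v - 2))) :
    SimpChain n 1 (star n v f l (lastUp n v) (n + v - 2))
      (star n v f l (lastRight n v) (n + v - 2)) := by
  have b1 := h.le_sub
  have e1 : ∀ c, OnPath n (lastUp n v) (n + v - 2) (n + v) c ↔
      (c = (v, 0) ∨ c = (n - 1, v)) ∨ c = (n - 1, v - 1) := fun c => by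
    rw [onPath_eq_or (by omega), onPath_eq_or (by omega),
      show n + v - 2 + 1 + 1 = n + v by ring, onPath_self]
    simp only [lastUp]
    rw [if_neg (by omega), if_pos (by omega), if_pos (by omega), enc_self, enc_of_lt (by omega),
      enc_of_lt (by omega), show n + v - n = v by ring, show n + v - 2 + 1 - (n - 1) = v by ring,
      show n + v - 2 - (n - 1) = v - 1 by ring]
  have e2 : ∀ c, OnPath n (lastRight n v) (n + v - 2) (n + v) c ↔
      (c = (v, 0) ∨ c = (v - 1, 0)) ∨ c = (n - 1, v - 1) := fun c => by
    rw [onPath_eq_or (by omega), onPath_eq_or (by omega),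
      show n + v - 2 + 1 + 1 = n + v by ring, onPath_self]
    simp only [lastRight]
    rw [if_neg (by omega), if_neg (by omega), if_pos (by omega), enc_self, enc_self,
      enc_of_lt (by omega), show n + v - n = v by ring, show n + v - 2 + 1 - n = v - 1 by ring,
      show n + v - 2 - (n - 1) = v - 1 by ring]
  have g1 : lastUp n v (n + v - 2) = n - 1 := by rw [lastUp, if_pos (by omega)]
  have g2 : lastRight n v (n + v - 2) = n - 1 := by rw [lastRight, if_pos (by omega)]
  have mem : ∀ c, c ∈ star n v f l (lastUp n v) (n + v - 2) ↔ IsCode n c ∧ (c.2 = c.1 + 1 ∨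
      OnPath n f v l c ∨ ((c = (v, 0) ∨ c = (n - 1, v)) ∨ c = (n - 1, v - 1)) ∨
      (c.1 = v + 2 ∧ l - f l ≤ c.2 ∧ c.2 ≤ v - 1) ∨ (c.1 = v ∧ c.2 = v + 2 ∧ f l = v) ∨
      (c.1 = v + 2 ∧ v + 2 < c.2 ∧ c.2 ≤ n - 1)) := fun c => by
    rw [mem_star, StarArc, e1, g1, show n + v - 2 - (n - 1) = v - 1 by ring]
  have hq := isQuad_crossing_last (n := n) (p := n - 1) (q := v - 1) (q' := v) (by omega)
    (by omega) (by omega) (by omega)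
  refine simpChain_of_quad hq ?_ ?_ ?_ ?_ h.isSimp h'.isSimp (Or.inl ht)
  · intro s hs
    simp only [Finset.mem_insert, Finset.mem_singleton] at hs
    rw [mem]
    rcases hs with rfl | rfl | rfl | rfl
    · exact ⟨by simp only [IsCode]; omega, Or.inr (Or.inr (Or.inl (Or.inr rfl)))⟩
    · exact ⟨by simp only [IsCode]; omega, Or.inr (Or.inr (Or.inl (Or.inl (Or.inl rfl))))⟩
    · exact ⟨by simp only [IsCode]; omega, Or.inl (by simp only; omega)⟩
    · exact ⟨by simp only [IsCode]; omega, Or.inl (by simp only; omega)⟩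
  · rw [mem]
    exact ⟨by simp only [IsCode]; omega, Or.inr (Or.inr (Or.inl (Or.inl (Or.inr rfl))))⟩
  · rw [mem]
    rintro ⟨-, hm⟩
    have pl := h.onPath_left (c := (v - 1, 0))
    simp only [Prod.mk.injEq] at hm pl
    rcases hm with hm | hm | hm | hm | hm | hm
    · omega
    · have := pl hm
      omega
    all_goals omega
  · rintro ⟨i, j⟩
    rw [mem, mem_star, StarArc, e2, g2, show n + v - 2 - (n - 1) = v - 1 by ring]
    have pl := h.onPath_left (c := (i, j))
    simp only [Prod.mk.injEq, ne_eq, IsCode] at pl ⊢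
    clear mem e1 e2 hq ht
    have k0 : i = v - 1 ∧ j = 0 → (0 ≤ i ∧ i < n ∧ 0 ≤ j ∧ j ≤ i + n) ∧ ¬(i = n - 1 ∧ j = v) := by
      omega
    have k1 : OnPath n f v l (i, j) → ¬(i = n - 1 ∧ j = v) := fun h => by
      have := pl h
      omega
    have k2 : j = i + 1 ∨ (i = v ∧ j = 0) ∨ (i = n - 1 ∧ j = v - 1) ∨
        (i = v + 2 ∧ l - f l ≤ j ∧ j ≤ v - 1) ∨ (i = v ∧ j = v + 2 ∧ f l = v) ∨
        (i = v + 2 ∧ v + 2 < j ∧ j ≤ n - 1) → ¬(i = n - 1 ∧ j = v) := by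
      rintro (h | h | h | h | h | h) <;> omega
    constructor
    · rintro ⟨hc, h⟩
      rcases h with h | h | ((h | h) | h) | h | h | h
      · exact Or.inr ⟨⟨hc, Or.inl h⟩, k2 (Or.inl h)⟩
      · exact Or.inr ⟨⟨hc, Or.inr (Or.inl h)⟩, k1 h⟩
      · exact Or.inr ⟨⟨hc, Or.inr (Or.inr (Or.inl (Or.inl (Or.inl h))))⟩, k2 (Or.inr (Or.inl h))⟩
      · exact Or.inl h
      · exact Or.inr ⟨⟨hc, Or.inr (Or.inr (Or.inl (Or.inr h)))⟩, k2 (Or.inr (Or.inr (Or.inl h)))⟩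
      · exact Or.inr ⟨⟨hc, Or.inr (Or.inr (Or.inr (Or.inl h)))⟩,
          k2 (Or.inr (Or.inr (Or.inr (Or.inl h))))⟩
      · exact Or.inr ⟨⟨hc, Or.inr (Or.inr (Or.inr (Or.inr (Or.inl h))))⟩,
          k2 (Or.inr (Or.inr (Or.inr (Or.inr (Or.inl h)))))⟩
      · exact Or.inr ⟨⟨hc, Or.inr (Or.inr (Or.inr (Or.inr (Or.inr h))))⟩,
          k2 (Or.inr (Or.inr (Or.inr (Or.inr (Or.inr h)))))⟩
    · rintro (h | ⟨⟨hc, h⟩, hne⟩)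
      · exact ⟨(k0 h).1, Or.inr (Or.inr (Or.inl (Or.inl (Or.inr h))))⟩
      · refine ⟨hc, ?_⟩
        rcases h with h | h | ((h | h) | h) | h
        · exact Or.inl h
        · exact Or.inr (Or.inl h)
        · exact Or.inr (Or.inr (Or.inl (Or.inl (Or.inl h))))
        · exact absurd h hne
        · exact Or.inr (Or.inr (Or.inl (Or.inr h)))
        · exact Or.inr (Or.inr (Or.inr h))

/-- The two stars are five flips apart: `v + 2` is disconnected from the last vertices on one side,
a corner of the path is flipped, and `v + 2` is connected to the vertices on the other side. -/
theorem simpChain_starOne_starTwo {n v : ℤ} (hv : 3 ≤ v) (hn : v ≤ n - 4)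
    (ht : IsTri n (starOne n v)) : SimpChain n 5 (starOne n v) (starTwo n v) := by
  have u1 : turn v v = v := by rw [turn, if_pos le_rfl]
  have u2 : turn v (v + 1) = v + 1 := by rw [turn, if_neg (by omega)]
  have g1 : ∀ ξ, n + v - 2 ≤ ξ → ξ ≤ n + v - 1 → lastUp n v ξ = n - 1 :=
    fun ξ _ h => by rw [lastUp, if_pos (by omega)]
  have g2 : lastUp n v (n + v) = n := by rw [lastUp, if_neg (by omega)]
  have g3 : lastRight n v (n + v - 2) = n - 1 := by rw [lastRight, if_pos (by omega)]
  have g4 : ∀ ξ, n + v - 1 ≤ ξ → lastRight n v ξ = n := fun ξ h => by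
    rw [lastRight, if_neg (by omega)]
  have l1 : ∀ ξ, v ≤ ξ → ξ ≤ v + 1 → v ≤ turn v ξ ∧ turn v ξ ≤ v + 1 ∧ turn v ξ ≤ ξ ∧
      ξ - turn v ξ ≤ v ∧ 2 ≤ 2 * turn v ξ - ξ ∧ 2 * turn v ξ - ξ ≤ n - 2 := fun ξ h1 h2 => by
    obtain rfl | rfl : ξ = v ∨ ξ = v + 1 := by omega
    · omega
    · omega
  have l2 : ∀ ξ, v ≤ ξ → ξ ≤ v + 1 → v ≤ v ∧ v ≤ v + 1 ∧ v ≤ ξ ∧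
      ξ - v ≤ v ∧ 2 ≤ 2 * v - ξ ∧ 2 * v - ξ ≤ n - 2 := fun ξ h1 h2 => by omega
  have r1 : ∀ ξ, n + v - 2 ≤ ξ → ξ ≤ n + v → v + 3 ≤ lastUp n v ξ ∧ lastUp n v ξ ≤ n ∧
      lastUp n v ξ ≤ ξ ∧ ξ - lastUp n v ξ ≤ v ∧ 2 ≤ 2 * lastUp n v ξ - ξ ∧
      2 * lastUp n v ξ - ξ ≤ n - 2 := fun ξ h1 h2 => by
    rcases h2.lt_or_eq with h2 | rfl
    · rw [g1 ξ h1 (by omega)]; omega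
    · omega
  have r2 : ∀ ξ, n + v - 2 ≤ ξ → ξ ≤ n + v → v + 3 ≤ lastRight n v ξ ∧ lastRight n v ξ ≤ n ∧
      lastRight n v ξ ≤ ξ ∧ ξ - lastRight n v ξ ≤ v ∧ 2 ≤ 2 * lastRight n v ξ - ξ ∧
      2 * lastRight n v ξ - ξ ≤ n - 2 := fun ξ h1 h2 => by
    rcases h1.lt_or_eq with h1 | rfl
    · rw [g4 ξ (by omega)]; omega
    · omega
  have g1' := g1 (n + v - 2) le_rfl (by omega)
  have g1'' := g1 (n + v - 1) (by omega) le_rfl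
  have g4' := g4 (n + v - 1) le_rfl
  have eq1 : n + v - 2 + 1 = n + v - 1 := by ring
  have A0 : StarData n v (turn v) (v + 1) (lastUp n v) (n + v - 2 + 1) := by
    rw [eq1]
    exact ⟨by omega, hn, by omega, by omega, fun ξ a b => l1 ξ a b,
      fun ξ a b => r1 ξ (by omega) b, by omega, by omega, by omega⟩
  have A1 : StarData n v (turn v) (v + 1) (lastUp n v) (n + v - 2) :=
    ⟨by omega, hn, by omega, by omega, fun ξ a b => l1 ξ a b, fun ξ a b => r1 ξ (by omega) b,
      by omega, by omega, by omega⟩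
  have A2 : StarData n v (turn v) v (lastUp n v) (n + v - 2) :=
    ⟨by omega, hn, by omega, by omega, fun ξ a b => l1 ξ a (by omega),
      fun ξ a b => r1 ξ (by omega) b, by omega, by omega, by omega⟩
  have A2' : StarData n v (fun _ => v) v (lastUp n v) (n + v - 2) :=
    ⟨by omega, hn, by omega, by omega, fun ξ a b => l2 ξ a (by omega),
      fun ξ a b => r1 ξ (by omega) b, by omega, by omega, by omega⟩
  have A3 : StarData n v (fun _ => v) (v + 1) (lastUp n v) (n + v - 2) :=
    ⟨by omega, hn, by omega, by omega, fun ξ a b => l2 ξ a b, fun ξ a b => r1 ξ (by omega) b,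
      by omega, by omega, by omega⟩
  have A4 : StarData n v (fun _ => v) (v + 1) (lastRight n v) (n + v - 2) :=
    ⟨by omega, hn, by omega, by omega, fun ξ a b => l2 ξ a b, fun ξ a b => r2 ξ (by omega) b,
      by omega, by omega, by omega⟩
  have A5 : StarData n v (fun _ => v) (v + 1) (lastRight n v) (n + v - 2 + 1) := by
    rw [eq1]
    exact ⟨by omega, hn, by omega, by omega, fun ξ a b => l2 ξ a b,
      fun ξ a b => r2 ξ (by omega) b, by omega, by omega, by omega⟩
  have c1 := (A1.simpChain_right A0 (by rw [eq1]; omega) (Or.inr (by rw [eq1]; exact ht))).symm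
  have c2 := A1.simpChain_left A2 (by omega) (Or.inl c1.isTri_right.1)
  have c2t := c2.isTri_right.1
  have e : star n v (turn v) v (lastUp n v) (n + v - 2) =
      star n v (fun _ => v) v (lastUp n v) (n + v - 2) :=
    star_congr le_rfl (by omega) (fun ξ a b => by rw [le_antisymm b a, u1]) fun _ _ _ => rfl
  have c3 := (A3.simpChain_left A2' (Or.inl rfl) (Or.inr (e ▸ c2t))).symm
  have c4 := simpChain_corner hv A3 A4 c3.isTri_right.1
  have c5 := A4.simpChain_right A5 (by rw [eq1]; omega) (Or.inl c4.isTri_right.1)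
  rw [← e] at c3
  rw [eq1] at c1 c5
  exact (((c1.trans c2).trans c3).trans c4).trans c5

theorem IsLatticePath.exists_step {n v w : ℤ} {f : ℤ → ℤ} (h : IsLatticePath n v f) (hv : 0 ≤ v) (h1 : v ≤ w)
    (h2 : w < n) : ∃ ξ, v ≤ ξ ∧ ξ < n + v ∧ f ξ = w ∧ f (ξ + 1) = w + 1 := by
  by_contra! hne
  have key : ∀ k : ℕ, v + k ≤ n + v → f (v + k) ≤ w := by
    intro k
    induction k with
    | zero => intro _; simpa [h.start] using h1
    | succ k ih =>
      intro hk
      push_cast at hk ⊢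
      have a1 := ih (by omega)
      have a2 := h.step (v + k) (by omega) (by omega)
      have a3 := hne (v + k) (by omega) (by omega)
      rw [← add_assoc]
      omega
  have h3 := key n.toNat (by omega)
  rw [show v + (n.toNat : ℤ) = n + v by omega, h.finish] at h3
  omega

theorem chain_right {n v l : ℤ} {f g : ℤ → ℤ} {r : ℤ} (k : ℕ)
    (hD : ∀ r', r ≤ r' → r' ≤ r + k → StarData n v f l g r')
    (hs : ∀ r', r ≤ r' → r' < r + k → g (r' + 1) = g r' ∨ g (r' + 1) = g r' + 1)
    (ht : IsTri n (star n v f l g r)) :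
    SimpChain n k (star n v f l g r) (star n v f l g (r + k)) := by
  induction k with
  | zero =>
    rw [Nat.cast_zero, add_zero]
    exact .refl ht (hD r le_rfl (by simp)).isSimp
  | succ k ih =>
    push_cast at hD hs ⊢
    have h1 := ih (fun r' a b => hD r' a (by omega)) fun r' a b => hs r' a (by omega)
    have h2 := (hD (r + k) (by omega) (by omega)).simpChain_right
      (hD (r + k + 1) (by omega) (by omega)) (hs _ (by omega) (by omega)) (Or.inl h1.isTri_right.1)
    rw [← add_assoc]
    exact h1.trans h2

theorem chain_left {n v l : ℤ} {f g : ℤ → ℤ} {r : ℤ} (k : ℕ)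
    (hD : ∀ l', l - k ≤ l' → l' ≤ l → StarData n v f l' g r)
    (hs : ∀ l', l - k ≤ l' → l' < l → f (l' + 1) = f l' ∨ f (l' + 1) = f l' + 1)
    (ht : IsTri n (star n v f l g r)) :
    SimpChain n k (star n v f l g r) (star n v f (l - k) g r) := by
  induction k with
  | zero =>
    rw [Nat.cast_zero, sub_zero]
    exact .refl ht (hD l (by simp) le_rfl).isSimp
  | succ k ih =>
    push_cast at hD hs ⊢
    have h1 := ih (fun r' a b => hD r' (by omega) b) fun r' a b => hs r' (by omega) b
    have e : l - k = l - (k + 1) + 1 := by ring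
    rw [e] at h1
    have h2 := (hD (l - (k + 1) + 1) (by omega) (by omega)).simpChain_left
      (hD (l - (k + 1)) (by omega) (by omega)) (hs _ (by omega) (by omega))
      (Or.inl h1.isTri_right.1)
    exact h1.trans h2

/-! ### The distance between triangulations without planar arcs -/

/-- After at most one flip, the vertices `v + 2` and `v` are not joined by a crossing arc of slope
two. -/
theorem IsPureTri.exists_notMem {n v : ℤ} {U : Finset (ℤ × ℤ)} (h : IsPureTri n U) (hv : 2 ≤ v)
    (hvn : v ≤ n - 4) (hU : (v, 0) ∈ U) :
    ∃ V, IsPureTri n V ∧ (v, 0) ∈ V ∧ (v + 2, v) ∉ V ∧ ∃ k ≤ 1, SimpChain n k U V := by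
  by_cases hm : (v + 2, v) ∈ U
  swap
  · exact ⟨U, h, hU, hm, 0, Nat.zero_le _, .refl h.isTri h.isSimp⟩
  obtain ⟨f, hf, hfU⟩ := h.exists_path (by omega) hU (by omega)
  have mem : ∀ ξ, v ≤ ξ → ξ ≤ n + v → f ξ < n → (f ξ, ξ - f ξ) ∈ U := fun ξ h1 h2 h3 => by
    have h4 := hf.bounds h1 h2
    exact (hfU _).2 ⟨by simp only [IsCode]; omega, Or.inr ⟨ξ, h1, h2, by rw [enc_of_lt h3]⟩⟩
  -- The path is horizontal after and vertical before the vertex `(v + 2, v)`.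
  have e0 : f (2 * v + 2) = v + 2 := by
    rcases ((hfU _).1 hm).2 with h1 | ⟨ξ, h1, h2, h3⟩
    · simp only at h1
      omega
    · have h4 := hf.bounds h1 h2
      rcases h4.2.1.lt_or_eq with h5 | h5
      · rw [enc_of_lt h5, Prod.mk.injEq] at h3
        rw [show 2 * v + 2 = ξ by omega]
        omega
      · rw [h5, enc_self, Prod.mk.injEq] at h3
        omega
  have e1 : f (2 * v + 1) = v + 2 := by
    have h1 := hf.step (2 * v + 1) (by omega) (by omega)
    have h2 := hf.lower (2 * v + 1) (by omega) (by omega)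
    rw [show 2 * v + 1 + 1 = 2 * v + 2 by ring] at h1
    omega
  have e2 : f (2 * v + 3) = v + 3 := by
    have h1 := hf.step (2 * v + 2) (by omega) (by omega)
    have h2 := hf.bounds (ξ := 2 * v + 3) (by omega) (by omega)
    rw [show 2 * v + 2 + 1 = 2 * v + 3 by ring] at h1
    omega
  have m1 := mem (2 * v + 1) (by omega) (by omega) (by omega)
  have m2 := mem (2 * v + 3) (by omega) (by omega) (by omega)
  rw [e1, show 2 * v + 1 - (v + 2) = v - 1 by ring] at m1
  rw [e2, show 2 * v + 3 - (v + 3) = v by ring] at m2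
  have hq := isQuad_crossing (n := n) (p := v + 2) (p' := v + 3) (q := v - 1) (q' := v) (by omega)
    (by omega) (by omega) (by omega) (by omega)
  have hh := h.flip hq (fun s hs => by
    simp only [Finset.mem_insert, Finset.mem_singleton] at hs
    rcases hs with rfl | rfl | rfl | rfl
    · exact m1
    · exact m2
    · have := h.isTri.boundary_mem (i := v + 2) (by omega) (by omega)
      rwa [show v + 2 + 1 = v + 3 by ring] at this
    · have := h.isTri.boundary_mem (i := v - 1) (by omega) (by omega)
      rwa [sub_add_cancel] at this) hm (by simp only; omega) (by simp only; omega)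
  refine ⟨_, hh.1, ?_, ?_, 1, le_rfl, hh.2⟩
  · refine Finset.mem_insert_of_mem (Finset.mem_erase.2 ⟨?_, hU⟩)
    simp only [ne_eq, Prod.mk.injEq]
    omega
  · intro hc
    rcases Finset.mem_insert.1 hc with h1 | h1
    · rw [Prod.mk.injEq] at h1
      omega
    · exact Finset.ne_of_mem_erase h1 rfl

/-- A triangulation without planar arcs is a star whose centre has only crossing arcs. -/
theorem IsPureTri.exists_eq_star {n v : ℤ} {U : Finset (ℤ × ℤ)} (h : IsPureTri n U) (hv : 2 ≤ v)
    (hvn : v ≤ n - 4) (hU : (v, 0) ∈ U) (hm : (v + 2, v) ∉ U) :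
    ∃ f l r, IsLatticePath n v f ∧ v ≤ l ∧ l < r ∧ r < n + v ∧ f l = v + 1 ∧ f r = v + 3 ∧
      r - f r < v ∧ l - f l ≤ r - f r ∧ U = star n v f l f r := by
  obtain ⟨f, hf, hfU⟩ := h.exists_path (by omega) hU (by omega)
  obtain ⟨l, l1, l2, l3, l4⟩ := hf.exists_step (w := v + 1) (by omega) (by omega) (by omega)
  obtain ⟨r, r1, r2, r3, r4⟩ := hf.exists_step (w := v + 2) (by omega) (by omega) (by omega)
  rw [show v + 1 + 1 = v + 2 by ring] at l4
  rw [show v + 2 + 1 = v + 3 by ring] at r4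
  have hlr : l + 1 ≤ r := by
    by_contra! hc
    have := hf.mono (ξ := r + 1) (τ := l + 1) (by omega) (by omega) (by omega)
    omega
  have hb := hf.bounds r1 r2.le
  have hrv : r - (v + 2) ≠ v := fun e => by
    refine hm ((hfU _).2 ⟨by simp only [IsCode]; omega, Or.inr ⟨r, r1, r2.le, ?_⟩⟩)
    rw [r3, enc_of_lt (by omega), e]
  have hbr := hf.bounds (ξ := r + 1) (by omega) (by omega)
  have hrn : r + 1 < n + v := by
    rcases lt_or_ge (r + 1) (n + v) with h1 | h1
    · exact h1
    · have h2 : r + 1 = n + v := by omega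
      have := hf.finish
      rw [← h2] at this
      omega
  refine ⟨f, l, r + 1, hf, l1, by omega, hrn, l3, r4, by omega, by omega, ?_⟩
  ext ⟨i, j⟩
  rw [hfU, mem_star, StarArc, l3, r4]
  refine and_congr_right fun hc => ?_
  constructor
  · rintro (h1 | ⟨ξ, h1, h2, h3⟩)
    · exact Or.inl h1
    rcases le_or_gt ξ l with h4 | h4
    · exact Or.inr (Or.inl ⟨ξ, h1, h4, h3⟩)
    rcases le_or_gt (r + 1) ξ with h5 | h5
    · exact Or.inr (Or.inr (Or.inl ⟨ξ, h5, h2, h3⟩))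
    have h6 := hf.mono (ξ := l + 1) (τ := ξ) (by omega) (by omega) (by omega)
    have h7 := hf.mono (ξ := ξ) (τ := r) (by omega) (by omega) (by omega)
    have h8 : f ξ = v + 2 := by omega
    rw [h8, enc_of_lt (by omega), Prod.mk.injEq] at h3
    exact Or.inr (Or.inr (Or.inr (Or.inl ⟨h3.1, by simp only; omega, by simp only; omega⟩)))
  · rintro (h1 | ⟨ξ, h1, h2, h3⟩ | ⟨ξ, h1, h2, h3⟩ | ⟨h1, h2, h3⟩ | ⟨h1, h2, h3⟩ | ⟨h1, h2, h3⟩)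
    · exact Or.inl h1
    · exact Or.inr ⟨ξ, h1, by omega, h3⟩
    · exact Or.inr ⟨ξ, by omega, h2, h3⟩
    · simp only at h1 h2 h3
      refine Or.inr ⟨v + 2 + j, by omega, by omega, ?_⟩
      have h6 := hf.mono (ξ := l + 1) (τ := v + 2 + j) (by omega) (by omega) (by omega)
      have h7 := hf.mono (ξ := v + 2 + j) (τ := r) (by omega) (by omega) (by omega)
      have h8 : f (v + 2 + j) = v + 2 := by omega
      rw [h8, enc_of_lt (by omega), h1, add_sub_cancel_left]
    · omega
    · simp only at h1 h2 h3
      exact Or.inl (by simp only; omega)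

/-- A path reaches first its last row or its last column. -/
theorem IsLatticePath.exists_exit {n v r : ℤ} {f : ℤ → ℤ} (h : IsLatticePath n v f) (hv : v ≤ r)
    (hr : r < n + v) (h1 : f r < n) (h2 : r - f r < v) :
    ∃ s, r ≤ s ∧ s < n + v ∧ f s < n ∧ s - f s < v ∧
      (f (s + 1) = n ∨ s + 1 - f (s + 1) = v) := by
  by_contra! hne
  have key : ∀ k : ℕ, r + k ≤ n + v → f (r + k) < n ∧ r + k - f (r + k) < v := by
    intro k
    induction k with
    | zero => intro _; simpa using ⟨h1, h2⟩
    | succ k ih =>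
      intro hk
      push_cast at hk ⊢
      have a1 := ih (by omega)
      have a2 := hne (r + k) (by omega) (by omega) a1.1 a1.2
      have a3 := h.bounds (ξ := r + k + 1) (by omega) (by omega)
      rw [← add_assoc]
      omega
  have h3 := key (n + v - r).toNat (by omega)
  rw [show r + ((n + v - r).toNat : ℤ) = n + v by omega, h.finish] at h3
  omega

/-- A triangulation without planar arcs that contains a given crossing arc is transformed into one
of two triangulations by flips that all, but for a bounded number of them, insert arcs incident
to the vertex `v + 2`. -/
theorem IsPureTri.exists_chain {n v : ℤ} {U : Finset (ℤ × ℤ)} (h : IsPureTri n U) (hv : 2 ≤ v)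
    (hvn : v ≤ n - 4) (hU : (v, 0) ∈ U) : ∃ k : ℕ, (k : ℤ) ≤ n + 1 ∧
      (SimpChain n k U (starOne n v) ∨ 3 ≤ v ∧ SimpChain n k U (starTwo n v)) := by
  obtain ⟨V, hV, hvV, hmV, k₀, hk₀, c₀⟩ := h.exists_notMem hv hvn hU
  obtain ⟨f, l, r, hf, h1, h2, h3, h4, h5, h6, h7, rfl⟩ := hV.exists_eq_star hv hvn hvV hmV
  have hleft : ∀ ξ, v ≤ ξ → ξ ≤ l → v ≤ f ξ ∧ f ξ ≤ v + 1 ∧ f ξ ≤ ξ ∧ ξ - f ξ ≤ v ∧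
      2 ≤ 2 * f ξ - ξ ∧ 2 * f ξ - ξ ≤ n - 2 := fun ξ a b => by
    have a1 := hf.bounds a (by omega)
    have a2 := hf.mono a b (by omega)
    have a3 := hf.lower ξ a (by omega)
    have a4 := hf.upper ξ a (by omega)
    omega
  have hright : ∀ ξ, r ≤ ξ → ξ ≤ n + v → v + 3 ≤ f ξ ∧ f ξ ≤ n ∧ f ξ ≤ ξ ∧ ξ - f ξ ≤ v ∧
      2 ≤ 2 * f ξ - ξ ∧ 2 * f ξ - ξ ≤ n - 2 := fun ξ a b => by
    have a1 := hf.bounds (ξ := ξ) (by omega) b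
    have a2 := hf.mono (ξ := r) (τ := ξ) (by omega) a b
    have a3 := hf.lower ξ (by omega) b
    have a4 := hf.upper ξ (by omega) b
    omega
  obtain ⟨s, s1, s2, s3, s4, s5⟩ := hf.exists_exit (by omega) h3 (by omega) h6
  have hfv := hf.start
  have hfn := hf.finish
  -- All the arcs on the left of the star are flipped.
  have c₁ := chain_left (n := n) (v := v) (l := l) (f := f) (g := f) (r := r) (l - v).toNat
    (fun l' a b => by
      have b1 := hf.mono (ξ := l') (τ := l) (by omega) b (by omega)
      exact ⟨hv, hvn, by omega, by omega, fun ξ a' b' => hleft ξ a' (by omega), hright,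
        by omega, by omega, by omega⟩)
    (fun l' a b => hf.step l' (by omega) (by omega)) hV.isTri
  rw [show l - ((l - v).toNat : ℤ) = v by omega] at c₁
  -- The arcs on the right are flipped until the star reaches `v` or `0` for the second time.
  have c₂ := chain_right (n := n) (v := v) (l := v) (f := f) (g := f) (r := r) (s - r).toNat
    (fun r' a b => by
      have b1 := hf.mono (ξ := r') (τ := s) (by omega) (by omega) (by omega)
      have b2 := hf.bounds (ξ := r') (by omega) (by omega)
      exact ⟨hv, hvn, le_rfl, by omega, fun ξ a' b' => hleft ξ a' (by omega),
        fun ξ a' b' => hright ξ (by omega) b', by omega, by omega, by omega⟩)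
    (fun r' a b => hf.step r' (by omega) (by omega)) c₁.isTri_right.1
  rw [show r + ((s - r).toNat : ℤ) = s by omega] at c₂
  have t₂ := c₂.isTri_right.1
  have c₁₂ := (c₀.trans c₁).trans c₂
  have hstep := hf.step s (by omega) s2
  have hsb := hf.bounds (ξ := s) (by omega) (by omega)
  have hsv : s < n + v - 1 := by omega
  have D₀ : StarData n v f v f s :=
    ⟨hv, hvn, le_rfl, by omega, fun ξ a' b' => hleft ξ a' (by omega),
      fun ξ a' b' => hright ξ (by omega) b', by omega, by omega, by omega⟩
  have mono : ∀ ξ, s + 1 ≤ ξ → ξ ≤ n + v → f (s + 1) ≤ f ξ ∧ s + 1 - f (s + 1) ≤ ξ - f ξ ∧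
      f ξ ≤ n ∧ ξ - f ξ ≤ v := fun ξ a b => by
    have b1 := hf.mono (ξ := s + 1) (τ := ξ) (by omega) a b
    have b2 := hf.bounds (ξ := ξ) (by omega) b
    omega
  rcases s5 with s5 | s5
  · -- The star reaches the vertex `0` at the bottom, and `(v + 2, 0)` is flipped.
    have b0 := hright (s + 1) (by omega) (by omega)
    have hv3 : 3 ≤ v := by omega
    have D : ∀ l' r', v ≤ l' → l' ≤ v + 1 → s ≤ r' → r' ≤ n + v - 1 → r' = s ∨ v < l' →
        StarData n v (fun _ => v) l' f r' := fun l' r' a1 a2 a3 a4 a5 => by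
      have b1 : r' = s ∨ f r' = n := by
        rcases a3.lt_or_eq with a3 | a3
        · have := mono r' (by omega) (by omega)
          omega
        · exact Or.inl a3.symm
      have b2 : r' = s → f r' = n - 1 := fun e => by rw [e]; omega
      exact ⟨hv, hvn, a1, by omega, fun ξ _ _ => by omega,
        fun ξ a' b' => hright ξ (by omega) b', by omega, by omega, by omega⟩
    have e : star n v f v f s = star n v (fun _ => v) v f s :=
      star_congr le_rfl (by omega) (fun ξ a b => by rw [le_antisymm b a, hfv]) fun _ _ _ => rfl
    have c₃ := ((D (v + 1) s (by omega) le_rfl le_rfl (by omega) (Or.inl rfl)).simpChain_left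
      (D v s le_rfl (by omega) le_rfl (by omega) (Or.inl rfl)) (Or.inl rfl)
      (Or.inr (e ▸ t₂))).symm
    rw [← e] at c₃
    have c₄ := chain_right (n := n) (v := v) (l := v + 1) (f := fun _ => v) (g := f) (r := s)
      (n + v - 1 - s).toNat
      (fun r' a b => D (v + 1) r' (by omega) le_rfl a (by omega) (Or.inr (by omega)))
      (fun r' a b => hf.step r' (by omega) (by omega)) c₃.isTri_right.1
    rw [show s + ((n + v - 1 - s).toNat : ℤ) = n + v - 1 by omega] at c₄
    have e' : star n v (fun _ => v) (v + 1) f (n + v - 1) = starTwo n v := by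
      refine star_congr (by omega) (by omega) (fun _ _ _ => rfl) fun ξ a b => ?_
      rw [lastRight, if_neg (by omega)]
      have := mono ξ (by omega) b
      omega
    rw [e'] at c₄
    exact ⟨_, by push_cast; omega, Or.inr ⟨hv3, (c₁₂.trans c₃).trans c₄⟩⟩
  · -- The star reaches the vertex `v` at the top, and `(v, v + 2)` is flipped.
    have u1 : turn v v = v := by rw [turn, if_pos le_rfl]
    have u2 : turn v (v + 1) = v + 1 := by rw [turn, if_neg (by omega)]
    have D : ∀ l' r', v ≤ l' → l' ≤ v + 1 → s ≤ r' → r' ≤ n + v - 1 → r' = s ∨ v < l' →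
        StarData n v (turn v) l' f r' := fun l' r' a1 a2 a3 a4 a5 => by
      have b1 : f r' < n ∧ 0 ≤ r' - f r' ∧ (r' = s → r' - f r' < v) := by
        rcases a3.lt_or_eq with a3 | a3
        · have := mono r' (by omega) (by omega)
          omega
        · rw [← a3]
          omega
      have b2 : l' = v ∧ turn v l' = v ∨ l' = v + 1 ∧ turn v l' = v + 1 := by
        rcases a2.lt_or_eq with a2 | a2
        · have : l' = v := by omega
          rw [this]
          exact Or.inl ⟨rfl, u1⟩
        · rw [a2]
          exact Or.inr ⟨rfl, u2⟩
      refine ⟨hv, hvn, a1, by omega, fun ξ a' b' => ?_,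
        fun ξ a' b' => hright ξ (by omega) b', by omega, by omega, by omega⟩
      rcases a'.lt_or_eq with a' | a'
      · rw [show ξ = v + 1 by omega, u2]
        omega
      · rw [← a', u1]
        omega
    have e : star n v f v f s = star n v (turn v) v f s :=
      star_congr le_rfl (by omega) (fun ξ a b => by rw [le_antisymm b a, hfv, u1]) fun _ _ _ => rfl
    have c₃ := ((D (v + 1) s (by omega) le_rfl le_rfl (by omega) (Or.inl rfl)).simpChain_left
      (D v s le_rfl (by omega) le_rfl (by omega) (Or.inl rfl)) (Or.inr (by rw [u1, u2]))
      (Or.inr (e ▸ t₂))).symm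
    rw [← e] at c₃
    have c₄ := chain_right (n := n) (v := v) (l := v + 1) (f := turn v) (g := f) (r := s)
      (n + v - 1 - s).toNat
      (fun r' a b => D (v + 1) r' (by omega) le_rfl a (by omega) (Or.inr (by omega)))
      (fun r' a b => hf.step r' (by omega) (by omega)) c₃.isTri_right.1
    rw [show s + ((n + v - 1 - s).toNat : ℤ) = n + v - 1 by omega] at c₄
    have e' : star n v (turn v) (v + 1) f (n + v - 1) = starOne n v := by
      refine star_congr (by omega) (by omega) (fun _ _ _ => rfl) fun ξ a b => ?_
      rcases b.lt_or_eq with b | b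
      · rw [lastUp, if_pos b]
        have := mono ξ (by omega) b.le
        omega
      · rw [b, hfn, lastUp, if_neg (lt_irrefl _)]
    rw [e'] at c₄
    exact ⟨_, by push_cast; omega, Or.inl ((c₁₂.trans c₃).trans c₄)⟩

theorem IsPureTri.exists_simpChain_of_mem {n v : ℤ} {U V : Finset (ℤ × ℤ)} (hU : IsPureTri n U)
    (hV : IsPureTri n V) (hv : 2 ≤ v) (hvn : v ≤ n - 4) (hvU : (v, 0) ∈ U) (hvV : (v, 0) ∈ V) :
    ∃ k : ℕ, (k : ℤ) ≤ 2 * n + 7 ∧ SimpChain n k U V := by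
  obtain ⟨k, hk, c⟩ := hU.exists_chain hv hvn hvU
  obtain ⟨k', hk', c'⟩ := hV.exists_chain hv hvn hvV
  rcases c with c | ⟨hv3, c⟩ <;> rcases c' with c' | ⟨hv3', c'⟩
  · exact ⟨_, by push_cast; omega, c.trans c'.symm⟩
  · exact ⟨_, by push_cast; omega,
      (c.trans (simpChain_starOne_starTwo hv3' hvn c.isTri_right.1)).trans c'.symm⟩
  · exact ⟨_, by push_cast; omega,
      (c.trans (simpChain_starOne_starTwo hv3 hvn c'.isTri_right.1).symm).trans c'.symm⟩
  · exact ⟨_, by push_cast; omega, c.trans c'.symm⟩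

/-- A rotation places a common crossing arc at `(v, 0)`, with enough room on both sides. -/
theorem IsPureTri.exists_simpChain_of_seven_le {n : ℤ} (hn : 7 ≤ n) {U V : Finset (ℤ × ℤ)}
    (hU : IsPureTri n U) (hV : IsPureTri n V) :
    ∃ k : ℕ, (k : ℤ) ≤ 2 * n + 7 ∧ SimpChain n k U V := by
  obtain ⟨⟨p, q⟩, h1, h2, h3⟩ := hU.exists_common hV (by omega)
  have hb := hU.bounds (by omega) h1 h3
  have key : ∃ f v, IsMotion n f ∧ f (p, q) = (v, 0) ∧ 2 ≤ v ∧ v ≤ n - 4 := by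
    obtain ⟨f, hf, hfc⟩ := exists_isMotion_crossing (hU.isTri.1.1 _ h1) (by omega)
    rcases lt_or_ge (p - q) 4 with h4 | h4
    · obtain ⟨g, hg, hgc⟩ := exists_isMotion_crossing (hfc ▸ hf.isCode _ (hU.isTri.1.1 _ h1))
        (by omega)
      exact ⟨g ∘ f, p - q, hg.comp hf, by
        rw [Function.comp, hfc, hgc, sub_zero, sub_sub_cancel], by omega, by omega⟩
    · exact ⟨f, n - (p - q), hf, hfc, by omega, by omega⟩
  obtain ⟨f, v, hf, hfc, h4, h5⟩ := key
  obtain ⟨g, hg, hgf⟩ := hf.exists_inverse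
  obtain ⟨k, hk, c⟩ := (hU.image hf).exists_simpChain_of_mem (hV.image hf) h4 h5
    (hfc ▸ Finset.mem_image_of_mem f h1) (hfc ▸ Finset.mem_image_of_mem f h2)
  have := hg.simpChain c
  rw [IsMotion.image_image hgf hU.isTri.1.1, IsMotion.image_image hgf hV.isTri.1.1] at this
  exact ⟨k, hk, this⟩

/-! ### Polygons with five and six vertices -/

namespace IsPureTri

variable {n : ℤ} {U V S : Finset (ℤ × ℤ)} {α β : ℤ × ℤ}

theorem subset_of_forall (hU : IsPureTri n U) (hV : IsPureTri n V)
    (h : ∀ p q, (p, q) ∈ U → q ≤ p → (p, q) ∈ V) : U ⊆ V := by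
  rintro ⟨i, j⟩ hc
  rcases lt_or_ge i j with hij | hij
  · have h1 := hU.isPure _ hc hij
    have h2 := hU.isTri.1.1 _ hc
    simp only [IsCode] at h1 h2
    rw [h1]
    exact hV.isTri.boundary_mem (by omega) (by omega)
  · exact h _ _ hc hij

/-- The pentagon with a cross-cap has only one simplicial triangulation without planar arcs. -/
theorem subset_of_five (hU : IsPureTri 5 U) (hV : IsPureTri 5 V) : U ⊆ V := by
  refine hU.subset_of_forall hV fun p q hc hpq => ?_
  have h1 := hU.bounds (by norm_num) hc hpq
  refine hV.mem_of_forall h1.1 h1.2.1 hpq fun s t hd hst => ?_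
  have h2 := hV.bounds (by norm_num) hd hst
  simp only [CrossingCrossing]
  omega

theorem exists_erase (h : IsPureTri n U) (hq : IsQuad n S α β) (hS : S ⊆ U)
    (hβ : β.2 + 2 ≤ β.1) (hβ' : β.1 ≤ β.2 + n - 2) :
    ∃ V, IsPureTri n V ∧ α ∉ V ∧ (∀ c ∈ V, c ∈ U ∨ c = β) ∧ ∃ k ≤ 1, SimpChain n k U V := by
  by_cases hα : α ∈ U
  · have hf := h.flip hq hS hα hβ hβ'
    refine ⟨_, hf.1, fun hc => ?_, fun c hc => ?_, 1, le_rfl, hf.2⟩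
    · rcases Finset.mem_insert.1 hc with h1 | h1
      · exact hq.notMem h.isTri hα (h1 ▸ hα)
      · exact Finset.ne_of_mem_erase h1 rfl
    · rcases Finset.mem_insert.1 hc with h1 | h1
      · exact Or.inr h1
      · exact Or.inl (Finset.mem_of_mem_erase h1)
  · exact ⟨U, h, hα, fun c hc => Or.inl hc, 0, Nat.zero_le _, .refl h.isTri h.isSimp⟩

theorem mem_of_six (h : IsPureTri 6 U) {q : ℤ} (hq : 0 ≤ q) (hq' : q ≤ 2) : (q + 3, q) ∈ U := by
  refine h.mem_of_forall (by omega) hq (by omega) fun s t hd hst => ?_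
  have h2 := h.bounds (by norm_num) hd hst
  simp only [CrossingCrossing]
  omega

theorem subset_of_six (hU : IsPureTri 6 U) (hV : IsPureTri 6 V)
    (u1 : ((3 : ℤ), (1 : ℤ)) ∉ U) (u2 : ((4 : ℤ), (2 : ℤ)) ∉ U) (u3 : ((2 : ℤ), (0 : ℤ)) ∉ U)
    (v1 : ((3 : ℤ), (1 : ℤ)) ∉ V) (v2 : ((4 : ℤ), (2 : ℤ)) ∉ V) (v3 : ((2 : ℤ), (0 : ℤ)) ∉ V) :
    U ⊆ V := by
  refine hU.subset_of_forall hV fun p q hc hpq => ?_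
  have h1 := hU.bounds (by norm_num) hc hpq
  have a1 : ¬ (p = 3 ∧ q = 1) := fun e => u1 (by rwa [← e.1, ← e.2])
  have a2 : ¬ (p = 4 ∧ q = 2) := fun e => u2 (by rwa [← e.1, ← e.2])
  have a3 : ¬ (p = 2 ∧ q = 0) := fun e => u3 (by rwa [← e.1, ← e.2])
  refine hV.mem_of_forall h1.1 h1.2.1 hpq fun s t hd hst => ?_
  have h2 := hV.bounds (by norm_num) hd hst
  have b1 : ¬ (s = 3 ∧ t = 1) := fun e => v1 (by rwa [← e.1, ← e.2])
  have b2 : ¬ (s = 4 ∧ t = 2) := fun e => v2 (by rwa [← e.1, ← e.2])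
  have b3 : ¬ (s = 2 ∧ t = 0) := fun e => v3 (by rwa [← e.1, ← e.2])
  simp only [CrossingCrossing]
  omega

/-- Three optional flips lead from a triangulation of the hexagon with a cross-cap without planar
arcs to the one that avoids three of the six arcs of slope two or four. -/
theorem exists_six (h : IsPureTri 6 U) :
    ∃ V, IsPureTri 6 V ∧ ((3 : ℤ), (1 : ℤ)) ∉ V ∧ ((4 : ℤ), (2 : ℤ)) ∉ V ∧
      ((2 : ℤ), (0 : ℤ)) ∉ V ∧ ∃ k ≤ 3, SimpChain 6 k U V := by
  have sub : ∀ {W : Finset (ℤ × ℤ)} {a b c d : ℤ × ℤ}, a ∈ W → b ∈ W → c ∈ W → d ∈ W →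
      ({a, b, c, d} : Finset (ℤ × ℤ)) ⊆ W := fun h1 h2 h3 h4 s hs => by
    simp only [Finset.mem_insert, Finset.mem_singleton] at hs
    rcases hs with rfl | rfl | rfl | rfl
    exacts [h1, h2, h3, h4]
  obtain ⟨A, hA, nA, sA, k₁, hk₁, c₁⟩ := h.exists_erase
    (isQuad_crossing (p := 3) (p' := 4) (q := 0) (q' := 1) (by norm_num) (by norm_num)
      (by norm_num) (by norm_num) (by norm_num))
    (sub (h.mem_of_six le_rfl (by norm_num)) (h.mem_of_six (q := 1) (by norm_num) (by norm_num))
      (h.isTri.boundary_mem (i := 3) (by norm_num) (by norm_num))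
      (h.isTri.boundary_mem (i := 0) (by norm_num) (by norm_num))) (by norm_num) (by norm_num)
  obtain ⟨B, hB, nB, sB, k₂, hk₂, c₂⟩ := hA.exists_erase
    (isQuad_crossing (p := 4) (p' := 5) (q := 1) (q' := 2) (by norm_num) (by norm_num)
      (by norm_num) (by norm_num) (by norm_num))
    (sub (hA.mem_of_six (q := 1) (by norm_num) (by norm_num))
      (hA.mem_of_six (q := 2) (by norm_num) (by norm_num))
      (hA.isTri.boundary_mem (i := 4) (by norm_num) (by norm_num))
      (hA.isTri.boundary_mem (i := 1) (by norm_num) (by norm_num))) (by norm_num) (by norm_num)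
  obtain ⟨C, hC, nC, sC, k₃, hk₃, c₃⟩ := hB.exists_erase
    (isQuad_crossing_last (n := 6) (p := 5) (q := 2) (q' := 3) (by norm_num) (by norm_num)
      (by norm_num) (by norm_num)).symm
    (sub (hB.mem_of_six (q := 2) (by norm_num) (by norm_num))
      (hB.mem_of_six (q := 0) (by norm_num) (by norm_num))
      (hB.isTri.boundary_mem (i := 5) (by norm_num) (by norm_num))
      (hB.isTri.boundary_mem (i := 2) (by norm_num) (by norm_num))) (by norm_num) (by norm_num)
  have n1 : ((3 : ℤ), (1 : ℤ)) ∉ B := fun hc => (sB _ hc).elim nA (by simp)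
  refine ⟨C, hC, fun hc => (sC _ hc).elim n1 (by simp), fun hc => (sC _ hc).elim nB (by simp), nC,
    k₁ + k₂ + k₃, by omega, (c₁.trans c₂).trans c₃⟩

theorem exists_simpChain (hn : 5 ≤ n) (hU : IsPureTri n U) (hV : IsPureTri n V) :
    ∃ k : ℕ, (k : ℤ) ≤ 2 * n + 7 ∧ SimpChain n k U V := by
  rcases le_or_gt 7 n with h7 | h7
  · exact hU.exists_simpChain_of_seven_le h7 hV
  obtain rfl | rfl : n = 5 ∨ n = 6 := by omega
  · obtain rfl := (hU.subset_of_five hV).antisymm (hV.subset_of_five hU)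
    exact ⟨0, by norm_num, .refl hU.isTri hU.isSimp⟩
  · obtain ⟨A, hA, a1, a2, a3, k, hk, hc⟩ := hU.exists_six
    obtain ⟨B, hB, b1, b2, b3, l, hl, hd⟩ := hV.exists_six
    obtain rfl := (hA.subset_of_six hB a1 a2 a3 b1 b2 b3).antisymm
      (hB.subset_of_six hA b1 b2 b3 a1 a2 a3)
    exact ⟨k + l, by push_cast; omega, hc.trans hd.symm⟩

end IsPureTri

/-- Two simplicial triangulations are joined by at most `4 n + 7` flips. -/
theorem exists_simpChain_le_four_mul {n : ℕ} (hn : 5 ≤ n) {U V : Finset (ℤ × ℤ)} (hU : IsTri n U)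
    (hU' : IsSimp n U) (hV : IsTri n V) (hV' : IsSimp n V) :
    ∃ k ≤ 4 * n + 7, SimpChain n k U V := by
  obtain ⟨A, pA, k, hk, hc⟩ := hU.exists_isPure (by omega) hU'
  obtain ⟨B, pB, l, hl, hd⟩ := hV.exists_isPure (by omega) hV'
  have h1 := hU.planarCard_le (by omega)
  have h2 := hV.planarCard_le (by omega)
  obtain ⟨m, hm, he⟩ := IsPureTri.exists_simpChain (n := n) (by omega)
    ⟨hc.isTri_right.1, hc.isTri_right.2, pA⟩ ⟨hd.isTri_right.1, hd.isTri_right.2, pB⟩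
  exact ⟨k + m + l, by omega, (hc.trans he).trans hd.symm⟩

end MobiusFlip

theorem theorem1p3 :
    ∃ K : ℤ, ∀ n : ℕ, 5 ≤ n →
      (MobiusFlip.simplicialFlipGraph n).ediam ≠ ⊤ ∧
      ⌊(5 / 2 : ℝ) * (n : ℝ)⌋ - 16 ≤ ((MobiusFlip.simplicialFlipGraph n).diam : ℤ) ∧
      ((MobiusFlip.simplicialFlipGraph n).diam : ℤ) ≤ 4 * (n : ℤ) + K := by
  refine ⟨7, fun n hn => ?_⟩
  have h := MobiusFlip.diam_simplicialFlipGraph (n := n) (by omega)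
    (fun U V => MobiusFlip.exists_simpChain_le_four_mul hn) (MobiusFlip.exists_simpChain_le hn)
  have hfl : ⌊(5 / 2 : ℝ) * (n : ℝ)⌋ = 5 * (n : ℤ) / 2 := by
    rw [Int.floor_eq_iff]
    have h1 : 2 * (5 * (n : ℤ) / 2) ≤ 5 * n ∧ 5 * (n : ℤ) < 2 * (5 * (n : ℤ) / 2) + 2 := by omega
    have h2 : (2 : ℝ) * ((5 * (n : ℤ) / 2 : ℤ) : ℝ) ≤ 5 * n := by exact_mod_cast h1.1
    have h3 : (5 : ℝ) * n < 2 * ((5 * (n : ℤ) / 2 : ℤ) : ℝ) + 2 := by exact_mod_cast h1.2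
    constructor <;> linarith
  rw [hfl]
  exact ⟨h.1, h.2.1, by exact_mod_cast h.2.2⟩
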